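/- **Setting.** All manifolds, maps and functions are smooth. Let $(M,g)$ be a geodesically complete Lorentzian manifold of dimension $1+n$ and signature $(-,+,\dots,+)$, and let $U,V\subset M$ be embedded hypersurfaces, each of them either timelike or spacelike. Let $\gamma_0:[0,1]\to M$ be a lightlike geodesic from $x_0\in U$ to $y_0\in V$ which is transversal to $U$ at $x_0$ and to $V$ at $y_0$; put $v_0=\dot\gamma_0(0)$. For an open neighborhood $\mathcal W\subset TM$ of $(x_0,v_0)$ and open neighborhoods $U'\subset U$, $V'\subset V$ of $x_0,y_0$, only geodesics $\gamma:[0,1]\to M$ with $(\gamma(0),\dot\gamma(0))\in\mathcal W$ are considered ("locally"). * $\Sigma=\Sigma_g\subset U'\times V'$ is the set of pairs $(x,y)$ which are connected by a (locally) unique lightlike geodesic. * A smooth $r:U'\times V'\to\mathbb R$ is a *defining function* of $\Sigma$ if $\Sigma=\{r=0\}$, $dr\neq0$ on $\Sigma$, and $r(x,y)<0$ if and only if the locally unique geodesic from $x$ to $y$ is timelike. * The *scattering relation* $\mathcal S$ is the map $(x,v')\mapsto(y,w')$, where, for a lightlike geodesic $\gamma:[0,T]\to M$, $T>0$, with $\gamma(0)=x\in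 U'$, $\gamma(T)=y\in V'$, $(x,T\dot\gamma(0))\in\mathcal W$, the vectors $v'\in T_xU$, $w'\in T_yV$ are the orthogonal projections of $\dot\gamma(0)$, $\dot\gamma(T)$. $\mathcal S^\sharp$ is the corresponding map on covectors, with tangent vectors of $U$, $V$ identified with covectors by the induced metrics; both are positively homogeneous of degree one. A *reduced representation* of $\mathcal S^\sharp$ is its restriction to a hypersurface of $T^*U$ contained in its domain which every radial ray of the domain meets exactly once and transversally. **Theorem.** Assume that $x_0$ and $y_0$ are not conjugate along $\gamma_0$. If $\mathcal W$ is small enough and then $U'$ and $V'$ are small enough (depending on $\mathcal W$), every pair $(x,y)\in U'\times V'$ is connected by a locally unique geodesic $\gamma_{[x,y]}:[0,1]\to M$, and the following holds. (a) $\Sigma$ is a codimension one submanifold of $U'\times V'$. Let $r:U'\times V'\to\mathbb R$ be any defining function of $\Sigma$, and let $d'_xr$, $d'_yr$ be its partial differentials, as covectors on $U$ and $V$. (b) The set $\{(x,-d'_xr,y,d'_yr):\ r(x,y)=0\}$ is the graph of a reduced representation of $\mathcal S^\sharp$. (c) There is a smooth nowhere vanishing function $\kappa$ on $U'\times V'$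 such that, for every one-parameter family $g_\tau$ of Lorentzian metrics on $M$ depending smoothly on $\tau$ near $\tau=0$ with $g_0=g$, and all defining functions $r_\tau:U'\times V'\to\mathbb R$ of $\Sigma_{g_\tau}$ depending smoothly on $\tau$ near $\tau=0$ with $r_0=r$, $$\frac{d}{d\tau}\Big|_{\tau=0}r_\tau(x,y)=\kappa(x,y)\int_0^1\big\langle f,\dot\gamma_{[x,y]}(t)\otimes\dot\gamma_{[x,y]}(t)\big\rangle\,dt\quad\text{for all }(x,y)\in\Sigma,\qquad f=\frac{d g_\tau}{d\tau}\Big|_{\tau=0}.$$ -/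

import Mathlib

open Set Filter Topology Bundle Manifold
open scoped Manifold ContDiff

noncomputable section

namespace LightRay

/-- A bilinear form on a finite-dimensional real vector space has signature `(-, +, …, +)`:
there is a timelike vector whose orthogonal complement is positive definite. -/
def IsLorentzForm {W : Type*} [AddCommGroup W] (B : W → W → ℝ) : Prop :=
  ∃ e : W, B e e < 0 ∧ ∀ w : W, w ≠ 0 → B e w = 0 → 0 < B w w

/-- A smooth Lorentzian metric, of signature `(-, +, …, +)`, on a manifold of dimension `k`. -/
structure LorentzMetric (k : ℕ) (M : Type*) [TopologicalSpace M]
    [ChartedSpace (EuclideanSpace ℝ (Fin k)) M] [IsManifold (𝓡 k) ∞ M] where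
  inner : ∀ x : M, TangentSpace (𝓡 k) x →L[ℝ] TangentSpace (𝓡 k) x →L[ℝ] ℝ
  symm : ∀ (x : M) (v w : TangentSpace (𝓡 k) x), inner x v w = inner x w v
  lorentz : ∀ x : M, IsLorentzForm (fun v w : TangentSpace (𝓡 k) x => inner x v w)
  contMDiff : ContMDiff (𝓡 k)
    ((𝓡 k).prod 𝓘(ℝ, EuclideanSpace ℝ (Fin k) →L[ℝ] EuclideanSpace ℝ (Fin k) →L[ℝ] ℝ)) ∞
    (fun x => TotalSpace.mk'
      (EuclideanSpace ℝ (Fin k) →L[ℝ] EuclideanSpace ℝ (Fin k) →L[ℝ] ℝ) x (inner x))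

section Ambient

variable {k : ℕ} {M : Type*} [TopologicalSpace M]
  [ChartedSpace (EuclideanSpace ℝ (Fin k)) M] [IsManifold (𝓡 k) ∞ M]

/-- A nonzero tangent vector `v` with `(v, v)_g = 0`. -/
def IsLightlike (g : LorentzMetric k M) (p : TangentBundle (𝓡 k) M) : Prop :=
  p.2 ≠ 0 ∧ g.inner p.1 p.2 p.2 = 0

/-- A tangent vector `v` with `(v, v)_g < 0`. -/
def IsTimelike (g : LorentzMetric k M) (p : TangentBundle (𝓡 k) M) : Prop :=
  g.inner p.1 p.2 p.2 < 0

/-- The components of the metric in the chart at `p`: the pull-back of `g` under the inverse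
chart, evaluated at the point `z` of the model space on the constant vectors `a` and `b`. -/
def chartMetric (g : LorentzMetric k M) (p : M) (z a b : EuclideanSpace ℝ (Fin k)) : ℝ :=
  g.inner ((extChartAt (𝓡 k) p).symm z)
    (mfderiv 𝓘(ℝ, EuclideanSpace ℝ (Fin k)) (𝓡 k) (extChartAt (𝓡 k) p).symm z a)
    (mfderiv 𝓘(ℝ, EuclideanSpace ℝ (Fin k)) (𝓡 k) (extChartAt (𝓡 k) p).symm z b)

/-- Christoffel symbols of the first kind in the chart at `p`, as a trilinear form:
`Γ(a, b; c) = (∂_a g(b, c) + ∂_b g(a, c) - ∂_c g(a, b)) / 2`. -/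
def christoffel (g : LorentzMetric k M) (p : M) (z a b c : EuclideanSpace ℝ (Fin k)) : ℝ :=
  (fderiv ℝ (fun z' => chartMetric g p z' b c) z a
    + fderiv ℝ (fun z' => chartMetric g p z' a c) z b
    - fderiv ℝ (fun z' => chartMetric g p z' a b) z c) / 2

/-- A smooth curve on the open set `s` which satisfies there, in each chart, the geodesic equation
`g(c'', w) + Γ(c', c'; w) = 0` for all `w`. -/
def IsGeodesicOn (g : LorentzMetric k M) (γ : ℝ → M) (s : Set ℝ) : Prop :=
  ContMDiffOn 𝓘(ℝ, ℝ) (𝓡 k) ∞ γ s ∧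
    ∀ t ∈ s, ∀ p : M, γ t ∈ (extChartAt (𝓡 k) p).source →
      ∀ w : EuclideanSpace ℝ (Fin k),
        chartMetric g p (extChartAt (𝓡 k) p (γ t))
            (deriv (deriv fun s => extChartAt (𝓡 k) p (γ s)) t) w
          + christoffel g p (extChartAt (𝓡 k) p (γ t))
              (deriv (fun s => extChartAt (𝓡 k) p (γ s)) t)
              (deriv (fun s => extChartAt (𝓡 k) p (γ s)) t) w = 0

/-- A geodesic `[0, T] → M`, that is, a curve which is a geodesic on an open interval around
`[0, T]`. -/
def IsGeodesicSegment (g : LorentzMetric k M) (γ : ℝ → M) (T : ℝ) : Prop :=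
  ∃ ε > 0, IsGeodesicOn g γ (Ioo (-ε) (T + ε))

/-- The velocity vector of a curve, as a point of the tangent bundle. -/
def velocity (k : ℕ) {M : Type*} [TopologicalSpace M]
    [ChartedSpace (EuclideanSpace ℝ (Fin k)) M] (γ : ℝ → M) (t : ℝ) : TangentBundle (𝓡 k) M :=
  ⟨γ t, mfderiv 𝓘(ℝ, ℝ) (𝓡 k) γ t (1 : ℝ)⟩

/-- Geodesic completeness. -/
def IsGeodesicallyComplete (g : LorentzMetric k M) : Prop :=
  ∀ p : TangentBundle (𝓡 k) M, ∃ γ : ℝ → M, IsGeodesicOn g γ univ ∧ velocity k γ 0 = p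

/-- The geodesic `[0, 1] → M` with initial velocity `p` exists and ends at `y`, that is,
`exp_x v = y` where `p = (x, v)`. -/
def Joins (g : LorentzMetric k M) (p : TangentBundle (𝓡 k) M) (y : M) : Prop :=
  ∃ γ : ℝ → M, IsGeodesicSegment g γ 1 ∧ velocity k γ 0 = p ∧ γ 1 = y

open Classical in
/-- The exponential map `(x, v) ↦ exp_x v` (with the value `x` where it is undefined). -/
def expMap (g : LorentzMetric k M) (p : TangentBundle (𝓡 k) M) : M :=
  if h : ∃ y, Joins g p y then h.choose else p.1

/-- The endpoints of the geodesic `γ : [0, 1] → M` are conjugate along `γ`: with `x = γ(0)` and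
`v = γ'(0)`, the vector `v` is a critical point of `exp_x : T_x M → M`. -/
def ConjugateAlong (g : LorentzMetric k M) (γ : ℝ → M) : Prop :=
  ¬ Function.Bijective
    (mfderiv 𝓘(ℝ, EuclideanSpace ℝ (Fin k)) (𝓡 k)
      (fun v : EuclideanSpace ℝ (Fin k) => expMap g ⟨γ 0, v⟩)
      ((velocity k γ 0).2))

/-- `f = d g_τ / dτ` at `τ = 0`, evaluated as `⟨f, v ⊗ w⟩`. -/
def metricVariation (g : ℝ → LorentzMetric k M) (x : M) (v w : TangentSpace (𝓡 k) x) : ℝ :=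
  deriv (fun τ => (g τ).inner x v w) 0

/-- The light ray transform `∫₀¹ ⟨f, γ' ⊗ γ'⟩ dt` of `f = d g_τ / dτ` at `τ = 0`. -/
def rayTransform (g : ℝ → LorentzMetric k M) (γ : ℝ → M) : ℝ :=
  ∫ t in (0 : ℝ)..1, metricVariation g (γ t) (velocity k γ t).2 (velocity k γ t).2

/-- A one-parameter family of metrics depends smoothly on `(τ, x)` for `τ ∈ s`. -/
def SmoothFamilyOn (g : ℝ → LorentzMetric k M) (s : Set ℝ) : Prop :=
  ContMDiffOn (𝓘(ℝ, ℝ).prod (𝓡 k))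
    ((𝓡 k).prod 𝓘(ℝ, EuclideanSpace ℝ (Fin k) →L[ℝ] EuclideanSpace ℝ (Fin k) →L[ℝ] ℝ)) ∞
    (fun q : ℝ × M => TotalSpace.mk'
      (E := fun x : M => TangentSpace (𝓡 k) x →L[ℝ] TangentSpace (𝓡 k) x →L[ℝ] ℝ)
      (EuclideanSpace ℝ (Fin k) →L[ℝ] EuclideanSpace ℝ (Fin k) →L[ℝ] ℝ) q.2 ((g q.1).inner q.2))
    (s ×ˢ univ)

end Ambient

/-- An embedded codimension one submanifold `S` of a manifold: locally a regular level set of a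
smooth function. -/
def IsHypersurface {F H : Type*} [NormedAddCommGroup F] [NormedSpace ℝ F] [TopologicalSpace H]
    (I : ModelWithCorners ℝ F H) {N : Type*} [TopologicalSpace N] [ChartedSpace H N]
    (S : Set N) : Prop :=
  ∀ p ∈ S, ∃ O : Set N, IsOpen O ∧ p ∈ O ∧ ∃ ρ : N → ℝ, ContMDiffOn I 𝓘(ℝ, ℝ) ∞ ρ O ∧
    S ∩ O = {q ∈ O | ρ q = 0} ∧ ∀ q ∈ S ∩ O, mvfderiv I ρ q ≠ 0

/-- The cotangent bundle of a manifold of dimension `n`. -/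
abbrev Cotangent (n : ℕ) (U : Type*) [TopologicalSpace U]
    [ChartedSpace (EuclideanSpace ℝ (Fin n)) U] [IsManifold (𝓡 n) ∞ U] : Type _ :=
  TotalSpace (EuclideanSpace ℝ (Fin n) →L[ℝ] ℝ)
    (fun x : U => TangentSpace (𝓡 n) x →L[ℝ] ℝ)

/-- A set `S` in the cotangent bundle is an embedded hypersurface which is transversal to the
radial rays `{(x, λ ξ) : λ > 0}`: it is locally the zero set of a smooth function whose derivative
in the radial direction does not vanish on `S`. -/
def IsRadiallyTransversalHypersurface {n : ℕ} {U : Type*} [TopologicalSpace U]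
    [ChartedSpace (EuclideanSpace ℝ (Fin n)) U] [IsManifold (𝓡 n) ∞ U]
    (S : Set (Cotangent n U)) : Prop :=
  ∀ α ∈ S, ∃ O : Set (Cotangent n U), IsOpen O ∧ α ∈ O ∧ ∃ ρ : Cotangent n U → ℝ,
    ContMDiffOn ((𝓡 n).prod 𝓘(ℝ, EuclideanSpace ℝ (Fin n) →L[ℝ] ℝ)) 𝓘(ℝ, ℝ) ∞ ρ O ∧
      S ∩ O = {β ∈ O | ρ β = 0} ∧
      ∀ β ∈ S ∩ O, deriv (fun l : ℝ => ρ ⟨β.1, l • β.2⟩) 1 ≠ 0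

/-- `R` is the graph of a reduced representation of the positively homogeneous relation `C`
between cotangent bundles: the graph of the restriction of `C`, as a map, to some hypersurface `S`
of its domain, where each radial ray of the domain of `C` meets `S` exactly once and
transversally. -/
def IsReducedRepresentation {n : ℕ} {U V : Type*}
    [TopologicalSpace U] [ChartedSpace (EuclideanSpace ℝ (Fin n)) U] [IsManifold (𝓡 n) ∞ U]
    [TopologicalSpace V] [ChartedSpace (EuclideanSpace ℝ (Fin n)) V] [IsManifold (𝓡 n) ∞ V]
    (C R : Set (Cotangent n U × Cotangent n V)) : Prop :=
  ∃ S : Set (Cotangent n U), IsRadiallyTransversalHypersurface S ∧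
    (∀ α ∈ S, ∃! β, (α, β) ∈ C) ∧
    (∀ α β, (α, β) ∈ C → ∃! l : ℝ, 0 < l ∧ (⟨α.1, l • α.2⟩ : Cotangent n U) ∈ S) ∧
    R = {c ∈ C | c.1 ∈ S}

section Surface

variable {n : ℕ} {M : Type*} [TopologicalSpace M]
  [ChartedSpace (EuclideanSpace ℝ (Fin (n + 1))) M] [IsManifold (𝓡 (n + 1)) ∞ M]
  {U : Type*} [TopologicalSpace U] [ChartedSpace (EuclideanSpace ℝ (Fin n)) U]
  [IsManifold (𝓡 n) ∞ U]
  {V : Type*} [TopologicalSpace V] [ChartedSpace (EuclideanSpace ℝ (Fin n)) V]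
  [IsManifold (𝓡 n) ∞ V]

/-- The metric induced on `T_x U` by the embedding `ι : U → M`. -/
def inducedMetric (g : LorentzMetric (n + 1) M) (ι : U → M) (x : U)
    (a b : TangentSpace (𝓡 n) x) : ℝ :=
  g.inner (ι x) (mfderiv (𝓡 n) (𝓡 (n + 1)) ι x a) (mfderiv (𝓡 n) (𝓡 (n + 1)) ι x b)

/-- The surface is spacelike: its induced metric is Riemannian. -/
def IsSpacelikeSurface (g : LorentzMetric (n + 1) M) (ι : U → M) : Prop :=
  ∀ (x : U) (a : TangentSpace (𝓡 n) x), a ≠ 0 → 0 < inducedMetric g ι x a a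

/-- The surface is timelike: its induced metric is Lorentzian. -/
def IsTimelikeSurface (g : LorentzMetric (n + 1) M) (ι : U → M) : Prop :=
  ∀ x : U, IsLorentzForm (inducedMetric g ι x)

/-- The vector `p`, based at a point of the surface, is not tangent to the surface at `x`. -/
def IsTransversalTo (ι : U → M) (x : U) (p : TangentBundle (𝓡 (n + 1)) M) : Prop :=
  ∀ a : TangentSpace (𝓡 n) x,
    (⟨ι x, mfderiv (𝓡 n) (𝓡 (n + 1)) ι x a⟩ : TangentBundle (𝓡 (n + 1)) M) ≠ p

/-- `a ∈ T_x U` is the orthogonal projection to `T_x U` of the vector `p` based at `ι x`. -/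
def IsOrthProj (g : LorentzMetric (n + 1) M) (ι : U → M) (p : TangentBundle (𝓡 (n + 1)) M)
    (a : TangentBundle (𝓡 n) U) : Prop :=
  ∃ v : TangentSpace (𝓡 (n + 1)) (ι a.1), p = ⟨ι a.1, v⟩ ∧
    ∀ b : TangentSpace (𝓡 n) a.1,
      g.inner (ι a.1) (v - mfderiv (𝓡 n) (𝓡 (n + 1)) ι a.1 a.2)
        (mfderiv (𝓡 n) (𝓡 (n + 1)) ι a.1 b) = 0

/-- The graph of the scattering relation `(x, v') ↦ (y, w')` from `T U'` to `T V'`, for geodesics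
near a given one: `v'` and `w'` are the orthogonal projections of the velocities at `x ∈ U'` and at
`y ∈ V'` of a lightlike geodesic `γ : [0, T] → M` from `x` to `y` for which `T γ'(0)`, the initial
velocity after rescaling to the parameter interval `[0, 1]`, belongs to `𝒲`. -/
def scattering (g : LorentzMetric (n + 1) M) (ιU : U → M) (ιV : V → M)
    (𝒲 : Set (TangentBundle (𝓡 (n + 1)) M)) (U' : Set U) (V' : Set V) :
    Set (TangentBundle (𝓡 n) U × TangentBundle (𝓡 n) V) :=
  {c | c.1.1 ∈ U' ∧ c.2.1 ∈ V' ∧ ∃ (γ : ℝ → M) (T : ℝ), 0 < T ∧ IsGeodesicSegment g γ T ∧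
    IsLightlike g (velocity (n + 1) γ 0) ∧
    (⟨γ 0, T • (velocity (n + 1) γ 0).2⟩ :
      TangentBundle (𝓡 (n + 1)) M) ∈ 𝒲 ∧
    IsOrthProj g ιU (velocity (n + 1) γ 0) c.1 ∧ IsOrthProj g ιV (velocity (n + 1) γ T) c.2}

/-- `ξ` is the covector identified with `a ∈ T_x U` by the induced metric. -/
def IsFlat (g : LorentzMetric (n + 1) M) (ι : U → M) (a : TangentBundle (𝓡 n) U)
    (ξ : Cotangent n U) : Prop :=
  ∃ η : TangentSpace (𝓡 n) a.1 →L[ℝ] ℝ, ξ = ⟨a.1, η⟩ ∧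
    ∀ b : TangentSpace (𝓡 n) a.1, η b = inducedMetric g ι a.1 a.2 b

/-- The graph of the scattering relation on the cotangent bundles. -/
def scatteringSharp (g : LorentzMetric (n + 1) M) (ιU : U → M) (ιV : V → M)
    (𝒲 : Set (TangentBundle (𝓡 (n + 1)) M)) (U' : Set U) (V' : Set V) :
    Set (Cotangent n U × Cotangent n V) :=
  {c | ∃ a b, (a, b) ∈ scattering g ιU ιV 𝒲 U' V' ∧ IsFlat g ιU a c.1 ∧ IsFlat g ιV b c.2}

/-- The set `Σ` of pairs `(x, y) ∈ U' × V'` connected by a (locally) unique lightlike geodesic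
`[0, 1] → M`; "locally" means: among the geodesics with initial velocity in `𝒲`. -/
def lightPairs (g : LorentzMetric (n + 1) M) (ιU : U → M) (ιV : V → M)
    (𝒲 : Set (TangentBundle (𝓡 (n + 1)) M)) (U' : Set U) (V' : Set V) : Set (U × V) :=
  {q | q.1 ∈ U' ∧ q.2 ∈ V' ∧ ∃! p : TangentBundle (𝓡 (n + 1)) M,
    p ∈ 𝒲 ∧ p.1 = ιU q.1 ∧ IsLightlike g p ∧ Joins g p (ιV q.2)}

/-- `r` is a (smooth) defining function on `U' × V'` of `Σ`: its zero set is `Σ`, `dr ≠ 0` on `Σ`,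
and `r(x, y) < 0` if and only if the (locally unique) geodesic from `x` to `y` is timelike. -/
def IsDefiningFunction (g : LorentzMetric (n + 1) M) (ιU : U → M) (ιV : V → M)
    (𝒲 : Set (TangentBundle (𝓡 (n + 1)) M)) (U' : Set U) (V' : Set V) (r : U × V → ℝ) : Prop :=
  ContMDiffOn ((𝓡 n).prod (𝓡 n)) 𝓘(ℝ, ℝ) ∞ r (U' ×ˢ V') ∧
  (∀ q ∈ U' ×ˢ V', r q = 0 ↔ q ∈ lightPairs g ιU ιV 𝒲 U' V') ∧
  (∀ q ∈ lightPairs g ιU ιV 𝒲 U' V', mvfderiv ((𝓡 n).prod (𝓡 n)) r q ≠ 0) ∧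
  (∀ q ∈ U' ×ˢ V', r q < 0 ↔ ∃ p : TangentBundle (𝓡 (n + 1)) M,
    p ∈ 𝒲 ∧ p.1 = ιU q.1 ∧ IsTimelike g p ∧ Joins g p (ιV q.2))

/-- The set `{(x, -d'ₓ r, y, d'ᵧ r) : (x, y) ∈ U' × V', r(x, y) = 0}`. -/
def gradientGraph (r : U × V → ℝ) (U' : Set U) (V' : Set V) :
    Set (Cotangent n U × Cotangent n V) :=
  {c | ∃ x ∈ U', ∃ y ∈ V', r (x, y) = 0 ∧
    c = (⟨x, -mvfderiv (𝓡 n) (fun x' => r (x', y)) x⟩,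
      ⟨y, mvfderiv (𝓡 n) (fun y' => r (x, y')) y⟩)}

end Surface

end LightRay

end

/-!
# Light rays between two hypersurfaces

Since the endpoints of `γ₀` are not conjugate, the exponential map is a local diffeomorphism at the
initial velocity of `γ₀`, so nearby points `x ∈ U` and `y ∈ V` are connected by exactly one geodesic
`γ_{x,y}` with initial velocity near that of `γ₀`, and it depends smoothly on `(x, y)`, and on the
metric if the metric varies (`exists_localExp`). This rests on the smooth dependence of geodesics on
initial values and parameters (`exists_geodesic_family`), and thereby on the smoothness of flows of
vector fields, which is obtained from the implicit function theorem for the integral equation in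
`C([-1, 1], Y)` (`exists_smooth_flow`).

The proof studies the energy `E(x, y) = (γ', γ') / 2` of `γ = γ_{x,y}`, a smooth function which is
zero, negative or positive when `γ` is lightlike, timelike or spacelike. By the first variation
formula (`first_variation`), its differential is the pairing with the final velocity on `T_y V`
minus the pairing with the initial velocity on `T_x U`: as covectors, `-d'ₓE` and `d'ᵧE` are the
projections of `γ'(0)` to `U` and of `γ'(1)` to `V` (`fderiv_rayEnergy`). A nonzero lightlike vector
transversal to a nondegenerate hyperplane is not orthogonal to it (`eq_zero_of_orthogonal`), so `dE`
does not vanish, and the set of pairs connected by light rays is the regular level set `E = 0`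
(`RayChart.isHypersurface_lightPairs`).

A defining function `r` has the same sign as `E` wherever one of them is negative, so that
`dr = c dE` with `c > 0` on `E = 0` (`exists_eq_smul_of_neg`, `RayChart.fderiv_productCoord_eq`).
Hence `-d'ₓr` and `d'ᵧr` are the projections of the initial and final velocities of the light ray,
multiplied by the same positive factor; as the scattering relation is homogeneous, it contains the
graph of the differentials. For this graph to be a reduced representation, a light ray has to be
determined by its initial point and the direction of its initial covector. This holds because
`(x, y, l) ↦ (x, -l d'ₓE, E)` is a local diffeomorphism near `l = 1`
(`injective_fderiv_rayMap`): the inverse also shows that the covectors `-d'ₓr` form a hypersurface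
transversal to the radial rays (`RayChart.isRadiallyTransversalHypersurface_raySurface`).

For a family of metrics, the first variation formula with fixed endpoints says that the derivative
of the energy in the parameter is half the light ray transform of the variation of the metric
(`LocalExp.hasDerivAt_energy`). The functions `r_τ(x, y)` and `E_τ(x, y)` of `(τ, x)`, with `y`
fixed, are again related by their signs, so that their differentials at a pair in `E = 0` are
proportional; comparison of the derivatives in `x` shows that the factor is `c`
(`RayChart.hasDerivAt_definingFunction`). The function `κ = (c² + E²)^{1/2} / 2`, where `c` is
extended smoothly as the quotient of the derivatives of `r` and `E` in a fixed direction, is equal to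
`c / 2` on `E = 0` and positive everywhere.

The properties of the geodesics between the two surfaces on which these arguments rely are collected
in the structure `RayChart`; `exists_nhds_rayChart` provides it for all small neighborhoods of the
initial velocity.
-/

noncomputable section

namespace LightRay

set_option linter.unusedSectionVars false

/-! ### Inverse and implicit functions of class `C^∞` on open sets -/


section InverseFunction

variable {E₁ E₂ F : Type*} [NormedAddCommGroup E₁] [NormedSpace ℝ E₁] [CompleteSpace E₁]
  [NormedAddCommGroup E₂] [NormedSpace ℝ E₂] [CompleteSpace E₂]
  [NormedAddCommGroup F] [NormedSpace ℝ F]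

/-- Smooth inverse function theorem on a whole neighborhood: since `ContDiffAt ℝ ∞` is not an open
condition, smoothness of the inverse is obtained at each point separately. -/
theorem exists_smooth_local_inverse {f : E₁ → F} {Ω : Set E₁} (hΩ : IsOpen Ω)
    (hf : ContDiffOn ℝ ∞ f Ω) {u : E₁} (hu : u ∈ Ω) (f' : E₁ ≃L[ℝ] F)
    (hf' : HasFDerivAt f (f' : E₁ →L[ℝ] F) u) :
    ∃ e : OpenPartialHomeomorph E₁ F, u ∈ e.source ∧ e.source ⊆ Ω ∧ (∀ x, e x = f x) ∧
      ContDiffOn ℝ ∞ e.symm e.target := by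
  have hfu : ContDiffAt ℝ ∞ f u := hf.contDiffAt (hΩ.mem_nhds hu)
  have h0 : (∞ : WithTop ℕ∞) ≠ 0 := by simp
  set e₀ := hfu.toOpenPartialHomeomorph f hf' h0 with he₀
  have hcont : ContinuousOn (fderiv ℝ f) Ω := hf.continuousOn_fderiv_of_isOpen hΩ (by simp)
  have hinv : IsOpen (Ω ∩ (fderiv ℝ f) ⁻¹' (range ((↑) : (E₁ ≃L[ℝ] F) → E₁ →L[ℝ] F))) :=
    hcont.isOpen_inter_preimage hΩ (ContinuousLinearEquiv.isOpen (𝕜 := ℝ))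
  set O := Ω ∩ (fderiv ℝ f) ⁻¹' (range ((↑) : (E₁ ≃L[ℝ] F) → E₁ →L[ℝ] F)) with hO
  refine ⟨e₀.restrOpen O hinv, ?_, ?_, fun x => rfl, ?_⟩
  · rw [OpenPartialHomeomorph.restrOpen_source]
    exact ⟨hfu.mem_toOpenPartialHomeomorph_source hf' h0, hu, f', hf'.fderiv.symm⟩
  · rw [OpenPartialHomeomorph.restrOpen_source]
    exact fun x hx => hx.2.1
  · intro y hy
    have hmem := (e₀.restrOpen O hinv).map_target hy
    rw [OpenPartialHomeomorph.restrOpen_source] at hmem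
    obtain ⟨-, hxΩ, A, hA⟩ := hmem
    have hx : ContDiffAt ℝ ∞ f ((e₀.restrOpen O hinv).symm y) :=
      hf.contDiffAt (hΩ.mem_nhds hxΩ)
    refine ((e₀.restrOpen O hinv).contDiffAt_symm hy (f₀' := A) ?_ ?_).contDiffWithinAt
    · rw [hA]
      exact (hx.differentiableAt h0).hasFDerivAt
    · exact hx

/-- Smooth implicit function theorem on a whole neighborhood, obtained from the inverse function
theorem for `(x, y) ↦ (x, f (x, y))`. -/
theorem exists_smooth_implicit [CompleteSpace F] {f : E₁ × E₂ → F} {Ω : Set (E₁ × E₂)} (hΩ : IsOpen Ω)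
    (hf : ContDiffOn ℝ ∞ f Ω) {u : E₁ × E₂} (hu : u ∈ Ω) (A : E₂ ≃L[ℝ] F)
    (hA : ∀ b, fderiv ℝ f u (0, b) = A b) :
    ∃ (O : Set E₁) (ψ : E₁ → E₂), IsOpen O ∧ u.1 ∈ O ∧ ContDiffOn ℝ ∞ ψ O ∧ ψ u.1 = u.2 ∧
      (∀ x ∈ O, (x, ψ x) ∈ Ω ∧ f (x, ψ x) = f u) ∧
      ∃ N ∈ 𝓝 u, ∀ v ∈ N, f v = f u → ψ v.1 = v.2 := by
  have hfu : ContDiffAt ℝ ∞ f u := hf.contDiffAt (hΩ.mem_nhds hu)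
  have hd := (hfu.differentiableAt (by simp)).hasFDerivAt
  set f' := fderiv ℝ f u with hf'
  have hsplit : ∀ a b, f' (a, b) = f' (a, 0) + A b := by
    intro a b
    rw [← hA, ← map_add]
    simp
  let B : (E₁ × E₂) ≃L[ℝ] (E₁ × F) := ContinuousLinearEquiv.equivOfInverse
    ((ContinuousLinearMap.fst ℝ E₁ E₂).prod f')
    ((ContinuousLinearMap.fst ℝ E₁ F).prod
      ((A.symm : F →L[ℝ] E₂).comp ((ContinuousLinearMap.snd ℝ E₁ F) -
        f'.comp ((ContinuousLinearMap.inl ℝ E₁ E₂).comp (ContinuousLinearMap.fst ℝ E₁ F)))))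
    (by
      rintro ⟨a, b⟩
      simp [hsplit a b])
    (by
      rintro ⟨a, c⟩
      simp only [ContinuousLinearMap.prod_apply, ContinuousLinearMap.coe_fst',
        ContinuousLinearMap.comp_apply, sub_apply,
        ContinuousLinearMap.coe_snd', ContinuousLinearMap.inl_apply,
        ContinuousLinearEquiv.coe_coe]
      rw [hsplit, ContinuousLinearEquiv.apply_symm_apply]
      simp)
  have hfst : HasFDerivAt (fun x : E₁ × E₂ => x.1) (ContinuousLinearMap.fst ℝ E₁ E₂) u :=
    hasFDerivAt_fst
  have hB : HasFDerivAt (fun x : E₁ × E₂ => (x.1, f x)) (B : E₁ × E₂ →L[ℝ] E₁ × F) u :=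
    hfst.prodMk hd
  obtain ⟨e, hue, heΩ, hef, hes⟩ := exists_smooth_local_inverse (f := fun x => (x.1, f x)) hΩ
    (contDiff_fst.contDiffOn.prodMk hf) hu B hB
  refine ⟨(fun x => (x, f u)) ⁻¹' e.target, fun x => (e.symm (x, f u)).2, ?_, ?_, ?_, ?_, ?_, ?_⟩
  · exact e.open_target.preimage (by fun_prop)
  · have := e.map_source hue
    rwa [hef] at this
  · refine contDiff_snd.comp_contDiffOn (hes.comp ?_ fun x hx => hx)
    exact (contDiff_id.prodMk contDiff_const).contDiffOn
  · have := e.left_inv hue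
    rw [hef] at this
    simp only [this]
  · intro x hx
    have h1 := e.right_inv (x := (x, f u)) hx
    have h2 := e.map_target (x := (x, f u)) hx
    rw [hef] at h1
    simp only [Prod.mk.injEq] at h1
    have h3 : (x, (e.symm (x, f u)).2) = e.symm (x, f u) := Prod.ext h1.1.symm rfl
    simp only [h3]
    exact ⟨heΩ h2, h1.2⟩
  · refine ⟨e.source, e.open_source.mem_nhds hue, fun v hv hfv => ?_⟩
    have := e.left_inv hv
    rw [hef, hfv] at this
    simp only [this]

end InverseFunction

/-! ### Smooth dependence of solutions of ordinary differential equations on initial values -/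

section Superposition

set_option synthInstance.maxHeartbeats 200000

universe u

variable {K : Type*} [TopologicalSpace K] [CompactSpace K]

/-- Pointwise evaluation of a continuous family of linear maps on a continuous family of vectors,
as a bounded bilinear map. -/
noncomputable def pointwiseApply (K : Type*) [TopologicalSpace K] [CompactSpace K]
    (Y Z : Type u) [NormedAddCommGroup Y] [NormedSpace ℝ Y] [NormedAddCommGroup Z]
    [NormedSpace ℝ Z] : C(K, Y →L[ℝ] Z) →L[ℝ] C(K, Y) →L[ℝ] C(K, Z) :=
  LinearMap.mkContinuous₂
    (LinearMap.mk₂ ℝ (fun (A : C(K, Y →L[ℝ] Z)) (u : C(K, Y)) =>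
        (⟨fun s => A s (u s), by fun_prop⟩ : C(K, Z)))
      (fun _ _ _ => by ext; simp) (fun _ _ _ => by ext; simp)
      (fun _ _ _ => by ext; simp) (fun _ _ _ => by ext; simp)) 1
    (fun A u => by
      rw [one_mul]
      refine (ContinuousMap.norm_le _ (by positivity)).2 fun s => ?_
      exact (A s).le_of_opNorm_le_of_le (A.norm_coe_le_norm s) (u.norm_coe_le_norm s))

/-- The superposition operator `u ↦ f ∘ u` is differentiable on `C(K, Y)`. -/
theorem hasFDerivAt_superposition {Y Z : Type u} [NormedAddCommGroup Y] [NormedSpace ℝ Y]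
    [NormedAddCommGroup Z] [NormedSpace ℝ Z] (f : C(Y, Z)) (f' : C(Y, Y →L[ℝ] Z))
    (hf : ∀ y, HasFDerivAt f (f' y) y) (u₀ : C(K, Y)) :
    HasFDerivAt (fun u : C(K, Y) => f.comp u) (pointwiseApply K Y Z (f'.comp u₀)) u₀ := by
  rw [hasFDerivAt_iff_isLittleO, Asymptotics.isLittleO_iff]
  intro ε hε
  have hcont : Continuous fun u : C(K, Y) => f'.comp u := f'.continuous_postcomp
  obtain ⟨δ, hδ, hball⟩ := (Metric.continuous_iff (α := C(K, Y))
    (β := C(K, Y →L[ℝ] Z)) (f := fun u => f'.comp u)).1 hcont u₀ ε hε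
  filter_upwards [Metric.ball_mem_nhds u₀ hδ] with u hu
  refine (ContinuousMap.norm_le _ (by positivity)).2 fun s => ?_
  -- the mean value inequality on the segment from `u₀ s` to `u s`; uniformly in `s`, `Df` is close
  -- to its value at `u₀ s` because `u ↦ Df ∘ u` is continuous for the supremum norm
  have hseg : ∀ y ∈ segment ℝ (u₀ s) (u s), ‖f' y - f' (u₀ s)‖ ≤ ε := by
    rintro y ⟨a, b, ha, hb, hab, rfl⟩
    have hmem : a • u₀ + b • u ∈ Metric.ball u₀ δ :=
      (convex_ball u₀ δ) (Metric.mem_ball_self hδ) hu ha hb hab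
    have h1 := hball _ hmem
    have h2 := (ContinuousMap.dist_apply_le_dist s).trans h1.le
    rw [dist_eq_norm] at h2
    exact h2
  have := (convex_segment (𝕜 := ℝ) (u₀ s) (u s)).norm_image_sub_le_of_norm_hasFDerivWithin_le'
    (f := f) (f' := f') (φ := f' (u₀ s)) (fun y _ => (hf y).hasFDerivWithinAt) hseg
    (left_mem_segment ℝ _ _) (right_mem_segment ℝ _ _)
  refine this.trans ?_
  gcongr
  exact (u - u₀).norm_coe_le_norm s

/-- The superposition operator `u ↦ f ∘ u` on `C(K, Y)` with a smooth `f` is of class `C^m`, by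
induction on `m`: its derivative is the superposition operator of the derivative of `f`. The spaces
`Y` and `Z` share a universe so that the induction can pass from `Z` to `Y →L[ℝ] Z`. -/
theorem contDiff_superposition {Y : Type u} [NormedAddCommGroup Y] [NormedSpace ℝ Y] (m : ℕ) :
    ∀ {Z : Type u} [NormedAddCommGroup Z] [NormedSpace ℝ Z] (f : C(Y, Z)), ContDiff ℝ ∞ f →
      ContDiff ℝ m (fun u : C(K, Y) => f.comp u) := by
  induction m with
  | zero =>
    intro Z _ _ f hf
    exact contDiff_zero.2 f.continuous_postcomp
  | succ m ih =>
    intro Z _ _ f hf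
    let f' : C(Y, Y →L[ℝ] Z) := ⟨fderiv ℝ f, hf.continuous_fderiv (by simp)⟩
    have hd : ∀ y, HasFDerivAt f (f' y) y := fun y =>
      (hf.differentiable (by simp) y).hasFDerivAt
    have hf' : ContDiff ℝ ∞ f' := hf.fderiv_right (by simp)
    push_cast
    refine (contDiff_succ_iff_hasFDerivAt (n := m)).2
      ⟨fun u => pointwiseApply K Y Z (f'.comp u), ?_, fun u => hasFDerivAt_superposition f f' hd u⟩
    exact (pointwiseApply K Y Z).contDiff.comp (ih f' hf')

theorem contDiff_superposition_infty {Y Z : Type u} [NormedAddCommGroup Y] [NormedSpace ℝ Y]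
    [NormedAddCommGroup Z] [NormedSpace ℝ Z] (f : C(Y, Z)) (hf : ContDiff ℝ ∞ f) :
    ContDiff ℝ ∞ (fun u : C(K, Y) => f.comp u) :=
  contDiff_infty.2 fun m => contDiff_superposition m f hf

end Superposition

section Flow

universe u

variable {Y : Type u} [NormedAddCommGroup Y] [NormedSpace ℝ Y]

/-- The integration operator `v ↦ (s ↦ ∫₀ˢ v)` on continuous functions on `[-1, 1]`. -/
noncomputable def primitiveOperator (Y : Type u) [NormedAddCommGroup Y] [NormedSpace ℝ Y] :
    C(Icc (-1 : ℝ) 1, Y) →L[ℝ] C(Icc (-1 : ℝ) 1, Y) :=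
  LinearMap.mkContinuous
    { toFun := fun v => ⟨fun s => ∫ r in (0 : ℝ)..s, v (projIcc (-1) 1 (by norm_num) r), by
        have : Continuous fun r : ℝ => v (projIcc (-1) 1 (by norm_num) r) :=
          v.continuous.comp continuous_projIcc
        exact (intervalIntegral.continuous_primitive (fun a b => this.intervalIntegrable a b)
          0).comp continuous_subtype_val⟩
      map_add' := fun v w => by
        ext s
        have (v : C(Icc (-1 : ℝ) 1, Y)) :
            Continuous fun r : ℝ => v (projIcc (-1) 1 (by norm_num) r) :=
          v.continuous.comp continuous_projIcc
        simp only [ContinuousMap.add_apply, ContinuousMap.coe_mk]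
        exact intervalIntegral.integral_add ((this v).intervalIntegrable _ _)
          ((this w).intervalIntegrable _ _)
      map_smul' := fun c v => by
        ext s
        simp only [ContinuousMap.smul_apply, ContinuousMap.coe_mk, RingHom.id_apply]
        exact intervalIntegral.integral_smul _ _ } 1
    (fun v => by
      rw [one_mul]
      refine (ContinuousMap.norm_le _ (by positivity)).2 fun s => ?_
      refine (intervalIntegral.norm_integral_le_of_norm_le_const (C := ‖v‖)
        fun r _ => v.norm_coe_le_norm _).trans ?_
      have : |(s : ℝ) - 0| ≤ 1 := by
        rw [sub_zero, abs_le]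
        exact s.2
      exact mul_le_of_le_one_right (norm_nonneg v) this)

theorem primitiveOperator_apply (v : C(Icc (-1 : ℝ) 1, Y)) (s : Icc (-1 : ℝ) 1) :
    primitiveOperator Y v s = ∫ r in (0 : ℝ)..s, v (projIcc (-1) 1 (by norm_num) r) := rfl

/-- A smooth vector field on an open set agrees near a given point with a compactly supported smooth
vector field, which is then globally Lipschitz. -/
theorem exists_compactly_supported_eq_near [FiniteDimensional ℝ Y] {X : Y → Y} {Ω : Set Y}
    (hΩ : IsOpen Ω) (hX : ContDiffOn ℝ ∞ X Ω) {y₀ : Y} (hy₀ : y₀ ∈ Ω) :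
    ∃ f : Y → Y, ContDiff ℝ ∞ f ∧ HasCompactSupport f ∧
      ∃ r > 0, Metric.ball y₀ r ⊆ Ω ∧ ∀ y ∈ Metric.ball y₀ r, f y = X y := by
  obtain ⟨r, hr, hrΩ⟩ := Metric.nhds_basis_closedBall.mem_iff.1 (hΩ.mem_nhds hy₀)
  let b : ContDiffBump y₀ := ⟨r / 2, r, by positivity, by linarith⟩
  refine ⟨fun y => b y • X y, ?_, b.hasCompactSupport.smul_right, r / 2, by positivity, ?_, ?_⟩
  · rw [contDiff_iff_contDiffAt]
    intro y
    by_cases hy : y ∈ Ω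
    · exact b.contDiff.contDiffAt.smul (hX.contDiffAt (hΩ.mem_nhds hy))
    · have hy' : y ∉ tsupport b := fun h => hy (hrΩ (by rwa [b.tsupport_eq] at h))
      have h0 : (fun y => b y • X y) =ᶠ[𝓝 y] fun _ => 0 := by
        filter_upwards [notMem_tsupport_iff_eventuallyEq.1 hy'] with z hz
        simp [hz]
      exact contDiffAt_const.congr_of_eventuallyEq h0
  · exact (Metric.ball_subset_closedBall.trans
      (Metric.closedBall_subset_closedBall (by linarith))).trans hrΩ
  · intro y hy
    simp only [b.one_of_mem_closedBall (Metric.ball_subset_closedBall hy), one_smul]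

/-- For small `h`, the rescaled initial value problem `u' = h f(u)`, `u(0) = y`, has a solution on
`[-1, 1]` which depends smoothly on `(h, y)`, as an element of the Banach space of continuous
functions: this is the implicit function theorem at `h = 0`. -/
theorem exists_smooth_rescaled_solution [CompleteSpace Y] {f : Y → Y} (hf : ContDiff ℝ ∞ f)
    (y₀ : Y) :
    ∃ (O : Set (ℝ × Y)) (ψ : ℝ × Y → C(Icc (-1 : ℝ) 1, Y)), IsOpen O ∧ (0, y₀) ∈ O ∧
      ContDiffOn ℝ ∞ ψ O ∧ ∀ q ∈ O, ∀ s, ψ q s = q.2 + q.1 •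
        ∫ r in (0 : ℝ)..s, f (ψ q (projIcc (-1) 1 (by norm_num) r)) := by
  let fc : C(Y, Y) := ⟨f, hf.continuous⟩
  let cst : Y →L[ℝ] C(Icc (-1 : ℝ) 1, Y) := LinearMap.mkContinuous
    { toFun := fun y => ContinuousMap.const _ y
      map_add' := fun _ _ => rfl
      map_smul' := fun _ _ => rfl } 1 (fun y => by
        rw [one_mul]
        exact (ContinuousMap.norm_le _ (by positivity)).2 fun s => le_rfl)
  let G : (ℝ × Y) × C(Icc (-1 : ℝ) 1, Y) → C(Icc (-1 : ℝ) 1, Y) :=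
    fun q => q.2 - cst q.1.2 - q.1.1 • primitiveOperator Y (fc.comp q.2)
  have hN : ContDiff ℝ ∞ fun q : (ℝ × Y) × C(Icc (-1 : ℝ) 1, Y) =>
      primitiveOperator Y (fc.comp q.2) :=
    (primitiveOperator Y).contDiff.comp ((contDiff_superposition_infty fc hf).comp contDiff_snd)
  have hG : ContDiff ℝ ∞ G := by
    refine (contDiff_snd.sub (cst.contDiff.comp contDiff_fst.snd)).sub (contDiff_fst.fst.smul hN)
  set u₀ : (ℝ × Y) × C(Icc (-1 : ℝ) 1, Y) := ((0, y₀), cst y₀) with hu₀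
  have hG0 : G u₀ = 0 := by simp [G, hu₀]
  have hA : ∀ b, fderiv ℝ G u₀ (0, b) = ContinuousLinearEquiv.refl ℝ _ b := by
    intro b
    have h1 : HasFDerivAt G (fderiv ℝ G u₀) u₀ :=
      (hG.differentiable (by simp) u₀).hasFDerivAt
    have h2 : HasFDerivAt (fun v : C(Icc (-1 : ℝ) 1, Y) => G (u₀.1, v))
        ((fderiv ℝ G u₀).comp (ContinuousLinearMap.inr ℝ _ _)) u₀.2 :=
      HasFDerivAt.comp (f := fun v : C(Icc (-1 : ℝ) 1, Y) => (u₀.1, v)) u₀.2 h1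
        (hasFDerivAt_prodMk_right u₀.1 u₀.2)
    have h3 : (fun v : C(Icc (-1 : ℝ) 1, Y) => G (u₀.1, v)) = fun v => v - cst y₀ := by
      funext v
      simp [G, hu₀]
    rw [h3] at h2
    have h4 := h2.unique ((hasFDerivAt_id u₀.2).sub_const (cst y₀))
    simpa using congrArg (fun L => L b) h4
  obtain ⟨O, ψ, hO, h0, hψ, -, heq, -⟩ := exists_smooth_implicit (Ω := univ) isOpen_univ
    hG.contDiffOn (mem_univ u₀) _ hA
  refine ⟨O, ψ, hO, h0, hψ, fun q hq s => ?_⟩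
  have h1 := (heq q hq).2
  rw [hG0] at h1
  have h2 := congrArg (fun v : C(Icc (-1 : ℝ) 1, Y) => v s) h1
  simp only [G, ContinuousMap.sub_apply, ContinuousMap.smul_apply, ContinuousMap.zero_apply,
    primitiveOperator_apply, sub_eq_zero] at h2
  rw [sub_eq_iff_eq_add'.1 h2]
  rfl

end Flow

section Flow

universe u

variable {Y : Type u} [NormedAddCommGroup Y] [NormedSpace ℝ Y]

/-- Local flow of a smooth vector field, jointly smooth in time and initial value. -/
theorem exists_smooth_flow [FiniteDimensional ℝ Y] {X : Y → Y} {Ω : Set Y} (hΩ : IsOpen Ω)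
    (hX : ContDiffOn ℝ ∞ X Ω) {y₀ : Y} (hy₀ : y₀ ∈ Ω) :
    ∃ δ > 0, ∃ (O : Set Y) (Φ : ℝ × Y → Y), IsOpen O ∧ y₀ ∈ O ∧
      ContDiffOn ℝ ∞ Φ (Ioo (-δ) δ ×ˢ O) ∧ (∀ y ∈ O, Φ (0, y) = y) ∧
      ∀ t ∈ Ioo (-δ) δ, ∀ y ∈ O, Φ (t, y) ∈ Ω ∧
        HasDerivAt (fun t => Φ (t, y)) (X (Φ (t, y))) t := by
  have : CompleteSpace Y := FiniteDimensional.complete ℝ Y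
  obtain ⟨f, hf, hfc, r₀, hr₀, hr₀Ω, hfX⟩ := exists_compactly_supported_eq_near hΩ hX hy₀
  obtain ⟨L, hL⟩ := (hf.of_le (m := 1) (by simp)).lipschitzWith_of_hasCompactSupport hfc one_ne_zero
  obtain ⟨O₁, ψ, hO₁, h0, hψ, heq⟩ := exists_smooth_rescaled_solution hf y₀
  -- the flow is the value at time `1` of the rescaled solution
  let one : Icc (-1 : ℝ) 1 := ⟨1, by norm_num⟩
  let Φ : ℝ × Y → Y := fun q => ψ q one
  have hΦ : ContDiffOn ℝ ∞ Φ O₁ :=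
    (ContinuousMap.evalCLM ℝ one : C(Icc (-1 : ℝ) 1, Y) →L[ℝ] Y).contDiff.comp_contDiffOn hψ
  have hΦ0 : ∀ y, (0, y) ∈ O₁ → Φ (0, y) = y := by
    intro y hy
    have h1 := heq _ hy one
    rwa [zero_smul, add_zero] at h1
  have hopen : IsOpen (O₁ ∩ Φ ⁻¹' Metric.ball y₀ r₀) :=
    hΦ.continuousOn.isOpen_inter_preimage hO₁ Metric.isOpen_ball
  have hmem : (0, y₀) ∈ O₁ ∩ Φ ⁻¹' Metric.ball y₀ r₀ :=
    ⟨h0, by rw [mem_preimage, hΦ0 _ h0]; exact Metric.mem_ball_self hr₀⟩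
  obtain ⟨ε, hε, hball⟩ := Metric.isOpen_iff.1 hopen _ hmem
  have hbox : ∀ t ∈ Ioo (-ε) ε, ∀ y ∈ Metric.ball y₀ ε,
      (t, y) ∈ O₁ ∩ Φ ⁻¹' Metric.ball y₀ r₀ := by
    intro t ht y hy
    apply hball
    rw [Metric.mem_ball, Prod.dist_eq, max_lt_iff]
    refine ⟨?_, hy⟩
    rw [Real.dist_eq, sub_zero, abs_lt]
    exact ht
  -- solutions extended to the real line
  let U : ℝ × Y → ℝ → Y := fun q s => q.2 + q.1 •
    ∫ r in (0 : ℝ)..s, f (ψ q (projIcc (-1) 1 (by norm_num) r))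
  have hUψ : ∀ q ∈ O₁, ∀ s (hs : s ∈ Icc (-1 : ℝ) 1), U q s = ψ q ⟨s, hs⟩ :=
    fun q hq s hs => (heq q hq ⟨s, hs⟩).symm
  have hU0 : ∀ q, U q 0 = q.2 := fun q => by simp [U]
  have hU : ∀ q ∈ O₁, ∀ s ∈ Icc (-1 : ℝ) 1, HasDerivAt (U q) (q.1 • f (U q s)) s := by
    intro q hq s hs
    have hc : Continuous fun r : ℝ => f (ψ q (projIcc (-1) 1 (by norm_num) r)) :=
      hf.continuous.comp ((ψ q).continuous.comp continuous_projIcc)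
    have h1 := (hc.integral_hasStrictDerivAt 0 s).hasDerivAt
    have h2 := (h1.const_smul q.1).const_add q.2
    rwa [projIcc_of_mem _ hs, ← hUψ q hq s hs] at h2
  refine ⟨ε, hε, Metric.ball y₀ ε, Φ, Metric.isOpen_ball, Metric.mem_ball_self hε,
    hΦ.mono fun q hq => (hbox q.1 hq.1 q.2 hq.2).1,
    fun y hy => hΦ0 y (hbox 0 ⟨by linarith, hε⟩ y hy).1, fun t ht y hy => ?_⟩
  have hbt := hbox t ht y hy
  refine ⟨hr₀Ω hbt.2, ?_⟩
  rw [← hfX _ hbt.2]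
  obtain ⟨h, hth, hhε⟩ : ∃ h, |t| < h ∧ h < ε := exists_between (abs_lt.2 ht)
  have hh : 0 < h := (abs_nonneg t).trans_lt hth
  have hqh : (h, y) ∈ O₁ := (hbox h ⟨by linarith, hhε⟩ y hy).1
  -- by uniqueness, solutions for different rescalings are reparametrizations of each other
  have hrep : ∀ t' ∈ Ioo (-h) h, Φ (t', y) = U (h, y) (t' / h) := by
    intro t' ht'
    have hq' : (t', y) ∈ O₁ := (hbox t' ⟨by linarith [ht'.1], by linarith [ht'.2]⟩ y hy).1
    have h1 : ∀ s ∈ Icc (0 : ℝ) 1, HasDerivAt (U (t', y)) (t' • f (U (t', y) s)) s :=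
      fun s hs => hU _ hq' s ⟨by linarith [hs.1], hs.2⟩
    have h2 : ∀ s ∈ Icc (0 : ℝ) 1, HasDerivAt (fun s => U (h, y) (t' / h * s))
        (t' • f (U (h, y) (t' / h * s))) s := by
      intro s hs
      have hb : |t' / h| ≤ 1 := by
        rw [abs_div, abs_of_pos hh, div_le_one hh]
        exact (abs_lt.2 ht').le
      have hs' : t' / h * s ∈ Icc (-1 : ℝ) 1 := by
        rw [mem_Icc, ← abs_le, abs_mul]
        exact mul_le_one₀ hb (abs_nonneg s) (by rw [abs_of_nonneg hs.1]; exact hs.2)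
      have h3 := (hU _ hqh _ hs').scomp s ((hasDerivAt_id s).const_mul (t' / h))
      refine HasDerivAt.congr_deriv h3 ?_
      rw [smul_smul]
      congr 1
      field_simp
    -- both functions solve the same equation on `[0, 1]` with the same initial value
    have hlip : ∀ _ : ℝ, LipschitzWith (‖t'‖₊ * L) fun z => t' • f z := fun _ =>
      (lipschitzWith_smul t').comp hL
    have := ODE_solution_unique (v := fun _ z => t' • f z) hlip
      (fun s hs => (h1 s hs).continuousAt.continuousWithinAt)
      (fun s hs => (h1 s (Ico_subset_Icc_self hs)).hasDerivWithinAt)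
      (fun s hs => (h2 s hs).continuousAt.continuousWithinAt)
      (fun s hs => (h2 s (Ico_subset_Icc_self hs)).hasDerivWithinAt)
      (by simp [hU0]) (right_mem_Icc.2 zero_le_one)
    simp only [mul_one] at this
    rw [← this, hUψ _ hq' 1 (by norm_num)]
  have hev : (fun t' => Φ (t', y)) =ᶠ[𝓝 t] fun t' => U (h, y) (t' / h) := by
    filter_upwards [Ioo_mem_nhds (abs_lt.1 hth).1 (abs_lt.1 hth).2] with t' ht' using hrep t' ht'
  have hth' : t / h ∈ Icc (-1 : ℝ) 1 := by
    rw [mem_Icc, ← abs_le, abs_div, abs_of_pos hh, div_le_one hh]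
    exact hth.le
  have h4 := (hU _ hqh _ hth').scomp t ((hasDerivAt_id t).div_const h)
  refine (h4.congr_of_eventuallyEq hev).congr_deriv ?_
  rw [smul_smul, hrep t (abs_lt.1 hth)]
  simp [hh.ne']

end Flow

/-! ### Charts of the tangent bundle -/

/-- The model space of a `k`-dimensional manifold. -/
abbrev Coord (k : ℕ) : Type := EuclideanSpace ℝ (Fin k)

section Chart

variable {k : ℕ} {M : Type*} [TopologicalSpace M]
  [ChartedSpace (EuclideanSpace ℝ (Fin k)) M] [IsManifold (𝓡 k) ∞ M]

/-- The derivative at `z` of the inverse of the chart at `m`, which takes coordinate vectors to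
tangent vectors. -/
def chartVec (m : M) (z : Coord k) :
    Coord k →L[ℝ] TangentSpace (𝓡 k) ((extChartAt (𝓡 k) m).symm z) :=
  mfderiv 𝓘(ℝ, Coord k) (𝓡 k) (extChartAt (𝓡 k) m).symm z

/-- The tangent vector with coordinates `q` in the chart at `m`. -/
def ofCoord (m : M) (q : Coord k × Coord k) : TangentBundle (𝓡 k) M :=
  ⟨(extChartAt (𝓡 k) m).symm q.1, chartVec m q.1 q.2⟩

/-- The coordinates of a tangent vector in the chart at `m`. -/
def toCoord (m : M) (p : TangentBundle (𝓡 k) M) : Coord k × Coord k :=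
  (extChartAt (𝓡 k) m p.1, mfderiv (𝓡 k) 𝓘(ℝ, Coord k) (extChartAt (𝓡 k) m) p.1 p.2)

theorem isOpen_chart_target (m : M) : IsOpen (extChartAt (𝓡 k) m).target :=
  isOpen_extChartAt_target m

theorem contMDiffOn_chart_symm (m : M) :
    ContMDiffOn 𝓘(ℝ, Coord k) (𝓡 k) ∞ (extChartAt (𝓡 k) m).symm (extChartAt (𝓡 k) m).target :=
  contMDiffOn_extChartAt_symm m

theorem contMDiffOn_chart (m : M) :
    ContMDiffOn (𝓡 k) 𝓘(ℝ, Coord k) ∞ (extChartAt (𝓡 k) m) (extChartAt (𝓡 k) m).source := by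
  rw [extChartAt_source]
  exact contMDiffOn_extChartAt

theorem contMDiffAt_chart_symm (m : M) {z : Coord k} (hz : z ∈ (extChartAt (𝓡 k) m).target) :
    ContMDiffAt 𝓘(ℝ, Coord k) (𝓡 k) ∞ (extChartAt (𝓡 k) m).symm z :=
  (contMDiffOn_chart_symm m).contMDiffAt ((isOpen_chart_target m).mem_nhds hz)

theorem contMDiffAt_chart (m : M) {x : M} (hx : x ∈ (extChartAt (𝓡 k) m).source) :
    ContMDiffAt (𝓡 k) 𝓘(ℝ, Coord k) ∞ (extChartAt (𝓡 k) m) x :=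
  (contMDiffOn_chart m).contMDiffAt ((isOpen_extChartAt_source m).mem_nhds hx)

theorem mdifferentiableAt_chart_symm (m : M) {z : Coord k}
    (hz : z ∈ (extChartAt (𝓡 k) m).target) :
    MDifferentiableAt 𝓘(ℝ, Coord k) (𝓡 k) (extChartAt (𝓡 k) m).symm z :=
  (contMDiffAt_chart_symm m hz).mdifferentiableAt (by simp)

theorem mdifferentiableAt_chart (m : M) {x : M} (hx : x ∈ (extChartAt (𝓡 k) m).source) :
    MDifferentiableAt (𝓡 k) 𝓘(ℝ, Coord k) (extChartAt (𝓡 k) m) x :=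
  (contMDiffAt_chart m hx).mdifferentiableAt (by simp)

theorem mfderiv_chart_chartVec (m : M) {z : Coord k} (hz : z ∈ (extChartAt (𝓡 k) m).target)
    (a : Coord k) :
    mfderiv (𝓡 k) 𝓘(ℝ, Coord k) (extChartAt (𝓡 k) m) ((extChartAt (𝓡 k) m).symm z)
      (chartVec m z a) = a := by
  have : IsManifold (𝓡 k) 1 M := IsManifold.of_le (n := ∞) (by simp)
  have h := mfderiv_extChartAt_comp_mfderivWithin_extChartAt_symm (I := 𝓡 k) hz
  simp only [ModelWithCorners.Boundaryless.range_eq_univ, mfderivWithin_univ] at h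
  exact congrArg (fun L : Coord k →L[ℝ] Coord k => L a) h

theorem chartVec_mfderiv_chart (m : M) {x : M} (hx : x ∈ (extChartAt (𝓡 k) m).source)
    (v : TangentSpace (𝓡 k) x) :
    (⟨(extChartAt (𝓡 k) m).symm (extChartAt (𝓡 k) m x), chartVec m (extChartAt (𝓡 k) m x)
      (mfderiv (𝓡 k) 𝓘(ℝ, Coord k) (extChartAt (𝓡 k) m) x v)⟩ : TangentBundle (𝓡 k) M) = ⟨x, v⟩ := by
  have : IsManifold (𝓡 k) 1 M := IsManifold.of_le (n := ∞) (by simp)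
  have h := mfderivWithin_extChartAt_symm_comp_mfderiv_extChartAt' (I := 𝓡 k) hx
  simp only [ModelWithCorners.Boundaryless.range_eq_univ, mfderivWithin_univ] at h
  have h2 := congrArg (fun L : Coord k →L[ℝ] Coord k => L v) h
  have h3 := (extChartAt (𝓡 k) m).left_inv hx
  refine TotalSpace.ext h3 ?_
  exact heq_of_eq h2

theorem ofCoord_toCoord (m : M) {p : TangentBundle (𝓡 k) M}
    (hp : p.1 ∈ (extChartAt (𝓡 k) m).source) : ofCoord m (toCoord m p) = p :=
  chartVec_mfderiv_chart m hp p.2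

theorem toCoord_ofCoord (m : M) {q : Coord k × Coord k}
    (hq : q.1 ∈ (extChartAt (𝓡 k) m).target) : toCoord m (ofCoord m q) = q :=
  Prod.ext ((extChartAt (𝓡 k) m).right_inv hq) (mfderiv_chart_chartVec m hq q.2)

theorem chartVec_injective (m : M) {z : Coord k} (hz : z ∈ (extChartAt (𝓡 k) m).target) :
    Function.Injective (chartVec m z) := by
  intro a b h
  have := congrArg (mfderiv (𝓡 k) 𝓘(ℝ, Coord k) (extChartAt (𝓡 k) m) _) h
  rwa [mfderiv_chart_chartVec m hz, mfderiv_chart_chartVec m hz] at this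

theorem chartVec_surjective (m : M) {z : Coord k} (hz : z ∈ (extChartAt (𝓡 k) m).target) :
    Function.Surjective (chartVec m z) :=
  (LinearMap.injective_iff_surjective
    (f := (show Coord k →ₗ[ℝ] Coord k from (chartVec m z).toLinearMap))).1 (chartVec_injective m hz)

/-- At the center of the chart, coordinate vectors are the tangent vectors themselves. -/
theorem ofCoord_self (m : M) (v : TangentSpace (𝓡 k) m) :
    ofCoord m (extChartAt (𝓡 k) m m, v) = ⟨m, v⟩ := by
  have : IsManifold (𝓡 k) 1 M := IsManifold.of_le (n := ∞) (by simp)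
  have h := chartVec_mfderiv_chart m (mem_extChartAt_source (I := 𝓡 k) m) v
  rw [mfderiv_extChartAt_self] at h
  exact h

theorem contMDiffOn_tangentMapWithin_chart_symm (m : M) :
    ContMDiffOn (𝓘(ℝ, Coord k)).tangent (𝓡 k).tangent ∞
      (fun p : TangentBundle 𝓘(ℝ, Coord k) (Coord k) => ofCoord m (p.1, p.2))
      (TotalSpace.proj ⁻¹' (extChartAt (𝓡 k) m).target) := by
  have : IsManifold (𝓡 k) 1 M := IsManifold.of_le (n := ∞) (by simp)
  refine ((contMDiffOn_chart_symm (k := k) m).contMDiffOn_tangentMapWithin (m := ∞) (by simp)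
    (isOpen_chart_target m).uniqueMDiffOn).congr ?_
  intro p hp
  have h3 := mfderivWithin_of_isOpen (f := (extChartAt (𝓡 k) m).symm) (I := 𝓘(ℝ, Coord k))
    (I' := 𝓡 k) (isOpen_chart_target m) hp
  refine TotalSpace.ext rfl (heq_of_eq ?_)
  exact congrArg (fun L : Coord k →L[ℝ] Coord k => L p.2) h3.symm

theorem continuousOn_ofCoord (m : M) :
    ContinuousOn (ofCoord m : Coord k × Coord k → TangentBundle (𝓡 k) M)
      ((extChartAt (𝓡 k) m).target ×ˢ univ) := by
  refine (contMDiffOn_tangentMapWithin_chart_symm m).continuousOn.comp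
    (f := fun q : Coord k × Coord k => (⟨q.1, q.2⟩ : TangentBundle 𝓘(ℝ, Coord k) (Coord k)))
    ?_ fun q hq => hq.1
  exact (tangentBundleModelSpaceHomeomorph 𝓘(ℝ, Coord k)).symm.continuous.continuousOn

/-- Coordinate vector fields are smooth. -/
theorem contMDiffOn_chartVec (m : M) (a : Coord k) :
    ContMDiffOn 𝓘(ℝ, Coord k) (𝓡 k).tangent ∞
      (fun z => (⟨(extChartAt (𝓡 k) m).symm z, chartVec m z a⟩ : TangentBundle (𝓡 k) M))
      (extChartAt (𝓡 k) m).target := by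
  refine (contMDiffOn_tangentMapWithin_chart_symm m).comp
    (f := fun z : Coord k => (⟨z, a⟩ : TangentBundle 𝓘(ℝ, Coord k) (Coord k))) ?_ fun z hz => hz
  exact (contMDiff_vectorSpace_iff_contDiff.2 contDiff_const).contMDiffOn

theorem continuousOn_toCoord (m : M) :
    ContinuousOn (toCoord m)
      (TotalSpace.proj ⁻¹' (extChartAt (𝓡 k) m).source : Set (TangentBundle (𝓡 k) M)) := by
  have : IsManifold (𝓡 k) 1 M := IsManifold.of_le (n := ∞) (by simp)
  have h := ((contMDiffOn_chart (k := k) m).contMDiffOn_tangentMapWithin (m := ∞) (by simp)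
    (isOpen_extChartAt_source m).uniqueMDiffOn).continuousOn
  refine ((tangentBundleModelSpaceHomeomorph 𝓘(ℝ, Coord k)).continuous.comp_continuousOn
    h).congr ?_
  intro p hp
  have h3 := mfderivWithin_of_isOpen (f := extChartAt (𝓡 k) m) (I := 𝓡 k)
    (I' := 𝓘(ℝ, Coord k)) (isOpen_extChartAt_source m) hp
  refine Prod.ext rfl ?_
  exact congrArg (fun L : Coord k →L[ℝ] Coord k => L p.2) h3.symm

theorem isOpen_proj_preimage_source (m : M) :
    IsOpen (TotalSpace.proj ⁻¹' (extChartAt (𝓡 k) m).source : Set (TangentBundle (𝓡 k) M)) :=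
  (isOpen_extChartAt_source m).preimage (FiberBundle.continuous_proj _ _)

end Chart

/-! ### The metric in charts -/

section FormInstances

variable {E : Type*} [NormedAddCommGroup E] [NormedSpace ℝ E]

/-- The norm on bilinear forms; this and the next three instances only shorten the search for the
instances which exist already. -/
instance bilinearFormNormed : NormedAddCommGroup (E →L[ℝ] E →L[ℝ] ℝ) :=
  ContinuousLinearMap.toNormedAddCommGroup

instance bilinearFormSpace : NormedSpace ℝ (E →L[ℝ] E →L[ℝ] ℝ) :=
  ContinuousLinearMap.toNormedSpace

instance trilinearFormNormed : NormedAddCommGroup (E →L[ℝ] E →L[ℝ] E →L[ℝ] ℝ) :=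
  ContinuousLinearMap.toNormedAddCommGroup

instance trilinearFormSpace : NormedSpace ℝ (E →L[ℝ] E →L[ℝ] E →L[ℝ] ℝ) :=
  ContinuousLinearMap.toNormedSpace

end FormInstances

section Metric

variable {k : ℕ} {M : Type*} [TopologicalSpace M]
  [ChartedSpace (EuclideanSpace ℝ (Fin k)) M] [IsManifold (𝓡 k) ∞ M]

/-- The metric in the chart at `m`, as a bilinear form on the model space. -/
def chartForm (g : LorentzMetric k M) (m : M) (z : Coord k) : Coord k →L[ℝ] Coord k →L[ℝ] ℝ :=
  ContinuousLinearMap.bilinearComp (E := Coord k) (F := Coord k) (G := ℝ)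
    (g.inner ((extChartAt (𝓡 k) m).symm z)) (E' := Coord k) (F' := Coord k)
    (chartVec m z) (chartVec m z)

theorem chartForm_apply (g : LorentzMetric k M) (m : M) (z a b : Coord k) :
    chartForm g m z a b = chartMetric g m z a b := rfl

theorem chartForm_symm (g : LorentzMetric k M) (m : M) (z a b : Coord k) :
    chartForm g m z a b = chartForm g m z b a :=
  g.symm _ _ _

/-- A Lorentzian form is nondegenerate. -/
theorem IsLorentzForm.eq_zero {W : Type*} [AddCommGroup W] {B : W → W → ℝ} (h : IsLorentzForm B)
    (hsymm : ∀ v w, B v w = B w v) {v : W} (hv : ∀ w, B v w = 0) : v = 0 := by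
  obtain ⟨e, -, he⟩ := h
  by_contra hne
  exact (he v hne (by rw [hsymm, hv])).ne' (hv v)

theorem LorentzMetric.eq_zero (g : LorentzMetric k M) {x : M} {v : TangentSpace (𝓡 k) x}
    (hv : ∀ w, g.inner x v w = 0) : v = 0 :=
  (g.lorentz x).eq_zero (g.symm x) hv

theorem chartForm_injective (g : LorentzMetric k M) (m : M) {z : Coord k}
    (hz : z ∈ (extChartAt (𝓡 k) m).target) : Function.Injective (chartForm g m z) := by
  rw [injective_iff_map_eq_zero]
  intro a ha
  have h1 : chartVec m z a = 0 := by
    refine g.eq_zero fun w => ?_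
    obtain ⟨b, rfl⟩ := chartVec_surjective m hz w
    exact congrArg (fun L : Coord k →L[ℝ] ℝ => L b) ha
  exact chartVec_injective m hz (h1.trans (map_zero _).symm)

theorem chartForm_isInvertible (g : LorentzMetric k M) (m : M) {z : Coord k}
    (hz : z ∈ (extChartAt (𝓡 k) m).target) : (chartForm g m z).IsInvertible := by
  have hfin : Module.finrank ℝ (Coord k) = Module.finrank ℝ (Coord k →L[ℝ] ℝ) := by
    rw [← LinearEquiv.finrank_eq (LinearMap.toContinuousLinearMap (𝕜 := ℝ) (E := Coord k) (F' := ℝ))]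
    exact Subspace.dual_finrank_eq.symm
  exact ⟨(LinearEquiv.ofInjectiveOfFinrankEq (chartForm g m z).toLinearMap
    (chartForm_injective g m hz) hfin).toContinuousLinearEquiv, by ext; rfl⟩

theorem contDiffOn_chartForm_family {gf : ℝ → LorentzMetric k M} {s : Set ℝ}
    (hgf : SmoothFamilyOn gf s) (m : M) :
    ContDiffOn ℝ ∞ (fun q : ℝ × Coord k => chartForm (gf q.1) m q.2)
      (s ×ˢ (extChartAt (𝓡 k) m).target) := by
  rw [contDiffOn_clm_apply]
  intro a
  rw [contDiffOn_clm_apply]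
  intro b
  rw [← contMDiffOn_iff_contDiffOn]
  have hsnd : ContMDiffOn 𝓘(ℝ, ℝ × Coord k) 𝓘(ℝ, Coord k) ∞ (fun q : ℝ × Coord k => q.2)
      (s ×ˢ (extChartAt (𝓡 k) m).target) := contDiff_snd.contMDiff.contMDiffOn
  have hfst : ContMDiffOn 𝓘(ℝ, ℝ × Coord k) 𝓘(ℝ, ℝ) ∞ (fun q : ℝ × Coord k => q.1)
      (s ×ˢ (extChartAt (𝓡 k) m).target) := contDiff_fst.contMDiff.contMDiffOn
  have hv (a : Coord k) := (contMDiffOn_chartVec m a).comp hsnd fun q hq => hq.2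
  have hb := (contMDiffOn_chart_symm m).comp hsnd fun q hq => hq.2
  have hg := ContMDiffOn.comp (f := fun q : ℝ × Coord k => (q.1, (extChartAt (𝓡 k) m).symm q.2))
    hgf (hfst.prodMk hb) fun q hq => ⟨hq.1, mem_univ _⟩
  have h : ContMDiffOn 𝓘(ℝ, ℝ × Coord k) ((𝓡 k).prod 𝓘(ℝ)) ∞
      (fun q : ℝ × Coord k => TotalSpace.mk' ℝ (E := Bundle.Trivial M ℝ)
        ((extChartAt (𝓡 k) m).symm q.2)
        ((gf q.1).inner ((extChartAt (𝓡 k) m).symm q.2) (chartVec m q.2 a) (chartVec m q.2 b)))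
      (s ×ˢ (extChartAt (𝓡 k) m).target) :=
    ContMDiffOn.clm_bundle_apply₂ (F₁ := Coord k) (F₂ := Coord k)
      (E₁ := (TangentSpace (𝓡 k) : M → Type _)) (E₂ := (TangentSpace (𝓡 k) : M → Type _))
      (E₃ := Bundle.Trivial M ℝ)
      hg (hv a) (hv b)
  intro q hq
  have := h q hq
  simp only [contMDiffWithinAt_totalSpace] at this
  exact this.2

theorem smoothFamilyOn_const (g : LorentzMetric k M) (s : Set ℝ) :
    SmoothFamilyOn (fun _ => g) s :=
  (g.contMDiff.comp contMDiff_snd).contMDiffOn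

theorem contDiffOn_chartForm (g : LorentzMetric k M) (m : M) :
    ContDiffOn ℝ ∞ (chartForm g m) (extChartAt (𝓡 k) m).target :=
  (contDiffOn_chartForm_family (smoothFamilyOn_const g univ) m).comp
    (f := fun z : Coord k => ((0 : ℝ), z)) (contDiff_const.prodMk contDiff_id).contDiffOn
    fun _ hz => ⟨mem_univ _, hz⟩

theorem differentiableAt_chartForm (g : LorentzMetric k M) (m : M) {z : Coord k}
    (hz : z ∈ (extChartAt (𝓡 k) m).target) : DifferentiableAt ℝ (chartForm g m) z :=
  ((contDiffOn_chartForm g m).contDiffAt ((isOpen_chart_target m).mem_nhds hz)).differentiableAt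
    (by simp)

theorem fderiv_chartMetric (g : LorentzMetric k M) (m : M) {z : Coord k}
    (hz : z ∈ (extChartAt (𝓡 k) m).target) (a b c : Coord k) :
    fderiv ℝ (fun z' => chartMetric g m z' a b) z c = fderiv ℝ (chartForm g m) z c a b := by
  have h := (((differentiableAt_chartForm g m hz).hasFDerivAt.clm_apply
    (hasFDerivAt_const a z)).clm_apply (hasFDerivAt_const b z)).fderiv
  have h2 : (fun z' => chartMetric g m z' a b) = fun z' => chartForm g m z' a b := rfl
  rw [h2, h]
  simp

theorem christoffel_eq (g : LorentzMetric k M) (m : M) {z : Coord k}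
    (hz : z ∈ (extChartAt (𝓡 k) m).target) (a b c : Coord k) :
    christoffel g m z a b c = (fderiv ℝ (chartForm g m) z a b c
      + fderiv ℝ (chartForm g m) z b a c - fderiv ℝ (chartForm g m) z c a b) / 2 := by
  simp only [christoffel, fderiv_chartMetric g m hz]

end Metric

/-! ### Change of charts -/

theorem hasFDerivAt_comp_fderiv {D E F : Type*} [NormedAddCommGroup D] [NormedSpace ℝ D]
    [NormedAddCommGroup E] [NormedSpace ℝ E] [NormedAddCommGroup F] [NormedSpace ℝ F]
    {G : E → F} {φ : D → E} {z : D} (hG : DifferentiableAt ℝ G (φ z))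
    (hφ : DifferentiableAt ℝ φ z) :
    HasFDerivAt (fun y => G (φ y)) ((fderiv ℝ G (φ z)).comp (fderiv ℝ φ z)) z :=
  hG.hasFDerivAt.comp z hφ.hasFDerivAt

/-- The derivative of the pull-back of a field of bilinear forms. -/
theorem fderiv_pullback_form {E : Type*} [NormedAddCommGroup E] [NormedSpace ℝ E]
    {G H : E → E →L[ℝ] E →L[ℝ] ℝ} {φ : E → E} {z : E} (hφ : ContDiffAt ℝ ∞ φ z)
    (hG : DifferentiableAt ℝ G (φ z)) (hH : DifferentiableAt ℝ H z)
    (h : ∀ᶠ y in 𝓝 z, ∀ a b, H y a b = G (φ y) (fderiv ℝ φ y a) (fderiv ℝ φ y b)) (a b c : E) :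
    fderiv ℝ H z a b c =
      fderiv ℝ G (φ z) (fderiv ℝ φ z a) (fderiv ℝ φ z b) (fderiv ℝ φ z c)
      + G (φ z) (fderiv ℝ (fderiv ℝ φ) z a b) (fderiv ℝ φ z c)
      + G (φ z) (fderiv ℝ φ z b) (fderiv ℝ (fderiv ℝ φ) z a c) := by
  have hφ1 := (hφ.differentiableAt (by simp)).hasFDerivAt
  have hφ2 := ((hφ.fderiv_right (m := ∞) (by simp)).differentiableAt (by simp)).hasFDerivAt
  have hGφ := hasFDerivAt_comp_fderiv (F := E →L[ℝ] E →L[ℝ] ℝ) hG (hφ.differentiableAt (by simp))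
  have hb := hφ2.clm_apply (hasFDerivAt_const b z)
  have hc := hφ2.clm_apply (hasFDerivAt_const c z)
  have h1 := (hGφ.clm_apply hb).clm_apply hc
  have h2 := (hH.hasFDerivAt.clm_apply (hasFDerivAt_const b z)).clm_apply (hasFDerivAt_const c z)
  have h3 : (fun y => H y b c) =ᶠ[𝓝 z] fun y => G (φ y) (fderiv ℝ φ y b) (fderiv ℝ φ y c) := by
    filter_upwards [h] with y hy
    exact hy b c
  have h4 := congrArg (fun L : E →L[ℝ] ℝ => L a) (h2.unique (h1.congr_of_eventuallyEq h3))
  simp only [ContinuousLinearMap.comp_apply, ContinuousLinearMap.flip_apply,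
    add_apply,
    ContinuousLinearMap.comp_zero, zero_add] at h4
  rw [h4]
  ring

section Transition

variable {k : ℕ} {M : Type*} [TopologicalSpace M]
  [ChartedSpace (EuclideanSpace ℝ (Fin k)) M] [IsManifold (𝓡 k) ∞ M]

theorem inner_congr (g : LorentzMetric k M) {x y : M} {v w : TangentSpace (𝓡 k) x}
    {v' w' : TangentSpace (𝓡 k) y} (hv : (⟨x, v⟩ : TangentBundle (𝓡 k) M) = ⟨y, v'⟩)
    (hw : (⟨x, w⟩ : TangentBundle (𝓡 k) M) = ⟨y, w'⟩) : g.inner x v w = g.inner y v' w' := by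
  cases hv
  cases hw
  rfl

/-- The transition map from the chart at `p` to the chart at `q`. -/
def transition (p q : M) (z : Coord k) : Coord k :=
  extChartAt (𝓡 k) q ((extChartAt (𝓡 k) p).symm z)

variable {p q : M} {z : Coord k}

theorem contDiffAt_transition (hz : z ∈ (extChartAt (𝓡 k) p).target)
    (hq : (extChartAt (𝓡 k) p).symm z ∈ (extChartAt (𝓡 k) q).source) :
    ContDiffAt ℝ ∞ (transition p q) z :=
  (ContMDiffAt.comp z (contMDiffAt_chart q hq) (contMDiffAt_chart_symm p hz)).contDiffAt

theorem eventually_transition_domain (hz : z ∈ (extChartAt (𝓡 k) p).target)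
    (hq : (extChartAt (𝓡 k) p).symm z ∈ (extChartAt (𝓡 k) q).source) :
    ∀ᶠ y in 𝓝 z, y ∈ (extChartAt (𝓡 k) p).target ∧
      (extChartAt (𝓡 k) p).symm y ∈ (extChartAt (𝓡 k) q).source :=
  ((isOpen_chart_target p).mem_nhds hz |> Filter.Eventually.and) <|
    (contMDiffAt_chart_symm p hz).continuousAt.preimage_mem_nhds
      ((isOpen_extChartAt_source q).mem_nhds hq)

theorem toCoord_ofCoord_transition (hz : z ∈ (extChartAt (𝓡 k) p).target)
    (hq : (extChartAt (𝓡 k) p).symm z ∈ (extChartAt (𝓡 k) q).source) (a : Coord k) :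
    toCoord q (ofCoord p (z, a)) = (transition p q z, fderiv ℝ (transition p q) z a) := by
  refine Prod.ext rfl ?_
  have h := mfderiv_comp z (mdifferentiableAt_chart q hq) (mdifferentiableAt_chart_symm p hz)
  have h2 : fderiv ℝ (transition p q) z = mfderiv 𝓘(ℝ, Coord k) 𝓘(ℝ, Coord k)
      (extChartAt (𝓡 k) q ∘ (extChartAt (𝓡 k) p).symm) z := mfderiv_eq_fderiv.symm
  simp only [h2]
  exact (congrArg (fun L : Coord k →L[ℝ] Coord k => L a) h).symm

theorem ofCoord_transition (hz : z ∈ (extChartAt (𝓡 k) p).target)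
    (hq : (extChartAt (𝓡 k) p).symm z ∈ (extChartAt (𝓡 k) q).source) (a : Coord k) :
    ofCoord q (transition p q z, fderiv ℝ (transition p q) z a) = ofCoord p (z, a) := by
  rw [← toCoord_ofCoord_transition hz hq, ofCoord_toCoord]
  exact hq

theorem fderiv_transition_surjective (hz : z ∈ (extChartAt (𝓡 k) p).target)
    (hq : (extChartAt (𝓡 k) p).symm z ∈ (extChartAt (𝓡 k) q).source) :
    Function.Surjective (fderiv ℝ (transition p q) z) := by
  intro b
  have hbase : (extChartAt (𝓡 k) q).symm (transition p q z) = (extChartAt (𝓡 k) p).symm z :=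
    (extChartAt (𝓡 k) q).left_inv hq
  have hmem : transition p q z ∈ (extChartAt (𝓡 k) q).target := (extChartAt (𝓡 k) q).map_source hq
  obtain ⟨a, ha⟩ := chartVec_surjective p hz
    (show TangentSpace (𝓡 k) ((extChartAt (𝓡 k) p).symm z) from chartVec q (transition p q z) b)
  have h1 : ofCoord p (z, a) = ofCoord q (transition p q z, b) :=
    TotalSpace.ext hbase.symm (heq_of_eq ha)
  have h2 := congrArg (toCoord q) h1
  rw [toCoord_ofCoord_transition hz hq, toCoord_ofCoord q hmem] at h2
  exact ⟨a, congrArg Prod.snd h2⟩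

theorem chartForm_transition (g : LorentzMetric k M) (hz : z ∈ (extChartAt (𝓡 k) p).target)
    (hq : (extChartAt (𝓡 k) p).symm z ∈ (extChartAt (𝓡 k) q).source) (a b : Coord k) :
    chartForm g p z a b = chartForm g q (transition p q z) (fderiv ℝ (transition p q) z a)
      (fderiv ℝ (transition p q) z b) :=
  inner_congr g (v := chartVec p z a) (w := chartVec p z b)
    (v' := chartVec q (transition p q z) (fderiv ℝ (transition p q) z a))
    (w' := chartVec q (transition p q z) (fderiv ℝ (transition p q) z b))
    (ofCoord_transition hz hq a).symm (ofCoord_transition hz hq b).symm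

theorem fderiv_chartForm_transition (g : LorentzMetric k M)
    (hz : z ∈ (extChartAt (𝓡 k) p).target)
    (hq : (extChartAt (𝓡 k) p).symm z ∈ (extChartAt (𝓡 k) q).source) (a b c : Coord k) :
    fderiv ℝ (chartForm g p) z a b c =
      fderiv ℝ (chartForm g q) (transition p q z) (fderiv ℝ (transition p q) z a)
        (fderiv ℝ (transition p q) z b) (fderiv ℝ (transition p q) z c)
      + chartForm g q (transition p q z) (fderiv ℝ (fderiv ℝ (transition p q)) z a b)
        (fderiv ℝ (transition p q) z c)
      + chartForm g q (transition p q z) (fderiv ℝ (transition p q) z b)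
        (fderiv ℝ (fderiv ℝ (transition p q)) z a c) := by
  refine fderiv_pullback_form (contDiffAt_transition hz hq)
    (differentiableAt_chartForm g q ((extChartAt (𝓡 k) q).map_source hq))
    (differentiableAt_chartForm g p hz) ?_ a b c
  filter_upwards [eventually_transition_domain hz hq] with y hy
  exact chartForm_transition g hy.1 hy.2

/-- The transformation law of the Christoffel symbols. -/
theorem christoffel_transition (g : LorentzMetric k M) (hz : z ∈ (extChartAt (𝓡 k) p).target)
    (hq : (extChartAt (𝓡 k) p).symm z ∈ (extChartAt (𝓡 k) q).source) (a w : Coord k) :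
    christoffel g p z a a w = christoffel g q (transition p q z)
        (fderiv ℝ (transition p q) z a) (fderiv ℝ (transition p q) z a)
        (fderiv ℝ (transition p q) z w)
      + chartForm g q (transition p q z) (fderiv ℝ (fderiv ℝ (transition p q)) z a a)
        (fderiv ℝ (transition p q) z w) := by
  have hsymm : fderiv ℝ (fderiv ℝ (transition p q)) z w a =
      fderiv ℝ (fderiv ℝ (transition p q)) z a w :=
    ((contDiffAt_transition hz hq).isSymmSndFDerivAt (by
      rw [minSmoothness_of_isRCLikeNormedField]; exact WithTop.coe_le_coe.2 le_top)) w a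
  have hmem : transition p q z ∈ (extChartAt (𝓡 k) q).target := (extChartAt (𝓡 k) q).map_source hq
  rw [christoffel_eq g p hz, christoffel_eq g q hmem]
  simp only [fderiv_chartForm_transition g hz hq, hsymm]
  rw [chartForm_symm g q _ (fderiv ℝ (fderiv ℝ (transition p q)) z a w)]
  ring

end Transition

section Curves

variable {k : ℕ} {M : Type*} [TopologicalSpace M]
  [ChartedSpace (EuclideanSpace ℝ (Fin k)) M] [IsManifold (𝓡 k) ∞ M]
  {γ : ℝ → M} {t : ℝ} {m p q : M}

theorem contDiffAt_chart_comp (hγ : ContMDiffAt 𝓘(ℝ, ℝ) (𝓡 k) ∞ γ t)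
    (hm : γ t ∈ (extChartAt (𝓡 k) m).source) :
    ContDiffAt ℝ ∞ (fun s => extChartAt (𝓡 k) m (γ s)) t :=
  (ContMDiffAt.comp t (contMDiffAt_chart m hm) hγ).contDiffAt

theorem toCoord_velocity (hγ : MDifferentiableAt 𝓘(ℝ, ℝ) (𝓡 k) γ t)
    (hm : γ t ∈ (extChartAt (𝓡 k) m).source) :
    toCoord m (velocity k γ t) =
      (extChartAt (𝓡 k) m (γ t), deriv (fun s => extChartAt (𝓡 k) m (γ s)) t) := by
  refine Prod.ext rfl ?_
  have h := mfderiv_comp t (mdifferentiableAt_chart m hm) hγ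
  have h2 : fderiv ℝ (fun s => extChartAt (𝓡 k) m (γ s)) t = mfderiv 𝓘(ℝ, ℝ) 𝓘(ℝ, Coord k)
      (extChartAt (𝓡 k) m ∘ γ) t := mfderiv_eq_fderiv.symm
  simp only [← fderiv_apply_one_eq_deriv, h2]
  exact (congrArg (fun L : ℝ →L[ℝ] Coord k => L 1) h).symm

theorem velocity_eq_ofCoord (hγ : MDifferentiableAt 𝓘(ℝ, ℝ) (𝓡 k) γ t)
    (hm : γ t ∈ (extChartAt (𝓡 k) m).source) :
    velocity k γ t = ofCoord m
      (extChartAt (𝓡 k) m (γ t), deriv (fun s => extChartAt (𝓡 k) m (γ s)) t) := by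
  rw [← toCoord_velocity hγ hm, ofCoord_toCoord]
  exact hm

/-- The geodesic equation at a given time does not depend on the chart. -/
theorem geodesic_equation_chart_change (g : LorentzMetric k M)
    (hγ : ContMDiffAt 𝓘(ℝ, ℝ) (𝓡 k) ∞ γ t)
    (hp : γ t ∈ (extChartAt (𝓡 k) p).source) (hq : γ t ∈ (extChartAt (𝓡 k) q).source)
    (h : ∀ w : Coord k, chartMetric g p (extChartAt (𝓡 k) p (γ t))
        (deriv (deriv fun s => extChartAt (𝓡 k) p (γ s)) t) w
      + christoffel g p (extChartAt (𝓡 k) p (γ t))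
        (deriv (fun s => extChartAt (𝓡 k) p (γ s)) t)
        (deriv (fun s => extChartAt (𝓡 k) p (γ s)) t) w = 0) (w : Coord k) :
    chartMetric g q (extChartAt (𝓡 k) q (γ t))
        (deriv (deriv fun s => extChartAt (𝓡 k) q (γ s)) t) w
      + christoffel g q (extChartAt (𝓡 k) q (γ t))
        (deriv (fun s => extChartAt (𝓡 k) q (γ s)) t)
        (deriv (fun s => extChartAt (𝓡 k) q (γ s)) t) w = 0 := by
  set c : ℝ → Coord k := fun s => extChartAt (𝓡 k) p (γ s) with hc
  set d : ℝ → Coord k := fun s => extChartAt (𝓡 k) q (γ s) with hd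
  have hcs : ContDiffAt ℝ ∞ c t := contDiffAt_chart_comp hγ hp
  have hz : c t ∈ (extChartAt (𝓡 k) p).target := (extChartAt (𝓡 k) p).map_source hp
  have hpt : (extChartAt (𝓡 k) p).symm (c t) = γ t := (extChartAt (𝓡 k) p).left_inv hp
  have hzq : (extChartAt (𝓡 k) p).symm (c t) ∈ (extChartAt (𝓡 k) q).source := by rwa [hpt]
  have hφt : transition p q (c t) = d t := by simp only [transition, hpt, hd]
  have hsrc : ∀ᶠ s in 𝓝 t, γ s ∈ (extChartAt (𝓡 k) p).source :=
    hγ.continuousAt.preimage_mem_nhds ((isOpen_extChartAt_source p).mem_nhds hp)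
  have hdc : d =ᶠ[𝓝 t] fun s => transition p q (c s) := by
    filter_upwards [hsrc] with s hs
    simp only [hd, hc, transition, (extChartAt (𝓡 k) p).left_inv hs]
  have hcd : ∀ᶠ s in 𝓝 t, HasDerivAt c (deriv c s) s := by
    filter_upwards [(hcs.of_le (m := 1) (by simp)).eventually (by simp)] with s hs
    exact (hs.differentiableAt (by simp)).hasDerivAt
  have hd1 : deriv d =ᶠ[𝓝 t] fun s => fderiv ℝ (transition p q) (c s) (deriv c s) := by
    have h1 : ∀ᶠ s in 𝓝 t, DifferentiableAt ℝ (transition p q) (c s) := by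
      filter_upwards [hcs.continuousAt.eventually (eventually_transition_domain hz hzq)] with s hs
      exact (contDiffAt_transition hs.1 hs.2).differentiableAt (by simp)
    filter_upwards [hdc.eventuallyEq_nhds, hcd, h1] with s h1 h2 h3
    rw [h1.deriv_eq]
    exact (h3.hasFDerivAt.comp_hasDerivAt s h2).deriv
  have hφ := contDiffAt_transition hz hzq
  have hφ2 := ((hφ.fderiv_right (m := ∞) (by simp)).differentiableAt (by simp)).hasFDerivAt
  have hc2 : HasDerivAt (deriv c) (deriv (deriv c) t) t := by
    have h1 : ContDiffAt ℝ 1 (deriv c) t := by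
      have h2 := (hcs.fderiv_right (m := 1) (WithTop.coe_le_coe.2 le_top)).clm_apply
        (contDiffAt_const (c := (1 : ℝ)))
      simpa only [fderiv_apply_one_eq_deriv] using h2
    exact (h1.differentiableAt (by simp)).hasDerivAt
  have hd2 : deriv (deriv d) t = fderiv ℝ (fderiv ℝ (transition p q)) (c t) (deriv c t) (deriv c t)
      + fderiv ℝ (transition p q) (c t) (deriv (deriv c) t) := by
    rw [hd1.deriv_eq]
    exact ((hφ2.comp_hasDerivAt t hcd.self_of_nhds).clm_apply hc2).deriv
  obtain ⟨b, rfl⟩ := fderiv_transition_surjective hz hzq w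
  have hb := h b
  rw [christoffel_transition g hz hzq, ← chartForm_apply, chartForm_transition g hz hzq] at hb
  rw [← chartForm_apply, hd2, hd1.self_of_nhds, show extChartAt (𝓡 k) q (γ t) = _ from hφt.symm]
  simp only [map_add, add_apply]
  linarith

end Curves

/-! ### The geodesic equation as a differential equation in charts -/

section Spray

variable {E : Type*} [NormedAddCommGroup E] [NormedSpace ℝ E]

/-- The covector `c ↦ D(w)(w, c) - D(c)(w, w) / 2`: the Christoffel symbol `Γ(w, w; ·)` of a field
of symmetric bilinear forms with derivative `D`. -/
def sprayCovector (D : E →L[ℝ] E →L[ℝ] E →L[ℝ] ℝ) (w : E) : E →L[ℝ] ℝ :=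
  D w w - (1 / 2 : ℝ) • (D.flip w).flip w

theorem sprayCovector_apply (D : E →L[ℝ] E →L[ℝ] E →L[ℝ] ℝ) (w c : E) :
    sprayCovector D w c = D w w c - 1 / 2 * D c w w := by
  simp [sprayCovector]

/-- The acceleration prescribed by the geodesic equation for a field of forms with value `G` and
derivative `D`. -/
def sprayAccel (G : E →L[ℝ] E →L[ℝ] ℝ) (D : E →L[ℝ] E →L[ℝ] E →L[ℝ] ℝ) (w : E) : E :=
  -G.inverse (sprayCovector D w)

theorem eq_sprayAccel_iff {G : E →L[ℝ] E →L[ℝ] ℝ} (hG : G.IsInvertible)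
    (D : E →L[ℝ] E →L[ℝ] E →L[ℝ] ℝ) (w a : E) :
    a = sprayAccel G D w ↔ ∀ c, G a c + sprayCovector D w c = 0 := by
  obtain ⟨A, rfl⟩ := hG
  rw [sprayAccel, ContinuousLinearMap.inverse_equiv]
  constructor
  · rintro rfl c
    simp
  · intro h
    have h1 : A a = -sprayCovector D w := by
      ext c
      exact eq_neg_of_add_eq_zero_left (h c)
    rw [← A.symm_apply_apply a, h1, map_neg]
    rfl

theorem contDiffAt_sprayAccel [FiniteDimensional ℝ E] {P : Type*} [NormedAddCommGroup P]
    [NormedSpace ℝ P] {G : P → E →L[ℝ] E →L[ℝ] ℝ} {D : P → E →L[ℝ] E →L[ℝ] E →L[ℝ] ℝ} {w : P → E}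
    {x : P} (hG : ContDiffAt ℝ ∞ G x) (hD : ContDiffAt ℝ ∞ D x) (hw : ContDiffAt ℝ ∞ w x)
    (hinv : (G x).IsInvertible) :
    ContDiffAt ℝ ∞ (fun y => sprayAccel (G y) (D y) (w y)) x := by
  have : CompleteSpace E := FiniteDimensional.complete ℝ E
  obtain ⟨A, hA⟩ := hinv
  have h1 : ContDiffAt ℝ ∞ (fun y => (G y).inverse) x := by
    refine ContDiffAt.comp (g := ContinuousLinearMap.inverse) x ?_ hG
    rw [← hA]
    exact contDiffAt_map_inverse A
  have hflip : ContDiffAt ℝ ∞ (fun y => (D y).flip (w y)) x :=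
    (ContDiffAt.comp (g := ContinuousLinearMap.flipₗᵢ ℝ E E (E →L[ℝ] ℝ)) x
      (ContinuousLinearMap.flipₗᵢ ℝ E E (E →L[ℝ] ℝ)).contDiff.contDiffAt hD).clm_apply hw
  have hflip2 : ContDiffAt ℝ ∞ (fun y => ((D y).flip (w y)).flip (w y)) x :=
    (ContDiffAt.comp (g := ContinuousLinearMap.flipₗᵢ ℝ E E ℝ) x
      (ContinuousLinearMap.flipₗᵢ ℝ E E ℝ).contDiff.contDiffAt hflip).clm_apply hw
  have h2 : ContDiffAt ℝ ∞ (fun y => sprayCovector (D y) (w y)) x :=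
    ((hD.clm_apply hw).clm_apply hw).sub (hflip2.const_smul (1 / 2 : ℝ))
  exact (h1.clm_apply h2).neg

end Spray

section GeodesicField

variable {k : ℕ} {M : Type*} [TopologicalSpace M]
  [ChartedSpace (EuclideanSpace ℝ (Fin k)) M] [IsManifold (𝓡 k) ∞ M]

/-- The acceleration of geodesics in the chart at `m`, as a function of position and velocity. -/
def chartAccel (g : LorentzMetric k M) (m : M) (q : Coord k × Coord k) : Coord k :=
  sprayAccel (chartForm g m q.1) (fderiv ℝ (chartForm g m) q.1) q.2

theorem eq_chartAccel_iff (g : LorentzMetric k M) (m : M) {z : Coord k}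
    (hz : z ∈ (extChartAt (𝓡 k) m).target) (w a : Coord k) :
    a = chartAccel g m (z, w) ↔
      ∀ c, chartMetric g m z a c + christoffel g m z w w c = 0 := by
  rw [chartAccel, eq_sprayAccel_iff (chartForm_isInvertible g m hz)]
  refine forall_congr' fun c => ?_
  rw [christoffel_eq g m hz, sprayCovector_apply, chartForm_apply]
  constructor <;> intro h <;> linarith

theorem contDiffAt_chartAccel_family {gf : ℝ → LorentzMetric k M} {s : Set ℝ} (hs : IsOpen s)
    (hgf : SmoothFamilyOn gf s) (m : M) {τ : ℝ} (hτ : τ ∈ s) {q : Coord k × Coord k}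
    (hq : q.1 ∈ (extChartAt (𝓡 k) m).target) :
    ContDiffAt ℝ ∞ (fun y : ℝ × (Coord k × Coord k) => chartAccel (gf y.1) m y.2) (τ, q) := by
  have hG : ContDiffAt ℝ ∞ (fun q : ℝ × Coord k => chartForm (gf q.1) m q.2) (τ, q.1) :=
    (contDiffOn_chartForm_family hgf m).contDiffAt
      ((hs.prod (isOpen_chart_target m)).mem_nhds ⟨hτ, hq⟩)
  have hG1 : ContDiffAt ℝ ∞ (fun y : ℝ × (Coord k × Coord k) => chartForm (gf y.1) m y.2.1)
      (τ, q) :=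
    ContDiffAt.comp (g := fun q : ℝ × Coord k => chartForm (gf q.1) m q.2)
      (f := fun y : ℝ × (Coord k × Coord k) => (y.1, y.2.1)) (τ, q) hG
      (contDiffAt_fst.prodMk (contDiffAt_fst.comp _ contDiffAt_snd))
  have hD : ContDiffAt ℝ ∞
      (fun y : ℝ × (Coord k × Coord k) => fderiv ℝ (chartForm (gf y.1) m) y.2.1) (τ, q) := by
    refine ContDiffAt.fderiv (f := fun (y : ℝ × (Coord k × Coord k)) z => chartForm (gf y.1) m z)
      (g := fun y : ℝ × (Coord k × Coord k) => y.2.1) (n := ∞) ?_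
      (contDiffAt_fst.comp _ contDiffAt_snd) (by simp)
    exact ContDiffAt.comp (g := fun q : ℝ × Coord k => chartForm (gf q.1) m q.2)
      (f := fun y : (ℝ × (Coord k × Coord k)) × Coord k => (y.1.1, y.2)) ((τ, q), q.1) hG
      ((contDiffAt_fst.comp _ contDiffAt_fst).prodMk contDiffAt_snd)
  exact contDiffAt_sprayAccel hG1 hD (contDiffAt_snd.comp _ contDiffAt_snd)
    (chartForm_isInvertible (gf τ) m hq)

/-- A curve which solves the geodesic equation in one chart is a geodesic. -/
theorem isGeodesicOn_of_chart (g : LorentzMetric k M) (m : M) {c : ℝ → Coord k} {s : Set ℝ}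
    (hs : IsOpen s) (hc : ContDiffOn ℝ ∞ c s) (hcm : ∀ t ∈ s, c t ∈ (extChartAt (𝓡 k) m).target)
    (heq : ∀ t ∈ s, deriv (deriv c) t = chartAccel g m (c t, deriv c t)) :
    IsGeodesicOn g (fun t => (extChartAt (𝓡 k) m).symm (c t)) s := by
  have hsm : ContMDiffOn 𝓘(ℝ, ℝ) (𝓡 k) ∞ (fun t => (extChartAt (𝓡 k) m).symm (c t)) s :=
    (contMDiffOn_chart_symm m).comp hc.contMDiffOn hcm
  refine ⟨hsm, fun t ht p hp => ?_⟩
  have hsrc : (extChartAt (𝓡 k) m).symm (c t) ∈ (extChartAt (𝓡 k) m).source :=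
    (extChartAt (𝓡 k) m).map_target (hcm t ht)
  have hev : (fun r => extChartAt (𝓡 k) m ((extChartAt (𝓡 k) m).symm (c r))) =ᶠ[𝓝 t] c := by
    filter_upwards [hs.mem_nhds ht] with r hr
    exact (extChartAt (𝓡 k) m).right_inv (hcm r hr)
  have h1 := hev.deriv.deriv_eq
  have h2 := hev.deriv_eq
  have h3 := (extChartAt (𝓡 k) m).right_inv (hcm t ht)
  have h4 := (eq_chartAccel_iff g m (hcm t ht) _ _).1 (heq t ht)
  have h5 := geodesic_equation_chart_change (γ := fun t => (extChartAt (𝓡 k) m).symm (c t))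
    (p := m) (q := p) g (hsm.contMDiffAt (hs.mem_nhds ht)) hsrc hp
  exact h5 fun w => by rw [h1, h2, h3]; exact h4 w

theorem velocity_chart_symm {m : M} {c : ℝ → Coord k} {t : ℝ} (hc : DifferentiableAt ℝ c t)
    (hcm : ∀ᶠ r in 𝓝 t, c r ∈ (extChartAt (𝓡 k) m).target) :
    velocity k (fun t => (extChartAt (𝓡 k) m).symm (c t)) t = ofCoord m (c t, deriv c t) := by
  have hct := hcm.self_of_nhds
  have hsrc : (extChartAt (𝓡 k) m).symm (c t) ∈ (extChartAt (𝓡 k) m).source :=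
    (extChartAt (𝓡 k) m).map_target hct
  have hev : (fun r => extChartAt (𝓡 k) m ((extChartAt (𝓡 k) m).symm (c r))) =ᶠ[𝓝 t] c := by
    filter_upwards [hcm] with r hr
    exact (extChartAt (𝓡 k) m).right_inv hr
  have hd : MDifferentiableAt 𝓘(ℝ, ℝ) (𝓡 k) (fun t => (extChartAt (𝓡 k) m).symm (c t)) t :=
    MDifferentiableAt.comp t (mdifferentiableAt_chart_symm m hct) hc.mdifferentiableAt
  rw [velocity_eq_ofCoord hd hsrc, hev.deriv_eq, (extChartAt (𝓡 k) m).right_inv hct]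

/-- Local geodesic flow in a chart, smooth in time, in the parameter of the family of metrics and
in the initial position and velocity. -/
theorem exists_local_geodesic_flow {gf : ℝ → LorentzMetric k M} {s : Set ℝ} (hs : IsOpen s)
    (hgf : SmoothFamilyOn gf s) (m : M) {τ₀ : ℝ} (hτ₀ : τ₀ ∈ s) {q₀ : Coord k × Coord k}
    (hq₀ : q₀.1 ∈ (extChartAt (𝓡 k) m).target) :
    ∃ δ > 0, ∃ (O : Set (ℝ × (Coord k × Coord k))) (c : ℝ × (ℝ × (Coord k × Coord k)) → Coord k),
      IsOpen O ∧ (τ₀, q₀) ∈ O ∧ ContDiffOn ℝ ∞ c (Ioo (-δ) δ ×ˢ O) ∧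
      (∀ t ∈ Ioo (-δ) δ, ∀ y ∈ O, c (t, y) ∈ (extChartAt (𝓡 k) m).target) ∧
      ∀ y ∈ O, IsGeodesicOn (gf y.1) (fun t => (extChartAt (𝓡 k) m).symm (c (t, y))) (Ioo (-δ) δ) ∧
        velocity k (fun t => (extChartAt (𝓡 k) m).symm (c (t, y))) 0 = ofCoord m y.2 := by
  let X : ℝ × (Coord k × Coord k) → ℝ × (Coord k × Coord k) :=
    fun y => (0, (y.2.2, chartAccel (gf y.1) m y.2))
  have hΩ : IsOpen (s ×ˢ ((extChartAt (𝓡 k) m).target ×ˢ (univ : Set (Coord k)))) :=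
    hs.prod ((isOpen_chart_target m).prod isOpen_univ)
  have hX : ContDiffOn ℝ ∞ X (s ×ˢ ((extChartAt (𝓡 k) m).target ×ˢ (univ : Set (Coord k)))) := by
    rintro ⟨τ, q⟩ hy
    exact (contDiffAt_const.prodMk ((contDiffAt_snd.comp _ contDiffAt_snd).prodMk
      (contDiffAt_chartAccel_family hs hgf m hy.1 hy.2.1))).contDiffWithinAt
  obtain ⟨δ, hδ, O, Φ, hO, hmem, hΦ, hΦ0, hflow⟩ :=
    exists_smooth_flow hΩ hX (y₀ := (τ₀, q₀)) ⟨hτ₀, hq₀, mem_univ _⟩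
  refine ⟨δ, hδ, O, fun q => (Φ q).2.1, hO, hmem,
    contDiff_fst.comp_contDiffOn (contDiff_snd.comp_contDiffOn hΦ),
    fun t ht y hy => (hflow t ht y hy).1.2.1, fun y hy => ?_⟩
  have h1 : ∀ t ∈ Ioo (-δ) δ, HasDerivAt (fun t => (Φ (t, y)).1) 0 t := fun t ht =>
    ((hasFDerivAt_fst.comp_hasDerivAt t (hflow t ht y hy).2) :)
  have h2 : ∀ t ∈ Ioo (-δ) δ, HasDerivAt (fun t => (Φ (t, y)).2.1) (Φ (t, y)).2.2 t := fun t ht =>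
    (hasFDerivAt_fst.comp_hasDerivAt t (hasFDerivAt_snd.comp_hasDerivAt t (hflow t ht y hy).2) :)
  have h3 : ∀ t ∈ Ioo (-δ) δ, HasDerivAt (fun t => (Φ (t, y)).2.2)
      (chartAccel (gf (Φ (t, y)).1) m (Φ (t, y)).2) t := fun t ht =>
    (hasFDerivAt_snd.comp_hasDerivAt t (hasFDerivAt_snd.comp_hasDerivAt t (hflow t ht y hy).2) :)
  have h0 : (0 : ℝ) ∈ Ioo (-δ) δ := ⟨by linarith, hδ⟩
  have hconst : ∀ t ∈ Ioo (-δ) δ, (Φ (t, y)).1 = y.1 := by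
    intro t ht
    have := isOpen_Ioo.is_const_of_deriv_eq_zero isPreconnected_Ioo
      (fun r hr => (h1 r hr).differentiableAt.differentiableWithinAt)
      (fun r hr => (h1 r hr).deriv) ht h0
    rw [this, hΦ0 y hy]
  have hd : ∀ t ∈ Ioo (-δ) δ, deriv (fun t => (Φ (t, y)).2.1) =ᶠ[𝓝 t] fun t => (Φ (t, y)).2.2 := by
    intro t ht
    filter_upwards [isOpen_Ioo.mem_nhds ht] with r hr using (h2 r hr).deriv
  have hcs : ContDiffOn ℝ ∞ (fun t => (Φ (t, y)).2.1) (Ioo (-δ) δ) :=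
    ContDiffOn.comp (g := fun q => (Φ q).2.1) (f := fun t => (t, y))
      (contDiff_fst.comp_contDiffOn (contDiff_snd.comp_contDiffOn hΦ))
      (contDiff_id.prodMk contDiff_const).contDiffOn fun t ht => ⟨ht, hy⟩
  refine ⟨isGeodesicOn_of_chart (gf y.1) m isOpen_Ioo hcs
    (fun t ht => (hflow t ht y hy).1.2.1) fun t ht => ?_, ?_⟩
  · rw [(hd t ht).deriv_eq, (h3 t ht).deriv, (hd t ht).self_of_nhds, hconst t ht]
  · rw [velocity_chart_symm (h2 0 h0).differentiableAt, (h2 0 h0).deriv, hΦ0 y hy]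
    filter_upwards [isOpen_Ioo.mem_nhds h0] with r hr using (hflow r hr y hy).1.2.1

end GeodesicField

/-! ### Uniqueness and reparametrization of geodesics -/

section Geodesics

variable {k : ℕ} {M : Type*} [TopologicalSpace M]
  [ChartedSpace (EuclideanSpace ℝ (Fin k)) M] [IsManifold (𝓡 k) ∞ M]
  {g : LorentzMetric k M} {γ γ₁ γ₂ : ℝ → M} {s u : Set ℝ} {t : ℝ}

theorem IsGeodesicOn.contMDiffAt (h : IsGeodesicOn g γ s) (hs : IsOpen s) (ht : t ∈ s) :
    ContMDiffAt 𝓘(ℝ, ℝ) (𝓡 k) ∞ γ t :=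
  h.1.contMDiffAt (hs.mem_nhds ht)

theorem IsGeodesicOn.mdifferentiableAt (h : IsGeodesicOn g γ s) (hs : IsOpen s) (ht : t ∈ s) :
    MDifferentiableAt 𝓘(ℝ, ℝ) (𝓡 k) γ t :=
  (h.contMDiffAt hs ht).mdifferentiableAt (by simp)

theorem IsGeodesicOn.mono (h : IsGeodesicOn g γ s) (hu : u ⊆ s) : IsGeodesicOn g γ u :=
  ⟨h.1.mono hu, fun t ht => h.2 t (hu ht)⟩

theorem isGeodesicOn_of_locally (hs : ∀ t ∈ s, ∃ u, IsOpen u ∧ t ∈ u ∧ IsGeodesicOn g γ u) :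
    IsGeodesicOn g γ s := by
  refine ⟨fun t ht => ?_, fun t ht => ?_⟩
  · obtain ⟨u, hu, htu, h⟩ := hs t ht
    exact (h.contMDiffAt hu htu).contMDiffWithinAt
  · obtain ⟨u, hu, htu, h⟩ := hs t ht
    exact h.2 t htu

theorem IsGeodesicOn.congr (h : IsGeodesicOn g γ₁ s) (hs : IsOpen s) (heq : EqOn γ₂ γ₁ s) :
    IsGeodesicOn g γ₂ s := by
  refine ⟨h.1.congr heq, fun t ht p hp w => ?_⟩
  have hev : (fun r => extChartAt (𝓡 k) p (γ₂ r)) =ᶠ[𝓝 t] fun r => extChartAt (𝓡 k) p (γ₁ r) := by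
    filter_upwards [hs.mem_nhds ht] with r hr
    rw [heq hr]
  have h1 := hev.deriv.deriv_eq
  have h2 := hev.deriv_eq
  rw [h1, h2, heq ht]
  exact h.2 t ht p (heq ht ▸ hp) w

theorem velocity_congr (h : γ₁ =ᶠ[𝓝 t] γ₂) : velocity k γ₁ t = velocity k γ₂ t := by
  refine TotalSpace.ext h.eq_of_nhds (heq_of_eq ?_)
  exact congrArg (fun L : ℝ →L[ℝ] Coord k => L 1)
    (h.mfderiv_eq (I := 𝓘(ℝ, ℝ)) (I' := 𝓡 k))

theorem christoffel_smul (g : LorentzMetric k M) (m : M) {z : Coord k}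
    (hz : z ∈ (extChartAt (𝓡 k) m).target) (r : ℝ) (a w : Coord k) :
    christoffel g m z (r • a) (r • a) w = r * (r * christoffel g m z a a w) := by
  rw [christoffel_eq g m hz, christoffel_eq g m hz]
  simp only [map_smul, smul_apply, smul_eq_mul]
  ring

/-- Affine reparametrizations of geodesics are geodesics. -/
theorem IsGeodesicOn.comp_affine (h : IsGeodesicOn g γ s) (r a : ℝ) :
    IsGeodesicOn g (fun t => γ (r * t + a)) ((fun t => r * t + a) ⁻¹' s) := by
  have haff : ContDiff ℝ ∞ fun t : ℝ => r * t + a := by fun_prop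
  refine ⟨h.1.comp haff.contMDiff.contMDiffOn fun t ht => ht, fun t ht p hp w => ?_⟩
  set c : ℝ → Coord k := fun t => extChartAt (𝓡 k) p (γ t) with hc
  have hd (f : ℝ → Coord k) : deriv (fun t => f (r * t + a)) = fun t => r • deriv f (r * t + a) := by
    funext t
    rw [deriv_comp_mul_left r (fun y => f (y + a)) t, deriv_comp_add_const]
  have h1 : deriv (fun t => extChartAt (𝓡 k) p (γ (r * t + a))) =
      fun t => r • deriv c (r * t + a) := hd c
  have h2 : deriv (deriv fun t => extChartAt (𝓡 k) p (γ (r * t + a))) t =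
      r • r • deriv (deriv c) (r * t + a) := by
    rw [h1, deriv_fun_const_smul_field, hd (deriv c)]
  have h3 := h.2 (r * t + a) ht p hp w
  rw [h2, h1, christoffel_smul g p ((extChartAt (𝓡 k) p).map_source hp), ← chartForm_apply,
    map_smul, map_smul, smul_apply, smul_apply, smul_eq_mul, smul_eq_mul, ← mul_add, ← mul_add]
  rw [← chartForm_apply] at h3
  rw [h3, mul_zero, mul_zero]

theorem velocity_comp_affine {r a : ℝ}
    (h : MDifferentiableAt 𝓘(ℝ, ℝ) (𝓡 k) γ (r * t + a)) :
    velocity k (fun t => γ (r * t + a)) t =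
      ⟨γ (r * t + a), r • (velocity k γ (r * t + a)).2⟩ := by
  have haff : HasDerivAt (fun t : ℝ => r * t + a) r t := by
    simpa using ((hasDerivAt_id t).const_mul r).add_const a
  have h1 := mfderiv_comp (I := 𝓘(ℝ, ℝ)) (I' := 𝓘(ℝ, ℝ)) t h haff.differentiableAt.mdifferentiableAt
  refine TotalSpace.ext rfl (heq_of_eq ?_)
  have h2 := congrArg (fun L : ℝ →L[ℝ] Coord k => L 1) h1
  refine h2.trans ?_
  have h3 : mfderiv 𝓘(ℝ, ℝ) 𝓘(ℝ, ℝ) (fun t : ℝ => r * t + a) t (1 : ℝ) = r • (1 : ℝ) := by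
    rw [mfderiv_eq_fderiv, haff.hasFDerivAt.fderiv]
    exact mul_comm (1 : ℝ) r
  change mfderiv 𝓘(ℝ, ℝ) (𝓡 k) γ (r * t + a)
    (mfderiv 𝓘(ℝ, ℝ) 𝓘(ℝ, ℝ) (fun t : ℝ => r * t + a) t (1 : ℝ)) = _
  rw [h3]
  exact (mfderiv 𝓘(ℝ, ℝ) (𝓡 k) γ (r * t + a)).map_smul r (1 : ℝ)

/-- In a chart, a geodesic solves an autonomous first order equation for position and velocity. -/
theorem IsGeodesicOn.hasDerivAt_chart (h : IsGeodesicOn g γ s) (hs : IsOpen s) (ht : t ∈ s) {m : M}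
    (hm : γ t ∈ (extChartAt (𝓡 k) m).source) :
    HasDerivAt (fun r => extChartAt (𝓡 k) m (γ r)) (deriv (fun r => extChartAt (𝓡 k) m (γ r)) t) t ∧
    HasDerivAt (deriv fun r => extChartAt (𝓡 k) m (γ r)) (chartAccel g m
      (extChartAt (𝓡 k) m (γ t), deriv (fun r => extChartAt (𝓡 k) m (γ r)) t)) t := by
  have hc := contDiffAt_chart_comp (h.contMDiffAt hs ht) hm
  have h1 : ContDiffAt ℝ 1 (deriv fun r => extChartAt (𝓡 k) m (γ r)) t := by
    have h2 := (hc.fderiv_right (m := 1) (WithTop.coe_le_coe.2 le_top)).clm_apply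
      (contDiffAt_const (c := (1 : ℝ)))
    simpa only [fderiv_apply_one_eq_deriv] using h2
  refine ⟨(hc.differentiableAt (by simp)).hasDerivAt, ?_⟩
  have h3 := (eq_chartAccel_iff g m ((extChartAt (𝓡 k) m).map_source hm) _ _).2 (h.2 t ht m hm)
  rw [← h3]
  exact (h1.differentiableAt (by simp)).hasDerivAt

/-- Local uniqueness of geodesics: in a chart they are determined by the autonomous first order
equation for position and velocity. -/
theorem IsGeodesicOn.eventuallyEq (h₁ : IsGeodesicOn g γ₁ s) (h₂ : IsGeodesicOn g γ₂ s)
    (hs : IsOpen s) (ht : t ∈ s) (hv : velocity k γ₁ t = velocity k γ₂ t) :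
    γ₁ =ᶠ[𝓝 t] γ₂ := by
  set m := γ₁ t with hm
  have hm1 : γ₁ t ∈ (extChartAt (𝓡 k) m).source := mem_extChartAt_source _
  have hbase : γ₁ t = γ₂ t := congrArg TotalSpace.proj hv
  have hm2 : γ₂ t ∈ (extChartAt (𝓡 k) m).source := hbase ▸ hm1
  have hco := congrArg (toCoord m) hv
  rw [toCoord_velocity (h₁.mdifferentiableAt hs ht) hm1,
    toCoord_velocity (h₂.mdifferentiableAt hs ht) hm2] at hco
  let v : Coord k × Coord k → Coord k × Coord k := fun q => (q.2, chartAccel g m q)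
  let f (γ : ℝ → M) (r : ℝ) : Coord k × Coord k :=
    (extChartAt (𝓡 k) m (γ r), deriv (fun r => extChartAt (𝓡 k) m (γ r)) r)
  have hsrc (γ : ℝ → M) (h : IsGeodesicOn g γ s) (hγ : γ t ∈ (extChartAt (𝓡 k) m).source) :
      ∀ᶠ r in 𝓝 t, γ r ∈ (extChartAt (𝓡 k) m).source :=
    (h.contMDiffAt hs ht).continuousAt.preimage_mem_nhds ((isOpen_extChartAt_source m).mem_nhds hγ)
  have hf (γ : ℝ → M) (h : IsGeodesicOn g γ s) (hγ : γ t ∈ (extChartAt (𝓡 k) m).source) :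
      ∀ᶠ r in 𝓝 t, HasDerivAt (f γ) (v (f γ r)) r := by
    filter_upwards [hsrc γ h hγ, hs.mem_nhds ht] with r hr hrs
    exact (h.hasDerivAt_chart hs hrs hr).1.prodMk (h.hasDerivAt_chart hs hrs hr).2
  have hvc : ContDiffAt ℝ 1 v (f γ₁ t) := by
    have h1 := contDiffAt_chartAccel_family isOpen_univ (smoothFamilyOn_const g univ) m
      (mem_univ (0 : ℝ)) (q := f γ₁ t) ((extChartAt (𝓡 k) m).map_source hm1)
    have h2 : ContDiffAt ℝ ∞ (chartAccel g m) (f γ₁ t) :=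
      ContDiffAt.comp (g := fun y : ℝ × (Coord k × Coord k) => chartAccel g m y.2)
        (f := fun q => ((0 : ℝ), q)) (f γ₁ t) h1 (contDiffAt_const.prodMk contDiffAt_id)
    exact contDiffAt_snd.prodMk (h2.of_le (by simp))
  obtain ⟨K, O, hO, hK⟩ := hvc.exists_lipschitzOnWith
  have hmemO (γ : ℝ → M) (h : IsGeodesicOn g γ s) (hγ : γ t ∈ (extChartAt (𝓡 k) m).source)
      (hft : f γ t = f γ₁ t) : ∀ᶠ r in 𝓝 t, f γ r ∈ O :=
    (hf γ h hγ).self_of_nhds.continuousAt.preimage_mem_nhds (by rwa [hft])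
  have huniq : f γ₁ =ᶠ[𝓝 t] f γ₂ :=
    ODE_solution_unique_of_eventually (v := fun _ => v) (s := fun _ => O)
      (Eventually.of_forall fun _ => hK) ((hf γ₁ h₁ hm1).and (hmemO γ₁ h₁ hm1 rfl))
      ((hf γ₂ h₂ hm2).and (hmemO γ₂ h₂ hm2 hco.symm)) hco
  filter_upwards [huniq, hsrc γ₁ h₁ hm1, hsrc γ₂ h₂ hm2] with r hr hr1 hr2
  have hr' : extChartAt (𝓡 k) m (γ₁ r) = extChartAt (𝓡 k) m (γ₂ r) := congrArg Prod.fst hr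
  rw [← (extChartAt (𝓡 k) m).left_inv hr1, hr', (extChartAt (𝓡 k) m).left_inv hr2]

/-- Uniqueness of geodesics with given initial velocity: the set of times at which the velocities
agree is open by local uniqueness and closed by continuity. -/
theorem IsGeodesicOn.eqOn [T2Space M] (h₁ : IsGeodesicOn g γ₁ s) (h₂ : IsGeodesicOn g γ₂ s)
    (hs : IsOpen s) (hconn : IsPreconnected s) (ht : t ∈ s)
    (hv : velocity k γ₁ t = velocity k γ₂ t) : EqOn γ₁ γ₂ s := by
  have hopen : IsOpen {r | r ∈ s ∧ velocity k γ₁ r = velocity k γ₂ r} := by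
    rw [isOpen_iff_mem_nhds]
    rintro r ⟨hr, hvr⟩
    filter_upwards [hs.mem_nhds hr, (h₁.eventuallyEq h₂ hs hr hvr).eventuallyEq_nhds] with r' h1 h2
    exact ⟨h1, velocity_congr h2⟩
  -- closedness, by passing to the limit in a chart at the limit point
  have hsub := hconn.subset_of_closure_inter_subset hopen ⟨t, ht, ht, hv⟩ ?_
  · exact fun r hr => congrArg TotalSpace.proj (hsub hr).2
  rintro r ⟨hrc, hr⟩
  refine ⟨hr, ?_⟩
  rw [mem_closure_iff_frequently] at hrc
  have hbase : γ₁ r = γ₂ r := by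
    refine tendsto_nhds_unique_of_frequently_eq
      (h₁.contMDiffAt hs hr).continuousAt (h₂.contMDiffAt hs hr).continuousAt ?_
    exact hrc.mono fun r' h => congrArg TotalSpace.proj h.2
  set m := γ₁ r with hm
  have hm1 : γ₁ r ∈ (extChartAt (𝓡 k) m).source := mem_extChartAt_source _
  have hm2 : γ₂ r ∈ (extChartAt (𝓡 k) m).source := by rw [← hbase]; exact hm1
  have hderiv : deriv (fun r => extChartAt (𝓡 k) m (γ₁ r)) r =
      deriv (fun r => extChartAt (𝓡 k) m (γ₂ r)) r := by
    refine tendsto_nhds_unique_of_frequently_eq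
      (h₁.hasDerivAt_chart hs hr hm1).2.continuousAt (h₂.hasDerivAt_chart hs hr hm2).2.continuousAt ?_
    have hsrc1 := (h₁.contMDiffAt hs hr).continuousAt.preimage_mem_nhds
      ((isOpen_extChartAt_source m).mem_nhds hm1)
    have hsrc2 := (h₂.contMDiffAt hs hr).continuousAt.preimage_mem_nhds
      ((isOpen_extChartAt_source m).mem_nhds hm2)
    refine (hrc.and_eventually (Filter.Eventually.and hsrc1 hsrc2)).mono fun r' h => ?_
    have hco := congrArg (toCoord m) h.1.2
    rw [toCoord_velocity (h₁.mdifferentiableAt hs h.1.1) h.2.1,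
      toCoord_velocity (h₂.mdifferentiableAt hs h.1.1) h.2.2] at hco
    exact congrArg Prod.snd hco
  rw [velocity_eq_ofCoord (h₁.mdifferentiableAt hs hr) hm1,
    velocity_eq_ofCoord (h₂.mdifferentiableAt hs hr) hm2, hderiv]
  rw [← hbase]

end Geodesics

/-! ### Smooth families of geodesics -/

section Family

variable {k : ℕ} {M : Type*} [TopologicalSpace M]
  [ChartedSpace (EuclideanSpace ℝ (Fin k)) M] [IsManifold (𝓡 k) ∞ M]
  {P : Type*} [NormedAddCommGroup P] [NormedSpace ℝ P]
  {gf : ℝ → LorentzMetric k M} {τ : P → ℝ} {Γ : ℝ × P → M} {J : Set ℝ} {B : Set P}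

/-- `t ↦ Γ (t, b)`, `t ∈ J`, is a geodesic of the metric `gf (τ b)`, depending smoothly on
`(t, b) ∈ J × B`. -/
def IsGeodesicFamily (gf : ℝ → LorentzMetric k M) (τ : P → ℝ) (Γ : ℝ × P → M) (J : Set ℝ)
    (B : Set P) : Prop :=
  ContMDiffOn 𝓘(ℝ, ℝ × P) (𝓡 k) ∞ Γ (J ×ˢ B) ∧
    ∀ b ∈ B, IsGeodesicOn (gf (τ b)) (fun t => Γ (t, b)) J

theorem IsGeodesicFamily.mono {J' : Set ℝ} {B' : Set P} (h : IsGeodesicFamily gf τ Γ J B)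
    (hJ : J' ⊆ J) (hB : B' ⊆ B) : IsGeodesicFamily gf τ Γ J' B' :=
  ⟨h.1.mono (prod_mono hJ hB), fun b hb => (h.2 b (hB hb)).mono hJ⟩

theorem isOpen_chart_preimage (hΓ : ContMDiffOn 𝓘(ℝ, ℝ × P) (𝓡 k) ∞ Γ (J ×ˢ B))
    (hJ : IsOpen J) (hB : IsOpen B) (m : M) :
    IsOpen ((J ×ˢ B) ∩ Γ ⁻¹' (extChartAt (𝓡 k) m).source) :=
  hΓ.continuousOn.isOpen_inter_preimage (hJ.prod hB) (isOpen_extChartAt_source m)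

theorem contDiffOn_chart_family (hΓ : ContMDiffOn 𝓘(ℝ, ℝ × P) (𝓡 k) ∞ Γ (J ×ˢ B)) (m : M) :
    ContDiffOn ℝ ∞ (fun x => extChartAt (𝓡 k) m (Γ x))
      ((J ×ˢ B) ∩ Γ ⁻¹' (extChartAt (𝓡 k) m).source) := by
  rw [← contMDiffOn_iff_contDiffOn]
  exact (contMDiffOn_chart m).comp (hΓ.mono inter_subset_left) fun x hx => hx.2

/-- The position and velocity of a family of curves in the chart at `m`. -/
def familyCoord (m : M) (Γ : ℝ × P → M) (x : ℝ × P) : Coord k × Coord k :=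
  (extChartAt (𝓡 k) m (Γ x), fderiv ℝ (fun x => extChartAt (𝓡 k) m (Γ x)) x (1, 0))

theorem contDiffOn_familyCoord (hΓ : ContMDiffOn 𝓘(ℝ, ℝ × P) (𝓡 k) ∞ Γ (J ×ˢ B))
    (hJ : IsOpen J) (hB : IsOpen B) (m : M) :
    ContDiffOn ℝ ∞ (familyCoord (k := k) m Γ) ((J ×ˢ B) ∩ Γ ⁻¹' (extChartAt (𝓡 k) m).source) := by
  have h := contDiffOn_chart_family hΓ m
  exact h.prodMk ((h.fderiv_of_isOpen (isOpen_chart_preimage hΓ hJ hB m) (m := ∞)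
    (by simp)).clm_apply contDiffOn_const)

theorem mdifferentiableAt_family (hΓ : ContMDiffOn 𝓘(ℝ, ℝ × P) (𝓡 k) ∞ Γ (J ×ˢ B))
    (hJ : IsOpen J) (hB : IsOpen B) {t : ℝ} {b : P} (ht : t ∈ J) (hb : b ∈ B) :
    MDifferentiableAt 𝓘(ℝ, ℝ) (𝓡 k) (fun t => Γ (t, b)) t := by
  have h1 : MDifferentiableAt 𝓘(ℝ, ℝ × P) (𝓡 k) Γ (t, b) :=
    (hΓ.contMDiffAt ((hJ.prod hB).mem_nhds ⟨ht, hb⟩)).mdifferentiableAt (by simp)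
  have h2 : DifferentiableAt ℝ (fun t : ℝ => (t, b)) t := by fun_prop
  exact MDifferentiableAt.comp t h1 h2.mdifferentiableAt

theorem velocity_family (hΓ : ContMDiffOn 𝓘(ℝ, ℝ × P) (𝓡 k) ∞ Γ (J ×ˢ B))
    (hJ : IsOpen J) (hB : IsOpen B) {m : M} {t : ℝ} {b : P} (ht : t ∈ J) (hb : b ∈ B)
    (hm : Γ (t, b) ∈ (extChartAt (𝓡 k) m).source) :
    velocity k (fun t => Γ (t, b)) t = ofCoord m (familyCoord m Γ (t, b)) := by
  rw [velocity_eq_ofCoord (m := m) (mdifferentiableAt_family hΓ hJ hB ht hb) hm]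
  have h1 : DifferentiableAt ℝ (fun x => extChartAt (𝓡 k) m (Γ x)) (t, b) :=
    ((contDiffOn_chart_family hΓ m).contDiffAt
      ((isOpen_chart_preimage hΓ hJ hB m).mem_nhds ⟨⟨ht, hb⟩, hm⟩)).differentiableAt (by simp)
  have h2 : HasDerivAt (fun t : ℝ => (t, b)) ((1 : ℝ), (0 : P)) t :=
    (hasDerivAt_id t).prodMk (hasDerivAt_const t b)
  have h3 := HasFDerivAt.comp_hasDerivAt (l := fun x => extChartAt (𝓡 k) m (Γ x)) t
    h1.hasFDerivAt h2
  change _ = ofCoord m (_, _)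
  exact congrArg (fun v => ofCoord m (extChartAt (𝓡 k) m (Γ (t, b)), v)) h3.deriv

/-- Two families of curves which agree where they are both defined can be glued. -/
theorem IsGeodesicFamily.glue {Γ₁ Γ₂ : ℝ × P → M} {a c t₁ t₂ : ℝ}
    (h₁ : IsGeodesicFamily gf τ Γ₁ (Ioo a t₂) B) {d : ℝ}
    (h₂ : IsGeodesicFamily gf τ Γ₂ (Ioo c d) B) (hB : IsOpen B) (hc : c < t₁) (ht : t₁ < t₂)
    (heq : ∀ b ∈ B, EqOn (fun t => Γ₁ (t, b)) (fun t => Γ₂ (t, b)) (Ioo a t₂ ∩ Ioo c d)) :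
    IsGeodesicFamily gf τ (fun x => if x.1 < t₁ then Γ₁ x else Γ₂ x) (Ioo a d) B := by
  have e₁ : ∀ t ∈ Ioo a d, ∀ b ∈ B, t < t₂ →
      (if t < t₁ then Γ₁ (t, b) else Γ₂ (t, b)) = Γ₁ (t, b) := by
    intro t htt b hb h
    split_ifs with h'
    · rfl
    · exact (heq b hb ⟨⟨htt.1, h⟩, by linarith, htt.2⟩).symm
  have e₂ : ∀ t ∈ Ioo a d, ∀ b ∈ B, c < t →
      (if t < t₁ then Γ₁ (t, b) else Γ₂ (t, b)) = Γ₂ (t, b) := by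
    intro t htt b hb h
    split_ifs with h'
    · exact heq b hb ⟨⟨htt.1, by linarith⟩, h, htt.2⟩
    · rfl
  refine ⟨?_, fun b hb => isGeodesicOn_of_locally fun t htt => ?_⟩
  · rintro ⟨t, b⟩ ⟨htt, hb⟩
    rcases lt_or_ge t t₂ with h | h
    · have hn : (Ioo a d ∩ Iio t₂) ×ˢ B ∈ 𝓝 (t, b) :=
        ((isOpen_Ioo.inter isOpen_Iio).prod hB).mem_nhds ⟨⟨htt, h⟩, hb⟩
      have h3 := h₁.1.contMDiffAt ((isOpen_Ioo.prod hB).mem_nhds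
        (show (t, b) ∈ Ioo a t₂ ×ˢ B from ⟨⟨htt.1, h⟩, hb⟩))
      refine (h3.congr_of_eventuallyEq ?_).contMDiffWithinAt
      filter_upwards [hn] with x hx using e₁ x.1 hx.1.1 x.2 hx.2 hx.1.2
    · have h' : c < t := by linarith
      have hn : (Ioo a d ∩ Ioi c) ×ˢ B ∈ 𝓝 (t, b) :=
        ((isOpen_Ioo.inter isOpen_Ioi).prod hB).mem_nhds ⟨⟨htt, h'⟩, hb⟩
      have h3 := h₂.1.contMDiffAt ((isOpen_Ioo.prod hB).mem_nhds
        (show (t, b) ∈ Ioo c d ×ˢ B from ⟨⟨h', htt.2⟩, hb⟩))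
      refine (h3.congr_of_eventuallyEq ?_).contMDiffWithinAt
      filter_upwards [hn] with x hx using e₂ x.1 hx.1.1 x.2 hx.2 hx.1.2
  · rcases lt_or_ge t t₂ with h | h
    · have ho : IsOpen (Ioo a d ∩ Iio t₂) := isOpen_Ioo.inter isOpen_Iio
      refine ⟨_, ho, ⟨htt, h⟩, ((h₁.2 b hb).mono fun r hr => ⟨hr.1.1, hr.2⟩).congr ho
        fun r hr => e₁ r hr.1 b hb hr.2⟩
    · have ho : IsOpen (Ioo a d ∩ Ioi c) := isOpen_Ioo.inter isOpen_Ioi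
      refine ⟨_, ho, ⟨htt, show c < t by linarith⟩, ((h₂.2 b hb).mono fun r hr =>
        ⟨hr.2, hr.1.2⟩).congr ho fun r hr => e₂ r hr.1 b hb hr.2⟩

/-- The local geodesic flow, applied to initial data depending on a parameter. -/
theorem exists_local_geodesic_family {s : Set ℝ} (hs : IsOpen s)
    (hgf : SmoothFamilyOn gf s) (m : M) {τ₀ : ℝ} (hτ₀ : τ₀ ∈ s) {q₀ : Coord k × Coord k}
    (hq₀ : q₀.1 ∈ (extChartAt (𝓡 k) m).target) :
    ∃ δ > 0, ∃ O : Set (ℝ × (Coord k × Coord k)), IsOpen O ∧ (τ₀, q₀) ∈ O ∧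
      ∀ (τ : P → ℝ) (q : P → Coord k × Coord k) (B : Set P) (t₁ : ℝ), ContDiffOn ℝ ∞ τ B →
        ContDiffOn ℝ ∞ q B → (∀ b ∈ B, (τ b, q b) ∈ O) →
        ∃ Γ : ℝ × P → M, IsGeodesicFamily gf τ Γ (Ioo (t₁ - δ) (t₁ + δ)) B ∧
          ∀ b ∈ B, velocity k (fun t => Γ (t, b)) t₁ = ofCoord m (q b) := by
  obtain ⟨δ, hδ, O, c, hO, hmem, hc, htar, hgeo⟩ := exists_local_geodesic_flow hs hgf m hτ₀ hq₀
  refine ⟨δ, hδ, O, hO, hmem, fun τ q B t₁ hτ hq hBO => ?_⟩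
  have hpre : (fun t : ℝ => 1 * t + -t₁) ⁻¹' Ioo (-δ) δ = Ioo (t₁ - δ) (t₁ + δ) := by
    ext t
    simp only [mem_preimage, mem_Ioo]
    constructor <;> rintro ⟨h1, h2⟩ <;> constructor <;> linarith
  refine ⟨fun x => (extChartAt (𝓡 k) m).symm (c (1 * x.1 + -t₁, (τ x.2, q x.2))),
    ⟨?_, fun b hb => ?_⟩, fun b hb => ?_⟩
  · refine (contMDiffOn_chart_symm m).comp (t := (extChartAt (𝓡 k) m).target)
      (f := fun x : ℝ × P => c (1 * x.1 + -t₁, (τ x.2, q x.2))) (ContDiffOn.contMDiffOn ?_) ?_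
    · refine hc.comp (t := Ioo (-δ) δ ×ˢ O)
        (f := fun x : ℝ × P => (1 * x.1 + -t₁, (τ x.2, q x.2))) ?_ ?_
      · refine ContDiffOn.prodMk (ContDiff.contDiffOn (by fun_prop)) (ContDiffOn.prodMk ?_ ?_)
        · exact hτ.comp contDiff_snd.contDiffOn fun x hx => hx.2
        · exact hq.comp contDiff_snd.contDiffOn fun x hx => hx.2
      · rintro x ⟨hx, hb⟩
        exact ⟨hpre.ge hx, hBO _ hb⟩
    · rintro x ⟨hx, hb⟩
      exact htar _ (hpre.ge hx) _ (hBO _ hb)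
  · have := (hgeo _ (hBO b hb)).1.comp_affine 1 (-t₁)
    rwa [hpre] at this
  · have h0 : (1 : ℝ) * t₁ + -t₁ = 0 := by ring
    have h1 := (hgeo _ (hBO b hb)).1.mdifferentiableAt isOpen_Ioo
      (t := 1 * t₁ + -t₁) (by rw [h0]; exact ⟨by linarith, hδ⟩)
    have h2 := velocity_comp_affine h1
    rw [h0, one_smul] at h2
    exact h2.trans (hgeo _ (hBO b hb)).2

/-- Geodesics depend smoothly on the metric and on the initial velocity, on every compact time
interval on which one of them exists. -/
theorem exists_geodesic_family [T2Space M] {s : Set ℝ} (hs : IsOpen s)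
    (hgf : SmoothFamilyOn gf s) (m : M) {q : P → Coord k × Coord k} {B₀ : Set P}
    (hB₀ : IsOpen B₀) {b₀ : P} (hb₀ : b₀ ∈ B₀) (hτ : ContDiffOn ℝ ∞ τ B₀)
    (hq : ContDiffOn ℝ ∞ q B₀) (hτ₀ : τ b₀ ∈ s) (hq₀ : (q b₀).1 ∈ (extChartAt (𝓡 k) m).target)
    {γ₀ : ℝ → M} {T : ℝ} (hγ₀ : IsGeodesicSegment (gf (τ b₀)) γ₀ T)
    (hv : velocity k γ₀ 0 = ofCoord m (q b₀)) :
    ∃ η > 0, ∃ B ⊆ B₀, IsOpen B ∧ b₀ ∈ B ∧ ∃ Γ : ℝ × P → M,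
      IsGeodesicFamily gf τ Γ (Ioo (-η) (T + η)) B ∧
      ∀ b ∈ B, velocity k (fun t => Γ (t, b)) 0 = ofCoord m (q b) := by
  obtain ⟨ε, hε, hγ₀⟩ := hγ₀
  -- `S` is the set of times which a smooth family reaches
  let S : Set ℝ := {T' | 0 < T' ∧ ∃ η > 0, ∃ B ⊆ B₀, IsOpen B ∧ b₀ ∈ B ∧ ∃ Γ : ℝ × P → M,
      IsGeodesicFamily gf τ Γ (Ioo (-η) T') B ∧
      ∀ b ∈ B, velocity k (fun t => Γ (t, b)) 0 = ofCoord m (q b)}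
  suffices h : ∃ T' ∈ S, T < T' by
    obtain ⟨T', ⟨-, η, hη, B, hBB, hB, hb, Γ, hΓ, hΓv⟩, hT'⟩ := h
    refine ⟨min η (T' - T), lt_min hη (by linarith), B, hBB, hB, hb, Γ, hΓ.mono ?_ Subset.rfl, hΓv⟩
    exact Ioo_subset_Ioo (by linarith [min_le_left η (T' - T)])
      (by linarith [min_le_right η (T' - T)])
  by_contra! hcon
  -- the family exists for short times
  have hne : S.Nonempty := by
    obtain ⟨δ, hδ, O, hO, hmem, hloc⟩ := exists_local_geodesic_family (P := P) hs hgf m hτ₀ hq₀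
    have hop : IsOpen (B₀ ∩ (fun b => (τ b, q b)) ⁻¹' O) :=
      (hτ.continuousOn.prodMk hq.continuousOn).isOpen_inter_preimage hB₀ hO
    obtain ⟨Γ, hΓ, hΓv⟩ := hloc τ q _ 0 (hτ.mono inter_subset_left) (hq.mono inter_subset_left)
      fun b hb => hb.2
    rw [zero_sub, zero_add] at hΓ
    exact ⟨δ, hδ, δ, hδ, _, inter_subset_left, hop, ⟨hb₀, hmem⟩, Γ, hΓ, hΓv⟩
  have hbdd : BddAbove S := ⟨T, hcon⟩
  set t' := sSup S with ht'
  have ht'0 : 0 < t' := hne.some_mem.1.trans_le (le_csSup hbdd hne.some_mem)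
  have ht'T : t' ≤ T := csSup_le hne hcon
  have ht'mem : t' ∈ Ioo (-ε) (T + ε) := ⟨by linarith, by linarith⟩
  set m' := γ₀ t' with hm'
  have hm'src : γ₀ t' ∈ (extChartAt (𝓡 k) m').source := mem_extChartAt_source _
  let f : ℝ → Coord k × Coord k := fun r =>
    (extChartAt (𝓡 k) m' (γ₀ r), deriv (fun r => extChartAt (𝓡 k) m' (γ₀ r)) r)
  obtain ⟨δ, hδ, O, hO, hmem, hloc⟩ := exists_local_geodesic_family (P := P) hs hgf m' hτ₀
    (q₀ := f t') ((extChartAt (𝓡 k) m').map_source hm'src)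
  have hfc : ContinuousAt f t' :=
    (hγ₀.hasDerivAt_chart isOpen_Ioo ht'mem hm'src).1.continuousAt.prodMk
      (hγ₀.hasDerivAt_chart isOpen_Ioo ht'mem hm'src).2.continuousAt
  have hev : ∀ᶠ r in 𝓝 t', (τ b₀, f r) ∈ O ∧ γ₀ r ∈ (extChartAt (𝓡 k) m').source :=
    Filter.Eventually.and ((continuousAt_const.prodMk hfc).preimage_mem_nhds (hO.mem_nhds hmem))
      ((hγ₀.contMDiffAt isOpen_Ioo ht'mem).continuousAt.preimage_mem_nhds
        ((isOpen_extChartAt_source m').mem_nhds hm'src))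
  obtain ⟨δ', hδ', hball⟩ := Metric.eventually_nhds_iff.1 hev
  -- restart the flow at a time `t₁` shortly before the supremum, from the position and velocity of
  -- a family which reaches `t₁`, to obtain a family beyond the supremum
  obtain ⟨t₂, ⟨ht₂0, η, hη, B, hBB, hB, hb, Γ, hΓ, hΓv⟩, ht₂⟩ :=
    exists_lt_of_lt_csSup hne (show t' - min (δ / 2) δ' < sSup S by
      rw [← ht']; linarith [lt_min (half_pos hδ) hδ'])
  have ht₂' : t₂ ≤ t' := le_csSup hbdd ⟨ht₂0, η, hη, B, hBB, hB, hb, Γ, hΓ, hΓv⟩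
  obtain ⟨t₁, ht₁, ht₁₂⟩ := exists_between (max_lt ht₂ ht₂0)
  have ht₁0 : 0 < t₁ := (le_max_right _ _).trans_lt ht₁
  have ht₁' : t' - min (δ / 2) δ' < t₁ := (le_max_left _ _).trans_lt ht₁
  have hd₁ : t' - t₁ < δ / 2 := by linarith [min_le_left (δ / 2) δ']
  have hd₂ : t' - t₁ < δ' := by linarith [min_le_right (δ / 2) δ']
  obtain ⟨hO₁, hsrc₁⟩ := hball (y := t₁) (by
    rw [Real.dist_eq, abs_sub_comm, abs_of_nonneg (by linarith)]; exact hd₂)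
  have ht₁mem : t₁ ∈ Ioo (-η) t₂ := ⟨by linarith, ht₁₂⟩
  have h0mem : (0 : ℝ) ∈ Ioo (-η) t₂ := ⟨by linarith, ht₂0⟩
  -- the given geodesic belongs to the family
  have hbase : (fun t => Γ (t, b₀)) =ᶠ[𝓝 t₁] γ₀ := by
    have h1 : EqOn (fun t => Γ (t, b₀)) γ₀ (Ioo (max (-η) (-ε)) t₂) :=
      ((hΓ.2 b₀ hb).mono (Ioo_subset_Ioo_left (le_max_left _ _))).eqOn
        (hγ₀.mono (Ioo_subset_Ioo (le_max_right _ _) (by linarith))) isOpen_Ioo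
        isPreconnected_Ioo (t := 0) ⟨max_lt (by linarith) (by linarith), ht₂0⟩
        ((hΓv b₀ hb).trans hv.symm)
    filter_upwards [isOpen_Ioo.mem_nhds (show t₁ ∈ Ioo (max (-η) (-ε)) t₂ from
      ⟨max_lt (by linarith) (by linarith), ht₁₂⟩)] with r hr using h1 hr
  have hQ := contDiffOn_familyCoord hΓ.1 isOpen_Ioo hB m'
  have hW := isOpen_chart_preimage hΓ.1 isOpen_Ioo hB m'
  have hb₁ : Γ (t₁, b₀) ∈ (extChartAt (𝓡 k) m').source := by
    have := hbase.self_of_nhds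
    simp only at this
    rwa [this]
  have hQ₀ : familyCoord m' Γ (t₁, b₀) = f t₁ := by
    have h1 := velocity_congr (k := k) hbase
    rw [velocity_family hΓ.1 isOpen_Ioo hB ht₁mem hb hb₁, velocity_eq_ofCoord
      (hγ₀.mdifferentiableAt isOpen_Ioo ⟨by linarith, by linarith⟩) hsrc₁] at h1
    have h2 := congrArg (toCoord m') h1
    rwa [toCoord_ofCoord, toCoord_ofCoord] at h2
    · exact (extChartAt (𝓡 k) m').map_source hsrc₁
    · exact (extChartAt (𝓡 k) m').map_source hb₁
  -- the part of the parameter space where the family can be continued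
  have hcont : ContDiff ℝ ∞ fun b : P => (t₁, b) := contDiff_const.prodMk contDiff_id
  let B₁ : Set P := (fun b : P => (t₁, b)) ⁻¹'
    ((Ioo (-η) t₂ ×ˢ B) ∩ Γ ⁻¹' (extChartAt (𝓡 k) m').source)
  have hB₁ : IsOpen B₁ := hW.preimage hcont.continuous
  have hB₁B : B₁ ⊆ B := fun b hb => hb.1.2
  have hQ₁ : ContDiffOn ℝ ∞ (fun b => familyCoord m' Γ (t₁, b)) B₁ :=
    hQ.comp hcont.contDiffOn fun b hb => hb
  let B₂ : Set P := B₁ ∩ (fun b => (τ b, familyCoord m' Γ (t₁, b))) ⁻¹' O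
  have hB₂ : IsOpen B₂ := ((hτ.continuousOn.mono (hB₁B.trans hBB)).prodMk
    hQ₁.continuousOn).isOpen_inter_preimage hB₁ hO
  obtain ⟨Γ', hΓ', hΓ'v⟩ := hloc τ (fun b => familyCoord m' Γ (t₁, b)) B₂ t₁
    (hτ.mono (inter_subset_left.trans (hB₁B.trans hBB))) (hQ₁.mono inter_subset_left)
    fun b hb => hb.2
  have hB₂B : B₂ ⊆ B := inter_subset_left.trans hB₁B
  have hglue := (hΓ.mono Subset.rfl hB₂B).glue hΓ' hB₂ (t₁ := t₁) (by linarith) ht₁₂ (by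
    intro b hb'
    refine ((hΓ.2 b (hB₂B hb')).mono inter_subset_left).eqOn
      ((hΓ'.2 b hb').mono inter_subset_right) (isOpen_Ioo.inter isOpen_Ioo) ?_ (t := t₁)
      ⟨ht₁mem, by linarith, by linarith⟩ ?_
    · rw [Ioo_inter_Ioo]
      exact isPreconnected_Ioo
    · rw [hΓ'v b hb', velocity_family hΓ.1 isOpen_Ioo hB ht₁mem (hB₂B hb') hb'.1.2])
  have hmemS : t₁ + δ ∈ S := by
    refine ⟨by linarith, η, hη, B₂, hB₂B.trans hBB, hB₂, ⟨⟨⟨ht₁mem, hb⟩, hb₁⟩, ?_⟩, _, hglue,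
      fun b hb' => ?_⟩
    · change (τ b₀, familyCoord m' Γ (t₁, b₀)) ∈ O
      rwa [hQ₀]
    · rw [← hΓv b (hB₂B hb')]
      refine velocity_congr ?_
      filter_upwards [gt_mem_nhds ht₁0] with r hr
      exact if_pos hr
  have := le_csSup hbdd hmemS
  linarith

end Family

/-! ### Energy and the first variation formula -/

section Speed

variable {k : ℕ} {M : Type*} [TopologicalSpace M]
  [ChartedSpace (EuclideanSpace ℝ (Fin k)) M] [IsManifold (𝓡 k) ∞ M]

/-- The energy `(p, p)_g / 2` of a tangent vector. -/
def energy (g : LorentzMetric k M) (p : TangentBundle (𝓡 k) M) : ℝ :=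
  g.inner p.1 p.2 p.2 / 2

theorem energy_ofCoord (g : LorentzMetric k M) (m : M) (q : Coord k × Coord k) :
    energy g (ofCoord m q) = chartForm g m q.1 q.2 q.2 / 2 := rfl

theorem energy_smul (g : LorentzMetric k M) (x : M) (v : TangentSpace (𝓡 k) x) (r : ℝ) :
    energy g ⟨x, r • v⟩ = r ^ 2 * energy g ⟨x, v⟩ := by
  simp only [energy, map_smul, smul_apply, smul_eq_mul]
  ring

variable {g : LorentzMetric k M} {γ : ℝ → M} {s : Set ℝ}

/-- Geodesics have constant speed. -/
theorem IsGeodesicOn.hasDerivAt_energy (h : IsGeodesicOn g γ s) (hs : IsOpen s) {t : ℝ}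
    (ht : t ∈ s) : HasDerivAt (fun r => energy g (velocity k γ r)) 0 t := by
  set m := γ t with hm
  have hm1 : γ t ∈ (extChartAt (𝓡 k) m).source := mem_extChartAt_source _
  set c : ℝ → Coord k := fun r => extChartAt (𝓡 k) m (γ r) with hc
  have hz := (extChartAt (𝓡 k) m).map_source hm1
  have hG : HasFDerivAt (chartForm g m) (fderiv ℝ (chartForm g m) (c t)) (c t) :=
    (differentiableAt_chartForm g m hz).hasFDerivAt
  have hd := h.hasDerivAt_chart hs ht hm1
  have h1 := ((hG.comp_hasDerivAt t hd.1).clm_apply hd.2).clm_apply hd.2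
  have hgeo := h.2 t ht m hm1 (deriv c t)
  rw [← chartForm_apply, christoffel_eq g m hz] at hgeo
  have hacc := (eq_chartAccel_iff g m hz _ _).2 (h.2 t ht m hm1)
  rw [← hacc] at h1
  have hev : (fun r => energy g (velocity k γ r)) =ᶠ[𝓝 t]
      fun r => (chartForm g m (c r) (deriv c r)) (deriv c r) / 2 := by
    filter_upwards [hs.mem_nhds ht, (h.contMDiffAt hs ht).continuousAt.preimage_mem_nhds
      ((isOpen_extChartAt_source m).mem_nhds hm1)] with r hr hr1
    rw [velocity_eq_ofCoord (h.mdifferentiableAt hs hr) hr1]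
    rfl
  refine HasDerivAt.congr_of_eventuallyEq ?_ hev
  refine (h1.div_const 2).congr_deriv ?_
  simp only [add_apply, Function.comp_apply]
  have hsy := chartForm_symm g m (c t) (deriv c t) (deriv (deriv c) t)
  change chartForm g m (c t) (deriv (deriv c) t) (deriv c t) + _ = 0 at hgeo
  linarith

theorem IsGeodesicOn.energy_eq (h : IsGeodesicOn g γ s) (hs : IsOpen s) (hconn : IsPreconnected s)
    {t r : ℝ} (ht : t ∈ s) (hr : r ∈ s) :
    energy g (velocity k γ t) = energy g (velocity k γ r) :=
  hs.is_const_of_deriv_eq_zero hconn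
    (fun _ hx => (h.hasDerivAt_energy hs hx).differentiableAt.differentiableWithinAt)
    (fun _ hx => (h.hasDerivAt_energy hs hx).deriv) ht hr

end Speed

section Variation

variable {k : ℕ} {M : Type*} [TopologicalSpace M]
  [ChartedSpace (EuclideanSpace ℝ (Fin k)) M] [IsManifold (𝓡 k) ∞ M]
  {gf : ℝ → LorentzMetric k M} {s : Set ℝ}

/-- The derivative of the components of a family of metrics in the parameter of the family and in
the position. -/
theorem hasFDerivAt_chartForm_family (hs : IsOpen s) (hgf : SmoothFamilyOn gf s) (m : M) {τ : ℝ}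
    (hτ : τ ∈ s) {z : Coord k} (hz : z ∈ (extChartAt (𝓡 k) m).target) :
    ∃ D : Coord k →L[ℝ] Coord k →L[ℝ] ℝ,
      HasFDerivAt (fun q : ℝ × Coord k => chartForm (gf q.1) m q.2)
        ((ContinuousLinearMap.fst ℝ ℝ (Coord k)).smulRight D +
          (fderiv ℝ (chartForm (gf τ) m) z).comp (ContinuousLinearMap.snd ℝ ℝ (Coord k))) (τ, z) ∧
      HasDerivAt (fun τ => chartForm (gf τ) m z) D τ ∧
      D = fderiv ℝ (fun q : ℝ × Coord k => chartForm (gf q.1) m q.2) (τ, z) (1, 0) := by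
  have h1 : DifferentiableAt ℝ (fun q : ℝ × Coord k => chartForm (gf q.1) m q.2) (τ, z) :=
    ((contDiffOn_chartForm_family hgf m).contDiffAt
      ((hs.prod (isOpen_chart_target m)).mem_nhds ⟨hτ, hz⟩)).differentiableAt (by simp)
  have h2 : HasDerivAt (fun τ : ℝ => (τ, z)) ((1 : ℝ), (0 : Coord k)) τ :=
    (hasDerivAt_id τ).prodMk (hasDerivAt_const τ z)
  have h3 := HasFDerivAt.comp_hasDerivAt
    (l := fun q : ℝ × Coord k => chartForm (gf q.1) m q.2) τ h1.hasFDerivAt h2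
  have h4 : HasFDerivAt (fun z : Coord k => (τ, z)) (ContinuousLinearMap.inr ℝ ℝ (Coord k)) z :=
    hasFDerivAt_prodMk_right τ z
  have h5 := HasFDerivAt.comp (g := fun q : ℝ × Coord k => chartForm (gf q.1) m q.2) z
    h1.hasFDerivAt h4
  refine ⟨_, h1.hasFDerivAt.congr_fderiv ?_, h3, rfl⟩
  have h6 : fderiv ℝ (chartForm (gf τ) m) z = _ := h5.fderiv
  rw [h6]
  refine ContinuousLinearMap.ext fun ⟨a, b⟩ => ?_
  have : ((a, b) : ℝ × Coord k) = a • ((1 : ℝ), (0 : Coord k)) + (0, b) := by simp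
  rw [this, map_add, map_smul]
  simp

theorem metricVariation_eq {m : M} {z : Coord k} {D : Coord k →L[ℝ] Coord k →L[ℝ] ℝ}
    (hD : HasDerivAt (fun τ => chartForm (gf τ) m z) D 0) {p : TangentBundle (𝓡 k) M} {a : Coord k}
    (hp : p = ofCoord m (z, a)) : metricVariation gf p.1 p.2 p.2 = D a a := by
  subst hp
  have h1 := (hD.clm_apply (hasDerivAt_const 0 a)).clm_apply (hasDerivAt_const 0 a)
  simp only [map_zero, add_zero] at h1
  exact h1.deriv

variable {Γ : ℝ × ℝ → M} {J B : Set ℝ}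

/-- The pairing of the velocity of the geodesic `Γ (·, 0)` with the variation field of the
family. -/
def variationPairing (g : LorentzMetric k M) (Γ : ℝ × ℝ → M) (t : ℝ) : ℝ :=
  g.inner (Γ (t, 0)) (velocity k (fun t => Γ (t, 0)) t).2 (velocity k (fun s => Γ (t, s)) 0).2

theorem variationPairing_eq {g : LorentzMetric k M} {t : ℝ} {m : M} {z a b : Coord k}
    (h₁ : velocity k (fun t => Γ (t, 0)) t = ofCoord m (z, a))
    (h₂ : velocity k (fun s => Γ (t, s)) 0 = ofCoord m (z, b)) :
    variationPairing g Γ t = chartForm g m z a b :=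
  inner_congr g (v' := chartVec m z a) (w' := chartVec m z b) h₁ h₂

/-- The derivative of the variation pairing along the geodesic, in terms of the derivative of the
energy with respect to the parameter of the family. -/
theorem hasDerivAt_variationPairing (hs : IsOpen s) (hgf : SmoothFamilyOn gf s)
    (hΓ : IsGeodesicFamily gf id Γ J B) (hJ : IsOpen J) (hB : IsOpen B) (h0 : 0 ∈ B) (h0s : 0 ∈ s)
    {t : ℝ} (ht : t ∈ J) :
    ∃ ℓ : ℝ, HasDerivAt (fun r => energy (gf r) (velocity k (fun t => Γ (t, r)) t)) ℓ 0 ∧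
      HasDerivAt (variationPairing (gf 0) Γ) (ℓ - metricVariation gf (Γ (t, 0))
        (velocity k (fun t => Γ (t, 0)) t).2 (velocity k (fun t => Γ (t, 0)) t).2 / 2) t := by
  set m := Γ (t, 0) with hm
  have hm1 : Γ (t, 0) ∈ (extChartAt (𝓡 k) m).source := mem_extChartAt_source _
  set c : ℝ × ℝ → Coord k := fun x => extChartAt (𝓡 k) m (Γ x) with hc
  set W := (J ×ˢ B) ∩ Γ ⁻¹' (extChartAt (𝓡 k) m).source with hW
  have hWo : IsOpen W := isOpen_chart_preimage hΓ.1 hJ hB m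
  have hcW : ContDiffOn ℝ ∞ c W := contDiffOn_chart_family hΓ.1 m
  have hmem : ((t, 0) : ℝ × ℝ) ∈ W := ⟨⟨ht, h0⟩, hm1⟩
  have hz : c (t, 0) ∈ (extChartAt (𝓡 k) m).target := (extChartAt (𝓡 k) m).map_source hm1
  have hct : ContDiffAt ℝ ∞ c (t, 0) := hcW.contDiffAt (hWo.mem_nhds hmem)
  have hc1 : HasFDerivAt c (fderiv ℝ c (t, 0)) (t, 0) := (hct.differentiableAt (by simp)).hasFDerivAt
  have hc2 : HasFDerivAt (fderiv ℝ c) (fderiv ℝ (fderiv ℝ c) (t, 0)) (t, 0) :=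
    ((hct.fderiv_right (m := 1) (WithTop.coe_le_coe.2 le_top)).differentiableAt
      (by simp)).hasFDerivAt
  have hdir1 : HasDerivAt (fun t : ℝ => (t, (0 : ℝ))) ((1 : ℝ), (0 : ℝ)) t :=
    (hasDerivAt_id t).prodMk (hasDerivAt_const t 0)
  have hdir2 : HasDerivAt (fun r : ℝ => (t, r)) ((0 : ℝ), (1 : ℝ)) 0 :=
    (hasDerivAt_const 0 t).prodMk (hasDerivAt_id 0)
  have hsymm : fderiv ℝ (fderiv ℝ c) (t, 0) (1, 0) (0, 1) =
      fderiv ℝ (fderiv ℝ c) (t, 0) (0, 1) (1, 0) :=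
    (hct.isSymmSndFDerivAt (by
      rw [minSmoothness_of_isRCLikeNormedField]; exact WithTop.coe_le_coe.2 le_top)).eq _ _
  obtain ⟨D, hG, hD, -⟩ := hasFDerivAt_chartForm_family hs hgf m h0s hz
  -- velocities in the chart
  have hvel : ∀ x ∈ W, velocity k (fun t => Γ (t, x.2)) x.1 = ofCoord m (c x, fderiv ℝ c x (1, 0)) :=
    fun x hx => velocity_family hΓ.1 hJ hB hx.1.1 hx.1.2 hx.2
  have hdert : ∀ x ∈ W, HasDerivAt (fun t => c (t, x.2)) (fderiv ℝ c x (1, 0)) x.1 := fun x hx =>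
    HasFDerivAt.comp_hasDerivAt (l := c) x.1
      ((hcW.contDiffAt (hWo.mem_nhds hx)).differentiableAt (by simp)).hasFDerivAt
      ((hasDerivAt_id x.1).prodMk (hasDerivAt_const x.1 x.2))
  have hW1 : ∀ᶠ r in 𝓝 t, ((r, 0) : ℝ × ℝ) ∈ W :=
    hdir1.continuousAt.preimage_mem_nhds (hWo.mem_nhds hmem)
  have hW2 : ∀ᶠ r in 𝓝 (0 : ℝ), (t, r) ∈ W :=
    hdir2.continuousAt.preimage_mem_nhds (hWo.mem_nhds hmem)
  have hvar : ∀ x ∈ W, x.2 = 0 → velocity k (fun s => Γ (x.1, s)) 0 =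
      ofCoord m (c x, fderiv ℝ c x (0, 1)) := by
    rintro ⟨r, _⟩ hx rfl
    have h1 : MDifferentiableAt 𝓘(ℝ, ℝ × ℝ) (𝓡 k) Γ (r, 0) :=
      (hΓ.1.contMDiffAt ((hJ.prod hB).mem_nhds hx.1)).mdifferentiableAt (by simp)
    have h2 : DifferentiableAt ℝ (fun s : ℝ => (r, s)) 0 := by fun_prop
    have h3 : MDifferentiableAt 𝓘(ℝ, ℝ) (𝓡 k) (fun s => Γ (r, s)) 0 :=
      MDifferentiableAt.comp 0 h1 h2.mdifferentiableAt
    rw [velocity_eq_ofCoord (m := m) h3 hx.2]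
    have h4 := HasFDerivAt.comp_hasDerivAt (l := c) 0
      ((hcW.contDiffAt (hWo.mem_nhds hx)).differentiableAt (by simp)).hasFDerivAt
      ((hasDerivAt_const 0 r).prodMk (hasDerivAt_id (0 : ℝ)))
    exact congrArg (fun v => ofCoord m (c (r, 0), v)) h4.deriv
  -- the two derivatives
  have hE : HasDerivAt (fun r => chartForm (gf r) m (c (t, r)) (fderiv ℝ c (t, r) (1, 0))
      (fderiv ℝ c (t, r) (1, 0)) / 2) _ 0 :=
    (((HasFDerivAt.comp_hasDerivAt (l := fun q : ℝ × Coord k => chartForm (gf q.1) m q.2)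
      (f := fun r => (r, c (t, r))) 0 hG
      ((hasDerivAt_id 0).prodMk (HasFDerivAt.comp_hasDerivAt (l := c) 0 hc1 hdir2))).clm_apply
      ((HasFDerivAt.comp_hasDerivAt (l := fderiv ℝ c) 0 hc2 hdir2).clm_apply
        (hasDerivAt_const 0 _))).clm_apply
      ((HasFDerivAt.comp_hasDerivAt (l := fderiv ℝ c) 0 hc2 hdir2).clm_apply
        (hasDerivAt_const 0 _))).div_const 2
  have hGz : HasFDerivAt (chartForm (gf 0) m) (fderiv ℝ (chartForm (gf 0) m) (c (t, 0))) (c (t, 0)) :=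
    (differentiableAt_chartForm (gf 0) m hz).hasFDerivAt
  have hP : HasDerivAt (fun r => chartForm (gf 0) m (c (r, 0)) (fderiv ℝ c (r, 0) (1, 0))
      (fderiv ℝ c (r, 0) (0, 1))) _ t :=
    ((HasFDerivAt.comp_hasDerivAt (l := chartForm (gf 0) m) t hGz
      (HasFDerivAt.comp_hasDerivAt (l := c) t hc1 hdir1)).clm_apply
      ((HasFDerivAt.comp_hasDerivAt (l := fderiv ℝ c) t hc2 hdir1).clm_apply
        (hasDerivAt_const t _))).clm_apply
      ((HasFDerivAt.comp_hasDerivAt (l := fderiv ℝ c) t hc2 hdir1).clm_apply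
        (hasDerivAt_const t _))
  have hder1 : deriv (fun t => c (t, 0)) =ᶠ[𝓝 t] fun t => fderiv ℝ c (t, 0) (1, 0) := by
    filter_upwards [hW1] with r hr using (hdert _ hr).deriv
  have hder2 : deriv (deriv fun t => c (t, 0)) t = fderiv ℝ (fderiv ℝ c) (t, 0) (1, 0) (1, 0) := by
    rw [hder1.deriv_eq]
    have := ((HasFDerivAt.comp_hasDerivAt (l := fderiv ℝ c) t hc2 hdir1).clm_apply
        (hasDerivAt_const t ((1 : ℝ), (0 : ℝ)))).deriv
    simpa using this
  have hgeo := (hΓ.2 0 h0).2 t ht m hm1 (fderiv ℝ c (t, 0) (0, 1))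
  change chartMetric (gf 0) m (c (t, 0)) (deriv (deriv fun t => c (t, 0)) t) _ +
    christoffel (gf 0) m (c (t, 0)) (deriv (fun t => c (t, 0)) t) (deriv (fun t => c (t, 0)) t) _ = 0
    at hgeo
  rw [← chartForm_apply, christoffel_eq (gf 0) m hz, hder2, hder1.self_of_nhds] at hgeo
  have hvar0 := metricVariation_eq hD (hvel _ hmem)
  refine ⟨_, hE.congr_of_eventuallyEq ?_, (hP.congr_of_eventuallyEq ?_).congr_deriv ?_⟩
  · filter_upwards [hW2] with r hr
    exact (congrArg (energy (gf r)) (hvel _ hr)).trans (energy_ofCoord _ _ _)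
  · filter_upwards [hW1] with r hr
    exact variationPairing_eq (hvel _ hr) (hvar _ hr rfl)
  · have h1 : metricVariation gf (Γ (t, 0)) (velocity k (fun t => Γ (t, 0)) t).2
      (velocity k (fun t => Γ (t, 0)) t).2 = _ := hvar0
    rw [h1]
    have hsy := chartForm_symm (gf 0) m (c (t, 0)) (fderiv ℝ c (t, 0) (1, 0))
      (fderiv ℝ (fderiv ℝ c) (t, 0) (0, 1) (1, 0))
    simp only [add_apply, map_zero, add_zero, ContinuousLinearMap.smulRight_apply,
      ContinuousLinearMap.comp_apply, ContinuousLinearMap.coe_fst', ContinuousLinearMap.coe_snd',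
      one_smul, hsymm, Function.comp_apply]
    linarith

/-- The first variation formula for the energy, for geodesics of a family of metrics. -/
theorem first_variation (hs : IsOpen s) (hgf : SmoothFamilyOn gf s) {η : ℝ} (hη : 0 < η)
    (hΓ : IsGeodesicFamily gf id Γ (Ioo (-η) (1 + η)) B) (hB : IsOpen B) (h0 : 0 ∈ B)
    (h0s : 0 ∈ s) :
    HasDerivAt (fun r => energy (gf r) (velocity k (fun t => Γ (t, r)) 0))
      (variationPairing (gf 0) Γ 1 - variationPairing (gf 0) Γ 0
        + rayTransform gf (fun t => Γ (t, 0)) / 2) 0 := by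
  have hsub : Icc (0 : ℝ) 1 ⊆ Ioo (-η) (1 + η) := fun t ht => ⟨by linarith [ht.1], by linarith [ht.2]⟩
  have h0J : (0 : ℝ) ∈ Ioo (-η) (1 + η) := hsub ⟨le_rfl, zero_le_one⟩
  -- `ℓ t` is the derivative of the energy at time `t` with respect to the parameter of the family;
  -- it does not depend on `t` since the energy is constant along each geodesic
  choose! ℓ h1 h2 using fun t (ht : t ∈ Ioo (-η) (1 + η)) =>
    hasDerivAt_variationPairing hs hgf hΓ isOpen_Ioo hB h0 h0s ht
  have hconst : ∀ t ∈ Ioo (-η) (1 + η), ℓ t = ℓ 0 := by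
    intro t ht
    refine (h1 t ht).unique ((h1 0 h0J).congr_of_eventuallyEq ?_)
    filter_upwards [hB.mem_nhds h0] with r hr
    exact (hΓ.2 r hr).energy_eq isOpen_Ioo isPreconnected_Ioo ht h0J
  set F : ℝ → ℝ := fun t => metricVariation gf (Γ (t, 0)) (velocity k (fun t => Γ (t, 0)) t).2
    (velocity k (fun t => Γ (t, 0)) t).2 with hF
  have hFc : ContinuousOn F (Ioo (-η) (1 + η)) := by
    intro t ht
    refine ContinuousAt.continuousWithinAt ?_
    set m := Γ (t, 0) with hm
    have hm1 : Γ (t, 0) ∈ (extChartAt (𝓡 k) m).source := mem_extChartAt_source _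
    have hgeo := hΓ.2 0 h0
    set c : ℝ → Coord k := fun t => extChartAt (𝓡 k) m (Γ (t, 0)) with hc
    have hz : c t ∈ (extChartAt (𝓡 k) m).target := (extChartAt (𝓡 k) m).map_source hm1
    have hd := hgeo.hasDerivAt_chart isOpen_Ioo ht hm1
    have hGs : ContDiffAt ℝ ∞ (fun q : ℝ × Coord k => chartForm (gf q.1) m q.2) (0, c t) :=
      (contDiffOn_chartForm_family hgf m).contDiffAt
        ((hs.prod (isOpen_chart_target m)).mem_nhds ⟨h0s, hz⟩)
    have hD : ContinuousAt (fun z => fderiv ℝ (fun q : ℝ × Coord k => chartForm (gf q.1) m q.2)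
        (0, z) (1, 0)) (c t) :=
      ((hGs.fderiv_right (m := 0) (by simp)).continuousAt.comp (f := fun z : Coord k => ((0 : ℝ), z))
        (by fun_prop)).clm_apply continuousAt_const
    have hcon : ContinuousAt (fun r => fderiv ℝ (fun q : ℝ × Coord k => chartForm (gf q.1) m q.2)
        (0, c r) (1, 0) (deriv c r) (deriv c r)) t :=
      ((ContinuousAt.comp (f := c) (x := t) hD hd.1.continuousAt).clm_apply
        hd.2.continuousAt).clm_apply hd.2.continuousAt
    refine hcon.congr ?_
    filter_upwards [isOpen_Ioo.mem_nhds ht, (hgeo.contMDiffAt isOpen_Ioo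
      ht).continuousAt.preimage_mem_nhds ((isOpen_extChartAt_source m).mem_nhds hm1)] with r hr hr1
    have hzr : c r ∈ (extChartAt (𝓡 k) m).target := (extChartAt (𝓡 k) m).map_source hr1
    obtain ⟨D, -, hD, hDe⟩ := hasFDerivAt_chartForm_family hs hgf m h0s hzr
    have h3 : F r = _ := metricVariation_eq hD
      (velocity_eq_ofCoord (hgeo.mdifferentiableAt isOpen_Ioo hr) hr1)
    rw [h3, hDe]
  have hint : IntervalIntegrable F MeasureTheory.volume 0 1 := by
    refine (hFc.mono ?_).intervalIntegrable
    rwa [uIcc_of_le zero_le_one]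
  -- integrate the derivative `ℓ 0 - F t / 2` of the pairing of velocity and variation field
  have hftc := intervalIntegral.integral_eq_sub_of_hasDerivAt (a := 0) (b := 1)
    (f := variationPairing (gf 0) Γ) (f' := fun t => ℓ 0 - F t / 2) (fun t ht => by
      rw [uIcc_of_le zero_le_one] at ht
      rw [← hconst t (hsub ht)]
      exact h2 t (hsub ht)) (intervalIntegrable_const.sub (hint.div_const 2))
  rw [intervalIntegral.integral_sub intervalIntegrable_const (hint.div_const 2),
    intervalIntegral.integral_const, intervalIntegral.integral_div] at hftc
  refine (h1 0 h0J).congr_deriv ?_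
  rw [← hftc]
  simp only [sub_zero, one_smul, rayTransform]
  change ℓ 0 = ℓ 0 - (∫ t in (0 : ℝ)..1, F t) / 2 + (∫ t in (0 : ℝ)..1, F t) / 2
  ring

end Variation

/-! ### Local inverse of the exponential map -/

section Exponential

variable {k : ℕ} {M : Type*} [TopologicalSpace M] [T2Space M]
  [ChartedSpace (EuclideanSpace ℝ (Fin k)) M] [IsManifold (𝓡 k) ∞ M]
  {g : LorentzMetric k M}

/-- Two geodesic segments with the same initial velocity agree on a neighborhood of `[0, T]`, so
that their final velocities agree as well. -/
theorem IsGeodesicSegment.eqOn {γ₁ γ₂ : ℝ → M} {T : ℝ} (hT : 0 ≤ T) (h₁ : IsGeodesicSegment g γ₁ T)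
    (h₂ : IsGeodesicSegment g γ₂ T) (hv : velocity k γ₁ 0 = velocity k γ₂ 0) :
    ∃ ε > 0, EqOn γ₁ γ₂ (Ioo (-ε) (T + ε)) := by
  obtain ⟨ε₁, hε₁, h₁⟩ := h₁
  obtain ⟨ε₂, hε₂, h₂⟩ := h₂
  have h := lt_min hε₁ hε₂
  refine ⟨min ε₁ ε₂, h, (h₁.mono (Ioo_subset_Ioo ?_ ?_)).eqOn
    (h₂.mono (Ioo_subset_Ioo ?_ ?_)) isOpen_Ioo isPreconnected_Ioo (t := 0)
    ⟨by linarith, by linarith⟩ hv⟩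
  all_goals linarith [min_le_left ε₁ ε₂, min_le_right ε₁ ε₂]

/-- The endpoint of a geodesic is determined by its initial velocity, so `expMap` does not depend on
a choice. -/
theorem Joins.unique {p : TangentBundle (𝓡 k) M} {y y' : M} (h : Joins g p y) (h' : Joins g p y') :
    y = y' := by
  obtain ⟨γ, hγ, hv, rfl⟩ := h
  obtain ⟨γ', hγ', hv', rfl⟩ := h'
  obtain ⟨ε, hε, heq⟩ := hγ.eqOn zero_le_one hγ' (hv.trans hv'.symm)
  exact heq ⟨by linarith, by linarith⟩

theorem Joins.expMap_eq {p : TangentBundle (𝓡 k) M} {y : M} (h : Joins g p y) :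
    expMap g p = y := by
  have h' : ∃ y, Joins g p y := ⟨y, h⟩
  rw [expMap, dif_pos h']
  exact h'.choose_spec.unique h

/-- The exponential maps of a family of metrics in charts at `m` (for initial points) and `m₁` (for
endpoints): `Γ (t, (τ, (z, w)))` is the geodesic of `gf τ` whose initial velocity has coordinates
`(z, w)`, and `w = W (τ, (z, z'))` is the only `w ∈ N` for which it ends, at time one, in the point
with coordinates `z'`. -/
structure LocalExp (gf : ℝ → LorentzMetric k M) (m m₁ : M) where
  Γ : ℝ × (ℝ × (Coord k × Coord k)) → M
  η : ℝ
  B : Set (ℝ × (Coord k × Coord k))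
  O : Set (ℝ × (Coord k × Coord k))
  N : Set (Coord k)
  W : ℝ × (Coord k × Coord k) → Coord k
  η_pos : 0 < η
  isOpen_B : IsOpen B
  isOpen_O : IsOpen O
  isOpen_N : IsOpen N
  family : IsGeodesicFamily gf Prod.fst Γ (Ioo (-η) (1 + η)) B
  velocity_zero : ∀ b ∈ B, velocity k (fun t => Γ (t, b)) 0 = ofCoord m b.2
  contDiffOn_W : ContDiffOn ℝ ∞ W O
  mem_target_end : ∀ c ∈ O, c.2.2 ∈ (extChartAt (𝓡 k) m₁).target
  W_mem : ∀ c ∈ O, W c ∈ N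
  mem_B : ∀ c ∈ O, ∀ w ∈ N, (c.1, (c.2.1, w)) ∈ B
  endpoint : ∀ c ∈ O, Γ (1, (c.1, (c.2.1, W c))) = (extChartAt (𝓡 k) m₁).symm c.2.2
  eq_W : ∀ c ∈ O, ∀ w ∈ N,
    Γ (1, (c.1, (c.2.1, w))) = (extChartAt (𝓡 k) m₁).symm c.2.2 → w = W c

variable {gf : ℝ → LorentzMetric k M} {m m₁ : M}

theorem IsGeodesicFamily.isGeodesicSegment {P : Type*} [NormedAddCommGroup P] [NormedSpace ℝ P]
    {τ : P → ℝ} {Γ : ℝ × P → M} {η : ℝ} {B : Set P} {T : ℝ}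
    (h : IsGeodesicFamily gf τ Γ (Ioo (-η) (T + η)) B)
    (hη : 0 < η) {b : P} (hb : b ∈ B) : IsGeodesicSegment (gf (τ b)) (fun t => Γ (t, b)) T :=
  ⟨η, hη, h.2 b hb⟩

theorem LocalExp.joins (L : LocalExp gf m m₁) {b : ℝ × (Coord k × Coord k)} (hb : b ∈ L.B) :
    Joins (gf b.1) (ofCoord m b.2) (L.Γ (1, b)) :=
  ⟨_, L.family.isGeodesicSegment L.η_pos hb, L.velocity_zero b hb, rfl⟩

/-- If the exponential map of `gf τ₀` is a local diffeomorphism at a vector, then the exponential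
maps of nearby metrics can be inverted smoothly near that vector. -/
theorem exists_localExp {s : Set ℝ} (hs : IsOpen s) (hgf : SmoothFamilyOn gf s) {τ₀ : ℝ}
    (hτ₀ : τ₀ ∈ s) {z₀ w₀ z₁ : Coord k} (hz₀ : z₀ ∈ (extChartAt (𝓡 k) m).target)
    (hz₁ : z₁ ∈ (extChartAt (𝓡 k) m₁).target) {γ₀ : ℝ → M}
    (hγ₀ : IsGeodesicSegment (gf τ₀) γ₀ 1) (hv : velocity k γ₀ 0 = ofCoord m (z₀, w₀))
    (hend : γ₀ 1 = (extChartAt (𝓡 k) m₁).symm z₁)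
    (hreg : Function.Bijective (fderiv ℝ
      (fun w => extChartAt (𝓡 k) m₁ (expMap (gf τ₀) (ofCoord m (z₀, w)))) w₀)) :
    ∃ L : LocalExp gf m m₁, (τ₀, (z₀, z₁)) ∈ L.O ∧ L.W (τ₀, (z₀, z₁)) = w₀ := by
  obtain ⟨η, hη, B, hBB, hB, hb₀, Γ, hΓ, hΓv⟩ := exists_geodesic_family
    (P := ℝ × (Coord k × Coord k)) (τ := Prod.fst) (q := Prod.snd) (b₀ := (τ₀, (z₀, w₀)))
    (B₀ := s ×ˢ ((extChartAt (𝓡 k) m).target ×ˢ univ)) hs hgf m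
    (hs.prod ((isOpen_chart_target m).prod isOpen_univ)) ⟨hτ₀, hz₀, mem_univ _⟩
    contDiff_fst.contDiffOn contDiff_snd.contDiffOn hτ₀ hz₀ hγ₀ hv
  have h1J : (1 : ℝ) ∈ Ioo (-η) (1 + η) := ⟨by linarith, by linarith⟩
  have hjoin : ∀ b ∈ B, Joins (gf b.1) (ofCoord m b.2) (Γ (1, b)) := fun b hb =>
    ⟨_, hΓ.isGeodesicSegment hη hb, hΓv b hb, rfl⟩
  have hbase : Γ (1, (τ₀, (z₀, w₀))) = (extChartAt (𝓡 k) m₁).symm z₁ := by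
    rw [← hend]
    exact (hjoin _ hb₀).unique ⟨γ₀, hγ₀, hv, rfl⟩
  -- the endpoint map in the charts
  have hJ : ContDiff ℝ ∞ fun b : ℝ × (Coord k × Coord k) => ((1 : ℝ), b) :=
    contDiff_const.prodMk contDiff_id
  let B₁ : Set (ℝ × (Coord k × Coord k)) := (fun b => ((1 : ℝ), b)) ⁻¹'
    ((Ioo (-η) (1 + η) ×ˢ B) ∩ Γ ⁻¹' (extChartAt (𝓡 k) m₁).source)
  have hB₁ : IsOpen B₁ := (isOpen_chart_preimage hΓ.1 isOpen_Ioo hB m₁).preimage hJ.continuous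
  let X : ℝ × (Coord k × Coord k) → Coord k := fun b => extChartAt (𝓡 k) m₁ (Γ (1, b))
  have hX : ContDiffOn ℝ ∞ X B₁ := (contDiffOn_chart_family hΓ.1 m₁).comp hJ.contDiffOn
    fun b hb => hb
  have hb₁ : (τ₀, (z₀, w₀)) ∈ B₁ := by
    refine ⟨⟨h1J, hb₀⟩, ?_⟩
    rw [mem_preimage, hbase]
    exact (extChartAt (𝓡 k) m₁).map_target hz₁
  have hX₀ : X (τ₀, (z₀, w₀)) = z₁ := by
    change extChartAt (𝓡 k) m₁ (Γ (1, (τ₀, (z₀, w₀)))) = z₁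
    rw [hbase, (extChartAt (𝓡 k) m₁).right_inv hz₁]
  have hιw : HasFDerivAt (fun w : Coord k => (τ₀, (z₀, w)))
      ((ContinuousLinearMap.inr ℝ ℝ (Coord k × Coord k)).comp
        (ContinuousLinearMap.inr ℝ (Coord k) (Coord k))) w₀ :=
    (hasFDerivAt_prodMk_right τ₀ (z₀, w₀)).comp w₀ (hasFDerivAt_prodMk_right z₀ w₀)
  have hXd : HasFDerivAt X (fderiv ℝ X (τ₀, (z₀, w₀))) (τ₀, (z₀, w₀)) :=
    ((hX.contDiffAt (hB₁.mem_nhds hb₁)).differentiableAt (by simp)).hasFDerivAt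
  have hXw : fderiv ℝ (fun w => extChartAt (𝓡 k) m₁ (expMap (gf τ₀) (ofCoord m (z₀, w)))) w₀ =
      (fderiv ℝ X (τ₀, (z₀, w₀))).comp ((ContinuousLinearMap.inr ℝ ℝ (Coord k × Coord k)).comp
        (ContinuousLinearMap.inr ℝ (Coord k) (Coord k))) := by
    refine HasFDerivAt.fderiv ((hXd.comp w₀ hιw).congr_of_eventuallyEq ?_)
    filter_upwards [hιw.continuousAt.preimage_mem_nhds (hB.mem_nhds hb₀)] with w hw
    exact congrArg (extChartAt (𝓡 k) m₁) (hjoin _ hw).expMap_eq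
  rw [hXw] at hreg
  let A : Coord k ≃L[ℝ] Coord k := (LinearEquiv.ofBijective
    ((fderiv ℝ X (τ₀, (z₀, w₀))).comp ((ContinuousLinearMap.inr ℝ ℝ (Coord k × Coord k)).comp
        (ContinuousLinearMap.inr ℝ (Coord k) (Coord k)))).toLinearMap hreg).toContinuousLinearEquiv
  -- the implicit function theorem
  let ι : (ℝ × (Coord k × Coord k)) × Coord k → ℝ × (Coord k × Coord k) :=
    fun u => (u.1.1, (u.1.2.1, u.2))
  have hι : ContDiff ℝ ∞ ι := by
    change ContDiff ℝ ∞ fun u : (ℝ × (Coord k × Coord k)) × Coord k => (u.1.1, (u.1.2.1, u.2))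
    fun_prop
  let u₀ : (ℝ × (Coord k × Coord k)) × Coord k := ((τ₀, (z₀, z₁)), w₀)
  let f : (ℝ × (Coord k × Coord k)) × Coord k → Coord k := fun u => X (ι u) - u.1.2.2
  have hf : ContDiffOn ℝ ∞ f (ι ⁻¹' B₁) :=
    (hX.comp hι.contDiffOn fun u hu => hu).sub (ContDiff.contDiffOn (by fun_prop))
  have hA : ∀ b, fderiv ℝ f u₀ (0, b) = A b := by
    intro b
    have hfd : DifferentiableAt ℝ f u₀ :=
      (hf.contDiffAt ((hB₁.preimage hι.continuous).mem_nhds hb₁)).differentiableAt (by simp)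
    have h1 := hfd.hasFDerivAt.comp w₀ (hasFDerivAt_prodMk_right (𝕜 := ℝ) (τ₀, (z₀, z₁)) w₀)
    have h2 : HasFDerivAt (fun w => X (τ₀, (z₀, w)) - z₁) _ w₀ :=
      (HasFDerivAt.comp (g := X) w₀ hXd hιw).sub_const z₁
    exact congrArg (fun L : Coord k →L[ℝ] Coord k => L b) (h1.unique h2)
  obtain ⟨O, ψ, hO, hu₀, hψ, hψ₀, hsol, N, hN, huniq⟩ := exists_smooth_implicit
    (hB₁.preimage hι.continuous) hf (u := u₀) hb₁ A hA
  have hfu₀ : f u₀ = 0 := sub_eq_zero.2 hX₀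
  have hN' : N ∩ ι ⁻¹' B₁ ∈ 𝓝 (u₀.1, u₀.2) :=
    inter_mem hN ((hB₁.preimage hι.continuous).mem_nhds hb₁)
  obtain ⟨N₁, hN₁, N₂, hN₂, hNsub⟩ := mem_nhds_prod_iff.1 hN'
  obtain ⟨N₁', hN₁', hN₁o, hN₁m⟩ := mem_nhds_iff.1 hN₁
  obtain ⟨N₂', hN₂', hN₂o, hN₂m⟩ := mem_nhds_iff.1 hN₂
  have hsubN : ∀ c ∈ N₁', ∀ w ∈ N₂', (c, w) ∈ N ∧ ι (c, w) ∈ B₁ := fun c hc w hw =>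
    hNsub (mk_mem_prod (hN₁' hc) (hN₂' hw))
  let T : Set (ℝ × (Coord k × Coord k)) := {c | c.2.2 ∈ (extChartAt (𝓡 k) m₁).target}
  have hT : IsOpen T := (isOpen_chart_target m₁).preimage (by fun_prop)
  have hO' : IsOpen (((O ∩ ψ ⁻¹' N₂') ∩ N₁') ∩ T) :=
    ((hψ.continuousOn.isOpen_inter_preimage hO hN₂o).inter hN₁o).inter hT
  refine ⟨⟨Γ, η, B, ((O ∩ ψ ⁻¹' N₂') ∩ N₁') ∩ T, N₂', ψ, hη, hB, hO', hN₂o, hΓ,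
    hΓv, hψ.mono fun c hc => hc.1.1.1, fun c hc => hc.2,
    fun c hc => hc.1.1.2, fun c hc w hw => (hsubN c hc.1.2 w hw).2.1.2, fun c hc => ?_,
    fun c hc w hw h => ?_⟩, ⟨⟨⟨hu₀, ?_⟩, hN₁m⟩, hz₁⟩, hψ₀⟩
  · have h1 := (hsol c hc.1.1.1).2
    rw [hfu₀] at h1
    have h2 : X (c.1, (c.2.1, ψ c)) = c.2.2 := sub_eq_zero.1 h1
    rw [← h2]
    exact ((extChartAt (𝓡 k) m₁).left_inv (hsol c hc.1.1.1).1.2).symm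
  · refine (huniq (c, w) (hsubN c hc.1.2 w hw).1 ?_).symm
    rw [hfu₀]
    refine sub_eq_zero.2 ?_
    change extChartAt (𝓡 k) m₁ (Γ (1, (c.1, (c.2.1, w)))) = c.2.2
    rw [h, (extChartAt (𝓡 k) m₁).right_inv hc.2]
  · rw [mem_preimage, hψ₀]
    exact hN₂m

/-- In the charts around its endpoints, the exponential map is regular along a geodesic without
conjugate endpoints. -/
theorem bijective_fderiv_expMap {γ₀ : ℝ → M} (hγ₀ : IsGeodesicSegment g γ₀ 1)
    (hconj : ¬ ConjugateAlong g γ₀) :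
    Function.Bijective (fderiv ℝ (fun w => extChartAt (𝓡 k) (γ₀ 1)
      (expMap g (ofCoord (γ₀ 0) (extChartAt (𝓡 k) (γ₀ 0) (γ₀ 0), w)))) (velocity k γ₀ 0).2) := by
  have : IsManifold (𝓡 k) 1 M := IsManifold.of_le (n := ∞) (by simp)
  rw [ConjugateAlong, not_not] at hconj
  set m := γ₀ 0 with hm
  set z₀ := extChartAt (𝓡 k) m m with hz₀
  set v₀ : Coord k := (velocity k γ₀ 0).2 with hv₀
  have hz₀t : z₀ ∈ (extChartAt (𝓡 k) m).target := mem_extChartAt_target m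
  have hvel : velocity k γ₀ 0 = ofCoord m (z₀, v₀) := (ofCoord_self m v₀).symm
  obtain ⟨η, hη, B, hBB, hB, hb₀, Γ, hΓ, hΓv⟩ := exists_geodesic_family
    (P := Coord k) (gf := fun _ => g) (τ := fun _ => 0) (q := fun w => (z₀, w)) (b₀ := v₀)
    (B₀ := univ) isOpen_univ (smoothFamilyOn_const g univ) m isOpen_univ (mem_univ _)
    contDiffOn_const (contDiff_const.prodMk contDiff_id).contDiffOn (mem_univ _) hz₀t hγ₀ hvel
  have h1J : (1 : ℝ) ∈ Ioo (-η) (1 + η) := ⟨by linarith, by linarith⟩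
  have hexp : ∀ w ∈ B, expMap g (ofCoord m (z₀, w)) = Γ (1, w) := fun w hw =>
    Joins.expMap_eq ⟨_, hΓ.isGeodesicSegment (τ := fun _ => 0) hη hw, hΓv w hw, rfl⟩
  have hdΓ : MDifferentiableAt 𝓘(ℝ, Coord k) (𝓡 k) (fun w => Γ (1, w)) v₀ := by
    have h1 : MDifferentiableAt 𝓘(ℝ, ℝ × Coord k) (𝓡 k) Γ (1, v₀) :=
      (hΓ.1.contMDiffAt ((isOpen_Ioo.prod hB).mem_nhds ⟨h1J, hb₀⟩)).mdifferentiableAt (by simp)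
    have h2 : DifferentiableAt ℝ (fun w : Coord k => ((1 : ℝ), w)) v₀ := by fun_prop
    exact MDifferentiableAt.comp v₀ h1 h2.mdifferentiableAt
  have hev : (fun w => expMap g (ofCoord m (z₀, w))) =ᶠ[𝓝 v₀] fun w => Γ (1, w) := by
    filter_upwards [hB.mem_nhds hb₀] with w hw using hexp w hw
  have hd : MDifferentiableAt 𝓘(ℝ, Coord k) (𝓡 k) (fun w => expMap g (ofCoord m (z₀, w))) v₀ :=
    hdΓ.congr_of_eventuallyEq hev
  have hend : expMap g (ofCoord m (z₀, v₀)) = γ₀ 1 :=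
    Joins.expMap_eq ⟨γ₀, hγ₀, hvel, rfl⟩
  have hfun : (fun w : Coord k => expMap g ⟨m, w⟩) = fun w => expMap g (ofCoord m (z₀, w)) := by
    funext w
    rw [ofCoord_self m w]
  rw [hfun] at hconj
  have hsrc : expMap g (ofCoord m (z₀, v₀)) ∈ (extChartAt (𝓡 k) (γ₀ 1)).source := by
    rw [hend]
    exact mem_extChartAt_source _
  have hcomp := mfderiv_comp v₀ (mdifferentiableAt_chart (γ₀ 1) hsrc) hd
  have hid : ∀ v, mfderiv (𝓡 k) 𝓘(ℝ, Coord k) (extChartAt (𝓡 k) (γ₀ 1))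
      (expMap g (ofCoord m (z₀, v₀))) v = v := by
    rw [hend]
    intro v
    -- the chart at a point has derivative the identity there, as tangent spaces are identified with
    -- the model space by this chart
    rw [mfderiv_extChartAt_self]
    rfl
  have hfd : ∀ w : Coord k, fderiv ℝ (fun w => extChartAt (𝓡 k) (γ₀ 1)
      (expMap g (ofCoord m (z₀, w)))) v₀ w =
      mfderiv 𝓘(ℝ, Coord k) (𝓡 k) (fun w => expMap g (ofCoord m (z₀, w))) v₀ w := by
    intro w
    rw [← mfderiv_eq_fderiv]
    exact (congrArg (fun L : Coord k →L[ℝ] Coord k => L w) hcomp).trans (hid _)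
  have heq : ⇑(fderiv ℝ (fun w => extChartAt (𝓡 k) (γ₀ 1)
      (expMap g (ofCoord m (z₀, w)))) v₀) = fun w : Coord k =>
      mfderiv 𝓘(ℝ, Coord k) (𝓡 k) (fun w => expMap g (ofCoord m (z₀, w))) v₀ w := funext hfd
  rw [heq]
  exact hconj

/-- The exponential map, in charts, is differentiable at the vectors given by its local inverse. -/
theorem LocalExp.differentiableAt_expMap (L : LocalExp gf m m₁) {c : ℝ × (Coord k × Coord k)}
    (hc : c ∈ L.O) :
    DifferentiableAt ℝ (fun w => extChartAt (𝓡 k) m₁ (expMap (gf c.1) (ofCoord m (c.2.1, w))))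
      (L.W c) := by
  obtain ⟨τ, z, z'⟩ := c
  have hη := L.η_pos
  have h1J : (1 : ℝ) ∈ Ioo (-L.η) (1 + L.η) := ⟨by linarith, by linarith⟩
  have hb := L.mem_B _ hc _ (L.W_mem _ hc)
  have hsrc : L.Γ (1, (τ, (z, L.W (τ, (z, z'))))) ∈ (extChartAt (𝓡 k) m₁).source := by
    rw [L.endpoint _ hc]
    exact (extChartAt (𝓡 k) m₁).map_target (L.mem_target_end _ hc)
  have h1 : DifferentiableAt ℝ (fun x => extChartAt (𝓡 k) m₁ (L.Γ x))
      (1, (τ, (z, L.W (τ, (z, z'))))) :=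
    ((contDiffOn_chart_family L.family.1 m₁).contDiffAt
      ((isOpen_chart_preimage L.family.1 isOpen_Ioo L.isOpen_B m₁).mem_nhds
        ⟨⟨h1J, hb⟩, hsrc⟩)).differentiableAt (by simp)
  have h2 : DifferentiableAt ℝ (fun w : Coord k => ((1 : ℝ), (τ, (z, w)))) (L.W (τ, (z, z'))) := by
    fun_prop
  refine (DifferentiableAt.comp (f := fun w : Coord k => ((1 : ℝ), (τ, (z, w))))
    (L.W (τ, (z, z'))) h1 h2).congr_of_eventuallyEq ?_
  filter_upwards [L.isOpen_N.mem_nhds (L.W_mem _ hc)] with w hw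
  exact congrArg (extChartAt (𝓡 k) m₁) (L.joins (L.mem_B _ hc w hw)).expMap_eq

/-- The partial inverse of the exponential map shows that the exponential map is regular. -/
theorem LocalExp.bijective_fderiv (L : LocalExp gf m m₁) {c : ℝ × (Coord k × Coord k)}
    (hc : c ∈ L.O) :
    Function.Bijective (fderiv ℝ
      (fun w => extChartAt (𝓡 k) m₁ (expMap (gf c.1) (ofCoord m (c.2.1, w)))) (L.W c)) := by
  obtain ⟨τ, z, z'⟩ := c
  have hWz : ContDiffAt ℝ ∞ (fun z' => L.W (τ, (z, z'))) z' :=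
    ContDiffAt.comp z' (L.contDiffOn_W.contDiffAt (L.isOpen_O.mem_nhds hc))
      (contDiffAt_const.prodMk (contDiffAt_const.prodMk contDiffAt_id))
  have hX := L.differentiableAt_expMap hc
  have hcomp := hX.hasFDerivAt.comp z' (hWz.differentiableAt (by simp)).hasFDerivAt
  have hid : HasFDerivAt ((fun w => extChartAt (𝓡 k) m₁ (expMap (gf τ) (ofCoord m (z, w)))) ∘
      fun z' => L.W (τ, (z, z'))) (ContinuousLinearMap.id ℝ (Coord k)) z' := by
    refine (hasFDerivAt_id z').congr_of_eventuallyEq ?_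
    have hzc : ContinuousAt (fun z' : Coord k => (τ, (z, z'))) z' := by fun_prop
    filter_upwards [hzc.preimage_mem_nhds (L.isOpen_O.mem_nhds hc)] with y hy
    have h1 := (L.joins (L.mem_B _ hy _ (L.W_mem _ hy))).expMap_eq
    rw [L.endpoint _ hy] at h1
    exact (congrArg (extChartAt (𝓡 k) m₁) h1).trans
      ((extChartAt (𝓡 k) m₁).right_inv (L.mem_target_end _ hy))
  have hsurj : Function.Surjective (fderiv ℝ
      (fun w => extChartAt (𝓡 k) m₁ (expMap (gf τ) (ofCoord m (z, w)))) (L.W (τ, (z, z')))) :=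
    fun y => ⟨_, congrArg (fun L : Coord k →L[ℝ] Coord k => L y) (hcomp.unique hid)⟩
  exact ⟨(LinearMap.injective_iff_surjective (f := ((fderiv ℝ
      (fun w => extChartAt (𝓡 k) m₁ (expMap (gf τ) (ofCoord m (z, w))))
      (L.W (τ, (z, z')))).toLinearMap))).2 hsurj, hsurj⟩

end Exponential

/-! ### Surfaces in charts -/

section Surface

variable {n : ℕ} {M : Type*} [TopologicalSpace M]
  [ChartedSpace (EuclideanSpace ℝ (Fin (n + 1))) M] [IsManifold (𝓡 (n + 1)) ∞ M]
  {U : Type*} [TopologicalSpace U] [ChartedSpace (EuclideanSpace ℝ (Fin n)) U]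
  [IsManifold (𝓡 n) ∞ U] {g : LorentzMetric (n + 1) M} {ι : U → M}

/-- The metric induced on the surface is nondegenerate. -/
def IsNondegenerateSurface (g : LorentzMetric (n + 1) M) (ι : U → M) : Prop :=
  ∀ (x : U) (a : TangentSpace (𝓡 n) x), (∀ b, inducedMetric g ι x a b = 0) → a = 0

theorem isNondegenerateSurface (h : IsTimelikeSurface g ι ∨ IsSpacelikeSurface g ι) :
    IsNondegenerateSurface g ι := by
  intro x a ha
  rcases h with h | h
  · exact (h x).eq_zero (fun v w => g.symm _ _ _) ha
  · by_contra hne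
    exact (h x a hne).ne' (ha a)

/-- The surface in the charts at `x₀ ∈ U` and `m ∈ M`. -/
def surfaceCoord (ι : U → M) (m : M) (x₀ : U) (u : Coord n) : Coord (n + 1) :=
  extChartAt (𝓡 (n + 1)) m (ι ((extChartAt (𝓡 n) x₀).symm u))

/-- The domain of `surfaceCoord`. -/
def surfaceDomain (ι : U → M) (m : M) (x₀ : U) : Set (Coord n) :=
  (extChartAt (𝓡 n) x₀).target ∩
    (fun u => ι ((extChartAt (𝓡 n) x₀).symm u)) ⁻¹' (extChartAt (𝓡 (n + 1)) m).source

variable {m : M} {x₀ : U} {u : Coord n}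

theorem contMDiffOn_surface (hι : ContMDiff (𝓡 n) (𝓡 (n + 1)) ∞ ι) :
    ContMDiffOn 𝓘(ℝ, Coord n) (𝓡 (n + 1)) ∞ (fun u => ι ((extChartAt (𝓡 n) x₀).symm u))
      (extChartAt (𝓡 n) x₀).target :=
  hι.comp_contMDiffOn (contMDiffOn_chart_symm x₀)

theorem isOpen_surfaceDomain (hι : ContMDiff (𝓡 n) (𝓡 (n + 1)) ∞ ι) :
    IsOpen (surfaceDomain (n := n) ι m x₀) :=
  (contMDiffOn_surface hι).continuousOn.isOpen_inter_preimage (isOpen_chart_target x₀)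
    (isOpen_extChartAt_source m)

theorem contDiffOn_surfaceCoord (hι : ContMDiff (𝓡 n) (𝓡 (n + 1)) ∞ ι) :
    ContDiffOn ℝ ∞ (surfaceCoord (n := n) ι m x₀) (surfaceDomain ι m x₀) := by
  rw [← contMDiffOn_iff_contDiffOn]
  exact (contMDiffOn_chart m).comp ((contMDiffOn_surface hι).mono inter_subset_left)
    fun u hu => hu.2

theorem surfaceCoord_mem_target (hu : u ∈ surfaceDomain ι m x₀) :
    surfaceCoord ι m x₀ u ∈ (extChartAt (𝓡 (n + 1)) m).target :=
  (extChartAt (𝓡 (n + 1)) m).map_source hu.2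

theorem chart_symm_surfaceCoord (hu : u ∈ surfaceDomain ι m x₀) :
    (extChartAt (𝓡 (n + 1)) m).symm (surfaceCoord ι m x₀ u) = ι ((extChartAt (𝓡 n) x₀).symm u) :=
  (extChartAt (𝓡 (n + 1)) m).left_inv hu.2

theorem ofCoord_surfaceCoord (hι : ContMDiff (𝓡 n) (𝓡 (n + 1)) ∞ ι)
    (hu : u ∈ surfaceDomain ι m x₀) (c : Coord n) :
    ofCoord m (surfaceCoord ι m x₀ u, fderiv ℝ (surfaceCoord ι m x₀) u c) =
      ⟨ι ((extChartAt (𝓡 n) x₀).symm u),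
        mfderiv (𝓡 n) (𝓡 (n + 1)) ι ((extChartAt (𝓡 n) x₀).symm u) (chartVec x₀ u c)⟩ := by
  set p : TangentBundle (𝓡 (n + 1)) M := ⟨ι ((extChartAt (𝓡 n) x₀).symm u),
        mfderiv (𝓡 n) (𝓡 (n + 1)) ι ((extChartAt (𝓡 n) x₀).symm u) (chartVec x₀ u c)⟩ with hp
  have h1 : toCoord m p = (surfaceCoord ι m x₀ u, fderiv ℝ (surfaceCoord ι m x₀) u c) := by
    refine Prod.ext rfl ?_
    have hιd : MDifferentiableAt (𝓡 n) (𝓡 (n + 1)) ι ((extChartAt (𝓡 n) x₀).symm u) :=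
      hι.mdifferentiableAt (by simp)
    have h2 := mfderiv_comp u hιd (mdifferentiableAt_chart_symm x₀ hu.1)
    have h3 := mfderiv_comp u (f := ι ∘ (extChartAt (𝓡 n) x₀).symm) (mdifferentiableAt_chart m hu.2)
      (hιd.comp u (mdifferentiableAt_chart_symm x₀ hu.1))
    have h4 : fderiv ℝ (surfaceCoord ι m x₀) u = mfderiv 𝓘(ℝ, Coord n) 𝓘(ℝ, Coord (n + 1))
        (extChartAt (𝓡 (n + 1)) m ∘ ι ∘ (extChartAt (𝓡 n) x₀).symm) u := mfderiv_eq_fderiv.symm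
    rw [h4, h3, h2]
    rfl
  rw [← h1, ofCoord_toCoord]
  exact hu.2

/-- The velocity of a coordinate line in the surface. -/
theorem velocity_surface_line (hι : ContMDiff (𝓡 n) (𝓡 (n + 1)) ∞ ι)
    (hu : u ∈ surfaceDomain ι m x₀) (c : Coord n) :
    velocity (n + 1) (fun r : ℝ => (extChartAt (𝓡 (n + 1)) m).symm
        (surfaceCoord ι m x₀ (u + r • c))) 0 =
      ofCoord m (surfaceCoord ι m x₀ u, fderiv ℝ (surfaceCoord ι m x₀) u c) := by
  have hline : HasDerivAt (fun r : ℝ => u + r • c) c 0 := by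
    simpa using ((hasDerivAt_id (0 : ℝ)).smul_const c).const_add u
  have h0 : u + (0 : ℝ) • c = u := by simp
  have hd : DifferentiableAt ℝ (surfaceCoord ι m x₀) (u + (0 : ℝ) • c) := by
    rw [h0]
    exact ((contDiffOn_surfaceCoord hι).contDiffAt
      ((isOpen_surfaceDomain hι).mem_nhds hu)).differentiableAt (by simp)
  have h1 := HasFDerivAt.comp_hasDerivAt (l := surfaceCoord ι m x₀) (0 : ℝ) hd.hasFDerivAt hline
  rw [h0] at h1
  have h2 := velocity_chart_symm (m := m) h1.differentiableAt (by
    have hcont : ContinuousAt (fun r : ℝ => u + r • c) 0 := hline.continuousAt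
    filter_upwards [hcont.preimage_mem_nhds ((isOpen_surfaceDomain (m := m) hι).mem_nhds
      (by rwa [h0]))] with r hr
    exact surfaceCoord_mem_target hr)
  rw [h1.deriv] at h2
  refine h2.trans ?_
  simp only [Function.comp_apply, h0]

theorem inner_surface (hι : ContMDiff (𝓡 n) (𝓡 (n + 1)) ∞ ι) (hu : u ∈ surfaceDomain ι m x₀)
    {w : Coord (n + 1)} {v : TangentSpace (𝓡 (n + 1)) (ι ((extChartAt (𝓡 n) x₀).symm u))}
    (hv : (⟨ι ((extChartAt (𝓡 n) x₀).symm u), v⟩ : TangentBundle (𝓡 (n + 1)) M) =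
      ofCoord m (surfaceCoord ι m x₀ u, w)) (c : Coord n) :
    g.inner (ι ((extChartAt (𝓡 n) x₀).symm u)) v
      (mfderiv (𝓡 n) (𝓡 (n + 1)) ι ((extChartAt (𝓡 n) x₀).symm u) (chartVec x₀ u c)) =
    chartForm g m (surfaceCoord ι m x₀ u) w (fderiv ℝ (surfaceCoord ι m x₀) u c) :=
  inner_congr g hv (ofCoord_surfaceCoord hι hu c).symm

theorem fderiv_surfaceCoord_injective (hg : IsNondegenerateSurface g ι)
    (hι : ContMDiff (𝓡 n) (𝓡 (n + 1)) ∞ ι) (hu : u ∈ surfaceDomain ι m x₀) :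
    Function.Injective (fderiv ℝ (surfaceCoord ι m x₀) u) := by
  rw [injective_iff_map_eq_zero]
  intro c hc
  have h1 := ofCoord_surfaceCoord hι hu c
  rw [hc] at h1
  refine chartVec_injective x₀ hu.1 ?_
  rw [map_zero]
  refine hg _ _ fun b => ?_
  have h2 : mfderiv (𝓡 n) (𝓡 (n + 1)) ι ((extChartAt (𝓡 n) x₀).symm u) (chartVec x₀ u c) = 0 := by
    have h3 := congrArg (toCoord m) h1.symm
    rw [toCoord_ofCoord] at h3
    · have h4 : (⟨ι ((extChartAt (𝓡 n) x₀).symm u), mfderiv (𝓡 n) (𝓡 (n + 1)) ι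
          ((extChartAt (𝓡 n) x₀).symm u) (chartVec x₀ u c)⟩ : TangentBundle (𝓡 (n + 1)) M) =
          ⟨ι ((extChartAt (𝓡 n) x₀).symm u), 0⟩ := by
        rw [← ofCoord_toCoord m (p := ⟨ι ((extChartAt (𝓡 n) x₀).symm u), 0⟩) hu.2, ← h1]
        congr 1
        refine Prod.ext rfl ?_
        exact (map_zero (mfderiv (𝓡 (n + 1)) 𝓘(ℝ, Coord (n + 1)) (extChartAt (𝓡 (n + 1)) m)
          (ι ((extChartAt (𝓡 n) x₀).symm u)))).symm
      exact eq_of_heq (TotalSpace.mk.inj h4).2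
    · exact surfaceCoord_mem_target hu
  change g.inner _ (mfderiv (𝓡 n) (𝓡 (n + 1)) ι ((extChartAt (𝓡 n) x₀).symm u) (chartVec x₀ u c)) _ = 0
  rw [h2, map_zero, zero_apply]

/-- A hyperplane and a vector outside it span the space. -/
theorem exists_eq_add_smul {A : Coord n →L[ℝ] Coord (n + 1)} (hA : Function.Injective A)
    {w : Coord (n + 1)} (hw : ∀ c, A c ≠ w) (v : Coord (n + 1)) :
    ∃ (c : Coord n) (r : ℝ), v = A c + r • w := by
  let f : Coord n × ℝ →ₗ[ℝ] Coord (n + 1) :=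
    A.toLinearMap.coprod (LinearMap.toSpanSingleton ℝ (Coord (n + 1)) w)
  have hf : ∀ q, f q = A q.1 + q.2 • w := fun q => by simp [f, LinearMap.coprod_apply]
  have hinj : Function.Injective f := by
    rw [injective_iff_map_eq_zero]
    rintro ⟨c, r⟩ h
    rw [hf] at h
    have hr : r = 0 := by
      by_contra hr
      refine hw (-(r⁻¹ • c)) ?_
      rw [map_neg, map_smul, eq_neg_of_add_eq_zero_left h]
      simp [smul_smul, inv_mul_cancel₀ hr]
    subst hr
    have hc : A c = 0 := by simpa using h
    rw [(injective_iff_map_eq_zero A).1 hA c hc]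
    rfl
  have hfin : Module.finrank ℝ (Coord n × ℝ) = Module.finrank ℝ (Coord (n + 1)) := by simp
  obtain ⟨⟨c, r⟩, h⟩ := (LinearMap.injective_iff_surjective_of_finrank_eq_finrank hfin).1 hinj v
  exact ⟨c, r, by rw [← h, hf]⟩

/-- A vector orthogonal to a nondegenerate hyperplane and to a vector outside it vanishes. -/
theorem eq_zero_of_orthogonal (g : LorentzMetric (n + 1) M) {z : Coord (n + 1)}
    (hz : z ∈ (extChartAt (𝓡 (n + 1)) m).target)
    {A : Coord n →L[ℝ] Coord (n + 1)} (hA : Function.Injective A) {w h : Coord (n + 1)}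
    (hw : ∀ c, A c ≠ w) (h1 : ∀ c, chartForm g m z h (A c) = 0) (h2 : chartForm g m z h w = 0) :
    h = 0 := by
  refine chartForm_injective g m hz ?_
  rw [map_zero]
  ext v
  obtain ⟨c, r, rfl⟩ := exists_eq_add_smul hA hw v
  rw [map_add, map_smul, h1, h2]
  simp

end Surface

/-! ### The energy of geodesics between two surfaces -/

section Composition

variable {k : ℕ} {M : Type*} [TopologicalSpace M]
  [ChartedSpace (EuclideanSpace ℝ (Fin k)) M] [IsManifold (𝓡 k) ∞ M]
  {P P' : Type*} [NormedAddCommGroup P] [NormedSpace ℝ P]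
  [NormedAddCommGroup P'] [NormedSpace ℝ P']
  {gf : ℝ → LorentzMetric k M} {τ : P → ℝ} {Γ : ℝ × P → M} {J : Set ℝ} {B : Set P}

theorem IsGeodesicFamily.comp (h : IsGeodesicFamily gf τ Γ J B) {φ : P' → P} {B' : Set P'}
    (hφ : ContDiffOn ℝ ∞ φ B') (hB : MapsTo φ B' B) :
    IsGeodesicFamily gf (τ ∘ φ) (fun x => Γ (x.1, φ x.2)) J B' := by
  refine ⟨ContMDiffOn.comp (f := fun x : ℝ × P' => (x.1, φ x.2)) h.1 (ContDiffOn.contMDiffOn ?_)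
    fun x hx => ⟨hx.1, hB hx.2⟩, fun b hb => h.2 (φ b) (hB hb)⟩
  exact contDiff_fst.contDiffOn.prodMk (hφ.comp contDiff_snd.contDiffOn fun x hx => hx.2)

theorem rayTransform_const (g : LorentzMetric k M) (γ : ℝ → M) :
    rayTransform (fun _ => g) γ = 0 := by
  simp [rayTransform, metricVariation]

end Composition

section RayEnergy

variable {n : ℕ} {M : Type*} [TopologicalSpace M] [T2Space M]
  [ChartedSpace (EuclideanSpace ℝ (Fin (n + 1))) M] [IsManifold (𝓡 (n + 1)) ∞ M]
  {U : Type*} [TopologicalSpace U] [ChartedSpace (EuclideanSpace ℝ (Fin n)) U]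
  [IsManifold (𝓡 n) ∞ U]
  {V : Type*} [TopologicalSpace V] [ChartedSpace (EuclideanSpace ℝ (Fin n)) V]
  [IsManifold (𝓡 n) ∞ V]
  {g : LorentzMetric (n + 1) M} {m m₁ : M}
  (L : LocalExp (fun _ => g) m m₁) (ιU : U → M) (ιV : V → M) (x₀ : U) (y₀ : V)

/-- The coordinates of the endpoints of the geodesic between the points of the surfaces with
coordinates `u` and `v`. -/
def rayEnds (m m₁ : M) (ιU : U → M) (ιV : V → M) (x₀ : U) (y₀ : V) (q : Coord n × Coord n) :
    ℝ × (Coord (n + 1) × Coord (n + 1)) :=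
  (0, (surfaceCoord ιU m x₀ q.1, surfaceCoord ιV m₁ y₀ q.2))

/-- The pairs of points of the surfaces, in coordinates, to which the local inverse of the
exponential map applies. -/
def rayDomain : Set (Coord n × Coord n) :=
  (surfaceDomain ιU m x₀ ×ˢ surfaceDomain ιV m₁ y₀) ∩ rayEnds m m₁ ιU ιV x₀ y₀ ⁻¹' L.O

/-- The coordinates of the initial velocity of the geodesic between two points of the surfaces. -/
def rayW (q : Coord n × Coord n) : Coord (n + 1) := L.W (rayEnds m m₁ ιU ιV x₀ y₀ q)

/-- The energy of the geodesic between two points of the surfaces. -/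
def rayEnergy (q : Coord n × Coord n) : ℝ :=
  chartForm g m (surfaceCoord ιU m x₀ q.1) (rayW L ιU ιV x₀ y₀ q) (rayW L ιU ιV x₀ y₀ q) / 2

/-- The initial velocity of the geodesic between two points of the surfaces. -/
def rayVector (q : Coord n × Coord n) : TangentBundle (𝓡 (n + 1)) M :=
  ofCoord m (surfaceCoord ιU m x₀ q.1, rayW L ιU ιV x₀ y₀ q)

variable {L ιU ιV x₀ y₀} {u v : Coord n}

theorem contDiffOn_rayEnds (hιU : ContMDiff (𝓡 n) (𝓡 (n + 1)) ∞ ιU)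
    (hιV : ContMDiff (𝓡 n) (𝓡 (n + 1)) ∞ ιV) : ContDiffOn ℝ ∞ (rayEnds (n := n) m m₁ ιU ιV x₀ y₀)
    (surfaceDomain ιU m x₀ ×ˢ surfaceDomain ιV m₁ y₀) :=
  contDiffOn_const.prodMk
    (((contDiffOn_surfaceCoord hιU).comp contDiff_fst.contDiffOn fun _ hq => hq.1).prodMk
      ((contDiffOn_surfaceCoord hιV).comp contDiff_snd.contDiffOn fun _ hq => hq.2))

theorem isOpen_rayDomain (hιU : ContMDiff (𝓡 n) (𝓡 (n + 1)) ∞ ιU)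
    (hιV : ContMDiff (𝓡 n) (𝓡 (n + 1)) ∞ ιV) : IsOpen (rayDomain (n := n) L ιU ιV x₀ y₀) :=
  (contDiffOn_rayEnds hιU hιV).continuousOn.isOpen_inter_preimage
    ((isOpen_surfaceDomain hιU).prod (isOpen_surfaceDomain hιV)) L.isOpen_O

theorem contDiffOn_rayW (hιU : ContMDiff (𝓡 n) (𝓡 (n + 1)) ∞ ιU)
    (hιV : ContMDiff (𝓡 n) (𝓡 (n + 1)) ∞ ιV) :
    ContDiffOn ℝ ∞ (rayW (n := n) L ιU ιV x₀ y₀) (rayDomain L ιU ιV x₀ y₀) :=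
  L.contDiffOn_W.comp ((contDiffOn_rayEnds hιU hιV).mono inter_subset_left) fun _ hq => hq.2

theorem contDiffOn_startForm (hιU : ContMDiff (𝓡 n) (𝓡 (n + 1)) ∞ ιU)
    (hιV : ContMDiff (𝓡 n) (𝓡 (n + 1)) ∞ ιV) : ContDiffOn ℝ ∞
    (fun q : Coord n × Coord n => chartForm g m (surfaceCoord ιU m x₀ q.1)
      (rayW L ιU ιV x₀ y₀ q)) (rayDomain L ιU ιV x₀ y₀) :=
  ((contDiffOn_chartForm g m).comp ((contDiffOn_surfaceCoord hιU).comp contDiff_fst.contDiffOn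
    fun _ hq => hq.1.1) fun _ hq => surfaceCoord_mem_target hq.1.1).clm_apply
    (contDiffOn_rayW hιU hιV)

theorem contDiffOn_rayEnergy (hιU : ContMDiff (𝓡 n) (𝓡 (n + 1)) ∞ ιU)
    (hιV : ContMDiff (𝓡 n) (𝓡 (n + 1)) ∞ ιV) :
    ContDiffOn ℝ ∞ (rayEnergy (n := n) L ιU ιV x₀ y₀) (rayDomain L ιU ιV x₀ y₀) :=
  ((contDiffOn_startForm hιU hιV).clm_apply (contDiffOn_rayW hιU hιV)).div_const 2

theorem rayEnergy_eq (q : Coord n × Coord n) :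
    energy g (rayVector L ιU ιV x₀ y₀ q) = rayEnergy L ιU ιV x₀ y₀ q := rfl

theorem rayVector_proj (hq : (u, v) ∈ rayDomain L ιU ιV x₀ y₀) :
    (rayVector L ιU ιV x₀ y₀ (u, v)).1 = ιU ((extChartAt (𝓡 n) x₀).symm u) :=
  chart_symm_surfaceCoord hq.1.1

theorem rayVector_joins (hq : (u, v) ∈ rayDomain L ιU ιV x₀ y₀) :
    Joins g (rayVector L ιU ιV x₀ y₀ (u, v)) (ιV ((extChartAt (𝓡 n) y₀).symm v)) := by
  have h := L.joins (L.mem_B _ hq.2 _ (L.W_mem _ hq.2))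
  rw [L.endpoint _ hq.2] at h
  have h2 := chart_symm_surfaceCoord hq.1.2
  rw [← h2]
  exact h

/-- The geodesic between two points of the surfaces is the only one near the given one. -/
theorem rayVector_unique (hq : (u, v) ∈ rayDomain L ιU ιV x₀ y₀)
    {p : TangentBundle (𝓡 (n + 1)) M} (hp : (toCoord m p).2 ∈ L.N)
    (hpU : p.1 = ιU ((extChartAt (𝓡 n) x₀).symm u))
    (hpV : Joins g p (ιV ((extChartAt (𝓡 n) y₀).symm v))) :
    p = rayVector L ιU ιV x₀ y₀ (u, v) := by
  have hsrc : p.1 ∈ (extChartAt (𝓡 (n + 1)) m).source := hpU ▸ hq.1.1.2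
  have h1 : p = ofCoord m (surfaceCoord ιU m x₀ u, (toCoord m p).2) := by
    conv_lhs => rw [← ofCoord_toCoord m hsrc]
    congr 1
    exact Prod.ext (congrArg (extChartAt (𝓡 (n + 1)) m) hpU) rfl
  rw [h1, rayVector]
  congr 2
  refine L.eq_W _ hq.2 _ hp ?_
  have h2 := L.joins (L.mem_B _ hq.2 _ hp)
  have h3 : Joins g (ofCoord m (surfaceCoord ιU m x₀ u, (toCoord m p).2))
    (ιV ((extChartAt (𝓡 n) y₀).symm v)) := h1 ▸ hpV
  refine (h2.unique h3).trans ?_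
  exact (chart_symm_surfaceCoord hq.1.2).symm

/-- The derivative of the energy of the geodesic between two points of the surfaces, in terms of
its initial and final velocities. -/
theorem hasDerivAt_rayEnergy (hιU : ContMDiff (𝓡 n) (𝓡 (n + 1)) ∞ ιU)
    (hιV : ContMDiff (𝓡 n) (𝓡 (n + 1)) ∞ ιV)
    (hq : (u, v) ∈ rayDomain L ιU ιV x₀ y₀) {γ : ℝ → M}
    (hγ : IsGeodesicSegment g γ 1) (hγ0 : velocity (n + 1) γ 0 = rayVector L ιU ιV x₀ y₀ (u, v))
    {w₁ : Coord (n + 1)}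
    (hγ1 : velocity (n + 1) γ 1 = ofCoord m₁ (surfaceCoord ιV m₁ y₀ v, w₁)) (c d : Coord n) :
    HasDerivAt (fun r : ℝ => rayEnergy L ιU ιV x₀ y₀ (u + r • c, v + r • d))
      (chartForm g m₁ (surfaceCoord ιV m₁ y₀ v) w₁ (fderiv ℝ (surfaceCoord ιV m₁ y₀) v d)
        - chartForm g m (surfaceCoord ιU m x₀ u) (rayW L ιU ιV x₀ y₀ (u, v))
          (fderiv ℝ (surfaceCoord ιU m x₀) u c)) 0 := by
  let line : ℝ → Coord n × Coord n := fun r => (u + r • c, v + r • d)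
  have hline : ContDiff ℝ ∞ line :=
    (contDiff_const.add (contDiff_id.smul contDiff_const)).prodMk
      (contDiff_const.add (contDiff_id.smul contDiff_const))
  have hline0 : line 0 = (u, v) := by simp [line]
  let B : Set ℝ := line ⁻¹' rayDomain L ιU ιV x₀ y₀
  have hB : IsOpen B := (isOpen_rayDomain hιU hιV).preimage hline.continuous
  have h0 : (0 : ℝ) ∈ B := by
    change line 0 ∈ rayDomain L ιU ιV x₀ y₀
    rwa [hline0]
  let φ : ℝ → ℝ × (Coord (n + 1) × Coord (n + 1)) := fun r =>
    (0, (surfaceCoord ιU m x₀ (line r).1, rayW L ιU ιV x₀ y₀ (line r)))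
  have hφ : ContDiffOn ℝ ∞ φ B :=
    contDiffOn_const.prodMk (((contDiffOn_surfaceCoord hιU).comp
      (contDiff_fst.comp hline).contDiffOn fun r hr => hr.1.1).prodMk
      ((contDiffOn_rayW hιU hιV).comp hline.contDiffOn fun r hr => hr))
  have hφB : MapsTo φ B L.B := fun r hr => L.mem_B _ hr.2 _ (L.W_mem _ hr.2)
  have hfam : IsGeodesicFamily (fun _ => g) id (fun x => L.Γ (x.1, φ x.2))
      (Ioo (-L.η) (1 + L.η)) B := L.family.comp hφ hφB
  have hvar := first_variation isOpen_univ (smoothFamilyOn_const g univ) L.η_pos hfam hB h0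
    (mem_univ _)
  have hvel : ∀ r ∈ B, velocity (n + 1) (fun t => L.Γ (t, φ r)) 0 =
      rayVector L ιU ιV x₀ y₀ (line r) := fun r hr => L.velocity_zero _ (hφB hr)
  have hend : ∀ r ∈ B, L.Γ (1, φ r) =
      (extChartAt (𝓡 (n + 1)) m₁).symm (surfaceCoord ιV m₁ y₀ (v + r • d)) := fun r hr =>
    L.endpoint _ hr.2
  have hstart : ∀ r ∈ B, L.Γ (0, φ r) =
      (extChartAt (𝓡 (n + 1)) m).symm (surfaceCoord ιU m x₀ (u + r • c)) := fun r hr =>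
    congrArg TotalSpace.proj (hvel r hr)
  have hdU : u ∈ surfaceDomain ιU m x₀ := hq.1.1
  have hdV : v ∈ surfaceDomain ιV m₁ y₀ := hq.1.2
  -- the variation field at the endpoints
  have hev0 : (fun r => L.Γ (0, φ r)) =ᶠ[𝓝 0] fun r =>
      (extChartAt (𝓡 (n + 1)) m).symm (surfaceCoord ιU m x₀ (u + r • c)) :=
    eventually_of_mem (hB.mem_nhds h0) hstart
  have hev1 : (fun r => L.Γ (1, φ r)) =ᶠ[𝓝 0] fun r =>
      (extChartAt (𝓡 (n + 1)) m₁).symm (surfaceCoord ιV m₁ y₀ (v + r • d)) :=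
    eventually_of_mem (hB.mem_nhds h0) hend
  have hV0 := (velocity_congr (k := n + 1) hev0).trans (velocity_surface_line hιU hdU c)
  have hV1 := (velocity_congr (k := n + 1) hev1).trans (velocity_surface_line hιV hdV d)
  have hbase : velocity (n + 1) (fun t => L.Γ (t, φ 0)) 0 = velocity (n + 1) γ 0 := by
    rw [hvel 0 h0, hγ0, hline0]
  obtain ⟨ε, hε, heq⟩ := IsGeodesicSegment.eqOn (g := g) zero_le_one ⟨L.η, L.η_pos, hfam.2 0 h0⟩
    hγ hbase
  have hvel1 : velocity (n + 1) (fun t => L.Γ (t, φ 0)) 1 = velocity (n + 1) γ 1 := by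
    have hev : (fun t => L.Γ (t, φ 0)) =ᶠ[𝓝 1] γ := by
      filter_upwards [isOpen_Ioo.mem_nhds (show (1 : ℝ) ∈ Ioo (-ε) (1 + ε) from
        ⟨by linarith, by linarith⟩)] with t ht using heq ht
    exact velocity_congr hev
  have hp1 : variationPairing g (fun x => L.Γ (x.1, φ x.2)) 1 =
      chartForm g m₁ (surfaceCoord ιV m₁ y₀ v) w₁ (fderiv ℝ (surfaceCoord ιV m₁ y₀) v d) :=
    variationPairing_eq (hvel1.trans hγ1) hV1
  have hp0 : variationPairing g (fun x => L.Γ (x.1, φ x.2)) 0 =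
      chartForm g m (surfaceCoord ιU m x₀ u) (rayW L ιU ιV x₀ y₀ (u, v))
          (fderiv ℝ (surfaceCoord ιU m x₀) u c) :=
    variationPairing_eq (hbase.trans hγ0) hV0
  rw [hp1, hp0, rayTransform_const, zero_div, add_zero] at hvar
  have hev : (fun r : ℝ => rayEnergy L ιU ιV x₀ y₀ (u + r • c, v + r • d)) =ᶠ[𝓝 0]
      fun r => energy g (velocity (n + 1) (fun t => L.Γ (t, φ r)) 0) := by
    filter_upwards [hB.mem_nhds h0] with r hr
    exact (congrArg (energy g) (hvel r hr)).symm
  exact HasDerivAt.congr_of_eventuallyEq hvar hev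

/-- The differential of the energy: the pairing with the final velocity on the second surface minus
the pairing with the initial velocity on the first one. -/
theorem fderiv_rayEnergy (hιU : ContMDiff (𝓡 n) (𝓡 (n + 1)) ∞ ιU)
    (hιV : ContMDiff (𝓡 n) (𝓡 (n + 1)) ∞ ιV)
    (hq : (u, v) ∈ rayDomain L ιU ιV x₀ y₀) {γ : ℝ → M}
    (hγ : IsGeodesicSegment g γ 1) (hγ0 : velocity (n + 1) γ 0 = rayVector L ιU ιV x₀ y₀ (u, v))
    {w₁ : Coord (n + 1)}
    (hγ1 : velocity (n + 1) γ 1 = ofCoord m₁ (surfaceCoord ιV m₁ y₀ v, w₁)) (c d : Coord n) :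
    fderiv ℝ (rayEnergy L ιU ιV x₀ y₀) (u, v) (c, d) =
      chartForm g m₁ (surfaceCoord ιV m₁ y₀ v) w₁ (fderiv ℝ (surfaceCoord ιV m₁ y₀) v d)
        - chartForm g m (surfaceCoord ιU m x₀ u) (rayW L ιU ιV x₀ y₀ (u, v))
          (fderiv ℝ (surfaceCoord ιU m x₀) u c) := by
  have hd : DifferentiableAt ℝ (rayEnergy L ιU ιV x₀ y₀) (u + (0 : ℝ) • c, v + (0 : ℝ) • d) := by
    simp only [zero_smul, add_zero]
    exact ((contDiffOn_rayEnergy hιU hιV).contDiffAt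
      ((isOpen_rayDomain hιU hιV).mem_nhds hq)).differentiableAt (by simp)
  have hline : HasDerivAt (fun r : ℝ => (u + r • c, v + r • d)) (c, d) 0 := by
    refine HasDerivAt.prodMk ?_ ?_
    · simpa using ((hasDerivAt_id (0 : ℝ)).smul_const c).const_add u
    · simpa using ((hasDerivAt_id (0 : ℝ)).smul_const d).const_add v
  have h1 := HasFDerivAt.comp_hasDerivAt (l := rayEnergy L ιU ιV x₀ y₀) (0 : ℝ) hd.hasFDerivAt hline
  simp only [zero_smul, add_zero] at h1
  exact h1.unique (hasDerivAt_rayEnergy hιU hιV hq hγ hγ0 hγ1 c d)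

end RayEnergy

/-! ### Initial covectors of light rays -/

section Rescaling

variable {k : ℕ} {M : Type*} [TopologicalSpace M]
  [ChartedSpace (EuclideanSpace ℝ (Fin k)) M] [IsManifold (𝓡 k) ∞ M]
  {g : LorentzMetric k M} {γ : ℝ → M}

theorem IsGeodesicSegment.comp_mul {T ρ : ℝ} (h : IsGeodesicSegment g γ (ρ * T)) (hρ : 0 < ρ) :
    IsGeodesicSegment g (fun t => γ (ρ * t)) T := by
  obtain ⟨ε, hε, h⟩ := h
  have h1 := h.comp_affine ρ 0
  simp only [add_zero] at h1
  refine ⟨ε / ρ, div_pos hε hρ, h1.mono fun t ht => ⟨?_, ?_⟩⟩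
  · have := mul_lt_mul_of_pos_left ht.1 hρ
    rwa [mul_neg, mul_div_cancel₀ _ hρ.ne'] at this
  · have := mul_lt_mul_of_pos_left ht.2 hρ
    rwa [mul_add, mul_div_cancel₀ _ hρ.ne'] at this

theorem IsGeodesicSegment.mdifferentiableAt {T t : ℝ} (h : IsGeodesicSegment g γ T) (h0 : 0 ≤ t)
    (hT : t ≤ T) : MDifferentiableAt 𝓘(ℝ, ℝ) (𝓡 k) γ t := by
  obtain ⟨ε, hε, h⟩ := h
  exact h.mdifferentiableAt isOpen_Ioo ⟨by linarith, by linarith⟩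

theorem velocity_comp_mul {t ρ : ℝ} (h : MDifferentiableAt 𝓘(ℝ, ℝ) (𝓡 k) γ (ρ * t)) :
    velocity k (fun t => γ (ρ * t)) t = ⟨γ (ρ * t), ρ • (velocity k γ (ρ * t)).2⟩ := by
  have h1 := velocity_comp_affine (k := k) (γ := γ) (t := t) (r := ρ) (a := 0) (by rwa [add_zero])
  have hf : (fun t => γ (ρ * t + 0)) = fun t => γ (ρ * t) := by simp
  rw [hf, add_zero] at h1
  exact h1

theorem ofCoord_smul {m : M} {z w : Coord k} (ρ : ℝ) {p : TangentBundle (𝓡 k) M}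
    (hp : p = ofCoord m (z, w)) :
    (⟨p.1, ρ • p.2⟩ : TangentBundle (𝓡 k) M) = ofCoord m (z, ρ • w) := by
  subst hp
  refine TotalSpace.ext rfl (heq_of_eq ?_)
  exact ((chartVec m z).map_smul ρ w).symm

/-- The derivative of the exponential map at `v`, applied to `v` itself, is the final velocity of
the geodesic. -/
theorem fderiv_expMap_self [T2Space M] {m m₁ : M} {z w z' w₁ : Coord k}
    (hγ : IsGeodesicSegment g γ 1) (h0 : velocity k γ 0 = ofCoord m (z, w))
    (h1 : velocity k γ 1 = ofCoord m₁ (z', w₁)) (hz' : z' ∈ (extChartAt (𝓡 k) m₁).target)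
    (hd : DifferentiableAt ℝ (fun w => extChartAt (𝓡 k) m₁ (expMap g (ofCoord m (z, w)))) w) :
    fderiv ℝ (fun w => extChartAt (𝓡 k) m₁ (expMap g (ofCoord m (z, w)))) w w = w₁ := by
  have hline : HasDerivAt (fun ρ : ℝ => ρ • w) w 1 := by
    simpa using (hasDerivAt_id (1 : ℝ)).smul_const w
  have hd1 : DifferentiableAt ℝ (fun w => extChartAt (𝓡 k) m₁ (expMap g (ofCoord m (z, w))))
      ((1 : ℝ) • w) := by rwa [one_smul]
  have h2 := HasFDerivAt.comp_hasDerivAt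
    (l := fun w => extChartAt (𝓡 k) m₁ (expMap g (ofCoord m (z, w)))) (1 : ℝ) hd1.hasFDerivAt hline
  rw [one_smul] at h2
  have hsrc : γ 1 ∈ (extChartAt (𝓡 k) m₁).source := by
    have h3 : γ 1 = (extChartAt (𝓡 k) m₁).symm z' := congrArg TotalSpace.proj h1
    rw [h3]
    exact (extChartAt (𝓡 k) m₁).map_target hz'
  have hmd := hγ.mdifferentiableAt zero_le_one le_rfl
  obtain ⟨ε, hε, hgeo⟩ := hγ
  have hev : (fun ρ : ℝ => extChartAt (𝓡 k) m₁ (expMap g (ofCoord m (z, ρ • w)))) =ᶠ[𝓝 1]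
      fun ρ => extChartAt (𝓡 k) m₁ (γ ρ) := by
    filter_upwards [isOpen_Ioo.mem_nhds (show (1 : ℝ) ∈ Ioo 0 (1 + ε) from
      ⟨one_pos, by linarith⟩)] with ρ hρ
    congr 1
    refine Joins.expMap_eq ⟨fun t => γ (ρ * t), IsGeodesicSegment.comp_mul
      ⟨min ε (1 + ε - ρ), lt_min hε (by linarith [hρ.2]), hgeo.mono (Ioo_subset_Ioo ?_ ?_)⟩
      hρ.1, ?_, ?_⟩
    · exact neg_le_neg (min_le_left _ _)
    · linarith [min_le_right ε (1 + ε - ρ)]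
    · rw [velocity_comp_mul]
      · rw [mul_zero]
        exact ofCoord_smul ρ h0
      · rw [mul_zero]
        exact hgeo.mdifferentiableAt isOpen_Ioo ⟨by linarith, by linarith⟩
    · simp
  have h3 := toCoord_velocity hmd hsrc
  rw [h1, toCoord_ofCoord] at h3
  · have h4 : w₁ = deriv (fun s => extChartAt (𝓡 k) m₁ (γ s)) 1 := congrArg Prod.snd h3
    rw [h4, ← hev.deriv_eq]
    exact h2.deriv.symm
  · exact hz'

end Rescaling

section RayChart

variable {n : ℕ} {M : Type*} [TopologicalSpace M] [T2Space M]
  [ChartedSpace (EuclideanSpace ℝ (Fin (n + 1))) M] [IsManifold (𝓡 (n + 1)) ∞ M]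
  {U : Type*} [TopologicalSpace U] [ChartedSpace (EuclideanSpace ℝ (Fin n)) U]
  [IsManifold (𝓡 n) ∞ U]
  {V : Type*} [TopologicalSpace V] [ChartedSpace (EuclideanSpace ℝ (Fin n)) V]
  [IsManifold (𝓡 n) ∞ V]
  {g : LorentzMetric (n + 1) M} {m m₁ : M}
  {L : LocalExp (fun _ => g) m m₁} {ιU : U → M} {ιV : V → M} {x₀ : U} {y₀ : V} {u v : Coord n}

/-- Transversality in coordinates: a transversal vector is not in the image of the derivative of the
coordinate representation of the surface. -/
theorem isTransversalTo_coord {ι : U → M} (hι : ContMDiff (𝓡 n) (𝓡 (n + 1)) ∞ ι)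
    (hu : u ∈ surfaceDomain ι m x₀) {w : Coord (n + 1)} {p : TangentBundle (𝓡 (n + 1)) M}
    (hp : p = ofCoord m (surfaceCoord ι m x₀ u, w))
    (h : IsTransversalTo ι ((extChartAt (𝓡 n) x₀).symm u) p) (c : Coord n) :
    fderiv ℝ (surfaceCoord ι m x₀) u c ≠ w := by
  rintro rfl
  refine h (chartVec x₀ u c) ?_
  rw [hp, ofCoord_surfaceCoord hι hu]

/-- The covector on the first surface given by the initial velocity of the geodesic between two
points of the surfaces, in coordinates. -/
def startCovector (L : LocalExp (fun _ => g) m m₁) (ιU : U → M) (ιV : V → M) (x₀ : U) (y₀ : V)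
    (q : Coord n × Coord n) : Coord n →L[ℝ] ℝ :=
  (chartForm g m (surfaceCoord ιU m x₀ q.1) (rayW L ιU ιV x₀ y₀ q)).comp
    (fderiv ℝ (surfaceCoord ιU m x₀) q.1)

theorem contDiffOn_startCovector (hιU : ContMDiff (𝓡 n) (𝓡 (n + 1)) ∞ ιU)
    (hιV : ContMDiff (𝓡 n) (𝓡 (n + 1)) ∞ ιV) :
    ContDiffOn ℝ ∞ (startCovector L ιU ιV x₀ y₀) (rayDomain L ιU ιV x₀ y₀) := by
  refine (contDiffOn_startForm hιU hιV).clm_comp ?_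
  exact ((contDiffOn_surfaceCoord hιU).fderiv_of_isOpen (isOpen_surfaceDomain hιU) (m := ∞)
    (by simp)).comp contDiff_fst.contDiffOn fun _ hq => hq.1.1

/-- The initial covector, up to scale, and the energy of the geodesic from a point of the first
surface determine the endpoint on the second surface. -/
def rayMap (L : LocalExp (fun _ => g) m m₁) (ιU : U → M) (ιV : V → M) (x₀ : U) (y₀ : V)
    (q : Coord n × Coord n × ℝ) : Coord n × (Coord n →L[ℝ] ℝ) × ℝ :=
  (q.1, (q.2.2 • startCovector L ιU ιV x₀ y₀ (q.1, q.2.1), rayEnergy L ιU ιV x₀ y₀ (q.1, q.2.1)))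

theorem contDiffOn_rayMap (hιU : ContMDiff (𝓡 n) (𝓡 (n + 1)) ∞ ιU)
    (hιV : ContMDiff (𝓡 n) (𝓡 (n + 1)) ∞ ιV) :
    ContDiffOn ℝ ∞ (rayMap L ιU ιV x₀ y₀)
      ((fun q : Coord n × Coord n × ℝ => (q.1, q.2.1)) ⁻¹' rayDomain L ιU ιV x₀ y₀) := by
  have hpr : ContDiff ℝ ∞ fun q : Coord n × Coord n × ℝ => (q.1, q.2.1) := by fun_prop
  refine contDiff_fst.contDiffOn.prodMk (ContDiffOn.prodMk (ContDiffOn.fun_smul ?_ ?_) ?_)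
  · exact (contDiff_snd.comp contDiff_snd).contDiffOn
  · exact (contDiffOn_startCovector hιU hιV).comp hpr.contDiffOn fun _ hq => hq
  · exact (contDiffOn_rayEnergy hιU hιV).comp hpr.contDiffOn fun _ hq => hq

theorem differentiableAt_expMap_rayW (hq : (u, v) ∈ rayDomain L ιU ιV x₀ y₀) :
    DifferentiableAt ℝ (fun w => extChartAt (𝓡 (n + 1)) m₁
      (expMap g (ofCoord m (surfaceCoord ιU m x₀ u, w)))) (rayW L ιU ιV x₀ y₀ (u, v)) := by
  have h := L.differentiableAt_expMap (c := rayEnds m m₁ ιU ιV x₀ y₀ (u, v)) hq.2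
  simp only [rayEnds] at h
  rw [rayW, rayEnds]
  exact h

theorem startCovector_apply (q : Coord n × Coord n) (c : Coord n) :
    startCovector L ιU ιV x₀ y₀ q c = chartForm g m (surfaceCoord ιU m x₀ q.1)
      (rayW L ιU ιV x₀ y₀ q) (fderiv ℝ (surfaceCoord ιU m x₀) q.1 c) := rfl

/-- The derivative of the exponential map takes the derivative of the initial velocity, when the
endpoint `v` moves on the second surface, to the velocity of the endpoint. -/
theorem fderiv_expMap_rayW (hιU : ContMDiff (𝓡 n) (𝓡 (n + 1)) ∞ ιU)
    (hιV : ContMDiff (𝓡 n) (𝓡 (n + 1)) ∞ ιV) (hq : (u, v) ∈ rayDomain L ιU ιV x₀ y₀) (d : Coord n) :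
    fderiv ℝ (fun w => extChartAt (𝓡 (n + 1)) m₁
        (expMap g (ofCoord m (surfaceCoord ιU m x₀ u, w)))) (rayW L ιU ιV x₀ y₀ (u, v))
        (fderiv ℝ (rayW L ιU ιV x₀ y₀) (u, v) (0, d)) =
      fderiv ℝ (surfaceCoord ιV m₁ y₀) v d := by
  have hW : DifferentiableAt ℝ (rayW L ιU ιV x₀ y₀) (u, v) :=
    ((contDiffOn_rayW hιU hιV).contDiffAt
      ((isOpen_rayDomain hιU hιV).mem_nhds hq)).differentiableAt (by simp)
  have hb : DifferentiableAt ℝ (surfaceCoord ιV m₁ y₀) v :=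
    ((contDiffOn_surfaceCoord hιV).contDiffAt
      ((isOpen_surfaceDomain hιV).mem_nhds hq.1.2)).differentiableAt (by simp)
  have h1 := HasFDerivAt.comp v (g := fun w => extChartAt (𝓡 (n + 1)) m₁
    (expMap g (ofCoord m (surfaceCoord ιU m x₀ u, w)))) (f := fun v => rayW L ιU ιV x₀ y₀ (u, v))
    (differentiableAt_expMap_rayW hq).hasFDerivAt
    (HasFDerivAt.comp v (g := rayW L ιU ιV x₀ y₀) hW.hasFDerivAt (hasFDerivAt_prodMk_right u v))
  have hline : ContinuousAt (fun v : Coord n => (u, v)) v := by fun_prop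
  have h2 := hb.hasFDerivAt.congr_of_eventuallyEq (f₁ := (fun w => extChartAt (𝓡 (n + 1)) m₁
    (expMap g (ofCoord m (surfaceCoord ιU m x₀ u, w)))) ∘ fun v => rayW L ιU ιV x₀ y₀ (u, v)) (by
      filter_upwards [hline.preimage_mem_nhds ((isOpen_rayDomain hιU hιV).mem_nhds hq)] with v' hv'
      exact congrArg (extChartAt (𝓡 (n + 1)) m₁) (rayVector_joins hv').expMap_eq)
  exact congrArg (fun L : Coord n →L[ℝ] Coord (n + 1) => L d) (h1.unique h2)

/-- The local structure of the light rays between the two surfaces near a given transversal light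
ray without conjugate endpoints: initial point and initial covector of a light ray, up to scale,
determine its endpoint infinitesimally. For a vector `(0, d, l)` in the kernel, let `w` be the
initial velocity and `dw` its derivative. Then `l w + dw` is orthogonal to the first surface and to
`w`, hence zero, so that the endpoint on the second surface moves by `-l` times the final velocity;
by transversality, `l = 0` and `d = 0`. -/
theorem injective_fderiv_rayMap (hιU : ContMDiff (𝓡 n) (𝓡 (n + 1)) ∞ ιU)
    (hιV : ContMDiff (𝓡 n) (𝓡 (n + 1)) ∞ ιV) (hU : IsNondegenerateSurface g ιU)
    (hV : IsNondegenerateSurface g ιV) (hq : (u, v) ∈ rayDomain L ιU ιV x₀ y₀) {γ : ℝ → M}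
    (hγ : IsGeodesicSegment g γ 1) (hγ0 : velocity (n + 1) γ 0 = rayVector L ιU ιV x₀ y₀ (u, v))
    (hnull : rayEnergy L ιU ιV x₀ y₀ (u, v) = 0)
    (htU : IsTransversalTo ιU ((extChartAt (𝓡 n) x₀).symm u) (velocity (n + 1) γ 0))
    (htV : IsTransversalTo ιV ((extChartAt (𝓡 n) y₀).symm v) (velocity (n + 1) γ 1)) :
    Function.Injective (fderiv ℝ (rayMap L ιU ιV x₀ y₀) (u, v, 1)) := by
  have hw := isTransversalTo_coord (u := u) hιU hq.1.1 hγ0 htU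
  have hDa := fderiv_surfaceCoord_injective (u := u) hU hιU hq.1.1
  have hDb := fderiv_surfaceCoord_injective (u := v) hV hιV hq.1.2
  have hz := surfaceCoord_mem_target (u := u) hq.1.1
  have hz' := surfaceCoord_mem_target (u := v) hq.1.2
  -- the final velocity in coordinates
  have hend : γ 1 = ιV ((extChartAt (𝓡 n) y₀).symm v) :=
    Joins.unique ⟨γ, hγ, hγ0, rfl⟩ (rayVector_joins hq)
  have hsrc : γ 1 ∈ (extChartAt (𝓡 (n + 1)) m₁).source := hend ▸ hq.1.2.2
  obtain ⟨w₁, hγ1⟩ : ∃ w₁, velocity (n + 1) γ 1 = ofCoord m₁ (surfaceCoord ιV m₁ y₀ v, w₁) := by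
    refine ⟨deriv (fun s => extChartAt (𝓡 (n + 1)) m₁ (γ s)) 1,
      (velocity_eq_ofCoord (hγ.mdifferentiableAt zero_le_one le_rfl) hsrc).trans ?_⟩
    rw [hend]
    rfl
  have hw₁ := isTransversalTo_coord (u := v) hιV hq.1.2 hγ1 htV
  have hγ0' : velocity (n + 1) γ 0 =
      ofCoord m (surfaceCoord ιU m x₀ u, rayW L ιU ιV x₀ y₀ (u, v)) := hγ0
  have hX1 := fderiv_expMap_self hγ hγ0' hγ1 hz' (differentiableAt_expMap_rayW hq)
  set q₀ : Coord n × Coord n := (u, v) with hq₀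
  set w := rayW L ιU ιV x₀ y₀ q₀ with hw_def
  set z := surfaceCoord ιU m x₀ u with hz_def
  have hpr : Continuous fun q : Coord n × Coord n × ℝ => (q.1, q.2.1) := by fun_prop
  have hF : HasFDerivAt (rayMap L ιU ιV x₀ y₀) (fderiv ℝ (rayMap L ιU ιV x₀ y₀) (u, v, 1))
      (u, v, 1) :=
    (((contDiffOn_rayMap hιU hιV).contDiffAt (((isOpen_rayDomain hιU hιV).preimage hpr).mem_nhds
      hq)).differentiableAt (by simp)).hasFDerivAt
  set F' := fderiv ℝ (rayMap L ιU ιV x₀ y₀) (u, v, 1) with hF'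
  have hF1 : ∀ p, (F' p).1 = p.1 := by
    intro p
    have h1 : HasFDerivAt (fun q => (rayMap L ιU ιV x₀ y₀ q).1) _ (u, v, 1) := hF.fst
    exact congrArg (fun L : (Coord n × Coord n × ℝ) →L[ℝ] Coord n => L p)
      (h1.unique hasFDerivAt_fst)
  rw [injective_iff_map_eq_zero]
  rintro ⟨du, d, l⟩ hker
  have hdu : du = 0 := by
    have := hF1 (du, d, l)
    rw [hker] at this
    exact this.symm
  subst hdu
  -- derivatives along the line in the direction of a vector in the kernel
  have hline : HasDerivAt (fun r : ℝ => (u, v + r • d, 1 + r * l)) ((0 : Coord n), d, l) 0 := by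
    refine (hasDerivAt_const 0 u).prodMk (HasDerivAt.prodMk ?_ ?_)
    · simpa using ((hasDerivAt_id (0 : ℝ)).smul_const d).const_add v
    · simpa using ((hasDerivAt_id (0 : ℝ)).mul_const l).const_add 1
  have hFl : HasFDerivAt (rayMap L ιU ιV x₀ y₀) F' (u, v + (0 : ℝ) • d, 1 + (0 : ℝ) * l) := by
    simpa using hF
  have hcomp := HasFDerivAt.comp_hasDerivAt (l := rayMap L ιU ιV x₀ y₀) (0 : ℝ) hFl hline
  rw [hker] at hcomp
  have hWd : HasDerivAt (fun r : ℝ => rayW L ιU ιV x₀ y₀ (u, v + r • d))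
      (fderiv ℝ (rayW L ιU ιV x₀ y₀) q₀ (0, d)) 0 := by
    have h1 : HasFDerivAt (rayW L ιU ιV x₀ y₀) (fderiv ℝ (rayW L ιU ιV x₀ y₀) q₀)
        (u, v + (0 : ℝ) • d) := by
      have := ((contDiffOn_rayW (L := L) (x₀ := x₀) (y₀ := y₀) hιU hιV).contDiffAt
        ((isOpen_rayDomain hιU hιV).mem_nhds hq)).differentiableAt (by simp)
      simpa using this.hasFDerivAt
    refine HasFDerivAt.comp_hasDerivAt (l := rayW L ιU ιV x₀ y₀) (0 : ℝ) h1 ?_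
    refine (hasDerivAt_const 0 u).prodMk ?_
    simpa using ((hasDerivAt_id (0 : ℝ)).smul_const d).const_add v
  set dw := fderiv ℝ (rayW L ιU ιV x₀ y₀) q₀ (0, d) with hdw
  have hform : HasDerivAt (fun r : ℝ => chartForm g m z (rayW L ιU ιV x₀ y₀ (u, v + r • d)))
      (chartForm g m z dw) 0 := (chartForm g m z).hasFDerivAt.comp_hasDerivAt 0 hWd
  -- the covector `l • startCovector` is stationary
  have hcov : ∀ c, chartForm g m z (l • w + dw) (fderiv ℝ (surfaceCoord ιU m x₀) u c) = 0 := by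
    intro c
    have h1 : HasDerivAt (fun r : ℝ => (1 + r * l) * chartForm g m z
        (rayW L ιU ιV x₀ y₀ (u, v + r • d)) (fderiv ℝ (surfaceCoord ιU m x₀) u c)) 0 0 := by
      have h2 := (((hasFDerivAt_fst.comp_hasDerivAt 0
        (hasFDerivAt_snd.comp_hasDerivAt 0 hcomp) :)).clm_apply (hasDerivAt_const 0 c))
      refine (h2.congr_deriv (by simp)).congr_of_eventuallyEq (Eventually.of_forall fun r => ?_)
      rfl
    have h3 : HasDerivAt (fun r : ℝ => 1 + r * l) l 0 := by
      simpa using ((hasDerivAt_id (0 : ℝ)).mul_const l).const_add 1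
    have h4 := h3.mul (hform.clm_apply (hasDerivAt_const 0 (fderiv ℝ (surfaceCoord ιU m x₀) u c)))
    have h5 := h1.unique h4
    simp only [zero_smul, add_zero, zero_mul, one_mul, map_zero] at h5
    rw [map_add, map_smul, add_apply, smul_apply, smul_eq_mul]
    exact h5.symm
  -- the energy is stationary
  have hen : chartForm g m z w dw = 0 := by
    have h1 : HasDerivAt (fun r : ℝ => rayEnergy L ιU ιV x₀ y₀ (u, v + r • d)) 0 0 :=
      (hasFDerivAt_snd.comp_hasDerivAt 0 (hasFDerivAt_snd.comp_hasDerivAt 0 hcomp) :)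
    have h2 := h1.unique ((hform.clm_apply hWd).div_const 2)
    simp only [zero_smul, add_zero] at h2
    have h3 := chartForm_symm g m z dw w
    linarith
  -- `w` is lightlike and transversal to the first surface
  have hzero : l • w + dw = 0 := by
    refine eq_zero_of_orthogonal g hz hDa hw hcov ?_
    have h1 : chartForm g m z w w / 2 = 0 := hnull
    rw [map_add, map_smul, add_apply, smul_apply, smul_eq_mul, chartForm_symm g m z dw w, hen]
    rw [show chartForm g m z w w = 0 by linarith]
    simp
  -- apply the derivative of the exponential map, which takes `w` to the final velocity `w₁`
  have hDbd : fderiv ℝ (surfaceCoord ιV m₁ y₀) v d = -(l • w₁) := by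
    rw [← fderiv_expMap_rayW hιU hιV hq d, ← hX1]
    have h1 : fderiv ℝ (rayW L ιU ιV x₀ y₀) (u, v) (0, d) = -(l • w) := by
      rw [← hq₀, ← hdw]
      exact eq_neg_of_add_eq_zero_right hzero
    rw [h1, map_neg, map_smul]
  have hl : l = 0 := by
    by_contra hl
    refine hw₁ (-(l⁻¹ • d)) ?_
    rw [map_neg, map_smul, hDbd, smul_neg, neg_neg, smul_smul, inv_mul_cancel₀ hl, one_smul]
  subst hl
  have hd : d = 0 := by
    refine (injective_iff_map_eq_zero _).1 hDb d ?_
    rw [hDbd, zero_smul, neg_zero]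
  rw [hd]
  rfl

end RayChart

/-! ### Variation of the metric -/

section Congr

variable {k : ℕ} {M : Type*} [TopologicalSpace M]
  [ChartedSpace (EuclideanSpace ℝ (Fin k)) M] [IsManifold (𝓡 k) ∞ M]
  {gf : ℝ → LorentzMetric k M} {γ₁ γ₂ : ℝ → M}

theorem rayTransform_congr {ε : ℝ} (hε : 0 < ε) (h : EqOn γ₁ γ₂ (Ioo (-ε) (1 + ε))) :
    rayTransform gf γ₁ = rayTransform gf γ₂ := by
  refine intervalIntegral.integral_congr fun t ht => ?_
  rw [uIcc_of_le zero_le_one] at ht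
  have hev : γ₁ =ᶠ[𝓝 t] γ₂ := by
    filter_upwards [isOpen_Ioo.mem_nhds (show t ∈ Ioo (-ε) (1 + ε) from
      ⟨by linarith [ht.1], by linarith [ht.2]⟩)] with r hr using h hr
  exact congrArg (fun p : TangentBundle (𝓡 k) M => metricVariation gf p.1 p.2 p.2)
    (velocity_congr hev)

theorem velocity_of_eventually_const {m : M} {z : Coord k} {t : ℝ}
    (hz : z ∈ (extChartAt (𝓡 k) m).target)
    (h : ∀ᶠ r in 𝓝 t, γ₁ r = (extChartAt (𝓡 k) m).symm z) :
    velocity k γ₁ t = ofCoord m (z, 0) := by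
  have hev : γ₁ =ᶠ[𝓝 t] fun _ => (extChartAt (𝓡 k) m).symm z := h
  rw [velocity_congr hev]
  have h1 := velocity_chart_symm (m := m) (c := fun _ : ℝ => z) (t := t) (differentiableAt_const z)
    (Eventually.of_forall fun _ => hz)
  rwa [deriv_const] at h1

end Congr

section RayChart

variable {n : ℕ} {M : Type*} [TopologicalSpace M] [T2Space M]
  [ChartedSpace (EuclideanSpace ℝ (Fin (n + 1))) M] [IsManifold (𝓡 (n + 1)) ∞ M]
  {U : Type*} [TopologicalSpace U] [ChartedSpace (EuclideanSpace ℝ (Fin n)) U]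
  [IsManifold (𝓡 n) ∞ U]
  {V : Type*} [TopologicalSpace V] [ChartedSpace (EuclideanSpace ℝ (Fin n)) V]
  [IsManifold (𝓡 n) ∞ V]
  {g : LorentzMetric (n + 1) M} {m m₁ : M}
  {L : LocalExp (fun _ => g) m m₁} {ιU : U → M} {ιV : V → M} {x₀ : U} {y₀ : V} {u v : Coord n}
  {𝒲 : Set (TangentBundle (𝓡 (n + 1)) M)}

/-- The final velocity of the geodesic between two points of the surfaces, in coordinates. -/
theorem exists_final_velocity (hq : (u, v) ∈ rayDomain L ιU ιV x₀ y₀) {γ : ℝ → M}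
    (hγ : IsGeodesicSegment g γ 1) (hγ0 : velocity (n + 1) γ 0 = rayVector L ιU ιV x₀ y₀ (u, v)) :
    ∃ w₁, velocity (n + 1) γ 1 = ofCoord m₁ (surfaceCoord ιV m₁ y₀ v, w₁) := by
  have hend : γ 1 = ιV ((extChartAt (𝓡 n) y₀).symm v) :=
    Joins.unique ⟨γ, hγ, hγ0, rfl⟩ (rayVector_joins hq)
  have hsrc : γ 1 ∈ (extChartAt (𝓡 (n + 1)) m₁).source := hend ▸ hq.1.2.2
  refine ⟨deriv (fun s => extChartAt (𝓡 (n + 1)) m₁ (γ s)) 1,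
    (velocity_eq_ofCoord (hγ.mdifferentiableAt zero_le_one le_rfl) hsrc).trans ?_⟩
  rw [hend]
  rfl

/-- The first variation formula for geodesics with fixed endpoints: the derivative of the energy in
the parameter of a family of metrics is half the light ray transform. -/
theorem LocalExp.hasDerivAt_energy {gf : ℝ → LorentzMetric (n + 1) M} {s : Set ℝ} (hs : IsOpen s)
    (h0s : (0 : ℝ) ∈ s) (hgf : SmoothFamilyOn gf s) (L₂ : LocalExp gf m m₁)
    {z z' w₁ : Coord (n + 1)} (hz : z ∈ (extChartAt (𝓡 (n + 1)) m).target)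
    (hz' : z' ∈ (extChartAt (𝓡 (n + 1)) m₁).target) (hc₂ : ((0 : ℝ), (z, z')) ∈ L₂.O)
    {γ : ℝ → M} (hγ : IsGeodesicSegment (gf 0) γ 1)
    (hγ0 : velocity (n + 1) γ 0 = ofCoord m (z, L₂.W (0, (z, z'))))
    (hγ1 : velocity (n + 1) γ 1 = ofCoord m₁ (z', w₁)) :
    HasDerivAt (fun s => energy (gf s) (ofCoord m (z, L₂.W (s, (z, z')))))
      (rayTransform gf γ / 2) 0 := by
  let c : ℝ → ℝ × (Coord (n + 1) × Coord (n + 1)) := fun s =>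
    (s, (z, z'))
  have hc : ContDiff ℝ ∞ c := contDiff_id.prodMk contDiff_const
  let B : Set ℝ := c ⁻¹' L₂.O
  have hB : IsOpen B := L₂.isOpen_O.preimage hc.continuous
  have h0B : (0 : ℝ) ∈ B := hc₂
  let φ : ℝ → ℝ × (Coord (n + 1) × Coord (n + 1)) := fun s =>
    (s, (z, L₂.W (c s)))
  have hφ : ContDiffOn ℝ ∞ φ B :=
    contDiffOn_id.prodMk (contDiffOn_const.prodMk
      (L₂.contDiffOn_W.comp hc.contDiffOn fun _ hs => hs))
  have hφB : MapsTo φ B L₂.B := fun s hs => L₂.mem_B _ hs _ (L₂.W_mem _ hs)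
  have hfam : IsGeodesicFamily gf id (fun x => L₂.Γ (x.1, φ x.2))
      (Ioo (-L₂.η) (1 + L₂.η)) B := L₂.family.comp hφ hφB
  have hvar := first_variation hs hgf L₂.η_pos hfam hB h0B h0s
  have hvel : ∀ s ∈ B, velocity (n + 1) (fun t => L₂.Γ (t, φ s)) 0 =
      ofCoord m (z, L₂.W (c s)) := fun s hs => L₂.velocity_zero _ (hφB hs)
  have hstart : velocity (n + 1) (fun s => L₂.Γ (0, φ s)) 0 =
      ofCoord m (z, 0) :=
    velocity_of_eventually_const hz (eventually_of_mem (hB.mem_nhds h0B) fun s hs =>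
      congrArg TotalSpace.proj (hvel s hs))
  have hfin : velocity (n + 1) (fun s => L₂.Γ (1, φ s)) 0 =
      ofCoord m₁ (z', 0) :=
    velocity_of_eventually_const hz' (eventually_of_mem (hB.mem_nhds h0B) fun s hs =>
      L₂.endpoint _ hs)
  have hbase : velocity (n + 1) (fun t => L₂.Γ (t, φ 0)) 0 = velocity (n + 1) γ 0 := by
    rw [hvel 0 h0B, hγ0]
  obtain ⟨ε', hε', heq⟩ := IsGeodesicSegment.eqOn (g := gf 0) zero_le_one
    ⟨L₂.η, L₂.η_pos, hfam.2 0 h0B⟩ hγ hbase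
  have hvel1 : velocity (n + 1) (fun t => L₂.Γ (t, φ 0)) 1 = velocity (n + 1) γ 1 := by
    have hev : (fun t => L₂.Γ (t, φ 0)) =ᶠ[𝓝 1] γ := by
      filter_upwards [isOpen_Ioo.mem_nhds (show (1 : ℝ) ∈ Ioo (-ε') (1 + ε') from
        ⟨by linarith, by linarith⟩)] with t ht using heq ht
    exact velocity_congr hev
  have hp1 : variationPairing (gf 0) (fun x => L₂.Γ (x.1, φ x.2)) 1 = 0 :=
    (variationPairing_eq (hvel1.trans hγ1) hfin).trans (map_zero _)
  have hp0 : variationPairing (gf 0) (fun x => L₂.Γ (x.1, φ x.2)) 0 = 0 :=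
    (variationPairing_eq (hvel 0 h0B) hstart).trans (map_zero _)
  have hray : rayTransform gf (fun t => L₂.Γ (t, φ 0)) = rayTransform gf γ :=
    rayTransform_congr hε' heq
  rw [hp1, hp0, sub_zero, zero_add] at hvar
  change HasDerivAt _ (rayTransform gf (fun t => L₂.Γ (t, φ 0)) / 2) 0 at hvar
  rw [hray] at hvar
  refine hvar.congr_of_eventuallyEq ?_
  filter_upwards [hB.mem_nhds h0B] with s hs
  exact congrArg (energy (gf s)) (hvel s hs).symm

/-- For a family of metrics, the energy of the geodesics between the surfaces which are close to a
given one is a differentiable function `𝓔` of the parameter of the family and of the position of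
the initial point on a line. Its derivative in the parameter is half the light ray transform. -/
theorem exists_energy_variation (hιU : ContMDiff (𝓡 n) (𝓡 (n + 1)) ∞ ιU)
    (h𝒲 : IsOpen 𝒲) (hN : ∀ p ∈ 𝒲, (toCoord m p).2 ∈ L.N)
    (hq : (u, v) ∈ rayDomain L ιU ιV x₀ y₀) (hmem : rayVector L ιU ιV x₀ y₀ (u, v) ∈ 𝒲)
    (hdom : IsOpen (rayDomain L ιU ιV x₀ y₀))
    {gf : ℝ → LorentzMetric (n + 1) M} {ε : ℝ} (hε : 0 < ε) (hgf0 : gf 0 = g)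
    (hgf : SmoothFamilyOn gf (Ioo (-ε) ε)) {γ : ℝ → M} (hγ : IsGeodesicSegment g γ 1)
    (hγ0 : velocity (n + 1) γ 0 = rayVector L ιU ιV x₀ y₀ (u, v)) (Z : Coord n) :
    ∃ 𝓔 : ℝ × ℝ → ℝ, DifferentiableAt ℝ 𝓔 (0, 0) ∧
      (∀ᶠ r in 𝓝 (0 : ℝ), 𝓔 (0, r) = rayEnergy L ιU ιV x₀ y₀ (u + r • Z, v)) ∧
      HasDerivAt (fun s => 𝓔 (s, 0)) (rayTransform gf γ / 2) 0 ∧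
      ∀ᶠ x in 𝓝 ((0 : ℝ), (0 : ℝ)), ∃ p ∈ 𝒲,
        p.1 = ιU ((extChartAt (𝓡 n) x₀).symm (u + x.2 • Z)) ∧
        Joins (gf x.1) p (ιV ((extChartAt (𝓡 n) y₀).symm v)) ∧ energy (gf x.1) p = 𝓔 x := by
  subst hgf0
  have h0ε : (0 : ℝ) ∈ Ioo (-ε) ε := ⟨by linarith, hε⟩
  have hz := surfaceCoord_mem_target (u := u) hq.1.1
  have hz' := surfaceCoord_mem_target (u := v) hq.1.2
  have hγ0' : velocity (n + 1) γ 0 =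
      ofCoord m (surfaceCoord ιU m x₀ u, rayW L ιU ιV x₀ y₀ (u, v)) := hγ0
  have hend : γ 1 = (extChartAt (𝓡 (n + 1)) m₁).symm (surfaceCoord ιV m₁ y₀ v) := by
    rw [chart_symm_surfaceCoord hq.1.2]
    exact Joins.unique ⟨γ, hγ, hγ0, rfl⟩ (rayVector_joins hq)
  obtain ⟨w₁, hγ1⟩ := exists_final_velocity hq hγ hγ0
  have hreg := L.bijective_fderiv (c := rayEnds m m₁ ιU ιV x₀ y₀ (u, v)) hq.2
  simp only [rayEnds] at hreg
  -- the local inverse `L` of the exponential map of `g` shows that this map is regular, so that the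
  -- exponential maps of the whole family can be inverted
  obtain ⟨L₂, hc₂, hW₂⟩ := exists_localExp (m := m) (m₁ := m₁) isOpen_Ioo hgf h0ε hz hz' hγ hγ0'
    hend hreg
  let ends : ℝ × ℝ → ℝ × (Coord (n + 1) × Coord (n + 1)) := fun x =>
    (x.1, (surfaceCoord ιU m x₀ (u + x.2 • Z), surfaceCoord ιV m₁ y₀ v))
  have hends0 : ends (0, 0) = (0, (surfaceCoord ιU m x₀ u, surfaceCoord ιV m₁ y₀ v)) := by
    simp [ends]
  have hu0 : u + (0 : ℝ) • Z = u := by simp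
  have hline : ContDiff ℝ ∞ fun x : ℝ × ℝ => u + x.2 • Z := by fun_prop
  have hcoord : ContDiffAt ℝ ∞ (fun x : ℝ × ℝ => surfaceCoord ιU m x₀ (u + x.2 • Z)) (0, 0) := by
    refine ContDiffAt.comp (g := surfaceCoord ιU m x₀) (f := fun x : ℝ × ℝ => u + x.2 • Z) (0, 0)
      ?_ hline.contDiffAt
    simp only [zero_smul, add_zero]
    exact (contDiffOn_surfaceCoord hιU).contDiffAt ((isOpen_surfaceDomain hιU).mem_nhds hq.1.1)
  have hends : ContDiffAt ℝ ∞ ends (0, 0) :=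
    contDiffAt_fst.prodMk (hcoord.prodMk contDiffAt_const)
  let W : ℝ × ℝ → Coord (n + 1) := fun x => L₂.W (ends x)
  have hW : ContDiffAt ℝ ∞ W (0, 0) := by
    refine ContDiffAt.comp (g := L₂.W) (f := ends) (0, 0) ?_ hends
    rw [hends0]
    exact L₂.contDiffOn_W.contDiffAt (L₂.isOpen_O.mem_nhds hc₂)
  have hW0 : W (0, 0) = rayW L ιU ιV x₀ y₀ (u, v) := by
    change L₂.W (ends (0, 0)) = _
    rw [hends0, hW₂]
  let p : ℝ × ℝ → TangentBundle (𝓡 (n + 1)) M := fun x =>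
    ofCoord m (surfaceCoord ιU m x₀ (u + x.2 • Z), W x)
  let 𝓔 : ℝ × ℝ → ℝ := fun x => chartForm (gf x.1) m (surfaceCoord ιU m x₀ (u + x.2 • Z))
    (W x) (W x) / 2
  have hform : ContDiffAt ℝ ∞ (fun x : ℝ × ℝ => chartForm (gf x.1) m
      (surfaceCoord ιU m x₀ (u + x.2 • Z))) (0, 0) := by
    refine ContDiffAt.comp (g := fun q : ℝ × Coord (n + 1) => chartForm (gf q.1) m q.2)
      (f := fun x : ℝ × ℝ => (x.1, surfaceCoord ιU m x₀ (u + x.2 • Z))) (0, 0) ?_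
      (contDiffAt_fst.prodMk hcoord)
    simp only [zero_smul, add_zero]
    exact (contDiffOn_chartForm_family hgf m).contDiffAt
      ((isOpen_Ioo.prod (isOpen_chart_target m)).mem_nhds ⟨h0ε, hz⟩)
  have h𝓔 : ContDiffAt ℝ ∞ 𝓔 (0, 0) := ((hform.clm_apply hW).clm_apply hW).div_const 2
  have hpc : ContinuousAt p (0, 0) := by
    refine ContinuousAt.comp (g := ofCoord m)
      (f := fun x : ℝ × ℝ => (surfaceCoord ιU m x₀ (u + x.2 • Z), W x)) ?_
      (hcoord.continuousAt.prodMk hW.continuousAt)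
    simp only [zero_smul, add_zero]
    exact (continuousOn_ofCoord m).continuousAt
      (((isOpen_chart_target m).prod isOpen_univ).mem_nhds ⟨hz, mem_univ _⟩)
  have hp0 : p (0, 0) = rayVector L ιU ιV x₀ y₀ (u, v) := by
    change ofCoord m (_, W (0, 0)) = _
    rw [hW0]
    simp only [zero_smul, add_zero]
    rfl
  have hev : ∀ᶠ x in 𝓝 ((0 : ℝ), (0 : ℝ)), p x ∈ 𝒲 ∧
      (p x).1 = ιU ((extChartAt (𝓡 n) x₀).symm (u + x.2 • Z)) ∧
      Joins (gf x.1) (p x) (ιV ((extChartAt (𝓡 n) y₀).symm v)) := by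
    filter_upwards [hpc.preimage_mem_nhds (h𝒲.mem_nhds (by rwa [hp0])),
      hends.continuousAt.preimage_mem_nhds (L₂.isOpen_O.mem_nhds (by rwa [hends0])),
      (hline.continuous.continuousAt (x := ((0 : ℝ), (0 : ℝ)))).preimage_mem_nhds
        ((isOpen_surfaceDomain hιU).mem_nhds (show u + ((0 : ℝ), (0 : ℝ)).2 • Z ∈
          surfaceDomain ιU m x₀ by simpa using hq.1.1))] with x h1 h2 h3
    refine ⟨h1, chart_symm_surfaceCoord h3, ?_⟩
    have h4 := L₂.joins (L₂.mem_B _ h2 _ (L₂.W_mem _ h2))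
    rw [L₂.endpoint _ h2, chart_symm_surfaceCoord hq.1.2] at h4
    exact h4
  refine ⟨𝓔, h𝓔.differentiableAt (by simp), ?_, ?_, ?_⟩
  · have hin : Continuous fun r : ℝ => ((0 : ℝ), r) := by fun_prop
    have hin2 : Continuous fun r : ℝ => (u + r • Z, v) := by fun_prop
    filter_upwards [(hin.continuousAt (x := (0 : ℝ))).preimage_mem_nhds hev,
      (hin2.continuousAt (x := (0 : ℝ))).preimage_mem_nhds
        (hdom.mem_nhds (show (u + (0 : ℝ) • Z, v) ∈ _ by rwa [hu0]))] with r h1 h2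
    have hE : energy (gf 0) (p (0, r)) = 𝓔 (0, r) := rfl
    have h3 : p (0, r) ∈ 𝒲 ∧ (p (0, r)).1 = ιU ((extChartAt (𝓡 n) x₀).symm (u + r • Z)) ∧
        Joins (gf 0) (p (0, r)) (ιV ((extChartAt (𝓡 n) y₀).symm v)) := h1
    have h4 : (u + r • Z, v) ∈ rayDomain L ιU ιV x₀ y₀ := h2
    rw [← hE, ← rayEnergy_eq]
    generalize p (0, r) = P at h3
    -- `L₂` and `L` give the same geodesics of `g` by uniqueness in `𝒲`
    rw [rayVector_unique h4 (hN _ h3.1) h3.2.1 h3.2.2]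
  · have hγ0'' : velocity (n + 1) γ 0 = ofCoord m (surfaceCoord ιU m x₀ u,
        L₂.W (0, (surfaceCoord ιU m x₀ u, surfaceCoord ιV m₁ y₀ v))) := by rw [hW₂, hγ0']
    refine (L₂.hasDerivAt_energy isOpen_Ioo h0ε hgf hz hz' hc₂ hγ hγ0'' hγ1).congr_of_eventuallyEq
      (Eventually.of_forall fun s => ?_)
    simp only [𝓔, W, ends, energy_ofCoord, zero_smul, add_zero]
  · filter_upwards [hev] with x hx
    exact ⟨p x, hx.1, hx.2.1, hx.2.2, rfl⟩

end RayChart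

/-! ### Charts for the geodesics between two surfaces -/

section RayChart

theorem finrank_coord_dual (n : ℕ) :
    Module.finrank ℝ (Coord n →L[ℝ] ℝ) = Module.finrank ℝ (Coord n) := by
  rw [← (LinearMap.toContinuousLinearMap (𝕜 := ℝ) (E := Coord n) (F' := ℝ)).finrank_eq,
    Module.finrank_linearMap_self]

variable {n : ℕ} {M : Type*} [TopologicalSpace M]
  [ChartedSpace (EuclideanSpace ℝ (Fin (n + 1))) M] [IsManifold (𝓡 (n + 1)) ∞ M]
  {U : Type*} [TopologicalSpace U] [ChartedSpace (EuclideanSpace ℝ (Fin n)) U]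
  [IsManifold (𝓡 n) ∞ U]
  {V : Type*} [TopologicalSpace V] [ChartedSpace (EuclideanSpace ℝ (Fin n)) V]
  [IsManifold (𝓡 n) ∞ V]

/-- The geodesics with initial velocity in `𝒲` between two surfaces, near a light ray from `x₀` to
`y₀`, in terms of coordinates `u ∈ DU` and `v ∈ DV` of their endpoints: `P (u, v)` is the initial
velocity and `E (u, v)` the energy. The derivative of `E` gives the projections to the surfaces of
the initial and final velocities, and `(u, v, l) ↦ (u, -l ∂ᵤE, E)` is a diffeomorphism near
`l = 1`: a light ray is determined by its initial point and its initial covector up to scale. The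
direction `Z` on the first surface is one in which `E` has nonzero derivative; the ratios of these
derivatives at different points `v` lie in the interval of scales `l` on which `e` is defined. For a
family of metrics, `variation` provides the energy as a function of the parameter of the family and
of the initial point on the line in the direction `Z`. -/
structure RayChart (g : LorentzMetric (n + 1) M) (ιU : U → M) (ιV : V → M)
    (𝒲 : Set (TangentBundle (𝓡 (n + 1)) M)) (x₀ : U) (y₀ : V) where
  DU : Set (Coord n)
  DV : Set (Coord n)
  isOpen_DU : IsOpen DU
  isOpen_DV : IsOpen DV
  mem_DU : extChartAt (𝓡 n) x₀ x₀ ∈ DU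
  mem_DV : extChartAt (𝓡 n) y₀ y₀ ∈ DV
  DU_subset : DU ⊆ (extChartAt (𝓡 n) x₀).target
  DV_subset : DV ⊆ (extChartAt (𝓡 n) y₀).target
  E : Coord n × Coord n → ℝ
  contDiffOn_E : ContDiffOn ℝ ∞ E (DU ×ˢ DV)
  P : Coord n × Coord n → TangentBundle (𝓡 (n + 1)) M
  P_mem : ∀ u ∈ DU, ∀ v ∈ DV, P (u, v) ∈ 𝒲
  P_proj : ∀ u ∈ DU, ∀ v ∈ DV, (P (u, v)).1 = ιU ((extChartAt (𝓡 n) x₀).symm u)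
  P_joins : ∀ u ∈ DU, ∀ v ∈ DV, Joins g (P (u, v)) (ιV ((extChartAt (𝓡 n) y₀).symm v))
  P_unique : ∀ u ∈ DU, ∀ v ∈ DV, ∀ p ∈ 𝒲, p.1 = ιU ((extChartAt (𝓡 n) x₀).symm u) →
    Joins g p (ιV ((extChartAt (𝓡 n) y₀).symm v)) → p = P (u, v)
  energy_P : ∀ q, energy g (P q) = E q
  deriv_left : ∀ u ∈ DU, ∀ v ∈ DV,
    ∀ p : TangentSpace (𝓡 (n + 1)) (ιU ((extChartAt (𝓡 n) x₀).symm u)),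
      P (u, v) = ⟨ιU ((extChartAt (𝓡 n) x₀).symm u), p⟩ → ∀ c,
      g.inner (ιU ((extChartAt (𝓡 n) x₀).symm u)) p (mfderiv (𝓡 n) (𝓡 (n + 1)) ιU
        ((extChartAt (𝓡 n) x₀).symm u) (chartVec x₀ u c)) = -fderiv ℝ E (u, v) (c, 0)
  deriv_right : ∀ u ∈ DU, ∀ v ∈ DV, ∀ γ : ℝ → M, IsGeodesicSegment g γ 1 →
    velocity (n + 1) γ 0 = P (u, v) →
    ∀ p : TangentSpace (𝓡 (n + 1)) (ιV ((extChartAt (𝓡 n) y₀).symm v)),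
      velocity (n + 1) γ 1 = ⟨ιV ((extChartAt (𝓡 n) y₀).symm v), p⟩ → ∀ c,
      g.inner (ιV ((extChartAt (𝓡 n) y₀).symm v)) p (mfderiv (𝓡 n) (𝓡 (n + 1)) ιV
        ((extChartAt (𝓡 n) y₀).symm v) (chartVec y₀ v c)) = fderiv ℝ E (u, v) (0, c)
  Z : Coord n
  fderiv_Z_ne : ∀ u ∈ DU, ∀ v ∈ DV, fderiv ℝ E (u, v) (Z, 0) ≠ 0
  δ : ℝ
  δ_pos : 0 < δ
  e : OpenPartialHomeomorph (Coord n × Coord n × ℝ) (Coord n × (Coord n →L[ℝ] ℝ) × ℝ)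
  mem_source : ∀ u ∈ DU, ∀ v ∈ DV, ∀ l ∈ Ioo (1 - δ) (1 + δ), (u, v, l) ∈ e.source
  e_apply : ∀ u ∈ DU, ∀ v ∈ DV, ∀ l, e (u, v, l) =
    (u, l • -(fderiv ℝ E (u, v)).comp (ContinuousLinearMap.inl ℝ (Coord n) (Coord n)), E (u, v))
  contDiffOn_e_symm : ContDiffOn ℝ ∞ e.symm e.target
  ratio : ∀ u ∈ DU, ∀ v ∈ DV, ∀ v' ∈ DV, ∀ l : ℝ,
    l * fderiv ℝ E (u, v) (Z, 0) = fderiv ℝ E (u, v') (Z, 0) → l ∈ Ioo (1 - δ) (1 + δ)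
  variation : ∀ (gf : ℝ → LorentzMetric (n + 1) M) (ε : ℝ), 0 < ε → gf 0 = g →
    SmoothFamilyOn gf (Ioo (-ε) ε) → ∀ u ∈ DU, ∀ v ∈ DV, ∀ γ : ℝ → M, IsGeodesicSegment g γ 1 →
    velocity (n + 1) γ 0 = P (u, v) →
    ∃ 𝓔 : ℝ × ℝ → ℝ, DifferentiableAt ℝ 𝓔 (0, 0) ∧
      (∀ᶠ r in 𝓝 (0 : ℝ), 𝓔 (0, r) = E (u + r • Z, v)) ∧
      HasDerivAt (fun s => 𝓔 (s, 0)) (rayTransform gf γ / 2) 0 ∧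
      ∀ᶠ x in 𝓝 ((0 : ℝ), (0 : ℝ)), ∃ p ∈ 𝒲,
        p.1 = ιU ((extChartAt (𝓡 n) x₀).symm (u + x.2 • Z)) ∧
        Joins (gf x.1) p (ιV ((extChartAt (𝓡 n) y₀).symm v)) ∧ energy (gf x.1) p = 𝓔 x

variable [T2Space M]
  {g : LorentzMetric (n + 1) M} {m m₁ : M}
  {L : LocalExp (fun _ => g) m m₁} {ιU : U → M} {ιV : V → M} {x₀ : U} {y₀ : V} {u v : Coord n}
  {𝒲 : Set (TangentBundle (𝓡 (n + 1)) M)}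

/-- The partial differential of the energy in the initial point is minus the initial covector. -/
theorem fderiv_rayEnergy_left (hιU : ContMDiff (𝓡 n) (𝓡 (n + 1)) ∞ ιU)
    (hιV : ContMDiff (𝓡 n) (𝓡 (n + 1)) ∞ ιV) (hq : (u, v) ∈ rayDomain L ιU ιV x₀ y₀)
    (c : Coord n) :
    fderiv ℝ (rayEnergy L ιU ιV x₀ y₀) (u, v) (c, 0) =
      -startCovector L ιU ιV x₀ y₀ (u, v) c := by
  obtain ⟨γ, hγ, hγ0, -⟩ := rayVector_joins hq
  obtain ⟨w₁, hγ1⟩ := exists_final_velocity hq hγ hγ0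
  rw [fderiv_rayEnergy hιU hιV hq hγ hγ0 hγ1, map_zero, map_zero, zero_sub, startCovector_apply]

/-- Near a transversal light ray, `rayMap` has a smooth local inverse. -/
theorem exists_rayMap_inverse (hιU : ContMDiff (𝓡 n) (𝓡 (n + 1)) ∞ ιU)
    (hιV : ContMDiff (𝓡 n) (𝓡 (n + 1)) ∞ ιV) (hU : IsNondegenerateSurface g ιU)
    (hV : IsNondegenerateSurface g ιV) (hq : (u, v) ∈ rayDomain L ιU ιV x₀ y₀) {γ : ℝ → M}
    (hγ : IsGeodesicSegment g γ 1) (hγ0 : velocity (n + 1) γ 0 = rayVector L ιU ιV x₀ y₀ (u, v))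
    (hnull : rayEnergy L ιU ιV x₀ y₀ (u, v) = 0)
    (htU : IsTransversalTo ιU ((extChartAt (𝓡 n) x₀).symm u) (velocity (n + 1) γ 0))
    (htV : IsTransversalTo ιV ((extChartAt (𝓡 n) y₀).symm v) (velocity (n + 1) γ 1)) :
    ∃ e : OpenPartialHomeomorph (Coord n × Coord n × ℝ) (Coord n × (Coord n →L[ℝ] ℝ) × ℝ),
      (u, v, (1 : ℝ)) ∈ e.source ∧ (∀ x, e x = rayMap L ιU ιV x₀ y₀ x) ∧
      ContDiffOn ℝ ∞ e.symm e.target := by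
  have hpr : Continuous fun q : Coord n × Coord n × ℝ => (q.1, q.2.1) := by fun_prop
  have hopen := (isOpen_rayDomain (L := L) (x₀ := x₀) (y₀ := y₀) hιU hιV).preimage hpr
  have hsm := contDiffOn_rayMap (L := L) (x₀ := x₀) (y₀ := y₀) hιU hιV
  have hinj := injective_fderiv_rayMap hιU hιV hU hV hq hγ hγ0 hnull htU htV
  have hF : HasFDerivAt (rayMap L ιU ιV x₀ y₀) (fderiv ℝ (rayMap L ιU ιV x₀ y₀) (u, v, 1))
      (u, v, 1) :=
    ((hsm.contDiffAt (hopen.mem_nhds hq)).differentiableAt (by simp)).hasFDerivAt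
  generalize fderiv ℝ (rayMap L ιU ιV x₀ y₀) (u, v, 1) = F' at hinj hF
  have hdim2 : Module.finrank ℝ (Coord n × Coord n × ℝ) =
      Module.finrank ℝ (Coord n × (Coord n →L[ℝ] ℝ) × ℝ) := by
    simp only [Module.finrank_prod, finrank_coord_dual]
  let A : (Coord n × Coord n × ℝ) ≃L[ℝ] (Coord n × (Coord n →L[ℝ] ℝ) × ℝ) :=
    (LinearEquiv.ofInjectiveOfFinrankEq F'.toLinearMap hinj hdim2).toContinuousLinearEquiv
  have hA : (A : (Coord n × Coord n × ℝ) →L[ℝ] (Coord n × (Coord n →L[ℝ] ℝ) × ℝ)) = F' :=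
    ContinuousLinearMap.ext fun x => rfl
  obtain ⟨e, h1, -, h2, h3⟩ := exists_smooth_local_inverse hopen hsm hq A (hA ▸ hF)
  exact ⟨e, h1, h2, h3⟩

/-- The initial covector of a transversal light ray does not vanish: otherwise the initial velocity
would be orthogonal to the surface and to itself. -/
theorem exists_startCovector_ne (hιU : ContMDiff (𝓡 n) (𝓡 (n + 1)) ∞ ιU)
    (hU : IsNondegenerateSurface g ιU) (hq : (u, v) ∈ rayDomain L ιU ιV x₀ y₀)
    (hnull : rayEnergy L ιU ιV x₀ y₀ (u, v) = 0) (hne : rayW L ιU ιV x₀ y₀ (u, v) ≠ 0)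
    (htU : IsTransversalTo ιU ((extChartAt (𝓡 n) x₀).symm u) (rayVector L ιU ιV x₀ y₀ (u, v))) :
    ∃ Z, startCovector L ιU ιV x₀ y₀ (u, v) Z ≠ 0 := by
  by_contra! hall
  refine hne (eq_zero_of_orthogonal g (surfaceCoord_mem_target hq.1.1)
    (fderiv_surfaceCoord_injective hU hιU hq.1.1) (isTransversalTo_coord hιU hq.1.1 rfl htU)
    hall ?_)
  rw [rayEnergy] at hnull
  linarith

/-- The ratio of two values of a continuous function near a point where it does not vanish is close
to one. -/
theorem eventually_ratio_mem {f : Coord n × Coord n → ℝ} {u v : Coord n} {δ : ℝ}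
    (hf : ContinuousAt f (u, v)) (hZ : f (u, v) ≠ 0) (hδ : 0 < δ) :
    ∀ᶠ x : Coord n × (Coord n × Coord n) in 𝓝 (u, (v, v)),
      f (x.1, x.2.2) / f (x.1, x.2.1) ∈ Ioo (1 - δ) (1 + δ) := by
  have h1 : ContinuousAt (fun x : Coord n × (Coord n × Coord n) => f (x.1, x.2.2))
      (u, (v, v)) :=
    ContinuousAt.comp (g := f) (f := fun x : Coord n × (Coord n × Coord n) => (x.1, x.2.2))
      hf (by fun_prop)
  have h2 : ContinuousAt (fun x : Coord n × (Coord n × Coord n) => f (x.1, x.2.1))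
      (u, (v, v)) :=
    ContinuousAt.comp (g := f) (f := fun x : Coord n × (Coord n × Coord n) => (x.1, x.2.1))
      hf (by fun_prop)
  have h3 := h1.div (f := fun x : Coord n × (Coord n × Coord n) => f (x.1, x.2.2)) h2 hZ
  refine h3.preimage_mem_nhds (isOpen_Ioo.mem_nhds ?_)
  change f (u, v) / f (u, v) ∈ _
  rw [div_self hZ]
  exact ⟨by linarith, by linarith⟩

theorem exists_eventually_forall_mem {S : Set (Coord n × Coord n × ℝ)} {u v : Coord n}
    (hS : IsOpen S) (h : (u, v, (1 : ℝ)) ∈ S) :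
    ∃ δ > 0, ∀ᶠ q : Coord n × Coord n in 𝓝 (u, v), ∀ l ∈ Ioo (1 - δ) (1 + δ),
      (q.1, q.2, l) ∈ S := by
  have hc : ContinuousAt (fun x : (Coord n × Coord n) × ℝ => (x.1.1, x.1.2, x.2))
      ((u, v), 1) := by fun_prop
  have h1 := hc.preimage_mem_nhds (hS.mem_nhds h)
  obtain ⟨A, hA, T, hT, hAT⟩ := mem_nhds_prod_iff.1 h1
  obtain ⟨δ, hδ, hball⟩ := Metric.mem_nhds_iff.1 hT
  refine ⟨δ, hδ, eventually_of_mem hA fun q hq l hl => hAT (show (q, l) ∈ A ×ˢ T from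
    ⟨hq, hball ?_⟩)⟩
  rw [Real.ball_eq_Ioo]
  exact hl

theorem continuousAt_rayVector (hιU : ContMDiff (𝓡 n) (𝓡 (n + 1)) ∞ ιU)
    (hιV : ContMDiff (𝓡 n) (𝓡 (n + 1)) ∞ ιV) (hq : (u, v) ∈ rayDomain L ιU ιV x₀ y₀) :
    ContinuousAt (rayVector L ιU ιV x₀ y₀) (u, v) := by
  have h1 : ContinuousAt (ofCoord m) (surfaceCoord ιU m x₀ u, rayW L ιU ιV x₀ y₀ (u, v)) :=
    (continuousOn_ofCoord m).continuousAt (((isOpen_chart_target m).prod isOpen_univ).mem_nhds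
      ⟨surfaceCoord_mem_target hq.1.1, mem_univ _⟩)
  have h2 : ContinuousAt (surfaceCoord ιU m x₀) u :=
    (contDiffOn_surfaceCoord hιU).continuousOn.continuousAt
      ((isOpen_surfaceDomain hιU).mem_nhds hq.1.1)
  have h3 : ContinuousAt (rayW L ιU ιV x₀ y₀) (u, v) :=
    (contDiffOn_rayW hιU hιV).continuousOn.continuousAt ((isOpen_rayDomain hιU hιV).mem_nhds hq)
  have h4 : ContinuousAt (fun q : Coord n × Coord n => surfaceCoord ιU m x₀ q.1) (u, v) :=
    ContinuousAt.comp (g := surfaceCoord ιU m x₀) (f := Prod.fst) h2 continuousAt_fst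
  have h5 : ContinuousAt (fun q => (surfaceCoord ιU m x₀ q.1, rayW L ιU ιV x₀ y₀ q)) (u, v) :=
    h4.prodMk h3
  have h6 : ContinuousAt (fun q => ofCoord m (surfaceCoord ιU m x₀ q.1, rayW L ιU ιV x₀ y₀ q))
      (u, v) := by
    generalize rayW L ιU ιV x₀ y₀ = w at *
    exact ContinuousAt.comp_of_eq (g := ofCoord m) h1 h5 rfl
  exact h6

/-- The geodesics between two nondegenerate surfaces near a transversal light ray without conjugate
endpoints are described by a `RayChart`. -/
theorem exists_rayChart (hιU : ContMDiff (𝓡 n) (𝓡 (n + 1)) ∞ ιU)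
    (hιV : ContMDiff (𝓡 n) (𝓡 (n + 1)) ∞ ιV) (hU : IsNondegenerateSurface g ιU)
    (hV : IsNondegenerateSurface g ιV) (h𝒲 : IsOpen 𝒲) (hN : ∀ p ∈ 𝒲, (toCoord m p).2 ∈ L.N)
    {u₀ v₀ : Coord n} (hu₀ : extChartAt (𝓡 n) x₀ x₀ = u₀) (hv₀ : extChartAt (𝓡 n) y₀ y₀ = v₀)
    (hq : (u₀, v₀) ∈ rayDomain L ιU ιV x₀ y₀) {γ : ℝ → M} (hγ : IsGeodesicSegment g γ 1)
    (hγ0 : velocity (n + 1) γ 0 = rayVector L ιU ιV x₀ y₀ (u₀, v₀))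
    (hmem : velocity (n + 1) γ 0 ∈ 𝒲) (hnull : rayEnergy L ιU ιV x₀ y₀ (u₀, v₀) = 0)
    (hne : rayW L ιU ιV x₀ y₀ (u₀, v₀) ≠ 0)
    (htU : IsTransversalTo ιU x₀ (velocity (n + 1) γ 0))
    (htV : IsTransversalTo ιV y₀ (velocity (n + 1) γ 1)) :
    Nonempty (RayChart g ιU ιV 𝒲 x₀ y₀) := by
  have hx₀ : (extChartAt (𝓡 n) x₀).symm u₀ = x₀ := hu₀ ▸ extChartAt_to_inv x₀
  have hy₀ : (extChartAt (𝓡 n) y₀).symm v₀ = y₀ := hv₀ ▸ extChartAt_to_inv y₀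
  have hdom := isOpen_rayDomain (L := L) (x₀ := x₀) (y₀ := y₀) hιU hιV
  obtain ⟨e, hes, hea, hesymm⟩ := exists_rayMap_inverse hιU hιV hU hV hq hγ hγ0 hnull
    (hx₀.symm ▸ htU) (hy₀.symm ▸ htV)
  obtain ⟨Z, hZ⟩ := exists_startCovector_ne hιU hU hq hnull hne (hx₀.symm ▸ hγ0 ▸ htU)
  obtain ⟨f, hfdef⟩ : ∃ f : Coord n × Coord n → ℝ,
      ∀ q, f q = startCovector L ιU ιV x₀ y₀ q Z := ⟨_, fun q => rfl⟩
  rw [← hfdef] at hZ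
  have hf : ContinuousAt f (u₀, v₀) := by
    rw [funext hfdef]
    exact ((contDiffOn_startCovector hιU hιV).continuousOn.continuousAt
      (hdom.mem_nhds hq)).clm_apply continuousAt_const
  -- the range of scales on which the local inverse is defined
  obtain ⟨δ, hδ, hbox⟩ := exists_eventually_forall_mem e.open_source hes
  have hrat := eventually_ratio_mem hf hZ hδ
  have hW := continuousAt_rayVector hιU hιV hq
  have hall : ∀ᶠ q in 𝓝 (u₀, v₀), q ∈ rayDomain L ιU ιV x₀ y₀ ∧
      rayVector L ιU ιV x₀ y₀ q ∈ 𝒲 ∧ f q ≠ 0 ∧ ∀ l ∈ Ioo (1 - δ) (1 + δ),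
      (q.1, q.2, l) ∈ e.source := by
    filter_upwards [hdom.mem_nhds hq, hW.preimage_mem_nhds (h𝒲.mem_nhds (hγ0 ▸ hmem)),
      hf.eventually_ne hZ, hbox] with q h1 h2 h3 h4 using ⟨h1, h2, h3, h4⟩
  -- product neighborhoods on which these conditions hold; the condition on ratios involves two
  -- points `v` of the second surface
  obtain ⟨A, B, hA, huA, hB, hvB, hAB⟩ := mem_nhds_prod_iff'.1 hall
  obtain ⟨A₂, C, hA₂, huA₂, hC, hvC, hAC⟩ := mem_nhds_prod_iff'.1 hrat
  obtain ⟨B₁, B₂, hB₁, hvB₁, hB₂, hvB₂, hBC⟩ := mem_nhds_prod_iff'.1 (hC.mem_nhds hvC)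
  have hAB' : ∀ u ∈ A ∩ A₂, ∀ v ∈ B ∩ (B₁ ∩ B₂), (u, v) ∈ rayDomain L ιU ιV x₀ y₀ ∧
      rayVector L ιU ιV x₀ y₀ (u, v) ∈ 𝒲 ∧ f (u, v) ≠ 0 ∧ ∀ l ∈ Ioo (1 - δ) (1 + δ),
      (u, v, l) ∈ e.source := fun u hu v hv => hAB (mk_mem_prod hu.1 hv.1)
  have hfE : ∀ u ∈ A ∩ A₂, ∀ v ∈ B ∩ (B₁ ∩ B₂),
      fderiv ℝ (rayEnergy L ιU ιV x₀ y₀) (u, v) (Z, 0) = -f (u, v) := fun u hu v hv =>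
    (fderiv_rayEnergy_left hιU hιV (hAB' u hu v hv).1 Z).trans (by rw [hfdef])
  exact ⟨{
    DU := A ∩ A₂
    DV := B ∩ (B₁ ∩ B₂)
    isOpen_DU := hA.inter hA₂
    isOpen_DV := hB.inter (hB₁.inter hB₂)
    mem_DU := hu₀.symm ▸ ⟨huA, huA₂⟩
    mem_DV := hv₀.symm ▸ ⟨hvB, hvB₁, hvB₂⟩
    DU_subset := fun u hu => (hAB' u hu v₀ ⟨hvB, hvB₁, hvB₂⟩).1.1.1.1
    DV_subset := fun v hv => (hAB' u₀ ⟨huA, huA₂⟩ v hv).1.1.2.1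
    E := rayEnergy L ιU ιV x₀ y₀
    contDiffOn_E := (contDiffOn_rayEnergy hιU hιV).mono fun q hq => (hAB' q.1 hq.1 q.2 hq.2).1
    P := rayVector L ιU ιV x₀ y₀
    P_mem := fun u hu v hv => (hAB' u hu v hv).2.1
    P_proj := fun u hu v hv => rayVector_proj (hAB' u hu v hv).1
    P_joins := fun u hu v hv => rayVector_joins (hAB' u hu v hv).1
    P_unique := fun u hu v hv p hp h1 h2 => rayVector_unique (hAB' u hu v hv).1 (hN p hp) h1 h2
    energy_P := rayEnergy_eq
    deriv_left := by
      intro u hu v hv p hp c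
      rw [fderiv_rayEnergy_left hιU hιV (hAB' u hu v hv).1, neg_neg, startCovector_apply]
      exact inner_surface hιU (hAB' u hu v hv).1.1.1 hp.symm c
    deriv_right := by
      intro u hu v hv γ hγ hγ0 p hp c
      obtain ⟨w₁, hγ1⟩ := exists_final_velocity (hAB' u hu v hv).1 hγ hγ0
      rw [fderiv_rayEnergy hιU hιV (hAB' u hu v hv).1 hγ hγ0 hγ1, map_zero, map_zero, sub_zero]
      exact inner_surface hιV (hAB' u hu v hv).1.1.2 (hp.symm.trans hγ1) c
    Z := Z
    fderiv_Z_ne := by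
      intro u hu v hv
      rw [hfE u hu v hv]
      exact neg_ne_zero.2 (hAB' u hu v hv).2.2.1
    δ := δ
    δ_pos := hδ
    e := e
    mem_source := fun u hu v hv => (hAB' u hu v hv).2.2.2
    e_apply := by
      intro u hu v hv l
      rw [hea, rayMap]
      have h1 : startCovector L ιU ιV x₀ y₀ (u, v) =
          -(fderiv ℝ (rayEnergy L ιU ιV x₀ y₀) (u, v)).comp
            (ContinuousLinearMap.inl ℝ (Coord n) (Coord n)) := by
        refine ContinuousLinearMap.ext fun c => ?_
        have h2 := fderiv_rayEnergy_left hιU hιV (hAB' u hu v hv).1 c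
        simp [h2]
      rw [h1]
    contDiffOn_e_symm := hesymm
    ratio := by
      intro u hu v hv v' hv' l hl
      rw [hfE u hu v hv, hfE u hu v' hv'] at hl
      have h1 : f (u, v') / f (u, v) ∈ Ioo (1 - δ) (1 + δ) :=
        hAC (show (u, (v, v')) ∈ A₂ ×ˢ C from ⟨hu.2, hBC ⟨hv.2.1, hv'.2.2⟩⟩)
      have h2 : f (u, v') / f (u, v) = l := by
        rw [div_eq_iff (hAB' u hu v hv).2.2.1]
        linarith
      rwa [h2] at h1
    variation := fun gf ε hε hgf0 hgf u hu v hv γ hγ hγ0 =>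
      exists_energy_variation hιU h𝒲 hN (hAB' u hu v hv).1 (hAB' u hu v hv).2.1 hdom hε hgf0 hgf hγ
        hγ0 Z }⟩

end RayChart

/-! ### Covectors and functions on products in charts -/

section CovectorCoordinates

variable {n : ℕ} {U : Type*} [TopologicalSpace U] [ChartedSpace (EuclideanSpace ℝ (Fin n)) U]
  [IsManifold (𝓡 n) ∞ U] {x₀ : U}

/-- The coordinates of a covector in the chart at `x₀`. -/
def covCoord (x₀ : U) (α : Cotangent n U) : Coord n × (Coord n →L[ℝ] ℝ) :=
  (extChartAt (𝓡 n) x₀ α.1, (show Coord n →L[ℝ] ℝ from α.2).comp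
    (show Coord n →L[ℝ] Coord n from chartVec x₀ (extChartAt (𝓡 n) x₀ α.1)))

theorem covCoord_smul (α : Cotangent n U) (l : ℝ) :
    covCoord x₀ ⟨α.1, l • α.2⟩ = ((covCoord x₀ α).1, l • (covCoord x₀ α).2) := rfl

/-- A covector has coordinates `(u, ξ)` if it is based at the point with coordinates `u` and takes
the values of `ξ` on the coordinate vectors. -/
theorem covCoord_eq_iff {α : Cotangent n U} (hα : α.1 ∈ (extChartAt (𝓡 n) x₀).source) {u : Coord n}
    (hu : u ∈ (extChartAt (𝓡 n) x₀).target) {φ : Coord n →L[ℝ] ℝ} :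
    covCoord x₀ α = (u, φ) ↔ ∃ ξ : TangentSpace (𝓡 n) ((extChartAt (𝓡 n) x₀).symm u) →L[ℝ] ℝ,
      α = ⟨(extChartAt (𝓡 n) x₀).symm u, ξ⟩ ∧ ∀ c, ξ (chartVec x₀ u c) = φ c := by
  obtain ⟨x, ξ⟩ := α
  constructor
  · intro h
    have h1 : extChartAt (𝓡 n) x₀ x = u := congrArg Prod.fst h
    subst h1
    have h2 : (extChartAt (𝓡 n) x₀).symm (extChartAt (𝓡 n) x₀ x) = x :=
      (extChartAt (𝓡 n) x₀).left_inv hα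
    refine ⟨show Coord n →L[ℝ] ℝ from ξ, TotalSpace.ext h2.symm HEq.rfl, fun c => ?_⟩
    exact congrArg (fun L : Coord n →L[ℝ] ℝ => L c) (congrArg Prod.snd h)
  · rintro ⟨ξ', h1, h2⟩
    rw [h1]
    have h3 : extChartAt (𝓡 n) x₀ ((extChartAt (𝓡 n) x₀).symm u) = u :=
      (extChartAt (𝓡 n) x₀).right_inv hu
    refine Prod.ext h3 (ContinuousLinearMap.ext fun c => ?_)
    refine Eq.trans ?_ (h2 c)
    change (show Coord n →L[ℝ] ℝ from ξ') ((show Coord n →L[ℝ] Coord n from chartVec x₀ _) c) = _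
    rw [h3]
    rfl

theorem covCoord_injOn {α β : Cotangent n U} (hα : α.1 ∈ (extChartAt (𝓡 n) x₀).source)
    (hβ : β.1 ∈ (extChartAt (𝓡 n) x₀).source) (h : covCoord x₀ α = covCoord x₀ β) : α = β := by
  have hu : extChartAt (𝓡 n) x₀ β.1 ∈ (extChartAt (𝓡 n) x₀).target :=
    (extChartAt (𝓡 n) x₀).map_source hβ
  obtain ⟨ξ, h1, h2⟩ := (covCoord_eq_iff (φ := (covCoord x₀ β).2) hα hu).1 h
  obtain ⟨η, h3, h4⟩ := (covCoord_eq_iff (φ := (covCoord x₀ β).2) hβ hu).1 rfl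
  have h5 : ξ = η := by
    refine ContinuousLinearMap.ext fun a => ?_
    obtain ⟨c, rfl⟩ := chartVec_surjective x₀ hu a
    rw [h2, h4]
  subst h5
  exact h1.trans h3.symm

/-- The coordinates are smooth on the cotangent bundle. Its smooth structure is that of the bundle
of homomorphisms from the tangent bundle to a trivial bundle. -/
theorem contMDiffOn_covCoord (x₀ : U) :
    ContMDiffOn ((𝓡 n).prod 𝓘(ℝ, Coord n →L[ℝ] ℝ)) 𝓘(ℝ, Coord n × (Coord n →L[ℝ] ℝ)) ∞
      (covCoord (n := n) x₀) (TotalSpace.proj ⁻¹' (extChartAt (𝓡 n) x₀).source) := by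
  have : IsManifold (𝓡 n) 1 U := IsManifold.of_le (n := ∞) (by simp)
  have h1 : ContMDiffOn ((𝓡 n).prod 𝓘(ℝ, Coord n →L[ℝ] ℝ)) 𝓘(ℝ, Coord n) ∞
      (fun α : Cotangent n U => extChartAt (𝓡 n) x₀ α.1)
      (TotalSpace.proj ⁻¹' (extChartAt (𝓡 n) x₀).source) :=
    (contMDiffOn_chart x₀).comp (Bundle.contMDiff_proj _).contMDiffOn fun _ h => h
  refine h1.prodMk_space ?_
  have h2 := (trivializationAt (Coord n →L[ℝ] ℝ)
    (fun x : U => TangentSpace (𝓡 n) x →L[ℝ] ℝ) x₀).contMDiffOn (n := ∞) (IB := 𝓡 n)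
  refine (contMDiff_snd.comp_contMDiffOn (h2.mono ?_)).congr ?_
  · intro α hα
    rw [Trivialization.mem_source, hom_trivializationAt_baseSet]
    refine ⟨?_, mem_univ _⟩
    simpa using hα
  · intro α hα
    rw [mem_preimage, extChartAt_source] at hα
    change _ = (trivializationAt (Coord n →L[ℝ] ℝ)
      (fun x : U => TangentSpace (𝓡 n) x →L[ℝ] Bundle.Trivial U ℝ x) x₀ α).2
    rw [hom_trivializationAt_apply]
    refine ContinuousLinearMap.ext fun c => ?_
    simp only [ContinuousLinearMap.inCoordinates, ContinuousLinearMap.comp_apply]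
    rw [TangentBundle.symmL_trivializationAt hα]
    simp [chartVec, mfderivWithin_univ]
    rfl

end CovectorCoordinates

section ProductCoordinates

variable {n : ℕ} {U : Type*} [TopologicalSpace U] [ChartedSpace (EuclideanSpace ℝ (Fin n)) U]
  [IsManifold (𝓡 n) ∞ U]
  {V : Type*} [TopologicalSpace V] [ChartedSpace (EuclideanSpace ℝ (Fin n)) V]
  [IsManifold (𝓡 n) ∞ V] {x₀ : U} {y₀ : V} {f : U × V → ℝ} {u v : Coord n}

/-- A function on the product of two manifolds, in the charts at `x₀` and `y₀`. -/
def productCoord (f : U × V → ℝ) (x₀ : U) (y₀ : V) (q : Coord n × Coord n) : ℝ :=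
  f ((extChartAt (𝓡 n) x₀).symm q.1, (extChartAt (𝓡 n) y₀).symm q.2)

theorem contMDiffOn_product_chart_symm (x₀ : U) (y₀ : V) :
    ContMDiffOn 𝓘(ℝ, Coord n × Coord n) ((𝓡 n).prod (𝓡 n)) ∞ (fun q : Coord n × Coord n =>
      ((extChartAt (𝓡 n) x₀).symm q.1, (extChartAt (𝓡 n) y₀).symm q.2))
      ((extChartAt (𝓡 n) x₀).target ×ˢ (extChartAt (𝓡 n) y₀).target) :=
  ((contMDiffOn_chart_symm x₀).comp contDiff_fst.contMDiff.contMDiffOn fun _ h => h.1).prodMk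
    ((contMDiffOn_chart_symm y₀).comp contDiff_snd.contMDiff.contMDiffOn fun _ h => h.2)

theorem contMDiffOn_product_chart (x₀ : U) (y₀ : V) :
    ContMDiffOn ((𝓡 n).prod (𝓡 n)) 𝓘(ℝ, Coord n × Coord n) ∞ (fun q : U × V =>
      (extChartAt (𝓡 n) x₀ q.1, extChartAt (𝓡 n) y₀ q.2))
      ((extChartAt (𝓡 n) x₀).source ×ˢ (extChartAt (𝓡 n) y₀).source) :=
  ((contMDiffOn_chart x₀).comp contMDiff_fst.contMDiffOn fun _ h => h.1).prodMk_space
    ((contMDiffOn_chart y₀).comp contMDiff_snd.contMDiffOn fun _ h => h.2)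

theorem contDiffOn_productCoord {S : Set (U × V)} {D : Set (Coord n × Coord n)}
    (hf : ContMDiffOn ((𝓡 n).prod (𝓡 n)) 𝓘(ℝ, ℝ) ∞ f S)
    (hD : D ⊆ (extChartAt (𝓡 n) x₀).target ×ˢ (extChartAt (𝓡 n) y₀).target)
    (hS : ∀ q ∈ D, ((extChartAt (𝓡 n) x₀).symm q.1, (extChartAt (𝓡 n) y₀).symm q.2) ∈ S) :
    ContDiffOn ℝ ∞ (productCoord f x₀ y₀) D :=
  contMDiffOn_iff_contDiffOn.1
    (hf.comp ((contMDiffOn_product_chart_symm x₀ y₀).mono hD) fun q hq => hS q hq)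

theorem productCoord_chart (h : (extChartAt (𝓡 n) x₀).source ×ˢ (extChartAt (𝓡 n) y₀).source ∈
    𝓝 ((extChartAt (𝓡 n) x₀).symm u, (extChartAt (𝓡 n) y₀).symm v)) :
    f =ᶠ[𝓝 ((extChartAt (𝓡 n) x₀).symm u, (extChartAt (𝓡 n) y₀).symm v)] fun q =>
      productCoord f x₀ y₀ (extChartAt (𝓡 n) x₀ q.1, extChartAt (𝓡 n) y₀ q.2) := by
  filter_upwards [h] with q hq
  exact congrArg f (Prod.ext ((extChartAt (𝓡 n) x₀).left_inv hq.1).symm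
    ((extChartAt (𝓡 n) y₀).left_inv hq.2).symm)

theorem product_source_mem_nhds (hu : u ∈ (extChartAt (𝓡 n) x₀).target)
    (hv : v ∈ (extChartAt (𝓡 n) y₀).target) :
    (extChartAt (𝓡 n) x₀).source ×ˢ (extChartAt (𝓡 n) y₀).source ∈
      𝓝 ((extChartAt (𝓡 n) x₀).symm u, (extChartAt (𝓡 n) y₀).symm v) :=
  ((isOpen_extChartAt_source x₀).prod (isOpen_extChartAt_source y₀)).mem_nhds
    ⟨(extChartAt (𝓡 n) x₀).map_target hu, (extChartAt (𝓡 n) y₀).map_target hv⟩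

theorem fderiv_productCoord_ne_zero (hu : u ∈ (extChartAt (𝓡 n) x₀).target)
    (hv : v ∈ (extChartAt (𝓡 n) y₀).target)
    (hd : DifferentiableAt ℝ (productCoord f x₀ y₀) (u, v))
    (h : mvfderiv ((𝓡 n).prod (𝓡 n)) f
      ((extChartAt (𝓡 n) x₀).symm u, (extChartAt (𝓡 n) y₀).symm v) ≠ 0) :
    fderiv ℝ (productCoord f x₀ y₀) (u, v) ≠ 0 := by
  intro h0
  refine h ?_
  have hn := product_source_mem_nhds hu hv
  have h2 : MDifferentiableAt ((𝓡 n).prod (𝓡 n)) 𝓘(ℝ, Coord n × Coord n) (fun q : U × V =>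
      (extChartAt (𝓡 n) x₀ q.1, extChartAt (𝓡 n) y₀ q.2))
      ((extChartAt (𝓡 n) x₀).symm u, (extChartAt (𝓡 n) y₀).symm v) :=
    ((contMDiffOn_product_chart x₀ y₀).contMDiffAt hn).mdifferentiableAt (by simp)
  have hval : (fun q : U × V => (extChartAt (𝓡 n) x₀ q.1, extChartAt (𝓡 n) y₀ q.2))
      ((extChartAt (𝓡 n) x₀).symm u, (extChartAt (𝓡 n) y₀).symm v) = (u, v) :=
    Prod.ext ((extChartAt (𝓡 n) x₀).right_inv hu) ((extChartAt (𝓡 n) y₀).right_inv hv)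
  have hd0 : HasFDerivAt (productCoord f x₀ y₀) (0 : Coord n × Coord n →L[ℝ] ℝ)
      ((fun q : U × V => (extChartAt (𝓡 n) x₀ q.1, extChartAt (𝓡 n) y₀ q.2))
        ((extChartAt (𝓡 n) x₀).symm u, (extChartAt (𝓡 n) y₀).symm v)) := by
    rw [hval, ← h0]
    exact hd.hasFDerivAt
  have h3 := HasMFDerivAt.comp (g := productCoord f x₀ y₀) (f := fun q : U × V =>
    (extChartAt (𝓡 n) x₀ q.1, extChartAt (𝓡 n) y₀ q.2)) _ hd0.hasMFDerivAt h2.hasMFDerivAt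
  have h4 := (h3.congr_of_eventuallyEq (productCoord_chart hn)).mfderiv
  refine ContinuousLinearMap.ext fun a => ?_
  exact congrArg (fun A : Coord n × Coord n →L[ℝ] ℝ => A a) h4

theorem mvfderiv_ne_zero_of_productCoord (hu : u ∈ (extChartAt (𝓡 n) x₀).target)
    (hv : v ∈ (extChartAt (𝓡 n) y₀).target)
    (hd : MDifferentiableAt ((𝓡 n).prod (𝓡 n)) 𝓘(ℝ, ℝ) f
      ((extChartAt (𝓡 n) x₀).symm u, (extChartAt (𝓡 n) y₀).symm v))
    (h : fderiv ℝ (productCoord f x₀ y₀) (u, v) ≠ 0) :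
    mvfderiv ((𝓡 n).prod (𝓡 n)) f
      ((extChartAt (𝓡 n) x₀).symm u, (extChartAt (𝓡 n) y₀).symm v) ≠ 0 := by
  intro h0
  refine h ?_
  have h2 := ((contMDiffOn_product_chart_symm x₀ y₀).contMDiffAt
    (((isOpen_chart_target x₀).prod (isOpen_chart_target y₀)).mem_nhds
      (mk_mem_prod hu hv))).mdifferentiableAt (by simp)
  have h3 := mvfderiv_comp (u, v) hd h2
  rw [h0, ContinuousLinearMap.zero_comp] at h3
  rw [← mfderiv_eq_fderiv]
  exact ContinuousLinearMap.ext fun a => congrArg (fun A : Coord n × Coord n →L[ℝ] ℝ => A a) h3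

/-- The partial differential in the first variable, in coordinates. -/
theorem mvfderiv_left (hu : u ∈ (extChartAt (𝓡 n) x₀).target)
    (hd : MDifferentiableAt ((𝓡 n).prod (𝓡 n)) 𝓘(ℝ, ℝ) f
      ((extChartAt (𝓡 n) x₀).symm u, (extChartAt (𝓡 n) y₀).symm v))
    (hd' : DifferentiableAt ℝ (productCoord f x₀ y₀) (u, v)) (c : Coord n) :
    mvfderiv (𝓡 n) (fun x => f (x, (extChartAt (𝓡 n) y₀).symm v)) ((extChartAt (𝓡 n) x₀).symm u)
      (chartVec x₀ u c) = fderiv ℝ (productCoord f x₀ y₀) (u, v) (c, 0) := by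
  have h1 : MDifferentiableAt (𝓡 n) 𝓘(ℝ, ℝ) (fun x => f (x, (extChartAt (𝓡 n) y₀).symm v))
      ((extChartAt (𝓡 n) x₀).symm u) :=
    MDifferentiableAt.comp (g := f) (f := fun x => (x, (extChartAt (𝓡 n) y₀).symm v)) _ hd
      (mdifferentiableAt_id.prodMk mdifferentiableAt_const)
  have h2 := mvfderiv_comp (u : Coord n) h1 (mdifferentiableAt_chart_symm x₀ hu)
  have h3 := HasFDerivAt.comp u (g := productCoord f x₀ y₀) (f := fun u => (u, v))
    hd'.hasFDerivAt (hasFDerivAt_prodMk_left u v)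
  have h4 := h3.hasMFDerivAt.mfderiv
  refine Eq.trans ?_ (congrArg (fun A : Coord n →L[ℝ] ℝ => A c) h4)
  exact (congrArg (fun A : Coord n →L[ℝ] ℝ => A c) h2).symm

/-- The partial differential in the second variable, in coordinates. -/
theorem mvfderiv_right (hv : v ∈ (extChartAt (𝓡 n) y₀).target)
    (hd : MDifferentiableAt ((𝓡 n).prod (𝓡 n)) 𝓘(ℝ, ℝ) f
      ((extChartAt (𝓡 n) x₀).symm u, (extChartAt (𝓡 n) y₀).symm v))
    (hd' : DifferentiableAt ℝ (productCoord f x₀ y₀) (u, v)) (c : Coord n) :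
    mvfderiv (𝓡 n) (fun y => f ((extChartAt (𝓡 n) x₀).symm u, y)) ((extChartAt (𝓡 n) y₀).symm v)
      (chartVec y₀ v c) = fderiv ℝ (productCoord f x₀ y₀) (u, v) (0, c) := by
  have h1 : MDifferentiableAt (𝓡 n) 𝓘(ℝ, ℝ) (fun y => f ((extChartAt (𝓡 n) x₀).symm u, y))
      ((extChartAt (𝓡 n) y₀).symm v) :=
    MDifferentiableAt.comp (g := f) (f := fun y => ((extChartAt (𝓡 n) x₀).symm u, y)) _ hd
      (mdifferentiableAt_const.prodMk mdifferentiableAt_id)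
  have h2 := mvfderiv_comp (v : Coord n) h1 (mdifferentiableAt_chart_symm y₀ hv)
  have h3 := HasFDerivAt.comp v (g := productCoord f x₀ y₀) (f := fun v => (u, v))
    hd'.hasFDerivAt (hasFDerivAt_prodMk_right u v)
  have h4 := h3.hasMFDerivAt.mfderiv
  refine Eq.trans ?_ (congrArg (fun A : Coord n →L[ℝ] ℝ => A c) h4)
  exact (congrArg (fun A : Coord n →L[ℝ] ℝ => A c) h2).symm

end ProductCoordinates

/-! ### Pairs of points connected by light rays and defining functions -/

theorem exists_eq_totalSpaceMk {B F : Type*} {E : B → Type*} {p : TotalSpace F E} {b : B}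
    (h : p.1 = b) : ∃ v : E b, p = ⟨b, v⟩ := by
  subst h
  exact ⟨p.2, rfl⟩

/-- If `f` is nonpositive wherever `h` is negative and both vanish at a point, then their
derivatives there are positively proportional. -/
theorem exists_eq_smul_of_neg {F : Type*} [NormedAddCommGroup F] [NormedSpace ℝ F] {f h : F → ℝ}
    {f' h' : F →L[ℝ] ℝ} {p : F} (hf : HasFDerivAt f f' p) (hh : HasFDerivAt h h' p) (hf0 : f p = 0)
    (hh0 : h p = 0) (hneg : ∀ᶠ x in 𝓝 p, h x < 0 → f x ≤ 0) {e : F} (he : h' e ≠ 0) :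
    0 ≤ f' e / h' e ∧ f' = (f' e / h' e) • h' := by
  -- `h` is negative on a short ray from `p` in the direction `v`
  have key : ∀ v, h' v < 0 → f' v ≤ 0 := by
    intro v hv
    have hline : HasDerivAt (fun t : ℝ => p + t • v) v 0 := by
      simpa using ((hasDerivAt_id (0 : ℝ)).smul_const v).const_add p
    have hp : p + (0 : ℝ) • v = p := by simp
    have hf1 : HasDerivAt (fun t : ℝ => f (p + t • v)) (f' v) 0 :=
      HasFDerivAt.comp_hasDerivAt (l := f) (0 : ℝ) (by rwa [hp]) hline
    have hh1 : HasDerivAt (fun t : ℝ => h (p + t • v)) (h' v) 0 :=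
      HasFDerivAt.comp_hasDerivAt (l := h) (0 : ℝ) (by rwa [hp]) hline
    have hh2 := hh1.hasDerivWithinAt (s := Ioi 0)
    have hf2 := hf1.hasDerivWithinAt (s := Ioi 0)
    rw [hasDerivWithinAt_iff_tendsto_slope' (by simp)] at hh2 hf2
    have hc : ContinuousAt (fun t : ℝ => p + t • v) 0 := hline.continuousAt
    have hev : ∀ᶠ t in 𝓝[>] (0 : ℝ), h (p + t • v) < 0 → f (p + t • v) ≤ 0 := by
      have hn : ∀ᶠ x in 𝓝 (p + (0 : ℝ) • v), h x < 0 → f x ≤ 0 := by rwa [hp]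
      exact nhdsWithin_le_nhds (hc.eventually hn)
    refine le_of_tendsto hf2 ?_
    filter_upwards [hh2.eventually (gt_mem_nhds hv), hev, self_mem_nhdsWithin] with t h1 h2 h3
    have h3' : (0 : ℝ) < t := h3
    simp only [slope_def_field, hp, hh0, hf0, sub_zero] at h1 ⊢
    refine div_nonpos_of_nonpos_of_nonneg (h2 ?_) h3'.le
    by_contra hge
    exact absurd h1 (not_lt.2 (div_nonneg (not_lt.1 hge) h3'.le))
  -- directions in the kernel of `h'` are limits of directions in which `h` decreases
  have key2 : ∀ e', h' e' < 0 → ∀ v, h' v = 0 → f' v ≤ 0 := by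
    intro e' he' v hv
    by_contra hpos
    rw [not_le] at hpos
    obtain ⟨k, hk⟩ : ∃ k : ℝ, 0 < k ∧ 0 < k * f' v + f' e' := by
      refine ⟨(|f' e'| + 1) / f' v, by positivity, ?_⟩
      rw [div_mul_cancel₀ _ hpos.ne']
      linarith [neg_abs_le (f' e')]
    have h1 := key (k • v + e') (by simpa [hv] using he')
    simp only [map_add, map_smul, smul_eq_mul] at h1
    linarith [hk.2]
  obtain ⟨e', he'⟩ : ∃ e', h' e' < 0 := by
    rcases lt_or_gt_of_ne he with h1 | h1
    · exact ⟨e, h1⟩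
    · exact ⟨-e, by simpa using h1⟩
  have key3 : ∀ v, h' v = 0 → f' v = 0 := by
    intro v hv
    have h1 := key2 e' he' v hv
    have h2 := key2 e' he' (-v) (by simpa using hv)
    rw [map_neg] at h2
    linarith
  refine ⟨?_, ContinuousLinearMap.ext fun v => ?_⟩
  · rcases lt_or_gt_of_ne he with h1 | h1
    · exact div_nonneg_of_nonpos (key e h1) h1.le
    · have h2 := key (-e) (by simpa using h1)
      rw [map_neg] at h2
      exact div_nonneg (by linarith) h1.le
  · have h1 := key3 (v - (h' v / h' e) • e) (by simp [he])
    simp only [map_sub, map_smul, smul_eq_mul] at h1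
    rw [smul_apply, smul_eq_mul]
    linear_combination h1

namespace RayChart

variable {n : ℕ} {M : Type*} [TopologicalSpace M]
  [ChartedSpace (EuclideanSpace ℝ (Fin (n + 1))) M] [IsManifold (𝓡 (n + 1)) ∞ M]
  {U : Type*} [TopologicalSpace U] [ChartedSpace (EuclideanSpace ℝ (Fin n)) U]
  [IsManifold (𝓡 n) ∞ U]
  {V : Type*} [TopologicalSpace V] [ChartedSpace (EuclideanSpace ℝ (Fin n)) V]
  [IsManifold (𝓡 n) ∞ V]
  {g : LorentzMetric (n + 1) M} {ιU : U → M} {ιV : V → M}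
  {𝒲 : Set (TangentBundle (𝓡 (n + 1)) M)} {x₀ : U} {y₀ : V} {u v : Coord n}
  {U' : Set U} {V' : Set V}
  (R : RayChart g ιU ιV 𝒲 x₀ y₀)

/-- The points of the first surface covered by the chart. -/
def sourceU : Set U := (extChartAt (𝓡 n) x₀).source ∩ extChartAt (𝓡 n) x₀ ⁻¹' R.DU

/-- The points of the second surface covered by the chart. -/
def sourceV : Set V := (extChartAt (𝓡 n) y₀).source ∩ extChartAt (𝓡 n) y₀ ⁻¹' R.DV

theorem isOpen_sourceU : IsOpen R.sourceU := isOpen_extChartAt_preimage' x₀ R.isOpen_DU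

theorem isOpen_sourceV : IsOpen R.sourceV := isOpen_extChartAt_preimage' y₀ R.isOpen_DV

/-- The coordinates of the points of `U' × V'`. -/
def domain (U' : Set U) (V' : Set V) : Set (Coord n × Coord n) :=
  (R.DU ∩ (extChartAt (𝓡 n) x₀).symm ⁻¹' U') ×ˢ (R.DV ∩ (extChartAt (𝓡 n) y₀).symm ⁻¹' V')

variable {R}

theorem isOpen_domain (hU' : IsOpen U') (hV' : IsOpen V') : IsOpen (R.domain U' V') :=
  (((continuousOn_extChartAt_symm x₀).mono R.DU_subset).isOpen_inter_preimage R.isOpen_DU hU').prod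
    (((continuousOn_extChartAt_symm y₀).mono R.DV_subset).isOpen_inter_preimage R.isOpen_DV hV')

theorem mem_target_of_mem_domain (h : (u, v) ∈ R.domain U' V') :
    u ∈ (extChartAt (𝓡 n) x₀).target ∧ v ∈ (extChartAt (𝓡 n) y₀).target :=
  ⟨R.DU_subset h.1.1, R.DV_subset h.2.1⟩

theorem domain_subset_target : R.domain U' V' ⊆
    (extChartAt (𝓡 n) x₀).target ×ˢ (extChartAt (𝓡 n) y₀).target := fun _ h =>
  mem_target_of_mem_domain h

theorem exists_mem_domain (hU' : U' ⊆ R.sourceU) (hV' : V' ⊆ R.sourceV) {x : U} (hx : x ∈ U')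
    {y : V} (hy : y ∈ V') : ∃ u v, (u, v) ∈ R.domain U' V' ∧
      x = (extChartAt (𝓡 n) x₀).symm u ∧ y = (extChartAt (𝓡 n) y₀).symm v := by
  have h1 : (extChartAt (𝓡 n) x₀).symm (extChartAt (𝓡 n) x₀ x) = x :=
    (extChartAt (𝓡 n) x₀).left_inv (hU' hx).1
  have h2 : (extChartAt (𝓡 n) y₀).symm (extChartAt (𝓡 n) y₀ y) = y :=
    (extChartAt (𝓡 n) y₀).left_inv (hV' hy).1
  refine ⟨_, _, ⟨⟨(hU' hx).2, ?_⟩, (hV' hy).2, ?_⟩, h1.symm, h2.symm⟩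
  · rwa [mem_preimage, h1]
  · rwa [mem_preimage, h2]

theorem differentiableAt_E (h : (u, v) ∈ R.domain U' V') : DifferentiableAt ℝ R.E (u, v) :=
  (R.contDiffOn_E.contDiffAt ((R.isOpen_DU.prod R.isOpen_DV).mem_nhds
    ⟨h.1.1, h.2.1⟩)).differentiableAt (by simp)

theorem inner_P :
    g.inner _ (R.P (u, v)).2 (R.P (u, v)).2 = 2 * R.E (u, v) := by
  rw [← R.energy_P, energy]
  ring

/-- The geodesics of a `RayChart` are not constant, as the derivative of the energy does not vanish.
-/
theorem P_ne_zero (h : (u, v) ∈ R.domain U' V') : (R.P (u, v)).2 ≠ 0 := by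
  obtain ⟨p, hp⟩ := exists_eq_totalSpaceMk (R.P_proj u h.1.1 v h.2.1)
  rw [hp]
  rintro (h0 : p = 0)
  have h1 := R.deriv_left u h.1.1 v h.2.1 p hp R.Z
  rw [h0, map_zero, zero_apply] at h1
  exact R.fderiv_Z_ne u h.1.1 v h.2.1 (neg_eq_zero.1 h1.symm)

theorem isLightlike_P (h : (u, v) ∈ R.domain U' V') (hE : R.E (u, v) = 0) :
    IsLightlike g (R.P (u, v)) :=
  ⟨P_ne_zero h, by rw [inner_P, hE, mul_zero]⟩

theorem existsUnique_joins (h : (u, v) ∈ R.domain U' V') :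
    ∃! p : TangentBundle (𝓡 (n + 1)) M, p ∈ 𝒲 ∧ p.1 = ιU ((extChartAt (𝓡 n) x₀).symm u) ∧
      Joins g p (ιV ((extChartAt (𝓡 n) y₀).symm v)) :=
  ⟨R.P (u, v), ⟨R.P_mem u h.1.1 v h.2.1, R.P_proj u h.1.1 v h.2.1, R.P_joins u h.1.1 v h.2.1⟩,
    fun p hp => R.P_unique u h.1.1 v h.2.1 p hp.1 hp.2.1 hp.2.2⟩

/-- In coordinates, the set of pairs connected by a light ray is the zero set of the energy. -/
theorem mem_lightPairs_iff (h : (u, v) ∈ R.domain U' V') :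
    ((extChartAt (𝓡 n) x₀).symm u, (extChartAt (𝓡 n) y₀).symm v) ∈ lightPairs g ιU ιV 𝒲 U' V' ↔
      R.E (u, v) = 0 := by
  constructor
  · rintro ⟨-, -, p, ⟨hp, h1, h2, h3⟩, -⟩
    have h4 := R.P_unique u h.1.1 v h.2.1 p hp h1 h3
    have h5 := h2.2
    rw [h4, inner_P] at h5
    linarith
  · intro hE
    exact ⟨h.1.2, h.2.2, R.P (u, v), ⟨R.P_mem u h.1.1 v h.2.1, R.P_proj u h.1.1 v h.2.1,
      isLightlike_P h hE, R.P_joins u h.1.1 v h.2.1⟩,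
      fun p hp => R.P_unique u h.1.1 v h.2.1 p hp.1 hp.2.1 hp.2.2.2⟩

/-- The geodesic between two points is timelike if and only if its energy is negative. -/
theorem exists_isTimelike_iff (h : (u, v) ∈ R.domain U' V') :
    (∃ p : TangentBundle (𝓡 (n + 1)) M, p ∈ 𝒲 ∧ p.1 = ιU ((extChartAt (𝓡 n) x₀).symm u) ∧
      IsTimelike g p ∧ Joins g p (ιV ((extChartAt (𝓡 n) y₀).symm v))) ↔ R.E (u, v) < 0 := by
  constructor
  · rintro ⟨p, hp, h1, h2, h3⟩
    have h4 := R.P_unique u h.1.1 v h.2.1 p hp h1 h3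
    rw [IsTimelike, h4, inner_P] at h2
    linarith
  · intro hE
    refine ⟨R.P (u, v), R.P_mem u h.1.1 v h.2.1, R.P_proj u h.1.1 v h.2.1, ?_,
      R.P_joins u h.1.1 v h.2.1⟩
    rw [IsTimelike, inner_P]
    linarith

theorem fderiv_E_ne_zero (h : (u, v) ∈ R.domain U' V') : fderiv ℝ R.E (u, v) ≠ 0 := fun h0 =>
  R.fderiv_Z_ne u h.1.1 v h.2.1 (by rw [h0]; rfl)

variable (R) in
/-- The energy of the geodesic between two points, as a function on `U × V`. -/
def pairEnergy (q : U × V) : ℝ := R.E (extChartAt (𝓡 n) x₀ q.1, extChartAt (𝓡 n) y₀ q.2)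

theorem contMDiffOn_comp_chart {F : Coord n × Coord n → ℝ}
    (hF : ContDiffOn ℝ ∞ F (R.domain U' V')) (hU' : U' ⊆ R.sourceU) (hV' : V' ⊆ R.sourceV) :
    ContMDiffOn ((𝓡 n).prod (𝓡 n)) 𝓘(ℝ, ℝ) ∞
      (fun q : U × V => F (extChartAt (𝓡 n) x₀ q.1, extChartAt (𝓡 n) y₀ q.2)) (U' ×ˢ V') := by
  refine hF.contMDiffOn.comp ((contMDiffOn_product_chart x₀ y₀).mono
    fun q hq => ⟨(hU' hq.1).1, (hV' hq.2).1⟩) fun q hq => ?_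
  refine ⟨⟨(hU' hq.1).2, ?_⟩, (hV' hq.2).2, ?_⟩
  · have h1 : (extChartAt (𝓡 n) x₀).symm (extChartAt (𝓡 n) x₀ q.1) = q.1 :=
      (extChartAt (𝓡 n) x₀).left_inv (hU' hq.1).1
    simpa only [mem_preimage, h1] using hq.1
  · have h2 : (extChartAt (𝓡 n) y₀).symm (extChartAt (𝓡 n) y₀ q.2) = q.2 :=
      (extChartAt (𝓡 n) y₀).left_inv (hV' hq.2).1
    simpa only [mem_preimage, h2] using hq.2

theorem contDiffOn_E_domain : ContDiffOn ℝ ∞ R.E (R.domain U' V') :=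
  R.contDiffOn_E.mono fun _ h => ⟨h.1.1, h.2.1⟩

theorem chart_symm_mem (h : (u, v) ∈ R.domain U' V') :
    ((extChartAt (𝓡 n) x₀).symm u, (extChartAt (𝓡 n) y₀).symm v) ∈ U' ×ˢ V' :=
  ⟨h.1.2, h.2.2⟩

theorem mdifferentiableAt_of_contMDiffOn {f : U × V → ℝ}
    (hf : ContMDiffOn ((𝓡 n).prod (𝓡 n)) 𝓘(ℝ, ℝ) ∞ f (U' ×ˢ V'))
    (hU' : IsOpen U') (hV' : IsOpen V') (h : (u, v) ∈ R.domain U' V') :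
    MDifferentiableAt ((𝓡 n).prod (𝓡 n)) 𝓘(ℝ, ℝ) f
      ((extChartAt (𝓡 n) x₀).symm u, (extChartAt (𝓡 n) y₀).symm v) :=
  (hf.contMDiffAt ((hU'.prod hV').mem_nhds (chart_symm_mem h))).mdifferentiableAt (by simp)

/-- The pairs of points connected by a light ray form a hypersurface: the energy is a defining
function. -/
theorem isHypersurface_lightPairs (hU'o : IsOpen U') (hV'o : IsOpen V') (hU' : U' ⊆ R.sourceU)
    (hV' : V' ⊆ R.sourceV) :
    IsHypersurface ((𝓡 n).prod (𝓡 n)) (lightPairs g ιU ιV 𝒲 U' V') := by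
  intro q hq
  have hsub : lightPairs g ιU ιV 𝒲 U' V' ⊆ U' ×ˢ V' := fun q hq => ⟨hq.1, hq.2.1⟩
  have hsm : ContMDiffOn ((𝓡 n).prod (𝓡 n)) 𝓘(ℝ, ℝ) ∞ R.pairEnergy (U' ×ˢ V') :=
    contMDiffOn_comp_chart contDiffOn_E_domain hU' hV'
  have hval : ∀ {u v}, (u, v) ∈ R.domain U' V' →
      productCoord R.pairEnergy x₀ y₀ (u, v) = R.E (u, v) := fun {u v} h =>
    congrArg R.E (Prod.ext ((extChartAt (𝓡 n) x₀).right_inv (R.DU_subset h.1.1))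
      ((extChartAt (𝓡 n) y₀).right_inv (R.DV_subset h.2.1)))
  refine ⟨U' ×ˢ V', hU'o.prod hV'o, hsub hq, R.pairEnergy, hsm, ?_, ?_⟩
  · ext ⟨x, y⟩
    rw [inter_eq_left.2 hsub]
    constructor
    · intro h
      obtain ⟨u, v, huv, rfl, rfl⟩ := exists_mem_domain hU' hV' h.1 h.2.1
      exact ⟨hsub h, (hval huv).trans ((mem_lightPairs_iff huv).1 h)⟩
    · rintro ⟨h, h0⟩
      obtain ⟨u, v, huv, rfl, rfl⟩ := exists_mem_domain hU' hV' h.1 h.2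
      exact (mem_lightPairs_iff huv).2 ((hval huv).symm.trans h0)
  · rintro ⟨x, y⟩ ⟨-, h⟩
    obtain ⟨u, v, huv, rfl, rfl⟩ := exists_mem_domain hU' hV' h.1 h.2
    have huv' := mem_target_of_mem_domain huv
    refine mvfderiv_ne_zero_of_productCoord huv'.1 huv'.2
      (mdifferentiableAt_of_contMDiffOn hsm hU'o hV'o huv) ?_
    have hev : productCoord R.pairEnergy x₀ y₀ =ᶠ[𝓝 (u, v)] R.E := by
      filter_upwards [(isOpen_domain hU'o hV'o).mem_nhds huv] with q hq using hval hq
    rw [hev.fderiv_eq]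
    exact fderiv_E_ne_zero huv

variable (R) in
/-- The ratio of the derivatives of a function on `U × V` and of the energy, in a fixed direction
transversal to the set of pairs connected by a light ray. -/
def derivRatio (r : U × V → ℝ) (q : Coord n × Coord n) : ℝ :=
  fderiv ℝ (productCoord r x₀ y₀) q (R.Z, 0) / fderiv ℝ R.E q (R.Z, 0)

theorem contDiffOn_productCoord_domain {r : U × V → ℝ}
    (hr : ContMDiffOn ((𝓡 n).prod (𝓡 n)) 𝓘(ℝ, ℝ) ∞ r (U' ×ˢ V')) :
    ContDiffOn ℝ ∞ (productCoord r x₀ y₀) (R.domain U' V') :=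
  contDiffOn_productCoord hr domain_subset_target fun _ hq => chart_symm_mem hq

theorem contDiffOn_derivRatio (hU'o : IsOpen U') (hV'o : IsOpen V') {r : U × V → ℝ}
    (hr : ContMDiffOn ((𝓡 n).prod (𝓡 n)) 𝓘(ℝ, ℝ) ∞ r (U' ×ˢ V')) :
    ContDiffOn ℝ ∞ (R.derivRatio r) (R.domain U' V') := by
  have hD := isOpen_domain (R := R) hU'o hV'o
  refine ContDiffOn.div ?_ ?_ fun q hq => R.fderiv_Z_ne q.1 hq.1.1 q.2 hq.2.1
  · exact ((contDiffOn_productCoord_domain hr).fderiv_of_isOpen hD (m := ∞) (by simp)).clm_apply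
      contDiffOn_const
  · exact (contDiffOn_E_domain.fderiv_of_isOpen hD (m := ∞) (by simp)).clm_apply contDiffOn_const

section DefiningFunction

variable {r : U × V → ℝ}

theorem productCoord_eq_zero_iff (hr : IsDefiningFunction g ιU ιV 𝒲 U' V' r)
    (h : (u, v) ∈ R.domain U' V') : productCoord r x₀ y₀ (u, v) = 0 ↔ R.E (u, v) = 0 :=
  (hr.2.1 _ (chart_symm_mem h)).trans (mem_lightPairs_iff h)

theorem productCoord_neg_iff (hr : IsDefiningFunction g ιU ιV 𝒲 U' V' r)
    (h : (u, v) ∈ R.domain U' V') : productCoord r x₀ y₀ (u, v) < 0 ↔ R.E (u, v) < 0 :=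
  (hr.2.2.2 _ (chart_symm_mem h)).trans (exists_isTimelike_iff h)

/-- On the set of pairs connected by a light ray, the differential of a defining function is a
positive multiple of the differential of the energy. -/
theorem fderiv_productCoord_eq (hr : IsDefiningFunction g ιU ιV 𝒲 U' V' r)
    (hU'o : IsOpen U') (hV'o : IsOpen V') (h : (u, v) ∈ R.domain U' V')
    (hE : R.E (u, v) = 0) : 0 < R.derivRatio r (u, v) ∧
      fderiv ℝ (productCoord r x₀ y₀) (u, v) = R.derivRatio r (u, v) • fderiv ℝ R.E (u, v) := by
  have hD := isOpen_domain (R := R) hU'o hV'o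
  have hd : DifferentiableAt ℝ (productCoord r x₀ y₀) (u, v) :=
    ((contDiffOn_productCoord_domain hr.1).contDiffAt (hD.mem_nhds h)).differentiableAt (by simp)
  have h0 : fderiv ℝ (productCoord r x₀ y₀) (u, v) ≠ 0 := by
    have ht := mem_target_of_mem_domain h
    exact fderiv_productCoord_ne_zero ht.1 ht.2 hd
      (hr.2.2.1 _ ((mem_lightPairs_iff h).2 hE))
  obtain ⟨h1, h2⟩ := exists_eq_smul_of_neg hd.hasFDerivAt (differentiableAt_E h).hasFDerivAt
    ((productCoord_eq_zero_iff hr h).2 hE) hE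
    (by filter_upwards [hD.mem_nhds h] with q hq hq0 using ((productCoord_neg_iff hr hq).2 hq0).le)
    (R.fderiv_Z_ne u h.1.1 v h.2.1)
  exact ⟨lt_of_le_of_ne h1 fun h3 => h0 (h2.trans
    ((congrArg (· • fderiv ℝ R.E (u, v)) h3.symm).trans (zero_smul _ _))), h2⟩

end DefiningFunction

end RayChart

/-! ### The scattering relation -/

section OrthogonalProjection

variable {n : ℕ} {M : Type*} [TopologicalSpace M]
  [ChartedSpace (EuclideanSpace ℝ (Fin (n + 1))) M] [IsManifold (𝓡 (n + 1)) ∞ M]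
  {U : Type*} [TopologicalSpace U] [ChartedSpace (EuclideanSpace ℝ (Fin n)) U]
  [IsManifold (𝓡 n) ∞ U] {g : LorentzMetric (n + 1) M} {ι : U → M}

/-- Vectors have orthogonal projections to nondegenerate surfaces. -/
theorem exists_orthProj (hU : IsNondegenerateSurface g ι) (x : U)
    (p : TangentSpace (𝓡 (n + 1)) (ι x)) :
    ∃ a : TangentSpace (𝓡 n) x, ∀ b : TangentSpace (𝓡 n) x,
      g.inner (ι x) (p - mfderiv (𝓡 n) (𝓡 (n + 1)) ι x a)
        (mfderiv (𝓡 n) (𝓡 (n + 1)) ι x b) = 0 := by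
  let A : Coord n →L[ℝ] Coord (n + 1) := mfderiv (𝓡 n) (𝓡 (n + 1)) ι x
  let G : Coord (n + 1) →L[ℝ] Coord (n + 1) →L[ℝ] ℝ := g.inner (ι x)
  let B : Coord n →ₗ[ℝ] (Coord n →L[ℝ] ℝ) :=
    { toFun := fun a => (G (A a)).comp A
      map_add' := fun a b => by rw [map_add, map_add, ContinuousLinearMap.add_comp]
      map_smul' := fun r a => by
        rw [map_smul, map_smul, ContinuousLinearMap.smul_comp, RingHom.id_apply] }
  have hB : Function.Injective B := by
    rw [injective_iff_map_eq_zero]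
    intro a ha
    exact hU x a fun b => congrArg (fun f : Coord n →L[ℝ] ℝ => f b) ha
  obtain ⟨a, ha⟩ := (LinearMap.injective_iff_surjective_of_finrank_eq_finrank
    (finrank_coord_dual n).symm).1 hB ((G p).comp A)
  refine ⟨a, fun b => ?_⟩
  rw [map_sub, sub_apply, sub_eq_zero]
  exact congrArg (fun f : Coord n →L[ℝ] ℝ => f b) ha.symm

theorem mk_smul_congr {p : TangentBundle (𝓡 (n + 1)) M} {m : M} {v : TangentSpace (𝓡 (n + 1)) m}
    (h : p = ⟨m, v⟩) (r : ℝ) :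
    (⟨p.1, r • p.2⟩ : TangentBundle (𝓡 (n + 1)) M) = ⟨m, r • v⟩ := by
  subst h
  rfl

end OrthogonalProjection

namespace RayChart

variable {n : ℕ} {M : Type*} [TopologicalSpace M] [T2Space M]
  [ChartedSpace (EuclideanSpace ℝ (Fin (n + 1))) M] [IsManifold (𝓡 (n + 1)) ∞ M]
  {U : Type*} [TopologicalSpace U] [ChartedSpace (EuclideanSpace ℝ (Fin n)) U]
  [IsManifold (𝓡 n) ∞ U]
  {V : Type*} [TopologicalSpace V] [ChartedSpace (EuclideanSpace ℝ (Fin n)) V]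
  [IsManifold (𝓡 n) ∞ V]
  {g : LorentzMetric (n + 1) M} {ιU : U → M} {ιV : V → M}
  {𝒲 : Set (TangentBundle (𝓡 (n + 1)) M)} {x₀ : U} {y₀ : V} {u v : Coord n}
  {U' : Set U} {V' : Set V}
  (R : RayChart g ιU ιV 𝒲 x₀ y₀)

/-- The projection of the initial velocity to the first surface, as a covector. -/
def startCov (q : Coord n × Coord n) : Coord n →L[ℝ] ℝ :=
  -(fderiv ℝ R.E q).comp (ContinuousLinearMap.inl ℝ (Coord n) (Coord n))

/-- The projection of the final velocity to the second surface, as a covector. -/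
def endCov (q : Coord n × Coord n) : Coord n →L[ℝ] ℝ :=
  (fderiv ℝ R.E q).comp (ContinuousLinearMap.inr ℝ (Coord n) (Coord n))

variable {R}

theorem startCov_apply (q : Coord n × Coord n) (c : Coord n) :
    R.startCov q c = -fderiv ℝ R.E q (c, 0) := rfl

theorem endCov_apply (q : Coord n × Coord n) (c : Coord n) :
    R.endCov q c = fderiv ℝ R.E q (0, c) := rfl

/-- The covectors related by the scattering relation are, in coordinates, common positive multiples
of the covectors of a light ray, which are given by the partial differentials of the energy. -/
theorem exists_of_mem_scatteringSharp (hU' : U' ⊆ R.sourceU) (hV' : V' ⊆ R.sourceV)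
    {α : Cotangent n U} {β : Cotangent n V} (h : (α, β) ∈ scatteringSharp g ιU ιV 𝒲 U' V') :
    ∃ (u v : Coord n) (l : ℝ), (u, v) ∈ R.domain U' V' ∧ R.E (u, v) = 0 ∧ 0 < l ∧
      α.1 ∈ (extChartAt (𝓡 n) x₀).source ∧ covCoord x₀ α = (u, l • R.startCov (u, v)) ∧
      β.1 ∈ (extChartAt (𝓡 n) y₀).source ∧ covCoord y₀ β = (v, l • R.endCov (u, v)) := by
  obtain ⟨⟨x, a⟩, ⟨y, b⟩, ⟨hx, hy, γ, T, hT, hγ, hl, hW, ⟨p, hp, hpo⟩, q, hq, hqo⟩,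
    ⟨ξ, hα, hξ⟩, ζ, hβ, hζ⟩ := h
  simp only at hx hy p hp hpo q hq hqo ξ hα hξ ζ hβ hζ
  obtain ⟨u, v, huv, rfl, rfl⟩ := exists_mem_domain hU' hV' hx hy
  obtain ⟨hut, hvt⟩ := mem_target_of_mem_domain huv
  have hαs : α.1 ∈ (extChartAt (𝓡 n) x₀).source := hα ▸ (extChartAt (𝓡 n) x₀).map_target hut
  have hβs : β.1 ∈ (extChartAt (𝓡 n) y₀).source := hβ ▸ (extChartAt (𝓡 n) y₀).map_target hvt
  -- the geodesic, rescaled to the interval `[0, 1]`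
  have hγ1 : IsGeodesicSegment g (fun t => γ (T * t)) 1 :=
    IsGeodesicSegment.comp_mul (by rwa [mul_one]) hT
  have hv0 : velocity (n + 1) (fun t => γ (T * t)) 0 =
      ⟨ιU ((extChartAt (𝓡 n) x₀).symm u), T • p⟩ := by
    have h1 := velocity_comp_mul (k := n + 1) (γ := γ) (t := 0) (ρ := T)
      (by rw [mul_zero]; exact hγ.mdifferentiableAt le_rfl hT.le)
    rw [mul_zero] at h1
    exact h1.trans (mk_smul_congr hp T)
  have hv1 : velocity (n + 1) (fun t => γ (T * t)) 1 =
      ⟨ιV ((extChartAt (𝓡 n) y₀).symm v), T • q⟩ := by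
    have h1 := velocity_comp_mul (k := n + 1) (γ := γ) (t := 1) (ρ := T)
      (by rw [mul_one]; exact hγ.mdifferentiableAt hT.le le_rfl)
    rw [mul_one] at h1
    exact h1.trans (mk_smul_congr hq T)
  have hW' : velocity (n + 1) (fun t => γ (T * t)) 0 ∈ 𝒲 := by
    rw [hv0, ← mk_smul_congr hp T]
    exact hW
  have hend : (fun t => γ (T * t)) 1 = ιV ((extChartAt (𝓡 n) y₀).symm v) :=
    congrArg TotalSpace.proj hv1
  have hP := R.P_unique u huv.1.1 v huv.2.1 _ hW' (congrArg TotalSpace.proj hv0)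
    ⟨_, hγ1, rfl, hend⟩
  have hE : R.E (u, v) = 0 := by
    rw [← R.energy_P, ← hP, hv0, energy_smul]
    have h1 := hl.2
    rw [hp] at h1
    rw [energy]
    simp only at h1 ⊢
    rw [h1, zero_div, mul_zero]
  refine ⟨u, v, T⁻¹, huv, hE, inv_pos.2 hT, hαs, (covCoord_eq_iff hαs hut).2 ⟨ξ, hα, fun c => ?_⟩,
    hβs, (covCoord_eq_iff hβs hvt).2 ⟨ζ, hβ, fun c => ?_⟩⟩
  · have h1 := R.deriv_left u huv.1.1 v huv.2.1 (T • p) (hP.symm.trans hv0) c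
    have h2 := hpo (chartVec x₀ u c)
    rw [map_sub, sub_apply, sub_eq_zero] at h2
    rw [map_smul, smul_apply, smul_eq_mul] at h1
    rw [hξ, inducedMetric, ← h2, smul_apply, startCov_apply, smul_eq_mul, ← h1,
      inv_mul_cancel_left₀ hT.ne']
  · have h1 := R.deriv_right u huv.1.1 v huv.2.1 _ hγ1 hP (T • q) hv1 c
    have h2 := hqo (chartVec y₀ v c)
    rw [map_sub, sub_apply, sub_eq_zero] at h2
    rw [map_smul, smul_apply, smul_eq_mul] at h1
    rw [hζ, inducedMetric, ← h2, smul_apply, endCov_apply, smul_eq_mul, ← h1,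
      inv_mul_cancel_left₀ hT.ne']

/-- Conversely, all common positive multiples of the covectors of a light ray are related by the
scattering relation: the factor `l` is obtained by parametrizing the light ray on `[0, 1 / l]`. -/
theorem mem_scatteringSharp (hU : IsNondegenerateSurface g ιU) (hV : IsNondegenerateSurface g ιV)
    {α : Cotangent n U} {β : Cotangent n V} {l : ℝ} (h : (u, v) ∈ R.domain U' V')
    (hE : R.E (u, v) = 0) (hl : 0 < l) (hα : α.1 ∈ (extChartAt (𝓡 n) x₀).source)
    (hα' : covCoord x₀ α = (u, l • R.startCov (u, v)))
    (hβ : β.1 ∈ (extChartAt (𝓡 n) y₀).source) (hβ' : covCoord y₀ β = (v, l • R.endCov (u, v))) :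
    (α, β) ∈ scatteringSharp g ιU ιV 𝒲 U' V' := by
  obtain ⟨hut, hvt⟩ := mem_target_of_mem_domain h
  obtain ⟨ξ, rfl, hξ⟩ := (covCoord_eq_iff hα hut).1 hα'
  obtain ⟨ζ, rfl, hζ⟩ := (covCoord_eq_iff hβ hvt).1 hβ'
  obtain ⟨γ, hγ, hγ0, hend⟩ := R.P_joins u h.1.1 v h.2.1
  obtain ⟨p, hp⟩ := exists_eq_totalSpaceMk (R.P_proj u h.1.1 v h.2.1)
  obtain ⟨q, hq⟩ := exists_eq_totalSpaceMk (p := velocity (n + 1) γ 1) hend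
  have hll : l * l⁻¹ = 1 := mul_inv_cancel₀ hl.ne'
  have hv0 : velocity (n + 1) (fun t => γ (l * t)) 0 =
      ⟨ιU ((extChartAt (𝓡 n) x₀).symm u), l • p⟩ := by
    have h1 := velocity_comp_mul (k := n + 1) (γ := γ) (t := 0) (ρ := l)
      (by rw [mul_zero]; exact hγ.mdifferentiableAt le_rfl zero_le_one)
    rw [mul_zero] at h1
    exact h1.trans (mk_smul_congr (hγ0.trans hp) l)
  have hv1 : velocity (n + 1) (fun t => γ (l * t)) l⁻¹ =
      ⟨ιV ((extChartAt (𝓡 n) y₀).symm v), l • q⟩ := by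
    have h1 := velocity_comp_mul (k := n + 1) (γ := γ) (t := l⁻¹) (ρ := l)
      (by rw [hll]; exact hγ.mdifferentiableAt zero_le_one le_rfl)
    rw [hll] at h1
    exact h1.trans (mk_smul_congr hq l)
  obtain ⟨a, ha⟩ := exists_orthProj hU ((extChartAt (𝓡 n) x₀).symm u) (l • p)
  obtain ⟨b, hb⟩ := exists_orthProj hV ((extChartAt (𝓡 n) y₀).symm v) (l • q)
  have hnull := isLightlike_P h hE
  refine ⟨⟨_, a⟩, ⟨_, b⟩, ⟨h.1.2, h.2.2, fun t => γ (l * t), l⁻¹, inv_pos.2 hl,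
    IsGeodesicSegment.comp_mul (by rwa [hll]) hl, ?_, ?_, ⟨l • p, hv0, ha⟩, l • q, hv1, hb⟩,
    ⟨ξ, rfl, fun c => ?_⟩, ζ, rfl, fun c => ?_⟩
  · rw [hv0]
    rw [hp] at hnull
    refine ⟨smul_ne_zero hl.ne' hnull.1, ?_⟩
    have h1 := hnull.2
    simp only [map_smul, smul_apply, smul_eq_mul] at h1 ⊢
    rw [h1, mul_zero, mul_zero]
  · have h1 := mk_smul_congr hv0 l⁻¹
    rw [smul_smul, inv_mul_cancel₀ hl.ne', one_smul, ← hp] at h1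
    have h2 := R.P_mem u h.1.1 v h.2.1
    rw [← h1] at h2
    exact h2
  · obtain ⟨c, rfl⟩ := chartVec_surjective x₀ hut c
    have h1 := R.deriv_left u h.1.1 v h.2.1 p hp c
    have h2 := ha (chartVec x₀ u c)
    rw [map_sub, sub_apply, sub_eq_zero, map_smul, smul_apply, smul_eq_mul, h1] at h2
    rw [hξ, inducedMetric, ← h2, smul_apply, startCov_apply, smul_eq_mul]
  · obtain ⟨c, rfl⟩ := chartVec_surjective y₀ hvt c
    have h1 := R.deriv_right u h.1.1 v h.2.1 γ hγ hγ0 q hq c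
    have h2 := hb (chartVec y₀ v c)
    rw [map_sub, sub_apply, sub_eq_zero, map_smul, smul_apply, smul_eq_mul, h1] at h2
    rw [hζ, inducedMetric, ← h2, smul_apply, endCov_apply, smul_eq_mul]

/-- The initial point and the initial covector of a light ray, up to scale, determine its endpoint.
The derivatives in the direction `Z` bound the ratio of the two scales, so that both triples lie in
the source of the local diffeomorphism `e`. -/
theorem eq_of_smul_startCov_eq {v' : Coord n} (h : (u, v) ∈ R.domain U' V')
    (h' : (u, v') ∈ R.domain U' V') (hE : R.E (u, v) = 0) (hE' : R.E (u, v') = 0) {l l' : ℝ}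
    (hl' : 0 < l') (heq : l • R.startCov (u, v) = l' • R.startCov (u, v')) : v = v' ∧ l = l' := by
  have h1 : (l / l') • R.startCov (u, v) = R.startCov (u, v') := by
    rw [div_eq_inv_mul, mul_smul, heq, smul_smul, inv_mul_cancel₀ hl'.ne', one_smul]
  have hrat : l / l' ∈ Ioo (1 - R.δ) (1 + R.δ) := by
    refine R.ratio u h.1.1 v h.2.1 v' h'.2.1 _ ?_
    have h2 := congrArg (fun A : Coord n →L[ℝ] ℝ => A R.Z) h1
    simp only [smul_apply, startCov_apply, smul_eq_mul] at h2
    linarith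
  have h1mem : (1 : ℝ) ∈ Ioo (1 - R.δ) (1 + R.δ) :=
    ⟨by linarith [R.δ_pos], by linarith [R.δ_pos]⟩
  have h2 := R.e_apply u h.1.1 v h.2.1 (l / l')
  have h3 := R.e_apply u h'.1.1 v' h'.2.1 1
  change _ = (u, (l / l') • R.startCov (u, v), _) at h2
  change _ = (u, (1 : ℝ) • R.startCov (u, v'), _) at h3
  rw [h1, hE] at h2
  rw [one_smul, hE'] at h3
  have h4 := R.e.injOn (R.mem_source u h.1.1 v h.2.1 _ hrat) (R.mem_source u h'.1.1 v' h'.2.1 _ h1mem)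
    (h2.trans h3.symm)
  have h5 : v = v' ∧ l / l' = 1 := by simpa using h4
  exact ⟨h5.1, (div_eq_one_iff_eq hl'.ne').1 h5.2⟩

end RayChart

/-! ### Reduced representations of the scattering relation -/

namespace RayChart

variable {n : ℕ} {M : Type*} [TopologicalSpace M] [T2Space M]
  [ChartedSpace (EuclideanSpace ℝ (Fin (n + 1))) M] [IsManifold (𝓡 (n + 1)) ∞ M]
  {U : Type*} [TopologicalSpace U] [ChartedSpace (EuclideanSpace ℝ (Fin n)) U]
  [IsManifold (𝓡 n) ∞ U]
  {V : Type*} [TopologicalSpace V] [ChartedSpace (EuclideanSpace ℝ (Fin n)) V]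
  [IsManifold (𝓡 n) ∞ V]
  {g : LorentzMetric (n + 1) M} {ιU : U → M} {ιV : V → M}
  {𝒲 : Set (TangentBundle (𝓡 (n + 1)) M)} {x₀ : U} {y₀ : V} {u v : Coord n}
  {U' : Set U} {V' : Set V} {R : RayChart g ιU ιV 𝒲 x₀ y₀} {r : U × V → ℝ}

theorem differentiableAt_productCoord (hr : IsDefiningFunction g ιU ιV 𝒲 U' V' r)
    (hU'o : IsOpen U') (hV'o : IsOpen V') (h : (u, v) ∈ R.domain U' V') :
    DifferentiableAt ℝ (productCoord r x₀ y₀) (u, v) :=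
  ((contDiffOn_productCoord_domain hr.1).contDiffAt
    ((isOpen_domain hU'o hV'o).mem_nhds h)).differentiableAt (by simp)

/-- In coordinates, `-d'ₓ r` is a positive multiple of the initial covector of the light ray. -/
theorem covCoord_neg_gradient (hr : IsDefiningFunction g ιU ιV 𝒲 U' V' r)
    (hU'o : IsOpen U') (hV'o : IsOpen V') (h : (u, v) ∈ R.domain U' V') (hE : R.E (u, v) = 0) :
    covCoord x₀ (⟨(extChartAt (𝓡 n) x₀).symm u, -mvfderiv (𝓡 n)
        (fun x => r (x, (extChartAt (𝓡 n) y₀).symm v)) ((extChartAt (𝓡 n) x₀).symm u)⟩ :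
        Cotangent n U) = (u, R.derivRatio r (u, v) • R.startCov (u, v)) := by
  obtain ⟨hu, hv⟩ := mem_target_of_mem_domain h
  refine (covCoord_eq_iff ((extChartAt (𝓡 n) x₀).map_target hu) hu).2 ⟨_, rfl, fun c => ?_⟩
  have h1 := mvfderiv_left hu (mdifferentiableAt_of_contMDiffOn hr.1 hU'o hV'o h)
    (differentiableAt_productCoord hr hU'o hV'o h) c
  rw [(fderiv_productCoord_eq hr hU'o hV'o h hE).2, smul_apply, smul_eq_mul] at h1
  rw [smul_apply, startCov_apply, smul_eq_mul, mul_neg, ← h1]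
  rfl

/-- In coordinates, `d'ᵧ r` is the same multiple of the final covector of the light ray. -/
theorem covCoord_gradient (hr : IsDefiningFunction g ιU ιV 𝒲 U' V' r)
    (hU'o : IsOpen U') (hV'o : IsOpen V') (h : (u, v) ∈ R.domain U' V') (hE : R.E (u, v) = 0) :
    covCoord y₀ (⟨(extChartAt (𝓡 n) y₀).symm v, mvfderiv (𝓡 n)
        (fun y => r ((extChartAt (𝓡 n) x₀).symm u, y)) ((extChartAt (𝓡 n) y₀).symm v)⟩ :
        Cotangent n V) = (v, R.derivRatio r (u, v) • R.endCov (u, v)) := by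
  obtain ⟨hu, hv⟩ := mem_target_of_mem_domain h
  refine (covCoord_eq_iff ((extChartAt (𝓡 n) y₀).map_target hv) hv).2 ⟨_, rfl, fun c => ?_⟩
  have h1 := mvfderiv_right hv (mdifferentiableAt_of_contMDiffOn hr.1 hU'o hV'o h)
    (differentiableAt_productCoord hr hU'o hV'o h) c
  rw [(fderiv_productCoord_eq hr hU'o hV'o h hE).2, smul_apply, smul_eq_mul] at h1
  rw [smul_apply, endCov_apply, smul_eq_mul, ← h1]

theorem mem_gradientGraph_iff (hr : IsDefiningFunction g ιU ιV 𝒲 U' V' r)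
    (hU'o : IsOpen U') (hV'o : IsOpen V') (hU' : U' ⊆ R.sourceU) (hV' : V' ⊆ R.sourceV)
    {α : Cotangent n U} {β : Cotangent n V} :
    (α, β) ∈ gradientGraph r U' V' ↔ ∃ u v : Coord n, (u, v) ∈ R.domain U' V' ∧ R.E (u, v) = 0 ∧
      α.1 ∈ (extChartAt (𝓡 n) x₀).source ∧
      covCoord x₀ α = (u, R.derivRatio r (u, v) • R.startCov (u, v)) ∧
      β.1 ∈ (extChartAt (𝓡 n) y₀).source ∧
      covCoord y₀ β = (v, R.derivRatio r (u, v) • R.endCov (u, v)) := by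
  constructor
  · rintro ⟨x, hx, y, hy, h0, hαβ⟩
    obtain ⟨u, v, h, rfl, rfl⟩ := exists_mem_domain hU' hV' hx hy
    obtain ⟨hu, hv⟩ := mem_target_of_mem_domain h
    have hE : R.E (u, v) = 0 := (productCoord_eq_zero_iff hr h).1 h0
    obtain ⟨rfl, rfl⟩ := Prod.ext_iff.1 hαβ
    exact ⟨u, v, h, hE, (extChartAt (𝓡 n) x₀).map_target hu,
      covCoord_neg_gradient hr hU'o hV'o h hE, (extChartAt (𝓡 n) y₀).map_target hv,
      covCoord_gradient hr hU'o hV'o h hE⟩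
  · rintro ⟨u, v, h, hE, hα, hα', hβ, hβ'⟩
    obtain ⟨hu, hv⟩ := mem_target_of_mem_domain h
    refine ⟨_, h.1.2, _, h.2.2, (productCoord_eq_zero_iff hr h).2 hE, Prod.ext ?_ ?_⟩
    · exact covCoord_injOn hα ((extChartAt (𝓡 n) x₀).map_target hu)
        (hα'.trans (covCoord_neg_gradient hr hU'o hV'o h hE).symm)
    · exact covCoord_injOn hβ ((extChartAt (𝓡 n) y₀).map_target hv)
        (hβ'.trans (covCoord_gradient hr hU'o hV'o h hE).symm)

variable (R) in
/-- The covectors `-d'ₓ r` at the pairs connected by a light ray. -/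
def raySurface (U' : Set U) (V' : Set V) (r : U × V → ℝ) : Set (Cotangent n U) :=
  {α | ∃ u v : Coord n, (u, v) ∈ R.domain U' V' ∧ R.E (u, v) = 0 ∧
    α.1 ∈ (extChartAt (𝓡 n) x₀).source ∧
    covCoord x₀ α = (u, R.derivRatio r (u, v) • R.startCov (u, v))}

theorem e_apply_null (h : (u, v) ∈ R.domain U' V') (hE : R.E (u, v) = 0) (l : ℝ) :
    R.e (u, v, l) = (u, l • R.startCov (u, v), 0) := by
  rw [R.e_apply u h.1.1 v h.2.1, hE]
  rfl

/-- The covectors `-d'ₓ r` form a hypersurface: writing a covector near one of them as the initial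
covector, up to the scale `l`, of a light ray, it belongs to the surface when `l` is the ratio of
the differentials of `r` and of the energy. -/
theorem isRadiallyTransversalHypersurface_raySurface (hr : IsDefiningFunction g ιU ιV 𝒲 U' V' r)
    (hU'o : IsOpen U') (hV'o : IsOpen V') :
    IsRadiallyTransversalHypersurface (R.raySurface U' V' r) := by
  rintro α ⟨u₁, v₁, h₁, hE₁, hα, hα'⟩
  have hD := isOpen_domain (R := R) hU'o hV'o
  set c₁ := R.derivRatio r (u₁, v₁) with hc₁
  have hc₁pos : 0 < c₁ := (fderiv_productCoord_eq hr hU'o hV'o h₁ hE₁).1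
  -- covectors at the points of the chart domain, scaled such that `α` corresponds to `l = 1`
  let S₀ : Set (Cotangent n U) := TotalSpace.proj ⁻¹' (extChartAt (𝓡 n) x₀).source
  have hS₀ : IsOpen S₀ := (isOpen_extChartAt_source x₀).preimage (FiberBundle.continuous_proj _ _)
  let A : Coord n × (Coord n →L[ℝ] ℝ) → Coord n × (Coord n →L[ℝ] ℝ) × ℝ := fun q =>
    (q.1, c₁⁻¹ • q.2, 0)
  have hA : ContDiff ℝ ∞ A := by
    have h1 : ContDiff ℝ ∞ fun q : Coord n × (Coord n →L[ℝ] ℝ) => c₁⁻¹ • q.2 :=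
      contDiff_snd.const_smul c₁⁻¹
    exact contDiff_fst.prodMk (h1.prodMk contDiff_const)
  let T : Set (Coord n × (Coord n →L[ℝ] ℝ)) := A ⁻¹' R.e.target
  have hT : IsOpen T := R.e.open_target.preimage hA.continuous
  let G : Coord n × (Coord n →L[ℝ] ℝ) → Coord n × Coord n × ℝ := fun q => R.e.symm (A q)
  have hG : ContDiffOn ℝ ∞ G T := R.contDiffOn_e_symm.comp hA.contDiffOn fun _ h => h
  let Q : Set (Coord n × Coord n × ℝ) :=
    {q | (q.1, q.2.1) ∈ R.domain U' V' ∧ q.2.2 ∈ Ioo (1 - R.δ) (1 + R.δ) ∧ 0 < q.2.2}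
  have hpr : Continuous fun q : Coord n × Coord n × ℝ => (q.1, q.2.1) := by fun_prop
  have hpl : Continuous fun q : Coord n × Coord n × ℝ => q.2.2 := by fun_prop
  have hQ : IsOpen Q :=
    (hD.preimage hpr).inter ((isOpen_Ioo.preimage hpl).inter (isOpen_Ioi.preimage hpl))
  let N : Set (Coord n × (Coord n →L[ℝ] ℝ)) := T ∩ G ⁻¹' Q
  have hN : IsOpen N := hG.continuousOn.isOpen_inter_preimage hT hQ
  let O : Set (Cotangent n U) := S₀ ∩ covCoord x₀ ⁻¹' N
  have hO : IsOpen O := (contMDiffOn_covCoord x₀).continuousOn.isOpen_inter_preimage hS₀ hN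
  -- zero if and only if the scale `c₁ l` of the covector is the ratio of the differentials
  let ρ₀ : Coord n × (Coord n →L[ℝ] ℝ) → ℝ := fun q =>
    c₁ * (G q).2.2 / R.derivRatio r ((G q).1, (G q).2.1) - 1
  -- the values of `G` in terms of covectors of light rays
  have hGe : ∀ u v l, (u, v) ∈ R.domain U' V' → R.E (u, v) = 0 → l ∈ Ioo (1 - R.δ) (1 + R.δ) →
      0 < l → (u, (c₁ * l) • R.startCov (u, v)) ∈ N ∧
        G (u, (c₁ * l) • R.startCov (u, v)) = (u, v, l) := by
    intro u v l h hE hl hl0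
    have h2 : A (u, (c₁ * l) • R.startCov (u, v)) = R.e (u, v, l) := by
      rw [e_apply_null h hE]
      change (u, c₁⁻¹ • (c₁ * l) • R.startCov (u, v), (0 : ℝ)) = _
      rw [smul_smul, inv_mul_cancel_left₀ hc₁pos.ne']
    have hs := R.mem_source u h.1.1 v h.2.1 l hl
    have h3 : G (u, (c₁ * l) • R.startCov (u, v)) = (u, v, l) := by
      change R.e.symm (A _) = _
      rw [h2, R.e.left_inv hs]
    refine ⟨⟨?_, ?_⟩, h3⟩
    · change A _ ∈ R.e.target
      rw [h2]
      exact R.e.map_source hs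
    · rw [mem_preimage, h3]
      exact ⟨h, hl, hl0⟩
  -- all covectors in `N` are covectors of light rays: the last component of `A` is the value zero
  -- of the energy
  have hGinv : ∀ q ∈ N, ∃ u v l, (u, v) ∈ R.domain U' V' ∧ R.E (u, v) = 0 ∧
      l ∈ Ioo (1 - R.δ) (1 + R.δ) ∧ 0 < l ∧ q = (u, (c₁ * l) • R.startCov (u, v)) := by
    rintro q ⟨hqT, hqQ⟩
    obtain ⟨⟨u, v, l⟩, hGq⟩ : ∃ w, G q = w := ⟨_, rfl⟩
    have h1 : R.e (u, v, l) = A q := by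
      rw [← hGq]
      exact R.e.right_inv hqT
    rw [mem_preimage, hGq] at hqQ
    obtain ⟨h, hl, hl0⟩ := hqQ
    simp only at h hl hl0
    rw [R.e_apply u h.1.1 v h.2.1] at h1
    have h2 : u = q.1 := congrArg Prod.fst h1
    have h3 : l • R.startCov (u, v) = c₁⁻¹ • q.2 := congrArg (fun p => p.2.1) h1
    have h4 : R.E (u, v) = 0 := congrArg (fun p => p.2.2) h1
    refine ⟨u, v, l, h, h4, hl, hl0, Prod.ext h2.symm ?_⟩
    rw [mul_smul, h3, smul_smul, mul_inv_cancel₀ hc₁pos.ne', one_smul]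
  have h1mem : (1 : ℝ) ∈ Ioo (1 - R.δ) (1 + R.δ) :=
    ⟨by linarith [R.δ_pos], by linarith [R.δ_pos]⟩
  refine ⟨O, hO, ⟨hα, ?_⟩, fun β => ρ₀ (covCoord x₀ β), ?_, ?_, ?_⟩
  · have h2 := (hGe u₁ v₁ 1 h₁ hE₁ h1mem one_pos).1
    rw [mul_one] at h2
    rw [mem_preimage, hα']
    exact h2
  · have hρ₀ : ContDiffOn ℝ ∞ ρ₀ N := by
      have hGN : ContDiffOn ℝ ∞ G N := hG.mono inter_subset_left
      have h2 : ContDiffOn ℝ ∞ (fun q => ((G q).1, (G q).2.1)) N :=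
        (contDiff_fst.prodMk (contDiff_fst.comp contDiff_snd)).comp_contDiffOn hGN
      have h3 : ContDiffOn ℝ ∞ (fun q => (G q).2.2) N :=
        (contDiff_snd.comp contDiff_snd).comp_contDiffOn hGN
      refine ((contDiffOn_const.mul h3).div ((contDiffOn_derivRatio hU'o hV'o hr.1).comp h2
        fun q hq => hq.2.1) ?_).sub contDiffOn_const
      intro q hq
      obtain ⟨u, v, l, h, hE, hl, hl0, rfl⟩ := hGinv q hq
      rw [Function.comp_apply, (hGe u v l h hE hl hl0).2]
      exact (fderiv_productCoord_eq hr hU'o hV'o h hE).1.ne'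
    exact hρ₀.contMDiffOn.comp ((contMDiffOn_covCoord x₀).mono inter_subset_left)
      fun β hβ => hβ.2
  · ext β
    constructor
    · rintro ⟨⟨u, v, h, hE, hβ, hβ'⟩, hβO⟩
      refine ⟨hβO, ?_⟩
      obtain ⟨u', v', l, h', hE', hl, hl0, heq⟩ := hGinv _ hβO.2
      rw [hβ'] at heq
      obtain ⟨rfl, h5⟩ := Prod.ext_iff.1 heq
      obtain ⟨rfl, h6⟩ := eq_of_smul_startCov_eq h h' hE hE' (mul_pos hc₁pos hl0) h5
      change ρ₀ (covCoord x₀ β) = 0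
      rw [hβ', h6]
      change c₁ * (G _).2.2 / R.derivRatio r ((G _).1, (G _).2.1) - 1 = 0
      rw [(hGe _ _ l h hE hl hl0).2]
      simp only
      rw [h6, div_self (mul_pos hc₁pos hl0).ne', sub_self]
    · rintro ⟨hβO, h0⟩
      refine ⟨?_, hβO⟩
      obtain ⟨u, v, l, h, hE, hl, hl0, heq⟩ := hGinv _ hβO.2
      change ρ₀ (covCoord x₀ β) = 0 at h0
      rw [heq] at h0
      change c₁ * (G _).2.2 / R.derivRatio r ((G _).1, (G _).2.1) - 1 = 0 at h0
      rw [(hGe _ _ l h hE hl hl0).2, sub_eq_zero,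
        div_eq_one_iff_eq (fderiv_productCoord_eq hr hU'o hV'o h hE).1.ne'] at h0
      simp only at h0
      exact ⟨u, v, h, hE, hβO.1, by rw [heq, h0]⟩
  · rintro β ⟨⟨u, v, h, hE, hβ, hβ'⟩, hβO⟩
    obtain ⟨u', v', l, h', hE', hl, hl0, heq⟩ := hGinv _ hβO.2
    rw [hβ'] at heq
    obtain ⟨rfl, h5⟩ := Prod.ext_iff.1 heq
    obtain ⟨rfl, h6⟩ := eq_of_smul_startCov_eq h h' hE hE' (mul_pos hc₁pos hl0) h5
    have hc := (fderiv_productCoord_eq hr hU'o hV'o h hE).1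
    have hcont : ContinuousAt (fun s : ℝ => s * l) 1 := by fun_prop
    -- along a radial ray, `ρ₀` is the affine function `s - 1`, whose derivative is nonzero
    have hev : (fun s : ℝ => ρ₀ (covCoord x₀ ⟨β.1, s • β.2⟩)) =ᶠ[𝓝 1] fun s => s - 1 := by
      filter_upwards [hcont.preimage_mem_nhds (isOpen_Ioo.mem_nhds (by rwa [one_mul])),
        hcont.preimage_mem_nhds (isOpen_Ioi.mem_nhds (show 1 * l ∈ Ioi (0 : ℝ) by
          rwa [one_mul]))] with s hs1 hs2
      rw [covCoord_smul, hβ', h6, smul_smul, mul_left_comm]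
      change c₁ * (G _).2.2 / R.derivRatio r ((G _).1, (G _).2.1) - 1 = _
      rw [(hGe _ _ (s * l) h hE hs1 hs2).2]
      simp only
      rw [mul_left_comm, ← h6, mul_div_cancel_right₀ _ hc.ne']
    change deriv (fun s : ℝ => ρ₀ (covCoord x₀ ⟨β.1, s • β.2⟩)) 1 ≠ 0
    rw [hev.deriv_eq]
    simp

/-- The partial differentials of a defining function are a reduced representation of the
scattering relation. -/
theorem isReducedRepresentation_gradientGraph (hU : IsNondegenerateSurface g ιU)
    (hV : IsNondegenerateSurface g ιV) (hr : IsDefiningFunction g ιU ιV 𝒲 U' V' r)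
    (hU'o : IsOpen U') (hV'o : IsOpen V') (hU' : U' ⊆ R.sourceU) (hV' : V' ⊆ R.sourceV) :
    IsReducedRepresentation (scatteringSharp g ιU ιV 𝒲 U' V') (gradientGraph r U' V') := by
  have hpos : ∀ {u v}, (u, v) ∈ R.domain U' V' → R.E (u, v) = 0 → 0 < R.derivRatio r (u, v) :=
    fun h hE => (fderiv_productCoord_eq hr hU'o hV'o h hE).1
  refine ⟨R.raySurface U' V' r, isRadiallyTransversalHypersurface_raySurface hr hU'o hV'o,
    ?_, ?_, ?_⟩
  · rintro α ⟨u, v, h, hE, hα, hα'⟩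
    obtain ⟨hu, hv⟩ := mem_target_of_mem_domain h
    refine ⟨_, mem_scatteringSharp hU hV h hE (hpos h hE) hα hα'
      ((extChartAt (𝓡 n) y₀).map_target hv) (covCoord_gradient hr hU'o hV'o h hE), ?_⟩
    intro β hβ
    obtain ⟨u', v', l, h', hE', hl, -, h3, h4, h5⟩ := exists_of_mem_scatteringSharp hU' hV' hβ
    obtain ⟨rfl, h6⟩ := Prod.ext_iff.1 (hα'.symm.trans h3)
    obtain ⟨rfl, h7⟩ := eq_of_smul_startCov_eq h h' hE hE' hl h6
    refine covCoord_injOn h4 ((extChartAt (𝓡 n) y₀).map_target hv) (h5.trans ?_)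
    rw [← h7]
    exact (covCoord_gradient hr hU'o hV'o h hE).symm
  · intro α β hαβ
    obtain ⟨u, v, l, h, hE, hl, hα, hα', -⟩ := exists_of_mem_scatteringSharp hU' hV' hαβ
    refine ⟨R.derivRatio r (u, v) / l, ⟨div_pos (hpos h hE) hl, u, v, h, hE, hα, ?_⟩, ?_⟩
    · rw [covCoord_smul, hα', smul_smul, div_mul_cancel₀ _ hl.ne']
    · rintro l' ⟨hl', u', v', h', hE', -, h3⟩
      rw [covCoord_smul, hα', smul_smul] at h3
      obtain ⟨rfl, h6⟩ := Prod.ext_iff.1 h3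
      obtain ⟨rfl, h7⟩ := eq_of_smul_startCov_eq h h' hE hE' (hpos h' hE') h6
      rw [← h7, mul_div_cancel_right₀ _ hl.ne']
  · ext ⟨α, β⟩
    rw [mem_gradientGraph_iff hr hU'o hV'o hU' hV']
    constructor
    · rintro ⟨u, v, h, hE, hα, hα', hβ, hβ'⟩
      exact ⟨mem_scatteringSharp hU hV h hE (hpos h hE) hα hα' hβ hβ', u, v, h, hE, hα, hα'⟩
    · rintro ⟨hαβ, u, v, h, hE, hα, hα'⟩
      obtain ⟨u', v', l, h', hE', hl, -, h3, h4, h5⟩ := exists_of_mem_scatteringSharp hU' hV' hαβ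
      obtain ⟨rfl, h6⟩ := Prod.ext_iff.1 (hα'.symm.trans h3)
      obtain ⟨rfl, h7⟩ := eq_of_smul_startCov_eq h h' hE hE' hl h6
      exact ⟨_, _, h, hE, hα, hα', h4, by rw [h5, ← h7]⟩

end RayChart

/-! ### Variation of defining functions -/

namespace RayChart

variable {n : ℕ} {M : Type*} [TopologicalSpace M] [T2Space M]
  [ChartedSpace (EuclideanSpace ℝ (Fin (n + 1))) M] [IsManifold (𝓡 (n + 1)) ∞ M]
  {U : Type*} [TopologicalSpace U] [ChartedSpace (EuclideanSpace ℝ (Fin n)) U]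
  [IsManifold (𝓡 n) ∞ U]
  {V : Type*} [TopologicalSpace V] [ChartedSpace (EuclideanSpace ℝ (Fin n)) V]
  [IsManifold (𝓡 n) ∞ V]
  {g : LorentzMetric (n + 1) M} {ιU : U → M} {ιV : V → M}
  {𝒲 : Set (TangentBundle (𝓡 (n + 1)) M)} {x₀ : U} {y₀ : V} {u v : Coord n}
  {U' : Set U} {V' : Set V} {R : RayChart g ιU ιV 𝒲 x₀ y₀} {r : U × V → ℝ}

variable (R) in
/-- Half the ratio of the differentials of a defining function and of the energy, extended from the
set of pairs connected by a light ray to a positive smooth function. -/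
def weightCoord (r : U × V → ℝ) (q : Coord n × Coord n) : ℝ :=
  Real.sqrt (R.derivRatio r q ^ 2 + R.E q ^ 2) / 2

variable (R) in
/-- The factor of proportionality between the variation of defining functions and the light ray
transform. -/
def weight (r : U × V → ℝ) (q : U × V) : ℝ :=
  R.weightCoord r (extChartAt (𝓡 n) x₀ q.1, extChartAt (𝓡 n) y₀ q.2)

theorem weightCoord_radicand_pos (hr : IsDefiningFunction g ιU ιV 𝒲 U' V' r)
    (hU'o : IsOpen U') (hV'o : IsOpen V') (h : (u, v) ∈ R.domain U' V') :
    0 < R.derivRatio r (u, v) ^ 2 + R.E (u, v) ^ 2 := by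
  by_cases hE : R.E (u, v) = 0
  · have := (fderiv_productCoord_eq hr hU'o hV'o h hE).1
    positivity
  · positivity

theorem contMDiffOn_weight (hr : IsDefiningFunction g ιU ιV 𝒲 U' V' r)
    (hU'o : IsOpen U') (hV'o : IsOpen V') (hU' : U' ⊆ R.sourceU) (hV' : V' ⊆ R.sourceV) :
    ContMDiffOn ((𝓡 n).prod (𝓡 n)) 𝓘(ℝ, ℝ) ∞ (R.weight r) (U' ×ˢ V') := by
  refine contMDiffOn_comp_chart (F := R.weightCoord r) ?_ hU' hV'
  refine ContDiffOn.div_const (ContDiffOn.sqrt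
    (((contDiffOn_derivRatio hU'o hV'o hr.1).pow 2).add (contDiffOn_E_domain.pow 2)) ?_) 2
  exact fun q hq => (weightCoord_radicand_pos hr hU'o hV'o hq).ne'

theorem weight_eq (h : (u, v) ∈ R.domain U' V') :
    R.weight r ((extChartAt (𝓡 n) x₀).symm u, (extChartAt (𝓡 n) y₀).symm v) =
      R.weightCoord r (u, v) := by
  obtain ⟨hu, hv⟩ := mem_target_of_mem_domain h
  exact congrArg (R.weightCoord r) (Prod.ext ((extChartAt (𝓡 n) x₀).right_inv hu)
    ((extChartAt (𝓡 n) y₀).right_inv hv))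

theorem weight_ne_zero (hr : IsDefiningFunction g ιU ιV 𝒲 U' V' r)
    (hU'o : IsOpen U') (hV'o : IsOpen V') (hU' : U' ⊆ R.sourceU) (hV' : V' ⊆ R.sourceV)
    {q : U × V} (hq : q ∈ U' ×ˢ V') : R.weight r q ≠ 0 := by
  obtain ⟨x, y⟩ := q
  obtain ⟨u, v, h, rfl, rfl⟩ := exists_mem_domain hU' hV' hq.1 hq.2
  rw [weight_eq h, weightCoord]
  have := Real.sqrt_pos.2 (weightCoord_radicand_pos hr hU'o hV'o h)
  positivity

theorem weight_of_null (hr : IsDefiningFunction g ιU ιV 𝒲 U' V' r)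
    (hU'o : IsOpen U') (hV'o : IsOpen V') (h : (u, v) ∈ R.domain U' V') (hE : R.E (u, v) = 0) :
    R.weight r ((extChartAt (𝓡 n) x₀).symm u, (extChartAt (𝓡 n) y₀).symm v) =
      R.derivRatio r (u, v) / 2 := by
  rw [weight_eq h, weightCoord, hE, zero_pow two_ne_zero, add_zero,
    Real.sqrt_sq (fderiv_productCoord_eq hr hU'o hV'o h hE).1.le]

/-- The derivative of a family of defining functions is the light ray transform of the derivative
of the family of metrics. The defining function `r_τ` is negative where the energy is negative;
varying the initial point along a line as well, so that the energy vanishes to first order only,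
the differentials of both functions at a light ray are positively proportional. -/
theorem hasDerivAt_definingFunction (hr : IsDefiningFunction g ιU ιV 𝒲 U' V' r)
    (hU'o : IsOpen U') (hV'o : IsOpen V') (h : (u, v) ∈ R.domain U' V') (hE : R.E (u, v) = 0)
    {gf : ℝ → LorentzMetric (n + 1) M} {rf : ℝ → U × V → ℝ} {ε : ℝ} (hε : 0 < ε)
    (hgf0 : gf 0 = g) (hrf0 : rf 0 = r) (hgf : SmoothFamilyOn gf (Ioo (-ε) ε))
    (hrf : ContMDiffOn (𝓘(ℝ, ℝ).prod ((𝓡 n).prod (𝓡 n))) 𝓘(ℝ, ℝ) ∞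
      (fun q : ℝ × U × V => rf q.1 q.2) (Ioo (-ε) ε ×ˢ (U' ×ˢ V')))
    (hdef : ∀ τ ∈ Ioo (-ε) ε, IsDefiningFunction (gf τ) ιU ιV 𝒲 U' V' (rf τ))
    {γ : ℝ → M} (hγ : IsGeodesicSegment g γ 1) (hγ0 : velocity (n + 1) γ 0 = R.P (u, v)) :
    HasDerivAt (fun τ => rf τ ((extChartAt (𝓡 n) x₀).symm u, (extChartAt (𝓡 n) y₀).symm v))
      (R.derivRatio r (u, v) / 2 * rayTransform gf γ) 0 := by
  obtain ⟨𝓔, hd, h𝓔r, h𝓔s, hev⟩ :=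
    R.variation gf ε hε hgf0 hgf u h.1.1 v h.2.1 γ hγ hγ0
  obtain ⟨hu, hv⟩ := mem_target_of_mem_domain h
  have h0ε : (0 : ℝ) ∈ Ioo (-ε) ε := ⟨by linarith, hε⟩
  set y := (extChartAt (𝓡 n) y₀).symm v with hy
  have hline : ContDiff ℝ ∞ fun x : ℝ × ℝ => u + x.2 • R.Z := by fun_prop
  have hu0 : u + (0 : ℝ) • R.Z = u := by simp
  let 𝓡f : ℝ × ℝ → ℝ := fun x => rf x.1 ((extChartAt (𝓡 n) x₀).symm (u + x.2 • R.Z), y)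
  have h𝓡 : DifferentiableAt ℝ 𝓡f (0, 0) := by
    have h1 : ContMDiffAt 𝓘(ℝ, ℝ × ℝ) (𝓡 n) ∞
        (fun x : ℝ × ℝ => (extChartAt (𝓡 n) x₀).symm (u + x.2 • R.Z)) (0, 0) := by
      refine ContMDiffAt.comp (g := (extChartAt (𝓡 n) x₀).symm)
        (f := fun x : ℝ × ℝ => u + x.2 • R.Z) (I' := 𝓘(ℝ, Coord n)) (0, 0) ?_
        hline.contMDiff.contMDiffAt
      simp only [hu0]
      exact contMDiffAt_chart_symm x₀ hu
    have h2 : ContMDiffAt 𝓘(ℝ, ℝ × ℝ) (𝓘(ℝ, ℝ).prod ((𝓡 n).prod (𝓡 n))) ∞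
        (fun x : ℝ × ℝ => (x.1, ((extChartAt (𝓡 n) x₀).symm (u + x.2 • R.Z), y))) (0, 0) :=
      contDiff_fst.contMDiff.contMDiffAt.prodMk (h1.prodMk contMDiffAt_const)
    have h3 : ContMDiffAt 𝓘(ℝ, ℝ × ℝ) 𝓘(ℝ, ℝ) ∞ 𝓡f (0, 0) := by
      refine ContMDiffAt.comp (g := fun q : ℝ × U × V => rf q.1 q.2)
        (f := fun x : ℝ × ℝ => (x.1, ((extChartAt (𝓡 n) x₀).symm (u + x.2 • R.Z), y))) (0, 0) ?_ h2
      simp only [hu0]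
      exact hrf.contMDiffAt ((isOpen_Ioo.prod (hU'o.prod hV'o)).mem_nhds ⟨h0ε, h.1.2, h.2.2⟩)
    exact (contMDiffAt_iff_contDiffAt.1 h3).differentiableAt (by simp)
  -- the partial derivatives of both functions
  have hs : HasDerivAt (fun s : ℝ => (s, (0 : ℝ))) (1, 0) 0 :=
    (hasDerivAt_id 0).prodMk (hasDerivAt_const 0 0)
  have ht : HasDerivAt (fun t : ℝ => ((0 : ℝ), t)) (0, 1) 0 :=
    (hasDerivAt_const 0 0).prodMk (hasDerivAt_id 0)
  have hlineZ : HasDerivAt (fun t : ℝ => (u + t • R.Z, v)) (R.Z, 0) 0 := by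
    refine HasDerivAt.prodMk ?_ (hasDerivAt_const 0 v)
    simpa using ((hasDerivAt_id (0 : ℝ)).smul_const R.Z).const_add u
  have h𝓔1 : fderiv ℝ 𝓔 (0, 0) (1, 0) = rayTransform gf γ / 2 :=
    (HasFDerivAt.comp_hasDerivAt (l := 𝓔) (f := fun s : ℝ => (s, (0 : ℝ))) (0 : ℝ)
      hd.hasFDerivAt hs).unique h𝓔s
  have h𝓔2 : fderiv ℝ 𝓔 (0, 0) (0, 1) = fderiv ℝ R.E (u, v) (R.Z, 0) := by
    have h1 : HasDerivAt (fun t : ℝ => R.E (u + t • R.Z, v)) (fderiv ℝ R.E (u, v) (R.Z, 0)) 0 :=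
      HasFDerivAt.comp_hasDerivAt (l := R.E) (0 : ℝ)
        (by rw [hu0]; exact (differentiableAt_E h).hasFDerivAt) hlineZ
    exact (hd.hasFDerivAt.comp_hasDerivAt (l := 𝓔) (0 : ℝ) ht).unique
      (h1.congr_of_eventuallyEq h𝓔r)
  have h𝓡1 : HasDerivAt (fun τ => rf τ ((extChartAt (𝓡 n) x₀).symm u, y))
      (fderiv ℝ 𝓡f (0, 0) (1, 0)) 0 := by
    refine (HasFDerivAt.comp_hasDerivAt (l := 𝓡f) (f := fun s : ℝ => (s, (0 : ℝ))) (0 : ℝ)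
      h𝓡.hasFDerivAt hs).congr_of_eventuallyEq
      (Eventually.of_forall fun τ => ?_)
    simp only [Function.comp_apply, 𝓡f, hu0]
  have h𝓡2 : fderiv ℝ 𝓡f (0, 0) (0, 1) = fderiv ℝ (productCoord r x₀ y₀) (u, v) (R.Z, 0) := by
    have h1 : HasDerivAt (fun t : ℝ => productCoord r x₀ y₀ (u + t • R.Z, v))
        (fderiv ℝ (productCoord r x₀ y₀) (u, v) (R.Z, 0)) 0 :=
      HasFDerivAt.comp_hasDerivAt (l := productCoord r x₀ y₀) (0 : ℝ)
        (by rw [hu0]; exact (differentiableAt_productCoord hr hU'o hV'o h).hasFDerivAt) hlineZ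
    refine (h𝓡.hasFDerivAt.comp_hasDerivAt (l := 𝓡f) (0 : ℝ) ht).unique
      (h1.congr_of_eventuallyEq (Eventually.of_forall fun t => ?_))
    simp only [Function.comp_apply, 𝓡f, hrf0, productCoord, hy]
  have h𝓔0 : 𝓔 (0, 0) = 0 := by
    have h1 := h𝓔r.self_of_nhds
    rw [hu0] at h1
    rw [h1, hE]
  have h𝓡0 : 𝓡f (0, 0) = 0 := by
    simp only [𝓡f, hu0, hrf0]
    exact (productCoord_eq_zero_iff hr h).2 hE
  have hneg : ∀ᶠ x in 𝓝 ((0 : ℝ), (0 : ℝ)), 𝓔 x < 0 → 𝓡f x ≤ 0 := by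
    have hc1 : ContinuousAt (fun x : ℝ × ℝ => (u + x.2 • R.Z, v)) (0, 0) :=
      (hline.continuous.prodMk continuous_const).continuousAt
    have hc2 : ContinuousAt (fun x : ℝ × ℝ => x.1) (0, 0) := continuousAt_fst
    filter_upwards [hev, hc1.preimage_mem_nhds ((isOpen_domain hU'o hV'o).mem_nhds
      (show (u + ((0 : ℝ), (0 : ℝ)).2 • R.Z, v) ∈ R.domain U' V' by simpa using h)),
      hc2.preimage_mem_nhds (isOpen_Ioo.mem_nhds h0ε)] with x hx h1 h2 h3
    obtain ⟨p, hp, hp1, hp2, hp3⟩ := hx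
    have h4 : (u + x.2 • R.Z, v) ∈ R.domain U' V' := h1
    refine (((hdef x.1 h2).2.2.2 _ (chart_symm_mem h4)).2 ⟨p, hp, hp1, ?_, hp2⟩).le
    rw [← hp3, energy] at h3
    rw [IsTimelike]
    linarith
  obtain ⟨-, h5⟩ := exists_eq_smul_of_neg (e := ((0 : ℝ), (1 : ℝ))) h𝓡.hasFDerivAt hd.hasFDerivAt
    h𝓡0 h𝓔0 hneg (by rw [h𝓔2]; exact R.fderiv_Z_ne u h.1.1 v h.2.1)
  rw [h𝓡2, h𝓔2] at h5
  have h6 := congrArg (fun A : ℝ × ℝ →L[ℝ] ℝ => A (1, 0)) h5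
  simp only [smul_apply, smul_eq_mul, h𝓔1] at h6
  rw [h6] at h𝓡1
  convert h𝓡1 using 1
  rw [derivRatio]
  ring

end RayChart

/-! ### Existence of charts for the geodesics between two surfaces -/

section Existence

variable {n : ℕ} {M : Type*} [TopologicalSpace M] [T2Space M]
  [ChartedSpace (EuclideanSpace ℝ (Fin (n + 1))) M] [IsManifold (𝓡 (n + 1)) ∞ M]
  {U : Type*} [TopologicalSpace U] [ChartedSpace (EuclideanSpace ℝ (Fin n)) U]
  [IsManifold (𝓡 n) ∞ U]
  {V : Type*} [TopologicalSpace V] [ChartedSpace (EuclideanSpace ℝ (Fin n)) V]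
  [IsManifold (𝓡 n) ∞ V]
  {g : LorentzMetric (n + 1) M} {ιU : U → M} {ιV : V → M} {x₀ : U} {y₀ : V}

/-- Near a transversal light ray without conjugate endpoints, all sufficiently small neighborhoods
of its initial velocity have a `RayChart`. -/
theorem exists_nhds_rayChart (hιU : ContMDiff (𝓡 n) (𝓡 (n + 1)) ∞ ιU)
    (hιV : ContMDiff (𝓡 n) (𝓡 (n + 1)) ∞ ιV) (hU : IsNondegenerateSurface g ιU)
    (hV : IsNondegenerateSurface g ιV) {γ₀ : ℝ → M} (hγ₀ : IsGeodesicSegment g γ₀ 1)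
    (hx₀ : γ₀ 0 = ιU x₀) (hy₀ : γ₀ 1 = ιV y₀) (hlight : IsLightlike g (velocity (n + 1) γ₀ 0))
    (htU : IsTransversalTo ιU x₀ (velocity (n + 1) γ₀ 0))
    (htV : IsTransversalTo ιV y₀ (velocity (n + 1) γ₀ 1)) (hconj : ¬ ConjugateAlong g γ₀) :
    ∃ 𝒩 : Set (TangentBundle (𝓡 (n + 1)) M), IsOpen 𝒩 ∧ velocity (n + 1) γ₀ 0 ∈ 𝒩 ∧
      ∀ 𝒲 ⊆ 𝒩, IsOpen 𝒲 → velocity (n + 1) γ₀ 0 ∈ 𝒲 →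
        Nonempty (RayChart g ιU ιV 𝒲 x₀ y₀) := by
  obtain ⟨m, hm⟩ : ∃ m, m = γ₀ 0 := ⟨_, rfl⟩
  obtain ⟨m₁, hm₁⟩ : ∃ m₁, m₁ = γ₀ 1 := ⟨_, rfl⟩
  obtain ⟨w₀, hw₀⟩ : ∃ w₀ : Coord (n + 1), w₀ = (velocity (n + 1) γ₀ 0).2 := ⟨_, rfl⟩
  obtain ⟨z₀, hz₀⟩ : ∃ z₀, z₀ = extChartAt (𝓡 (n + 1)) m m := ⟨_, rfl⟩
  obtain ⟨z₁, hz₁⟩ : ∃ z₁, z₁ = extChartAt (𝓡 (n + 1)) m₁ m₁ := ⟨_, rfl⟩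
  have hv : velocity (n + 1) γ₀ 0 = ofCoord m (z₀, w₀) := by
    rw [hz₀, hw₀, hm]
    exact (ofCoord_self (γ₀ 0) _).symm
  have hend : γ₀ 1 = (extChartAt (𝓡 (n + 1)) m₁).symm z₁ := by
    rw [hz₁, ← hm₁, extChartAt_to_inv]
  have hreg := bijective_fderiv_expMap hγ₀ hconj
  rw [← hm, ← hm₁, ← hz₀, ← hw₀] at hreg
  obtain ⟨L, hLO, hLW⟩ := exists_localExp (gf := fun _ => g) (m := m) (m₁ := m₁) (τ₀ := 0)
    isOpen_univ (smoothFamilyOn_const g univ) (mem_univ _)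
    (hz₀ ▸ mem_extChartAt_target m) (hz₁ ▸ mem_extChartAt_target m₁) hγ₀ hv hend hreg
  obtain ⟨u₀, hu₀⟩ : ∃ u₀, extChartAt (𝓡 n) x₀ x₀ = u₀ := ⟨_, rfl⟩
  obtain ⟨v₀, hv₀⟩ : ∃ v₀, extChartAt (𝓡 n) y₀ y₀ = v₀ := ⟨_, rfl⟩
  have hu : (extChartAt (𝓡 n) x₀).symm u₀ = x₀ := hu₀ ▸ extChartAt_to_inv x₀
  have hv' : (extChartAt (𝓡 n) y₀).symm v₀ = y₀ := hv₀ ▸ extChartAt_to_inv y₀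
  have hcu : surfaceCoord ιU m x₀ u₀ = z₀ := by rw [surfaceCoord, hu, ← hx₀, ← hm, hz₀]
  have hcv : surfaceCoord ιV m₁ y₀ v₀ = z₁ := by rw [surfaceCoord, hv', ← hy₀, ← hm₁, hz₁]
  have hends : rayEnds m m₁ ιU ιV x₀ y₀ (u₀, v₀) = (0, (z₀, z₁)) := by
    rw [rayEnds, hcu, hcv]
  have hrW : rayW L ιU ιV x₀ y₀ (u₀, v₀) = w₀ := by rw [rayW, hends, hLW]
  have hrV : velocity (n + 1) γ₀ 0 = rayVector L ιU ιV x₀ y₀ (u₀, v₀) := by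
    rw [hv, rayVector, hrW, hcu]
  have hq : (u₀, v₀) ∈ rayDomain L ιU ιV x₀ y₀ := by
    refine ⟨⟨⟨hu₀ ▸ mem_extChartAt_target x₀, ?_⟩, hv₀ ▸ mem_extChartAt_target y₀, ?_⟩, ?_⟩
    · rw [mem_preimage, hu, ← hx₀, ← hm]
      exact mem_extChartAt_source m
    · rw [mem_preimage, hv', ← hy₀, ← hm₁]
      exact mem_extChartAt_source m₁
    · rw [mem_preimage, hends]
      exact hLO
  have hnull : rayEnergy L ιU ιV x₀ y₀ (u₀, v₀) = 0 := by
    rw [← rayEnergy_eq, ← hrV, energy, hlight.2, zero_div]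
  have hne : rayW L ιU ιV x₀ y₀ (u₀, v₀) ≠ 0 := by
    rw [hrW, hw₀]
    exact hlight.1
  have hopen : IsOpen ((TotalSpace.proj ⁻¹' (extChartAt (𝓡 (n + 1)) m).source :
      Set (TangentBundle (𝓡 (n + 1)) M)) ∩ toCoord m ⁻¹' (univ ×ˢ L.N)) :=
    (continuousOn_toCoord m).isOpen_inter_preimage (isOpen_proj_preimage_source m)
      (isOpen_univ.prod L.isOpen_N)
  refine ⟨_, hopen, ⟨?_, mem_univ _, ?_⟩, fun 𝒲 h𝒲 h𝒲o hmem => ?_⟩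
  · exact hm ▸ mem_extChartAt_source (γ₀ 0)
  · rw [hv, toCoord_ofCoord m (hz₀ ▸ mem_extChartAt_target m), ← hLW]
    exact L.W_mem _ hLO
  · exact exists_rayChart hιU hιV hU hV h𝒲o (fun p hp => (h𝒲 hp).2.2) hu₀ hv₀ hq hγ₀ hrV hmem
      hnull hne htU htV

end Existence

end LightRay

end

open LightRay in
theorem theorem2p1 {n : ℕ}
    {M : Type*} [TopologicalSpace M] [T2Space M]
    [ChartedSpace (EuclideanSpace ℝ (Fin (n + 1))) M] [IsManifold (𝓡 (n + 1)) ∞ M]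
    {U : Type*} [TopologicalSpace U] [ChartedSpace (EuclideanSpace ℝ (Fin n)) U]
    [IsManifold (𝓡 n) ∞ U]
    {V : Type*} [TopologicalSpace V] [ChartedSpace (EuclideanSpace ℝ (Fin n)) V]
    [IsManifold (𝓡 n) ∞ V]
    (g : LorentzMetric (n + 1) M) (hg : IsGeodesicallyComplete g)
    (ιU : U → M) (hιU : IsSmoothEmbedding (𝓡 n) (𝓡 (n + 1)) ∞ ιU)
    (ιV : V → M) (hιV : IsSmoothEmbedding (𝓡 n) (𝓡 (n + 1)) ∞ ιV)
    (hU : IsTimelikeSurface g ιU ∨ IsSpacelikeSurface g ιU)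
    (hV : IsTimelikeSurface g ιV ∨ IsSpacelikeSurface g ιV)
    (x₀ : U) (y₀ : V) (γ₀ : ℝ → M) (hγ₀ : IsGeodesicSegment g γ₀ 1)
    (hx₀ : γ₀ 0 = ιU x₀) (hy₀ : γ₀ 1 = ιV y₀) (hlight : IsLightlike g (velocity (n + 1) γ₀ 0))
    (htU : IsTransversalTo ιU x₀ (velocity (n + 1) γ₀ 0)) (htV : IsTransversalTo ιV y₀ (velocity (n + 1) γ₀ 1))
    (hconj : ¬ ConjugateAlong g γ₀) :
    -- the neighborhoods `𝒲` of `(x₀, γ₀'(0))`, `U'` of `x₀` and `V'` of `y₀` are small enough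
    ∃ 𝒩 : Set (TangentBundle (𝓡 (n + 1)) M), IsOpen 𝒩 ∧ velocity (n + 1) γ₀ 0 ∈ 𝒩 ∧
    ∀ 𝒲 ⊆ 𝒩, IsOpen 𝒲 → velocity (n + 1) γ₀ 0 ∈ 𝒲 →
    ∃ (U₀ : Set U) (V₀ : Set V), IsOpen U₀ ∧ x₀ ∈ U₀ ∧ IsOpen V₀ ∧ y₀ ∈ V₀ ∧
    ∀ U' ⊆ U₀, IsOpen U' → x₀ ∈ U' → ∀ V' ⊆ V₀, IsOpen V' → y₀ ∈ V' →
      -- all pairs are connected by a locally unique geodesic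
      (∀ x ∈ U', ∀ y ∈ V', ∃! p : TangentBundle (𝓡 (n + 1)) M,
        p ∈ 𝒲 ∧ p.1 = ιU x ∧ Joins g p (ιV y)) ∧
      -- (a)
      IsHypersurface ((𝓡 n).prod (𝓡 n)) (lightPairs g ιU ιV 𝒲 U' V') ∧
      ∀ r : U × V → ℝ, IsDefiningFunction g ιU ιV 𝒲 U' V' r →
        -- (b)
        IsReducedRepresentation (scatteringSharp g ιU ιV 𝒲 U' V') (gradientGraph r U' V') ∧
        -- (c)
        ∃ κ : U × V → ℝ, ContMDiffOn ((𝓡 n).prod (𝓡 n)) 𝓘(ℝ, ℝ) ∞ κ (U' ×ˢ V') ∧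
          (∀ q ∈ U' ×ˢ V', κ q ≠ 0) ∧
          ∀ (gf : ℝ → LorentzMetric (n + 1) M) (rf : ℝ → U × V → ℝ) (ε : ℝ), 0 < ε →
            gf 0 = g → rf 0 = r → SmoothFamilyOn gf (Ioo (-ε) ε) →
            ContMDiffOn (𝓘(ℝ, ℝ).prod ((𝓡 n).prod (𝓡 n))) 𝓘(ℝ, ℝ) ∞
              (fun q : ℝ × U × V => rf q.1 q.2) (Ioo (-ε) ε ×ˢ (U' ×ˢ V')) →
            (∀ τ ∈ Ioo (-ε) ε, IsDefiningFunction (gf τ) ιU ιV 𝒲 U' V' (rf τ)) →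
            ∀ x ∈ U', ∀ y ∈ V', ∀ γ : ℝ → M, IsGeodesicSegment g γ 1 →
              velocity (n + 1) γ 0 ∈ 𝒲 → IsLightlike g (velocity (n + 1) γ 0) → γ 0 = ιU x → γ 1 = ιV y →
              HasDerivAt (fun τ => rf τ (x, y)) (κ (x, y) * rayTransform gf γ) 0 := by
  obtain ⟨𝒩, h𝒩, hmem, hchart⟩ := exists_nhds_rayChart hιU.contMDiff hιV.contMDiff
    (isNondegenerateSurface hU) (isNondegenerateSurface hV) hγ₀ hx₀ hy₀ hlight htU htV hconj
  refine ⟨𝒩, h𝒩, hmem, fun 𝒲 h𝒲 h𝒲o hmem𝒲 => ?_⟩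
  obtain ⟨R⟩ := hchart 𝒲 h𝒲 h𝒲o hmem𝒲
  refine ⟨R.sourceU, R.sourceV, R.isOpen_sourceU, ⟨mem_extChartAt_source x₀, R.mem_DU⟩,
    R.isOpen_sourceV, ⟨mem_extChartAt_source y₀, R.mem_DV⟩, ?_⟩
  intro U' hU' hU'o _ V' hV' hV'o _
  refine ⟨fun x hx y hy => ?_, RayChart.isHypersurface_lightPairs hU'o hV'o hU' hV', fun r hr =>
    ⟨RayChart.isReducedRepresentation_gradientGraph (isNondegenerateSurface hU)
      (isNondegenerateSurface hV) hr hU'o hV'o hU' hV', R.weight r,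
      RayChart.contMDiffOn_weight hr hU'o hV'o hU' hV',
      fun q hq => RayChart.weight_ne_zero hr hU'o hV'o hU' hV' hq, ?_⟩⟩
  · obtain ⟨u, v, h, rfl, rfl⟩ := RayChart.exists_mem_domain hU' hV' hx hy
    exact RayChart.existsUnique_joins h
  · intro gf rf ε hε hgf0 hrf0 hgf hrf hdef x hx y hy γ hγ hγ𝒲 hnull hγ0 hγ1
    obtain ⟨u, v, h, rfl, rfl⟩ := RayChart.exists_mem_domain hU' hV' hx hy
    have hP : velocity (n + 1) γ 0 = R.P (u, v) :=
      R.P_unique u h.1.1 v h.2.1 _ hγ𝒲 hγ0 ⟨γ, hγ, rfl, hγ1⟩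
    have hE : R.E (u, v) = 0 := by
      rw [← R.energy_P, ← hP, energy, hnull.2, zero_div]
    rw [RayChart.weight_of_null hr hU'o hV'o h hE]
    exact RayChart.hasDerivAt_definingFunction hr hU'o hV'o h hE hε hgf0 hrf0 hgf hrf hdef hγ hP
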